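/- Let $\mathsf{F}_4$ denote the subgroup of $GL_4(\mathbb{R})$ generated by the two matrices $$\frac12\begin{pmatrix}1&-1&1&1\\-1&-1&-1&1\\1&1&-1&1\\1&-1&-1&-1\end{pmatrix},\qquad \frac12\begin{pmatrix}-1&1&-1&-1\\1&-1&-1&-1\\-1&-1&1&-1\\1&1&1&-1\end{pmatrix}.$$ It is the reflection group of the root system of type $F_4$ (whose roots are the vectors of $\mathbb{Z}^4\cup(\mathbb{Z}+\tfrac12)^4$ of squared length $1$ or $2$). Let $\operatorname{conv}(\mathsf{F}_4)\subset\mathbb{R}^{4\times4}$ be the convex hull of its elements. Orbits and stabilizers of facets are taken with respect to the symmetry group of $\operatorname{conv}(\mathsf{F}_4)$, i.e. the group of all linear automorphisms of $\mathbb{R}^{4\times 4}$ that map $\operatorname{conv}(\mathsf{F}_4)$ onto itself; the incidence of a facet is the number of vertices of $\operatorname{conv}(\mathsf{F}_4)$ on it. For a finite reflection group $G\subset GL_n(\mathbb{R})$ of rank $n$, a Birkhoff tensor is a rank one matrix $A=(gu)(hw)^T$, where $g,h\in G$, the vectors $u,w$ are positive multiples of the fundamental weights of two different end vertices of the Coxeter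 graph of a simple system of $G$, and $\max_{X\in G}\operatorname{Tr}(XA)=1$; it is identified with the set of all $X\in\operatorname{conv}(G)$ with $\operatorname{Tr}(XA)=1$. The polytope $\operatorname{conv}(\mathsf{F}_4)$ has exactly $55872$ facets, and they form exactly two orbits: 1. The facets given by the Birkhoff tensors form one orbit. Each of them has incidence $288$ and a stabilizer of order $4608$. One representative inequality is $\operatorname{Tr}(XA)\le 1$ with $$A=\begin{pmatrix}0&0&0&0\\0&0&0&0\\0&0&0&0\\1&0&0&-1\end{pmatrix}.$$ 2. The other orbit contains no Birkhoff tensor. Each of its facets has incidence $36$ and a stabilizer of order $48$. One representative inequality is $\operatorname{Tr}(XA)\le 1$ with $$A=\frac14\begin{pmatrix}1&0&1&0\\0&1&0&-1\\0&1&0&1\\1&0&1&-2\end{pmatrix}.$$ In particular, not every facet of $\operatorname{conv}(\mathsf{F}_4)$ is given by a Birkhoff tensor. -/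

import Mathlib

open scoped Pointwise Matrix

noncomputable section

namespace CoxeterHull

/- Polytopes and their facets -/

/-- The convex hull `conv G`, in the space of real `n × n` matrices, of a matrix group `G`. -/
def convGroup {n : ℕ} (G : Subgroup (GL (Fin n) ℝ)) : Set (Matrix (Fin n) (Fin n) ℝ) :=
  convexHull ℝ ((fun g : GL (Fin n) ℝ => (g : Matrix (Fin n) (Fin n) ℝ)) '' (G : Set (GL (Fin n) ℝ)))

/-- `F` is a facet of `P`: a nonempty exposed face whose affine dimension is
one less than the affine dimension of `P`. -/
def IsFacet {E : Type*} [AddCommGroup E] [Module ℝ E] [TopologicalSpace E] (P F : Set E) : Prop :=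
  IsExposed ℝ P F ∧ F.Nonempty ∧
    Module.finrank ℝ (vectorSpan ℝ F) + 1 = Module.finrank ℝ (vectorSpan ℝ P)

/-- The set of facets of `P`. -/
def facets {E : Type*} [AddCommGroup E] [Module ℝ E] [TopologicalSpace E] (P : Set E) :
    Set (Set E) :=
  {F | IsFacet P F}

/-- The incidence of a facet `F` of `P`: the number of vertices of `P` lying on `F`. -/
def incidence {E : Type*} [AddCommGroup E] [Module ℝ E] (P F : Set E) : ℕ :=
  (P.extremePoints ℝ ∩ F).ncard

/-- The symmetry group of `P`: all linear automorphisms of the ambient space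
mapping `P` onto itself. -/
def symGroup {E : Type*} [AddCommGroup E] [Module ℝ E] (P : Set E) : Subgroup (E ≃ₗ[ℝ] E) :=
  MulAction.stabilizer (E ≃ₗ[ℝ] E) P

/-- The orbit of a subset `F` under the symmetry group of `P`. -/
def symOrbit {E : Type*} [AddCommGroup E] [Module ℝ E] (P F : Set E) : Set (Set E) :=
  MulAction.orbit (symGroup P) F

/-- The order of the stabilizer of `F` in the symmetry group of `P`. -/
def stabOrder {E : Type*} [AddCommGroup E] [Module ℝ E] (P F : Set E) : ℕ :=
  Nat.card (MulAction.stabilizer (symGroup P) F)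

/-- The part of `P` on which the inequality `Tr (X A) ≤ 1` is an equality. -/
def traceFace {n : ℕ} (P : Set (Matrix (Fin n) (Fin n) ℝ)) (A : Matrix (Fin n) (Fin n) ℝ) :
    Set (Matrix (Fin n) (Fin n) ℝ) :=
  {X ∈ P | (X * A).trace = 1}

/- Reflection groups and Birkhoff tensors -/

/-- The matrix of the orthogonal reflection in the hyperplane orthogonal to `v ≠ 0`. -/
def reflMatrix {n : ℕ} (v : Fin n → ℝ) : Matrix (Fin n) (Fin n) ℝ :=
  1 - (2 / (v ⬝ᵥ v)) • Matrix.vecMulVec v v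

/-- `v` is a root vector of `G`: it is nonzero and the reflection along `v` belongs to `G`. -/
def IsRootVector {n : ℕ} (G : Subgroup (GL (Fin n) ℝ)) (v : Fin n → ℝ) : Prop :=
  v ≠ 0 ∧ ∃ g ∈ G, (g : Matrix (Fin n) (Fin n) ℝ) = reflMatrix v

/-- `α` is a simple system of the reflection group `G`: a basis made of root vectors such that each
root vector has all its coordinates nonnegative or all its coordinates nonpositive.
Lengths of the root vectors are left free. -/
def IsSimpleSystem {n : ℕ} (G : Subgroup (GL (Fin n) ℝ))
    (α : Module.Basis (Fin n) ℝ (Fin n → ℝ)) : Prop :=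
  (∀ i, IsRootVector G (α i)) ∧
    ∀ v, IsRootVector G v → (∀ i, 0 ≤ α.repr v i) ∨ (∀ i, α.repr v i ≤ 0)

/-- `i` is an end vertex of the Coxeter graph of `α`: it has exactly one neighbour, two
distinct vertices being joined when their simple roots are not orthogonal. -/
def IsEndVertex {n : ℕ} (α : Module.Basis (Fin n) ℝ (Fin n → ℝ)) (i : Fin n) : Prop :=
  ∃! j, j ≠ i ∧ α i ⬝ᵥ α j ≠ 0

/-- `w` is a positive multiple of the fundamental weight of the vertex `i`. -/
def IsWeight {n : ℕ} (α : Module.Basis (Fin n) ℝ (Fin n → ℝ)) (i : Fin n) (w : Fin n → ℝ) : Prop :=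
  0 < w ⬝ᵥ α i ∧ ∀ j, j ≠ i → w ⬝ᵥ α j = 0

/-- Birkhoff tensors of `G`: the rank one matrices `(g u) (h w)ᵀ`, with `g, h ∈ G` and `u`, `w`
multiples of the fundamental weights of two different end vertices of the Coxeter graph,
normalized by `max {Tr (X A) | X ∈ G} = 1`. -/
def IsBirkhoffTensor {n : ℕ} (G : Subgroup (GL (Fin n) ℝ)) (A : Matrix (Fin n) (Fin n) ℝ) : Prop :=
  (∃ α : Module.Basis (Fin n) ℝ (Fin n → ℝ), IsSimpleSystem G α ∧
    ∃ i j, i ≠ j ∧ IsEndVertex α i ∧ IsEndVertex α j ∧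
    ∃ u w, IsWeight α i u ∧ IsWeight α j w ∧
    ∃ g ∈ G, ∃ h ∈ G,
      A = Matrix.vecMulVec ((g : Matrix (Fin n) (Fin n) ℝ) *ᵥ u)
        ((h : Matrix (Fin n) (Fin n) ℝ) *ᵥ w)) ∧
  IsGreatest {t : ℝ | ∃ X ∈ G, t = ((X : Matrix (Fin n) (Fin n) ℝ) * A).trace} 1

/-- The subsets of `conv G` cut out by Birkhoff tensors. -/
def birkhoffFaces {n : ℕ} (G : Subgroup (GL (Fin n) ℝ)) : Set (Set (Matrix (Fin n) (Fin n) ℝ)) :=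
  {F | ∃ A, IsBirkhoffTensor G A ∧ F = traceFace (convGroup G) A}

/- The group `F₄` -/

/-- The 48 roots of `F₄`: vectors of squared length `1` or `2` whose coordinates are all
integers or all half-integers. -/
def rootsF4 : Set (Fin 4 → ℝ) :=
  {v | ((∀ i, ∃ k : ℤ, v i = k) ∨ (∀ i, ∃ k : ℤ, v i = k + 1 / 2)) ∧
    (v ⬝ᵥ v = 1 ∨ v ⬝ᵥ v = 2)}

/-- The reflection group of the root system `F₄`. -/
def reflectionGroupF4 : Subgroup (GL (Fin 4) ℝ) :=
  Subgroup.closure {g | ∃ v ∈ rootsF4, (g : Matrix (Fin 4) (Fin 4) ℝ) = reflMatrix v}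

def mat1 : Matrix (Fin 4) (Fin 4) ℝ :=
  (1 / 2 : ℝ) • !![1, -1, 1, 1; -1, -1, -1, 1; 1, 1, -1, 1; 1, -1, -1, -1]

def mat2 : Matrix (Fin 4) (Fin 4) ℝ :=
  (1 / 2 : ℝ) • !![-1, 1, -1, -1; 1, -1, -1, -1; -1, -1, 1, -1; 1, 1, 1, -1]

theorem mat1_mul_transpose : mat1 * mat1ᵀ = 1 := by
  ext i j
  fin_cases i <;> fin_cases j <;> norm_num [mat1, Matrix.mul_apply, Fin.sum_univ_succ]

theorem mat2_mul_transpose : mat2 * mat2ᵀ = 1 := by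
  ext i j
  fin_cases i <;> fin_cases j <;> norm_num [mat2, Matrix.mul_apply, Fin.sum_univ_succ]

/-- `mat1` as an invertible matrix. -/
def gen1 : GL (Fin 4) ℝ :=
  ⟨mat1, mat1ᵀ, mat1_mul_transpose, mul_eq_one_comm.mp mat1_mul_transpose⟩

/-- `mat2` as an invertible matrix. -/
def gen2 : GL (Fin 4) ℝ :=
  ⟨mat2, mat2ᵀ, mat2_mul_transpose, mul_eq_one_comm.mp mat2_mul_transpose⟩

/-- The group `F₄`, generated by the two given matrices. -/
def groupF4 : Subgroup (GL (Fin 4) ℝ) :=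
  Subgroup.closure {gen1, gen2}

/-- The polytope `conv F₄`. -/
def convF4 : Set (Matrix (Fin 4) (Fin 4) ℝ) :=
  convGroup groupF4

/-- Matrix of the representative inequality of the first orbit. -/
def matA1 : Matrix (Fin 4) (Fin 4) ℝ :=
  !![0, 0, 0, 0; 0, 0, 0, 0; 0, 0, 0, 0; 1, 0, 0, -1]

/-- Matrix of the representative inequality of the second orbit. -/
def matA2 : Matrix (Fin 4) (Fin 4) ℝ :=
  (1 / 4 : ℝ) • !![1, 0, 1, 0; 0, 1, 0, -1; 0, 1, 0, 1; 1, 0, 1, -2]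

end CoxeterHull

end

open scoped NNReal

namespace CoxeterHull

/-- The space of real `4 × 4` matrices. -/
abbrev Mat4 := Matrix (Fin 4) (Fin 4) ℝ

/-- The Frobenius inner product. -/
noncomputable def frob : Mat4 →ₗ[ℝ] Mat4 →ₗ[ℝ] ℝ :=
  LinearMap.mk₂ ℝ (fun X Y => ∑ i, ∑ j, X i j * Y i j)
    (by intros; simp [add_mul, Finset.sum_add_distrib])
    (by intros; simp [mul_assoc, Finset.mul_sum])
    (by intros; simp [mul_add, Finset.sum_add_distrib])
    (by intros; simp [mul_left_comm, Finset.mul_sum])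

theorem frob_apply (X Y : Mat4) : frob X Y = ∑ i, ∑ j, X i j * Y i j := rfl

theorem frob_comm (X Y : Mat4) : frob X Y = frob Y X := by
  simp [frob_apply, mul_comm]

theorem frob_eq_trace (X Y : Mat4) : frob X Y = (X * Yᵀ).trace := by
  simp [frob_apply, Matrix.trace, Matrix.mul_apply]

theorem trace_mul_eq_frob (X A : Mat4) : (X * A).trace = frob X Aᵀ := by
  simp [frob_eq_trace]

theorem frob_self_nonneg (X : Mat4) : 0 ≤ frob X X := by
  rw [frob_apply]
  exact Finset.sum_nonneg fun i _ => Finset.sum_nonneg fun j _ => mul_self_nonneg (X i j)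

theorem eq_zero_of_frob_self {X : Mat4} (h : frob X X ≤ 0) : X = 0 := by
  have h0 : ∑ i, ∑ j, X i j * X i j = 0 := le_antisymm h (frob_self_nonneg X)
  rw [Finset.sum_eq_zero_iff_of_nonneg
    (fun i _ => Finset.sum_nonneg fun j _ => mul_self_nonneg (X i j))] at h0
  ext i j
  have h1 := h0 i (Finset.mem_univ i)
  rw [Finset.sum_eq_zero_iff_of_nonneg (fun j _ => mul_self_nonneg (X i j))] at h1
  simpa using h1 j (Finset.mem_univ j)

theorem eq_of_frob_eq {X Y : Mat4} (h : ∀ Z, frob Z X = frob Z Y) : X = Y := by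
  apply sub_eq_zero.mp
  apply eq_zero_of_frob_self
  rw [map_sub, h, sub_self]

theorem exists_frob_eq (l : Mat4 →ₗ[ℝ] ℝ) : ∃ C, ∀ X, l X = frob X C := by
  refine ⟨Matrix.of fun i j => l (Matrix.single i j 1), fun X => ?_⟩
  conv_lhs => rw [Matrix.matrix_eq_sum_single X]
  simp only [map_sum, frob_apply, Matrix.of_apply]
  refine Finset.sum_congr rfl fun i _ => Finset.sum_congr rfl fun j _ => ?_
  rw [← smul_eq_mul, ← map_smul, Matrix.smul_single, smul_eq_mul, mul_one]

theorem eq_of_frob_eq_on_span {S : Set Mat4} (hS : Submodule.span ℝ S = ⊤) {C D : Mat4}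
    (h : ∀ x ∈ S, frob x C = frob x D) : C = D := by
  apply eq_of_frob_eq
  intro Z
  have : (⊤ : Submodule ℝ Mat4) ≤ LinearMap.ker (frob.flip C - frob.flip D) := by
    rw [← hS, Submodule.span_le]
    intro x hx
    simp [h x hx]
  have := this (Submodule.mem_top (x := Z))
  simpa [sub_eq_zero] using this

/-- The elements of `V` at which the inequality with normal `C` is tight. -/
def tight (V : Set Mat4) (C : Mat4) : Set Mat4 := {x ∈ V | frob x C = 1}

/-- The face of `conv V` with normal `C`. -/
noncomputable def face (V : Set Mat4) (C : Mat4) : Set Mat4 := {x ∈ convexHull ℝ V | frob x C = 1}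

/-- `C` is the normal, at height one, of a facet of `conv V`. -/
def IsNormal (V : Set Mat4) (C : Mat4) : Prop :=
  (∀ x ∈ V, frob x C ≤ 1) ∧ Submodule.span ℝ (tight V C) = ⊤

theorem frob_le_of_mem_convexHull {V : Set Mat4} {C : Mat4} {a : ℝ} (h : ∀ x ∈ V, frob x C ≤ a) :
    ∀ x ∈ convexHull ℝ V, frob x C ≤ a := by
  have : convexHull ℝ V ⊆ {x | frob.flip C x ≤ a} :=
    convexHull_min h (convex_halfSpace_le (frob.flip C).isLinear a)
  exact this

theorem face_subset_span_tight {V : Set Mat4} {C : Mat4}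
    (h : ∀ x ∈ V, frob x C ≤ 1) : face V C ⊆ Submodule.span ℝ (tight V C) := by
  rintro x ⟨hx, hxC⟩
  obtain ⟨ι, _, w, z, hw0, hw1, hz, rfl⟩ := mem_convexHull_iff_exists_fintype.mp hx
  have hs : ∑ i, w i * (1 - frob (z i) C) = 0 := by
    have h2 : ∑ i, w i * frob (z i) C = 1 := by
      rw [← hxC]; simp [map_sum]
    simp [mul_sub, Finset.sum_sub_distrib, hw1, h2]
  rw [Finset.sum_eq_zero_iff_of_nonneg
    (fun i _ => mul_nonneg (hw0 i) (sub_nonneg.mpr (h _ (hz i))))] at hs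
  refine Submodule.sum_mem _ fun i _ => ?_
  rcases mul_eq_zero.mp (hs i (Finset.mem_univ i)) with h0 | h0
  · simp [h0]
  · exact Submodule.smul_mem _ _ (Submodule.subset_span ⟨hz i, by linarith⟩)

theorem tight_subset_face (V : Set Mat4) (C : Mat4) : tight V C ⊆ face V C :=
  fun _ hx => ⟨subset_convexHull ℝ V hx.1, hx.2⟩

theorem finrank_mat4 : Module.finrank ℝ Mat4 = 16 := by
  rw [Module.finrank_matrix]; simp

theorem span_eq_vectorSpan_sup {F : Set Mat4} {x : Mat4} (hx : x ∈ F) :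
    Submodule.span ℝ F = vectorSpan ℝ F ⊔ Submodule.span ℝ {x} := by
  apply le_antisymm
  · rw [Submodule.span_le]
    intro y hy
    rw [← sub_add_cancel y x]
    exact Submodule.add_mem_sup (by simpa using vsub_mem_vectorSpan ℝ hy hx)
      (Submodule.mem_span_singleton_self x)
  · rw [sup_le_iff]
    constructor
    · rw [vectorSpan_def, Submodule.span_le]
      rintro _ ⟨a, ha, b, hb, rfl⟩
      exact Submodule.sub_mem _ (Submodule.subset_span ha) (Submodule.subset_span hb)
    · rw [Submodule.span_le, Set.singleton_subset_iff]
      exact Submodule.subset_span hx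

theorem finrank_vectorSpan_face {V : Set Mat4} {C x : Mat4} (hx : x ∈ face V C) :
    Module.finrank ℝ (Submodule.span ℝ (face V C)) =
      Module.finrank ℝ (vectorSpan ℝ (face V C)) + 1 := by
  have hker : vectorSpan ℝ (face V C) ≤ LinearMap.ker (frob.flip C) := by
    rw [vectorSpan_def, Submodule.span_le]
    rintro _ ⟨a, ha, b, hb, rfl⟩
    simp [ha.2, hb.2]
  have hx0 : x ≠ 0 := by
    rintro rfl
    have := hx.2
    simp at this
  have hdis : vectorSpan ℝ (face V C) ⊓ Submodule.span ℝ {x} = ⊥ := by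
    rw [eq_bot_iff]
    rintro y ⟨hy1, hy2⟩
    obtain ⟨a, rfl⟩ := Submodule.mem_span_singleton.mp hy2
    have := hker hy1
    simp [hx.2] at this
    simp [this]
  have := Submodule.finrank_sup_add_finrank_inf_eq (vectorSpan ℝ (face V C)) (Submodule.span ℝ {x})
  rw [hdis, ← span_eq_vectorSpan_sup hx, finrank_bot, finrank_span_singleton hx0] at this
  omega

section Polytope

variable {V : Set Mat4}

theorem vectorSpan_convexHull_eq_top (h0 : (0 : Mat4) ∈ convexHull ℝ V)
    (hspan : Submodule.span ℝ V = ⊤) : vectorSpan ℝ (convexHull ℝ V) = ⊤ := by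
  have h := span_eq_vectorSpan_sup h0
  have h2 : Submodule.span ℝ (convexHull ℝ V) = ⊤ := by
    rw [eq_top_iff, ← hspan]
    exact Submodule.span_mono (subset_convexHull ℝ V)
  rw [h2] at h
  simpa using h.symm

theorem isFacet_face (h0 : (0 : Mat4) ∈ convexHull ℝ V)
    (hspan : Submodule.span ℝ V = ⊤) {C : Mat4} (hC : IsNormal V C) :
    IsFacet (convexHull ℝ V) (face V C) := by
  have hne : (tight V C).Nonempty := by
    by_contra h
    rw [Set.not_nonempty_iff_eq_empty] at h
    have h1 := hC.2
    rw [h, Submodule.span_empty] at h1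
    exact bot_ne_top h1
  obtain ⟨x, hx⟩ := hne
  have hxF := tight_subset_face V C hx
  refine ⟨fun _ => ⟨LinearMap.toContinuousLinearMap (frob.flip C), ?_⟩, ⟨x, hxF⟩, ?_⟩
  · ext y
    constructor
    · rintro ⟨hy, hy1⟩
      refine ⟨hy, fun z hz => ?_⟩
      simpa [hy1] using frob_le_of_mem_convexHull hC.1 z hz
    · rintro ⟨hy, hy1⟩
      refine ⟨hy, le_antisymm (frob_le_of_mem_convexHull hC.1 y hy) ?_⟩
      simpa [hxF.2] using hy1 x hxF.1
  · rw [← finrank_vectorSpan_face hxF, vectorSpan_convexHull_eq_top h0 hspan]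
    have : Submodule.span ℝ (face V C) = ⊤ := by
      rw [eq_top_iff, ← hC.2]
      exact Submodule.span_mono (tight_subset_face V C)
    rw [this]

theorem exists_normal_of_isFacet (h0' : (0 : Mat4) ∈ convexHull ℝ V)
    (hneg : ∀ x ∈ V, -x ∈ V) (hspan : Submodule.span ℝ V = ⊤) {F : Set Mat4} (hF : IsFacet (convexHull ℝ V) F) :
    ∃ C, IsNormal V C ∧ F = face V C := by
  obtain ⟨hexp, hne, hrank⟩ := hF
  obtain ⟨l, hl⟩ := hexp hne
  obtain ⟨C₀, hC₀⟩ := exists_frob_eq l.toLinearMap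
  obtain ⟨x, hx⟩ := hne
  have hl' : ∀ X, l X = frob X C₀ := hC₀
  have hxm : ∀ y ∈ convexHull ℝ V, frob y C₀ ≤ frob x C₀ := by
    rw [hl] at hx
    intro y hy
    rw [← hl', ← hl']
    exact hx.2 y hy
  have hm0 : 0 ≤ frob x C₀ := by simpa using hxm 0 h0'
  have hm : frob x C₀ ≠ 0 := by
    intro hm
    have hz : C₀ = 0 := by
      refine eq_of_frob_eq_on_span hspan fun y hy => ?_
      have h1 := hxm y (subset_convexHull ℝ V hy)
      have h2 := hxm (-y) (subset_convexHull ℝ V (hneg y hy))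
      rw [hm] at h1 h2
      simp only [map_neg, LinearMap.neg_apply, map_zero] at h2 ⊢
      linarith
    have hFP : F = convexHull ℝ V := by
      rw [hl]
      ext y
      constructor
      · exact fun h => h.1
      · intro hy
        refine ⟨hy, fun z hz' => ?_⟩
        rw [hl', hl', hz]; simp
    rw [hFP] at hrank
    omega
  have hpos : 0 < frob x C₀ := lt_of_le_of_ne hm0 (Ne.symm hm)
  set C := (frob x C₀)⁻¹ • C₀ with hC
  have hval : ∀ y, frob y C = (frob x C₀)⁻¹ * frob y C₀ := by intro y; simp [hC]
  have hv : ∀ y ∈ V, frob y C ≤ 1 := by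
    intro y hy
    rw [hval, inv_mul_le_one₀ hpos]
    exact hxm y (subset_convexHull ℝ V hy)
  have hFface : F = face V C := by
    rw [hl] at hx ⊢
    ext y
    constructor
    · rintro ⟨hy, hy1⟩
      refine ⟨hy, ?_⟩
      have h1 := hy1 x hx.1
      have h2 := hx.2 y hy
      rw [hl', hl'] at h1 h2
      rw [hval, le_antisymm h2 h1, inv_mul_cancel₀ hm]
    · rintro ⟨hy, hy1⟩
      refine ⟨hy, fun z hz => ?_⟩
      rw [hval, inv_mul_eq_one₀ hm] at hy1
      rw [hl', hl', ← hy1]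
      exact hxm z hz
  refine ⟨C, ⟨hv, ?_⟩, hFface⟩
  have hxF : x ∈ face V C := hFface ▸ hx
  have h1 := finrank_vectorSpan_face hxF
  rw [← hFface, hrank, vectorSpan_convexHull_eq_top h0' hspan, finrank_top, hFface] at h1
  have h2 : Submodule.span ℝ (face V C) = ⊤ := Submodule.eq_top_of_finrank_eq h1
  rw [eq_top_iff, ← h2, Submodule.span_le]
  exact face_subset_span_tight hv

end Polytope

section Symmetry

variable {V : Set Mat4}

theorem frob_self_le_of_mem_convexHull {r : ℝ} (hr : ∀ x ∈ V, frob x x = r) :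
    (∀ x ∈ V, ∀ y ∈ convexHull ℝ V, frob y x ≤ r) ∧ ∀ y ∈ convexHull ℝ V, frob y y ≤ r := by
  have h1 : ∀ x ∈ V, ∀ y ∈ convexHull ℝ V, frob y x ≤ r := by
    intro x hx
    apply frob_le_of_mem_convexHull
    intro y hy
    have := frob_self_nonneg (y - x)
    simp only [map_sub, LinearMap.sub_apply, hr x hx, hr y hy, frob_comm x y] at this
    linarith
  refine ⟨h1, fun y hy => ?_⟩
  refine frob_le_of_mem_convexHull (fun x hx => ?_) y hy
  rw [frob_comm]
  exact h1 x hx y hy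

theorem extremePoints_convexHull_eq {r : ℝ} (hr : ∀ x ∈ V, frob x x = r) :
    (convexHull ℝ V).extremePoints ℝ = V := by
  obtain ⟨h1, h2⟩ := frob_self_le_of_mem_convexHull hr
  refine Set.Subset.antisymm extremePoints_convexHull_subset fun x hx => ?_
  rw [mem_extremePoints_iff_left]
  refine ⟨subset_convexHull ℝ V hx, fun y hy z hz hxyz => ?_⟩
  obtain ⟨a, b, ha, hb, hab, rfl⟩ := hxyz
  have hy1 := h1 _ hx y hy
  have hz1 := h1 _ hx z hz
  have hx1 := hr _ hx
  set x := a • y + b • z with hxdef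
  have hx2 : a * frob y x + b * frob z x = r := by
    have h : frob (a • y + b • z) x = r := hx1
    simpa only [map_add, map_smul, LinearMap.add_apply, LinearMap.smul_apply, smul_eq_mul] using h
  have hy2 : frob y x = r := by
    apply le_antisymm hy1
    have hb' : b = 1 - a := by linarith
    subst hb'
    nlinarith
  have h3 := h2 y hy
  rw [← sub_eq_zero]
  apply eq_zero_of_frob_self
  simp only [map_sub, LinearMap.sub_apply, hx1, hy2, frob_comm x y]
  linarith

theorem mem_symGroup_iff {r : ℝ} (hr : ∀ x ∈ V, frob x x = r) {φ : Mat4 ≃ₗ[ℝ] Mat4} :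
    φ ∈ symGroup (convexHull ℝ V) ↔ φ '' V = V := by
  have key : φ ∈ symGroup (convexHull ℝ V) ↔ φ '' (convexHull ℝ V) = convexHull ℝ V := Iff.rfl
  have him : φ '' (convexHull ℝ V) = convexHull ℝ (φ '' V) :=
    LinearMap.image_convexHull (φ : Mat4 →ₗ[ℝ] Mat4) V
  rw [key]
  constructor
  · intro h
    have h1 : φ '' ((convexHull ℝ V).extremePoints ℝ) = (φ '' convexHull ℝ V).extremePoints ℝ :=
      image_extremePoints φ _
    rwa [h, extremePoints_convexHull_eq hr] at h1
  · intro h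
    rw [him, h]

theorem frob_map_map {r : ℝ} (hr : ∀ x ∈ V, frob x x = r) (hfin : V.Finite)
    {c : ℝ} (hc : c ≠ 0)
    (hgram : ∀ X Y, ∑ g ∈ hfin.toFinset, frob g X * frob g Y = c * frob X Y)
    {φ : Mat4 ≃ₗ[ℝ] Mat4} (hφ : φ ∈ symGroup (convexHull ℝ V)) (X Y : Mat4) :
    frob (φ X) (φ Y) = frob X Y := by
  have hV := (mem_symGroup_iff hr).mp hφ
  have hadj : ∀ Y, ∃ Y', ∀ X, frob (φ X) Y = frob X Y' := fun Y =>
    exists_frob_eq ((frob.flip Y) ∘ₗ (φ : Mat4 →ₗ[ℝ] Mat4))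
  choose ad had using hadj
  have hsum : ∀ f : Mat4 → ℝ, ∑ g ∈ hfin.toFinset, f (φ g) = ∑ g ∈ hfin.toFinset, f g := by
    intro f
    refine Finset.sum_bij (fun g _ => φ g) ?_ ?_ ?_ ?_
    · intro g hg
      rw [Set.Finite.mem_toFinset] at hg ⊢
      rw [← hV]
      exact Set.mem_image_of_mem _ hg
    · intro a _ b _ h
      exact φ.injective h
    · intro b hb
      rw [Set.Finite.mem_toFinset, ← hV] at hb
      obtain ⟨a, ha, rfl⟩ := hb
      exact ⟨a, by simpa using ha, rfl⟩
    · intro g _; rfl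
  have hiso : ∀ Y Z, frob (ad Y) (ad Z) = frob Y Z := by
    intro Y Z
    apply mul_left_cancel₀ hc
    rw [← hgram, ← hgram, ← hsum fun g => frob g Y * frob g Z]
    exact Finset.sum_congr rfl fun g _ => by rw [had, had]
  have hinv : ∀ Y, φ (ad Y) = Y := by
    intro Y
    apply eq_of_frob_eq
    intro Z
    rw [frob_comm, had, hiso, frob_comm]
  have h1 := had (φ Y) X
  have h2 : ad (φ Y) = Y := φ.injective (hinv _)
  rw [h1, h2]

theorem tight_map {φ : Mat4 ≃ₗ[ℝ] Mat4} (hV : φ '' V = V)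
    (hfr : ∀ X Y, frob (φ X) (φ Y) = frob X Y) (C : Mat4) : tight V (φ C) = φ '' tight V C := by
  ext x
  constructor
  · rintro ⟨hx, hx1⟩
    rw [← hV] at hx
    obtain ⟨y, hy, rfl⟩ := hx
    exact ⟨y, ⟨hy, by rwa [hfr] at hx1⟩, rfl⟩
  · rintro ⟨y, ⟨hy, hy1⟩, rfl⟩
    exact ⟨hV ▸ Set.mem_image_of_mem _ hy, by rwa [hfr]⟩

theorem face_map {φ : Mat4 ≃ₗ[ℝ] Mat4} (hV : φ '' V = V)
    (hfr : ∀ X Y, frob (φ X) (φ Y) = frob X Y) (C : Mat4) : face V (φ C) = φ '' face V C := by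
  have hP : φ '' (convexHull ℝ V) = convexHull ℝ V := by
    have := LinearMap.image_convexHull (φ : Mat4 →ₗ[ℝ] Mat4) V
    refine this.trans ?_
    exact congrArg _ hV
  ext x
  constructor
  · rintro ⟨hx, hx1⟩
    rw [← hP] at hx
    obtain ⟨y, hy, rfl⟩ := hx
    exact ⟨y, ⟨hy, by rwa [hfr] at hx1⟩, rfl⟩
  · rintro ⟨y, ⟨hy, hy1⟩, rfl⟩
    exact ⟨hP ▸ Set.mem_image_of_mem _ hy, by rwa [hfr]⟩

theorem IsNormal.map {φ : Mat4 ≃ₗ[ℝ] Mat4} (hV : φ '' V = V)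
    (hfr : ∀ X Y, frob (φ X) (φ Y) = frob X Y) {C : Mat4} (hC : IsNormal V C) :
    IsNormal V (φ C) := by
  constructor
  · intro x hx
    rw [← hV] at hx
    obtain ⟨y, hy, rfl⟩ := hx
    rw [hfr]
    exact hC.1 y hy
  · rw [tight_map hV hfr]
    have h := Submodule.map_span (φ : Mat4 →ₗ[ℝ] Mat4) (tight V C)
    rw [hC.2, Submodule.map_top, LinearMap.range_eq_top.mpr φ.surjective] at h
    exact h.symm

theorem inter_face (V : Set Mat4) (C : Mat4) : V ∩ face V C = tight V C := by
  ext x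
  exact ⟨fun h => ⟨h.1, h.2.2⟩, fun h => ⟨h.1, subset_convexHull ℝ V h.1, h.2⟩⟩

theorem face_injOn (V : Set Mat4) : Set.InjOn (face V) {C | IsNormal V C} := by
  intro C hC D hD h
  refine eq_of_frob_eq_on_span hC.2 fun x hx => ?_
  have h1 := tight_subset_face V C hx
  rw [h] at h1
  rw [hx.2, h1.2]

theorem IsNormal.eq_of_tight_subset {C D : Mat4} (hC : IsNormal V C)
    (h : ∀ x ∈ tight V C, frob x D = 1) : C = D :=
  eq_of_frob_eq_on_span hC.2 fun x hx => by rw [hx.2, h x hx]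

end Symmetry

/-- Integer `4 × 4` matrices, in a form suited to evaluation. -/
structure IntMat where
  (a b c d e f g h i j k l m n o p : ℤ)

namespace IntMat

/-- The real matrix with the given integer entries. -/
def real : IntMat → Mat4
  | ⟨a, b, c, d, e, f, g, h, i, j, k, l, m, n, o, p⟩ =>
    !![(a : ℝ), b, c, d; (e : ℝ), f, g, h; (i : ℝ), j, k, l; (m : ℝ), n, o, p]

/-- The sum of products of the entries of two quadruples. -/
def dot4 (a b c d a' b' c' d' : ℤ) : ℤ :=
  ((a.mul a').add (b.mul b')).add ((c.mul c').add (d.mul d'))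

theorem dot4_eq (a b c d a' b' c' d' : ℤ) :
    dot4 a b c d a' b' c' d' = a * a' + b * b' + (c * c' + d * d') := rfl

/-- The Frobenius inner product. -/
def dot : IntMat → IntMat → ℤ
  | ⟨a, b, c, d, e, f, g, h, i, j, k, l, m, n, o, p⟩,
    ⟨a', b', c', d', e', f', g', h', i', j', k', l', m', n', o', p'⟩ =>
    ((dot4 a b c d a' b' c' d').add (dot4 e f g h e' f' g' h')).add
      ((dot4 i j k l i' j' k' l').add (dot4 m n o p m' n' o' p'))

/-- The matrix product. -/
def mul : IntMat → IntMat → IntMat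
  | ⟨a, b, c, d, e, f, g, h, i, j, k, l, m, n, o, p⟩,
    ⟨a', b', c', d', e', f', g', h', i', j', k', l', m', n', o', p'⟩ =>
    ⟨dot4 a b c d a' e' i' m', dot4 a b c d b' f' j' n', dot4 a b c d c' g' k' o',
      dot4 a b c d d' h' l' p',
     dot4 e f g h a' e' i' m', dot4 e f g h b' f' j' n', dot4 e f g h c' g' k' o',
      dot4 e f g h d' h' l' p',
     dot4 i j k l a' e' i' m', dot4 i j k l b' f' j' n', dot4 i j k l c' g' k' o',
      dot4 i j k l d' h' l' p',
     dot4 m n o p a' e' i' m', dot4 m n o p b' f' j' n', dot4 m n o p c' g' k' o',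
      dot4 m n o p d' h' l' p'⟩

/-- The transpose. -/
def tr : IntMat → IntMat
  | ⟨a, b, c, d, e, f, g, h, i, j, k, l, m, n, o, p⟩ =>
    ⟨a, e, i, m, b, f, j, n, c, g, k, o, d, h, l, p⟩

/-- Apply a function to all entries. -/
def map (F : ℤ → ℤ) : IntMat → IntMat
  | ⟨a, b, c, d, e, f, g, h, i, j, k, l, m, n, o, p⟩ =>
    ⟨F a, F b, F c, F d, F e, F f, F g, F h, F i, F j, F k, F l, F m, F n, F o, F p⟩

/-- A condition on all entries. -/
def all (F : ℤ → Bool) : IntMat → Bool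
  | ⟨a, b, c, d, e, f, g, h, i, j, k, l, m, n, o, p⟩ =>
    F a && F b && F c && F d && F e && F f && F g && F h && F i && F j && F k && F l && F m &&
      F n && F o && F p

/-- Equality test. -/
def eqb : IntMat → IntMat → Bool
  | ⟨a, b, c, d, e, f, g, h, i, j, k, l, m, n, o, p⟩,
    ⟨a', b', c', d', e', f', g', h', i', j', k', l', m', n', o', p'⟩ =>
    decide (a = a') && decide (b = b') && decide (c = c') && decide (d = d') &&
    decide (e = e') && decide (f = f') && decide (g = g') && decide (h = h') &&
    decide (i = i') && decide (j = j') && decide (k = k') && decide (l = l') &&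
    decide (m = m') && decide (n = n') && decide (o = o') && decide (p = p')

theorem eq_of_eqb {x y : IntMat} (h : x.eqb y = true) : x = y := by
  cases x; cases y
  simp only [eqb, Bool.and_eq_true, decide_eq_true_eq] at h
  simp only [h]

theorem real_injective : Function.Injective real := by
  intro x y h
  cases x; cases y
  simp only [real] at h
  have h' := fun i j => congrFun (congrFun h i) j
  simp [Fin.forall_fin_succ] at h'
  simp [h']

theorem frob_real (x y : IntMat) : frob x.real y.real = (x.dot y : ℝ) := by
  cases x; cases y
  simp [frob_apply, Fin.sum_univ_four, real, dot, dot4_eq, add_assoc]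

theorem _root_.Matrix.mul_fin_four {R : Type*} [CommRing R] (a b c d e f g h i j k l m n o p
    a' b' c' d' e' f' g' h' i' j' k' l' m' n' o' p' : R) :
    !![a, b, c, d; e, f, g, h; i, j, k, l; m, n, o, p] *
      !![a', b', c', d'; e', f', g', h'; i', j', k', l'; m', n', o', p'] =
    !![a*a'+b*e'+c*i'+d*m', a*b'+b*f'+c*j'+d*n', a*c'+b*g'+c*k'+d*o', a*d'+b*h'+c*l'+d*p';
       e*a'+f*e'+g*i'+h*m', e*b'+f*f'+g*j'+h*n', e*c'+f*g'+g*k'+h*o', e*d'+f*h'+g*l'+h*p';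
       i*a'+j*e'+k*i'+l*m', i*b'+j*f'+k*j'+l*n', i*c'+j*g'+k*k'+l*o', i*d'+j*h'+k*l'+l*p';
       m*a'+n*e'+o*i'+p*m', m*b'+n*f'+o*j'+p*n', m*c'+n*g'+o*k'+p*o', m*d'+n*h'+o*l'+p*p'] := by
  simp only [Matrix.cons_mul, Matrix.vecMul_cons, Matrix.smul_cons, Matrix.empty_mul]
  simp [← add_assoc, Matrix.vecHead, Matrix.vecTail]

theorem real_mul (x y : IntMat) : (x.mul y).real = x.real * y.real := by
  cases x; cases y
  simp only [real, mul, dot4_eq, Matrix.mul_fin_four, Int.cast_add, Int.cast_mul, add_assoc]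

theorem real_tr (x : IntMat) : x.tr.real = x.realᵀ := by
  cases x
  ext r s
  fin_cases r <;> fin_cases s <;> simp [real, tr]

/-- The matrix whose entries, shifted by `t`, are the digits of `n` in base `2 ^ w`. -/
def ofCode (w t n : ℕ) : IntMat :=
  let F := fun k : ℕ => Int.subNatNat (Nat.land (Nat.shiftRight n (Nat.mul k w)) (Nat.sub (Nat.shiftLeft 1 w) 1)) t
  ⟨F 0, F 1, F 2, F 3, F 4, F 5, F 6, F 7, F 8, F 9, F 10, F 11, F 12, F 13, F 14, F 15⟩

/-- The inverse of `ofCode 3 2`. -/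
def code : IntMat → ℕ
  | ⟨a, b, c, d, e, f, g, h, i, j, k, l, m, n, o, p⟩ =>
    let F := fun (x : ℤ) (r : ℕ) => Nat.add (Int.toNat (x.add 2)) (Nat.shiftLeft r 3)
    F a <| F b <| F c <| F d <| F e <| F f <| F g <| F h <| F i <| F j <| F k <| F l <| F m <|
      F n <| F o <| F p 0

/-- Division of all entries by two. -/
def half (x : IntMat) : IntMat := x.map fun a => a.ediv 2

end IntMat

/-- The elements reached from a stack of natural numbers by some operations, found by a depth
first search; `p` is a modulus used to recognize elements found before. -/
def reach (ops : List (ℕ → ℕ)) (p : ℕ) : ℕ → List ℕ → ℕ → List ℕ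
  | 0, _, _ => []
  | _ + 1, [], _ => []
  | n + 1, c :: q, seen =>
    bif Nat.testBit seen (Nat.mod c p) then reach ops p n q seen
    else c :: reach ops p n (ops.foldr (fun F q => F c :: q) q)
      (Nat.lor seen (Nat.shiftLeft 1 (Nat.mod c p)))

theorem forall_mem_foldr_cons {P : ℕ → Prop} {ops : List (ℕ → ℕ)}
    (hP : ∀ F ∈ ops, ∀ c, P c → P (F c)) {q : List ℕ} (hq : ∀ c ∈ q, P c) {c₀ : ℕ} (h0 : P c₀) :
    ∀ c ∈ ops.foldr (fun F q => F c₀ :: q) q, P c := by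
  induction ops with
  | nil => exact hq
  | cons F ops ih =>
    intro c hc
    rcases List.mem_cons.mp hc with rfl | hc
    · exact hP F List.mem_cons_self c₀ h0
    · exact ih (fun F hF => hP F (List.mem_cons_of_mem _ hF)) c hc

theorem mem_reach {P : ℕ → Prop} {ops : List (ℕ → ℕ)} (hP : ∀ F ∈ ops, ∀ c, P c → P (F c)) {p : ℕ} :
    ∀ (n : ℕ) (q : List ℕ) (seen : ℕ), (∀ c ∈ q, P c) → ∀ c ∈ reach ops p n q seen, P c := by
  intro n
  induction n with
  | zero => intro q seen _ c hc; simp [reach] at hc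
  | succ n ih =>
    intro q seen hq c hc
    cases q with
    | nil => simp [reach] at hc
    | cons c₀ q =>
      rw [reach] at hc
      have hq' : ∀ c ∈ q, P c := fun c hc => hq c (List.mem_cons_of_mem _ hc)
      cases hb : Nat.testBit seen (Nat.mod c₀ p) with
      | true => rw [hb] at hc; exact ih q seen hq' c hc
      | false =>
        rw [hb] at hc
        rcases List.mem_cons.mp hc with rfl | hc
        · exact hq c List.mem_cons_self
        · refine ih _ _ ?_ c hc
          exact forall_mem_foldr_cons hP hq' (hq c₀ List.mem_cons_self)

/-- A test that the members of a list are pairwise different, by their residues modulo `p`. -/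
def distinctMod (p : ℕ) : List ℕ → ℕ → Bool
  | [], _ => true
  | c :: q, seen => bif Nat.testBit seen (Nat.mod c p) then false
    else distinctMod p q (Nat.lor seen (Nat.shiftLeft 1 (Nat.mod c p)))

theorem nodup_of_distinctMod {p : ℕ} : ∀ (q : List ℕ) (seen : ℕ), distinctMod p q seen = true →
    q.Nodup ∧ ∀ c ∈ q, Nat.testBit seen (Nat.mod c p) = false := by
  intro q
  induction q with
  | nil => intro _ _; simp
  | cons c q ih =>
    intro seen h
    rw [distinctMod] at h
    cases hb : Nat.testBit seen (Nat.mod c p) with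
    | true => rw [hb] at h; simp at h
    | false =>
      rw [hb] at h
      obtain ⟨h1, h2⟩ := ih _ h
      have h3 : ∀ x ∈ q, Nat.testBit seen (Nat.mod x p) = false ∧ Nat.mod x p ≠ Nat.mod c p := by
        intro x hx
        have h4 := h2 x hx
        change ((seen ||| (1 <<< (Nat.mod c p))).testBit (Nat.mod x p)) = false at h4
        rw [Nat.testBit_or, Bool.or_eq_false_iff, Nat.testBit_shiftLeft] at h4
        refine ⟨h4.1, fun he => ?_⟩
        have h5 := h4.2
        rw [he] at h5
        simp at h5
      refine ⟨List.nodup_cons.mpr ⟨fun hc => (h3 c hc).2 rfl, h1⟩, ?_⟩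
      intro x hx
      rcases List.mem_cons.mp hx with rfl | hx
      · exact hb
      · exact (h3 x hx).1

namespace IntMat

/-- Half of the real matrix with the given integer entries. -/
noncomputable def hreal (x : IntMat) : Mat4 := (1 / 2 : ℝ) • x.real

theorem hreal_injective : Function.Injective hreal := fun x y h =>
  real_injective (smul_right_injective Mat4 (by norm_num : (1 / 2 : ℝ) ≠ 0) h)

theorem frob_hreal (x y : IntMat) : frob x.hreal y.hreal = (x.dot y : ℝ) / 4 := by
  simp only [hreal, map_smul, LinearMap.smul_apply, smul_eq_mul, frob_real]
  ring

theorem hreal_tr (x : IntMat) : x.tr.hreal = x.hrealᵀ := by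
  rw [hreal, real_tr, hreal, Matrix.transpose_smul]

theorem real_map_mul {F : ℤ → ℤ} {c : ℝ} (x : IntMat) (h : x.all fun a => decide (((F a : ℤ) : ℝ) = c * a)) :
    (x.map F).real = c • x.real := by
  cases x
  simp only [all, Bool.and_eq_true, decide_eq_true_eq] at h
  simp only [map, real, Matrix.smul_of, Matrix.smul_cons, smul_eq_mul, Matrix.smul_empty]
  simp only [h]

theorem all_mono {F G : ℤ → Bool} (hFG : ∀ a, F a = true → G a = true) {x : IntMat}
    (h : x.all F = true) : x.all G = true := by
  cases x
  simp only [all, Bool.and_eq_true] at h ⊢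
  obtain ⟨⟨⟨⟨⟨⟨⟨⟨⟨⟨⟨⟨⟨⟨⟨h1, h2⟩, h3⟩, h4⟩, h5⟩, h6⟩, h7⟩, h8⟩, h9⟩, h10⟩, h11⟩, h12⟩, h13⟩, h14⟩,
    h15⟩, h16⟩ := h
  exact ⟨⟨⟨⟨⟨⟨⟨⟨⟨⟨⟨⟨⟨⟨⟨hFG _ h1, hFG _ h2⟩, hFG _ h3⟩, hFG _ h4⟩, hFG _ h5⟩, hFG _ h6⟩, hFG _ h7⟩,
    hFG _ h8⟩, hFG _ h9⟩, hFG _ h10⟩, hFG _ h11⟩, hFG _ h12⟩, hFG _ h13⟩, hFG _ h14⟩, hFG _ h15⟩,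
    hFG _ h16⟩

theorem real_half {x : IntMat} (h : x.all (fun a => decide (a % 2 = 0)) = true) :
    x.half.real = (1 / 2 : ℝ) • x.real := by
  refine real_map_mul x (all_mono (fun a ha => ?_) h)
  simp only [decide_eq_true_eq] at ha ⊢
  obtain ⟨b, rfl⟩ := Int.dvd_of_emod_eq_zero ha
  have : (2 * b).ediv 2 = b := Int.mul_ediv_cancel_left b (by norm_num)
  rw [this]
  push_cast
  ring

end IntMat

/-- Integer row vectors. -/
abbrev Row := ℤ × ℤ × ℤ × ℤ

/-- The dot product of rows. -/
def Row.dot : Row → Row → ℤ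
  | (a, b, c, d), (a', b', c', d') => IntMat.dot4 a b c d a' b' c' d'

/-- The integer vectors of squared length four. -/
def rowList : List Row :=
  [(2, 0, 0, 0), (-2, 0, 0, 0), (0, 2, 0, 0), (0, -2, 0, 0), (0, 0, 2, 0), (0, 0, -2, 0),
   (0, 0, 0, 2), (0, 0, 0, -2),
   (1, 1, 1, 1), (1, 1, 1, -1), (1, 1, -1, 1), (1, 1, -1, -1),
   (1, -1, 1, 1), (1, -1, 1, -1), (1, -1, -1, 1), (1, -1, -1, -1),
   (-1, 1, 1, 1), (-1, 1, 1, -1), (-1, 1, -1, 1), (-1, 1, -1, -1),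
   (-1, -1, 1, 1), (-1, -1, 1, -1), (-1, -1, -1, 1), (-1, -1, -1, -1)]

/-- Orthogonality test for rows. -/
def Row.orth (r s : Row) : Bool := decide (r.dot s = 0)

/-- The matrix with given rows. -/
def ofRows : Row → Row → Row → Row → IntMat
  | (a, b, c, d), (e, f, g, h), (i, j, k, l), (m, n, o, p) =>
    ⟨a, b, c, d, e, f, g, h, i, j, k, l, m, n, o, p⟩

/-- The doubles of the elements of `F₄`. -/
def allV : List IntMat :=
  rowList.flatMap fun r₁ => (rowList.filter r₁.orth).flatMap fun r₂ =>
    (rowList.filter fun r => r₁.orth r && r₂.orth r).flatMap fun r₃ =>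
      (rowList.filter fun r => r₁.orth r && r₂.orth r && r₃.orth r).map fun r₄ =>
        ofRows r₁ r₂ r₃ r₄

/-- The matrices of the elements of `F₄`: orthogonal with half-integral entries. -/
def setV : Set Mat4 := {X | X * Xᵀ = 1 ∧ ∃ x : IntMat, x.hreal = X}

theorem mem_rowList {r : Row} (h : r.dot r = 4) : r ∈ rowList := by
  obtain ⟨a, b, c, d⟩ := r
  have h' : a * a + b * b + (c * c + d * d) = 4 := h
  have key : ∀ a ∈ Finset.Icc (-2 : ℤ) 2, ∀ b ∈ Finset.Icc (-2 : ℤ) 2, ∀ c ∈ Finset.Icc (-2 : ℤ) 2,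
      ∀ d ∈ Finset.Icc (-2 : ℤ) 2, a * a + b * b + (c * c + d * d) = 4 → (a, b, c, d) ∈ rowList := by
    decide +kernel
  refine key a ?_ b ?_ c ?_ d ?_ h' <;> rw [Finset.mem_Icc] <;> constructor <;> nlinarith

theorem even_dot_of_mem_rowList {r s : Row} (hr : r ∈ rowList) (hs : s ∈ rowList) :
    r.dot s % 2 = 0 := by
  have key : ∀ r ∈ rowList, ∀ s ∈ rowList, r.dot s % 2 = 0 := by decide +kernel
  exact key r hr s hs

theorem ofRows_surjective (x : IntMat) : ∃ r₁ r₂ r₃ r₄, x = ofRows r₁ r₂ r₃ r₄ := by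
  obtain ⟨a, b, c, d, e, f, g, h, i, j, k, l, m, n, o, p⟩ := x
  exact ⟨(a, b, c, d), (e, f, g, h), (i, j, k, l), (m, n, o, p), rfl⟩

theorem mul_tr_ofRows (r₁ r₂ r₃ r₄ s₁ s₂ s₃ s₄ : Row) :
    (ofRows r₁ r₂ r₃ r₄).mul (ofRows s₁ s₂ s₃ s₄).tr =
      ⟨r₁.dot s₁, r₁.dot s₂, r₁.dot s₃, r₁.dot s₄, r₂.dot s₁, r₂.dot s₂, r₂.dot s₃, r₂.dot s₄,
       r₃.dot s₁, r₃.dot s₂, r₃.dot s₃, r₃.dot s₄, r₄.dot s₁, r₄.dot s₂, r₄.dot s₃, r₄.dot s₄⟩ := rfl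

theorem real_scalar : (⟨4, 0, 0, 0, 0, 4, 0, 0, 0, 0, 4, 0, 0, 0, 0, 4⟩ : IntMat).real =
    (4 : ℝ) • 1 := by
  ext i j
  fin_cases i <;> fin_cases j <;> simp [IntMat.real]

theorem hreal_mul_transpose (x y : IntMat) :
    x.hreal * y.hrealᵀ = (1 / 4 : ℝ) • (x.mul y.tr).real := by
  rw [IntMat.real_mul, IntMat.real_tr, IntMat.hreal, IntMat.hreal, Matrix.transpose_smul,
    Matrix.smul_mul, Matrix.mul_smul, smul_smul]
  norm_num

theorem hreal_mem_setV_iff (x : IntMat) : x.hreal ∈ setV ↔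
    x.mul x.tr = ⟨4, 0, 0, 0, 0, 4, 0, 0, 0, 0, 4, 0, 0, 0, 0, 4⟩ := by
  have h : x.hreal ∈ setV ↔ x.hreal * x.hrealᵀ = 1 := ⟨fun h => h.1, fun h => ⟨h, x, rfl⟩⟩
  rw [h, hreal_mul_transpose]
  constructor
  · intro h
    apply IntMat.real_injective
    rw [real_scalar, ← h, smul_smul]
    norm_num
  · intro h
    rw [h, real_scalar, smul_smul]
    norm_num

theorem dot_comm (r s : Row) : r.dot s = s.dot r := by
  simp only [Row.dot, IntMat.dot4_eq]
  ring

theorem hreal_ofRows_mem_iff (r₁ r₂ r₃ r₄ : Row) : (ofRows r₁ r₂ r₃ r₄).hreal ∈ setV ↔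
    (r₁.dot r₁ = 4 ∧ r₂.dot r₂ = 4 ∧ r₃.dot r₃ = 4 ∧ r₄.dot r₄ = 4) ∧
    (r₁.dot r₂ = 0 ∧ r₁.dot r₃ = 0 ∧ r₁.dot r₄ = 0 ∧ r₂.dot r₃ = 0 ∧ r₂.dot r₄ = 0 ∧
      r₃.dot r₄ = 0) := by
  rw [hreal_mem_setV_iff, mul_tr_ofRows, IntMat.mk.injEq, dot_comm r₂ r₁, dot_comm r₃ r₁,
    dot_comm r₄ r₁, dot_comm r₃ r₂, dot_comm r₄ r₂, dot_comm r₄ r₃]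
  tauto

theorem hreal_mem_setV {x : IntMat} : x.hreal ∈ setV ↔ x ∈ allV := by
  constructor
  · intro h
    obtain ⟨r₁, r₂, r₃, r₄, rfl⟩ := ofRows_surjective x
    obtain ⟨⟨h1, h2, h3, h4⟩, h5, h6, h7, h8, h9, h10⟩ := (hreal_ofRows_mem_iff _ _ _ _).mp h
    simp only [allV, List.mem_flatMap, List.mem_map, List.mem_filter, Row.orth, Bool.and_eq_true,
      decide_eq_true_eq]
    exact ⟨r₁, mem_rowList h1, r₂, ⟨mem_rowList h2, h5⟩, r₃, ⟨mem_rowList h3, h6, h8⟩, r₄,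
      ⟨mem_rowList h4, ⟨h7, h9⟩, h10⟩, rfl⟩
  · intro h
    simp only [allV, List.mem_flatMap, List.mem_map, List.mem_filter, Row.orth, Bool.and_eq_true,
      decide_eq_true_eq] at h
    obtain ⟨r₁, h1, r₂, ⟨h2, h5⟩, r₃, ⟨h3, h6, h8⟩, r₄, ⟨h4, ⟨h7, h9⟩, h10⟩, rfl⟩ := h
    have key : ∀ r ∈ rowList, r.dot r = 4 := by decide +kernel
    exact (hreal_ofRows_mem_iff _ _ _ _).mpr
      ⟨⟨key _ h1, key _ h2, key _ h3, key _ h4⟩, h5, h6, h7, h8, h9, h10⟩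

theorem setV_eq : setV = IntMat.hreal '' {x | x ∈ allV} := by
  ext X
  constructor
  · intro h
    obtain ⟨x, rfl⟩ := h.2
    exact ⟨x, hreal_mem_setV.mp h, rfl⟩
  · rintro ⟨x, hx, rfl⟩
    exact hreal_mem_setV.mpr hx

theorem half_mul_tr {x y : IntMat} (hx : x.hreal ∈ setV) (hy : y.hreal ∈ setV) :
    (x.mul y.tr).half.hreal = x.hreal * y.hrealᵀ := by
  have heven : (x.mul y.tr).all (fun a => decide (a % 2 = 0)) = true := by
    obtain ⟨r₁, r₂, r₃, r₄, rfl⟩ := ofRows_surjective x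
    obtain ⟨s₁, s₂, s₃, s₄, rfl⟩ := ofRows_surjective y
    obtain ⟨⟨h1, h2, h3, h4⟩, -⟩ := (hreal_ofRows_mem_iff _ _ _ _).mp hx
    obtain ⟨⟨k1, k2, k3, k4⟩, -⟩ := (hreal_ofRows_mem_iff _ _ _ _).mp hy
    have e := fun {r s : Row} (hr : r.dot r = 4) (hs : s.dot s = 4) =>
      even_dot_of_mem_rowList (mem_rowList hr) (mem_rowList hs)
    rw [mul_tr_ofRows]
    simp [IntMat.all, e h1 k1, e h1 k2, e h1 k3, e h1 k4, e h2 k1, e h2 k2, e h2 k3, e h2 k4,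
      e h3 k1, e h3 k2, e h3 k3, e h3 k4, e h4 k1, e h4 k2, e h4 k3, e h4 k4]
  rw [IntMat.hreal, IntMat.real_half heven, hreal_mul_transpose, smul_smul]
  norm_num

theorem mul_transpose_mem_setV {X Y : Mat4} (hX : X ∈ setV) (hY : Y ∈ setV) : X * Yᵀ ∈ setV := by
  obtain ⟨x, rfl⟩ := hX.2
  obtain ⟨y, rfl⟩ := hY.2
  refine ⟨?_, _, half_mul_tr hX hY⟩
  rw [Matrix.transpose_mul, Matrix.transpose_transpose, Matrix.mul_assoc,
    ← Matrix.mul_assoc y.hrealᵀ, mul_eq_one_comm.mp hY.1, Matrix.one_mul, hX.1]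

/-- The double of the identity matrix. -/
def IntMat.two : IntMat := ⟨2, 0, 0, 0, 0, 2, 0, 0, 0, 0, 2, 0, 0, 0, 0, 2⟩

theorem IntMat.hreal_two : IntMat.two.hreal = 1 := by
  ext i j
  fin_cases i <;> fin_cases j <;> simp [IntMat.hreal, IntMat.real, IntMat.two]

theorem one_mem_setV : (1 : Mat4) ∈ setV := ⟨by simp, _, IntMat.hreal_two⟩

theorem transpose_mem_setV {X : Mat4} (hX : X ∈ setV) : Xᵀ ∈ setV := by
  simpa using mul_transpose_mem_setV one_mem_setV hX

theorem mul_mem_setV {X Y : Mat4} (hX : X ∈ setV) (hY : Y ∈ setV) : X * Y ∈ setV := by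
  simpa using mul_transpose_mem_setV hX (transpose_mem_setV hY)

theorem neg_mem_setV {X : Mat4} (hX : X ∈ setV) : -X ∈ setV := by
  obtain ⟨h, x, rfl⟩ := hX
  refine ⟨by simpa using h, x.map fun a => -a, ?_⟩
  rw [IntMat.hreal, IntMat.real_map_mul (c := -1), IntMat.hreal, neg_smul, one_smul, smul_neg]
  cases x
  simp [IntMat.all]

theorem mul_transpose_self_of_mem {X : Mat4} (hX : X ∈ setV) : X * Xᵀ = 1 := hX.1

theorem transpose_mul_self_of_mem {X : Mat4} (hX : X ∈ setV) : Xᵀ * X = 1 :=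
  mul_eq_one_comm.mp hX.1

theorem half_mul {x y : IntMat} (hx : x.hreal ∈ setV) (hy : y.hreal ∈ setV) :
    (x.mul y).half.hreal = x.hreal * y.hreal := by
  have h := half_mul_tr hx (y := y.tr) (IntMat.hreal_tr y ▸ transpose_mem_setV hy)
  rw [IntMat.hreal_tr, Matrix.transpose_transpose] at h
  rw [← h]
  rfl

theorem ofCode_code {x : IntMat} (hx : x ∈ allV) : IntMat.ofCode 3 2 x.code = x := by
  have key : (allV.all fun x => (IntMat.ofCode 3 2 x.code).eqb x) = true := by decide +kernel
  exact IntMat.eq_of_eqb (List.all_eq_true.mp key x hx)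

theorem length_allV : allV.length = 1152 := by decide +kernel

theorem finite_setV : setV.Finite := by
  rw [setV_eq]
  exact (List.finite_toSet allV).image _

theorem ncard_setV_le : setV.ncard ≤ 1152 := by
  classical
  have h1 : {x | x ∈ allV} = (allV.toFinset : Set IntMat) := by
    ext; simp
  rw [setV_eq, h1]
  refine (Set.ncard_image_le (Finset.finite_toSet _)).trans ?_
  rw [Set.ncard_coe_finset, ← length_allV]
  exact List.toFinset_card_le allV

theorem frob_self_of_mem {X : Mat4} (hX : X ∈ setV) : frob X X = 4 := by
  rw [frob_eq_trace, hX.1]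
  simp

theorem mem_setV_iff {X : Mat4} : X ∈ setV ↔ X * Xᵀ = 1 ∧ ∀ i j, ∃ k : ℤ, X i j = k / 2 := by
  refine and_congr_right fun _ => ⟨?_, fun h => ?_⟩
  · rintro ⟨⟨a, b, c, d, e, f, g, h, i, j, k, l, m, n, o, p⟩, rfl⟩ r s
    refine ⟨!![a, b, c, d; e, f, g, h; i, j, k, l; m, n, o, p] r s, ?_⟩
    fin_cases r <;> fin_cases s <;> simp [IntMat.hreal, IntMat.real] <;> ring
  · choose F hF using h
    refine ⟨⟨F 0 0, F 0 1, F 0 2, F 0 3, F 1 0, F 1 1, F 1 2, F 1 3, F 2 0, F 2 1, F 2 2, F 2 3,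
      F 3 0, F 3 1, F 3 2, F 3 3⟩, ?_⟩
    ext r s
    rw [hF]
    fin_cases r <;> fin_cases s <;> simp [IntMat.hreal, IntMat.real] <;> ring

theorem mem_setV_of_entries {X : Mat4} (h1 : X * Xᵀ = 1)
    (h2 : ∀ i j, X i j = 0 ∨ X i j = 1 ∨ X i j = -1) : X ∈ setV := by
  refine mem_setV_iff.mpr ⟨h1, fun i j => ?_⟩
  rcases h2 i j with h | h | h
  · exact ⟨0, by simp [h]⟩
  · exact ⟨2, by simp [h]⟩
  · exact ⟨-2, by simp [h]⟩

/-- The diagonal matrix with a single entry `-1`. -/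
noncomputable def signMat (i : Fin 4) : Mat4 := Matrix.diagonal fun j => if j = i then -1 else 1

theorem signMat_mem (i : Fin 4) : signMat i ∈ setV := by
  apply mem_setV_of_entries
  · rw [signMat, Matrix.diagonal_transpose, Matrix.diagonal_mul_diagonal, ← Matrix.diagonal_one]
    congr 1
    ext j
    split_ifs <;> simp
  · intro r s
    rw [signMat, Matrix.diagonal_apply]
    split_ifs <;> simp

/-- The matrix exchanging two coordinates. -/
noncomputable def swapMat (i j : Fin 4) : Mat4 := (Equiv.swap i j).toPEquiv.toMatrix

theorem swapMat_mem (i j : Fin 4) : swapMat i j ∈ setV := by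
  apply mem_setV_of_entries
  · rw [swapMat, ← PEquiv.toMatrix_symm, ← PEquiv.toMatrix_trans, ← Equiv.toPEquiv_symm,
      ← Equiv.toPEquiv_trans]
    simp
  · intro r s
    rw [swapMat, PEquiv.toMatrix_apply]
    split_ifs <;> simp

theorem sum_setV_map {φ : Mat4 → Mat4} (hinj : Function.Injective φ) (hmem : ∀ g ∈ setV, φ g ∈ setV)
    (F : Mat4 → ℝ) : ∑ g ∈ finite_setV.toFinset, F (φ g) = ∑ g ∈ finite_setV.toFinset, F g := by
  classical
  have himg : finite_setV.toFinset.image φ = finite_setV.toFinset := by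
    refine Finset.eq_of_subset_of_card_le ?_ (Finset.card_image_of_injective _ hinj).ge
    intro x hx
    obtain ⟨y, hy, rfl⟩ := Finset.mem_image.mp hx
    simpa using hmem y (by simpa using hy)
  conv_rhs => rw [← himg]
  rw [Finset.sum_image fun a _ b _ h => hinj h]

theorem mul_left_injective_of_mem {D : Mat4} (hD : D ∈ setV) :
    Function.Injective fun g : Mat4 => D * g := fun x y h => by
  have := congrArg (fun z => Dᵀ * z) h
  simpa [← Matrix.mul_assoc, transpose_mul_self_of_mem hD] using this

theorem mul_right_injective_of_mem {D : Mat4} (hD : D ∈ setV) :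
    Function.Injective fun g : Mat4 => g * D := fun x y h => by
  have := congrArg (fun z => z * Dᵀ) h
  simpa [Matrix.mul_assoc, mul_transpose_self_of_mem hD] using this

theorem sum_entry_mul_entry (i j k l : Fin 4) :
    ∑ g ∈ finite_setV.toFinset, g i j * g k l =
      if i = k ∧ j = l then ∑ g ∈ finite_setV.toFinset, g 0 0 * g 0 0 else 0 := by
  split_ifs with h
  · obtain ⟨rfl, rfl⟩ := h
    have h1 := sum_setV_map (mul_left_injective_of_mem (swapMat_mem i 0))
      (fun g hg => mul_mem_setV (swapMat_mem i 0) hg) fun g => g i j * g i j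
    have h2 := sum_setV_map (mul_right_injective_of_mem (swapMat_mem j 0))
      (fun g hg => mul_mem_setV hg (swapMat_mem j 0)) fun g => g 0 j * g 0 j
    rw [← h1]
    simp only [swapMat, PEquiv.toMatrix_toPEquiv_mul, PEquiv.mul_toMatrix_toPEquiv,
      Matrix.submatrix_apply, Equiv.swap_apply_left, id, Equiv.symm_swap] at h2 ⊢
    exact h2.symm
  · by_cases hik : i = k
    · have hjl : l ≠ j := fun hjl => h ⟨hik, hjl.symm⟩
      have h1 := sum_setV_map (mul_right_injective_of_mem (signMat_mem j))
        (fun g hg => mul_mem_setV hg (signMat_mem j)) fun g => g i j * g k l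
      simp only [signMat, Matrix.mul_diagonal, if_true, hjl, if_false, mul_one, mul_neg, neg_mul,
        Finset.sum_neg_distrib] at h1
      linarith
    · have h1 := sum_setV_map (mul_left_injective_of_mem (signMat_mem i))
        (fun g hg => mul_mem_setV (signMat_mem i) hg) fun g => g i j * g k l
      simp only [signMat, Matrix.diagonal_mul, if_true, Ne.symm hik, if_false, one_mul, neg_mul,
        Finset.sum_neg_distrib] at h1
      linarith

theorem exists_gram : ∃ c : ℝ, c ≠ 0 ∧
    ∀ X Y, ∑ g ∈ finite_setV.toFinset, frob g X * frob g Y = c * frob X Y := by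
  refine ⟨∑ g ∈ finite_setV.toFinset, g 0 0 * g 0 0, ?_, fun X Y => ?_⟩
  · have h : (1 : Mat4) ∈ finite_setV.toFinset := by simpa using one_mem_setV
    have := Finset.single_le_sum (f := fun g : Mat4 => g 0 0 * g 0 0)
      (fun g _ => mul_self_nonneg (g 0 0)) h
    simp at this
    linarith
  · have h : ∀ g : Mat4, frob g X * frob g Y =
        ∑ i, ∑ j, ∑ k, ∑ l, Y i j * X k l * (g i j * g k l) := by
      intro g
      simp only [frob_apply, Finset.sum_mul, Finset.mul_sum]
      refine Finset.sum_congr rfl fun i _ => Finset.sum_congr rfl fun j _ =>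
        Finset.sum_congr rfl fun k _ => Finset.sum_congr rfl fun l _ => by ring
    have hs := sum_entry_mul_entry
    generalize ∑ g ∈ finite_setV.toFinset, g 0 0 * g 0 0 = b at hs ⊢
    simp only [h]
    simp_rw [Finset.sum_comm (s := finite_setV.toFinset), ← Finset.mul_sum, hs]
    simp only [ite_and, mul_ite, mul_zero, Finset.sum_ite_eq, Finset.mem_univ, if_true,
      Finset.sum_ite_irrel, Finset.sum_const_zero]
    simp only [frob_apply, Finset.mul_sum]
    exact Finset.sum_congr rfl fun i _ => Finset.sum_congr rfl fun j _ => by ring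

theorem span_setV : Submodule.span ℝ setV = ⊤ := by
  obtain ⟨c, hc, hgram⟩ := exists_gram
  rw [eq_top_iff]
  intro X _
  have h : X = c⁻¹ • ∑ g ∈ finite_setV.toFinset, frob g X • g := by
    rw [eq_inv_smul_iff₀ hc]
    apply eq_of_frob_eq
    intro Y
    simp only [map_smul, map_sum, smul_eq_mul]
    rw [← hgram]
    exact Finset.sum_congr rfl fun g _ => by rw [frob_comm Y g, mul_comm]
  rw [h]
  exact Submodule.smul_mem _ _ (Submodule.sum_mem _ fun g hg =>
    Submodule.smul_mem _ _ (Submodule.subset_span (by simpa using hg)))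

theorem zero_mem_convexHull : (0 : Mat4) ∈ convexHull ℝ setV := by
  have h := (convex_convexHull ℝ setV) (subset_convexHull ℝ _ one_mem_setV)
    (subset_convexHull ℝ _ (neg_mem_setV one_mem_setV)) (by norm_num : (0 : ℝ) ≤ 1 / 2)
    (by norm_num : (0 : ℝ) ≤ 1 / 2) (by norm_num)
  simpa using h

/-- The linear symmetry group of `conv V`. -/
abbrev symV : Subgroup (Mat4 ≃ₗ[ℝ] Mat4) := symGroup (convexHull ℝ setV)

theorem mem_symV_iff {φ : Mat4 ≃ₗ[ℝ] Mat4} : φ ∈ symV ↔ φ '' setV = setV :=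
  mem_symGroup_iff fun _ => frob_self_of_mem

theorem mem_symV_of_mapsTo {φ : Mat4 ≃ₗ[ℝ] Mat4} (h : ∀ x ∈ setV, φ x ∈ setV) : φ ∈ symV := by
  rw [mem_symV_iff]
  exact Set.eq_of_subset_of_ncard_le (Set.image_subset_iff.mpr h)
    (Set.ncard_image_of_injective _ φ.injective).ge finite_setV

theorem map_mem_setV {φ : Mat4 ≃ₗ[ℝ] Mat4} (hφ : φ ∈ symV) {x : Mat4} (hx : x ∈ setV) :
    φ x ∈ setV :=
  (mem_symV_iff.mp hφ) ▸ Set.mem_image_of_mem _ hx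

theorem frob_map_symV {φ : Mat4 ≃ₗ[ℝ] Mat4} (hφ : φ ∈ symV) (X Y : Mat4) :
    frob (φ X) (φ Y) = frob X Y := by
  obtain ⟨c, hc, hgram⟩ := exists_gram
  exact frob_map_map (fun _ => frob_self_of_mem) finite_setV hc hgram hφ X Y

/-- The double of `mat1`. -/
def intMat1 : IntMat := ⟨1, -1, 1, 1, -1, -1, -1, 1, 1, 1, -1, 1, 1, -1, -1, -1⟩

/-- The double of `mat2`. -/
def intMat2 : IntMat := ⟨-1, 1, -1, -1, 1, -1, -1, -1, -1, -1, 1, -1, 1, 1, 1, -1⟩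

theorem hreal_intMat1 : intMat1.hreal = mat1 := by
  simp [IntMat.hreal, mat1, intMat1, IntMat.real]

theorem hreal_intMat2 : intMat2.hreal = mat2 := by
  simp [IntMat.hreal, mat2, intMat2, IntMat.real]

theorem mat1_mem : mat1 ∈ setV := ⟨mat1_mul_transpose, _, hreal_intMat1⟩

theorem mat2_mem : mat2 ∈ setV := ⟨mat2_mul_transpose, _, hreal_intMat2⟩

theorem inv_coe_eq_transpose {g : GL (Fin 4) ℝ} (hg : (g : Mat4) ∈ setV) :
    ((g⁻¹ : GL (Fin 4) ℝ) : Mat4) = (g : Mat4)ᵀ := by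
  have h1 : ((g⁻¹ : GL (Fin 4) ℝ) : Mat4) * (g : Mat4) = 1 := by
    rw [← Units.val_mul, inv_mul_cancel, Units.val_one]
  calc ((g⁻¹ : GL (Fin 4) ℝ) : Mat4) = ((g⁻¹ : GL (Fin 4) ℝ) : Mat4) * ((g : Mat4) * (g : Mat4)ᵀ) := by
        rw [hg.1, mul_one]
    _ = (g : Mat4)ᵀ := by rw [← mul_assoc, h1, one_mul]

theorem coe_mem_setV {g : GL (Fin 4) ℝ} (hg : g ∈ groupF4) : (g : Mat4) ∈ setV := by
  induction hg using Subgroup.closure_induction with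
  | mem x hx =>
    rcases hx with rfl | rfl
    · exact mat1_mem
    · exact mat2_mem
  | one => exact one_mem_setV
  | mul x y _ _ hx hy => exact mul_mem_setV hx hy
  | inv x _ hx => rw [inv_coe_eq_transpose hx]; exact transpose_mem_setV hx

/-- Right multiplication by half an integer matrix, on codes. -/
def mulCode (g : IntMat) (c : ℕ) : ℕ := (((IntMat.ofCode 3 2 c).mul g).half).code

/-- The codes of the elements of `F₄`, found by multiplication with the generators. -/
def codesV : List ℕ :=
  reach [mulCode intMat1, mulCode intMat2] 26580 4000 [IntMat.two.code] 0

theorem codesV_check : (Nat.beq codesV.length 1152 && distinctMod 26580 codesV 0 &&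
    codesV.all fun c => (IntMat.ofCode 3 2 c).code.beq c) = true := by
  decide +kernel

/-- The matrices of the elements of `groupF4`. -/
def matF4 : Set Mat4 := (fun g : GL (Fin 4) ℝ => (g : Mat4)) '' (groupF4 : Set (GL (Fin 4) ℝ))

theorem matF4_subset : matF4 ⊆ setV := by
  rintro _ ⟨g, hg, rfl⟩
  exact coe_mem_setV hg

theorem mulCode_spec {g : IntMat} (hg : g.hreal ∈ setV) {c : ℕ}
    (hc : (IntMat.ofCode 3 2 c).hreal ∈ setV) :
    (IntMat.ofCode 3 2 (mulCode g c)).hreal = (IntMat.ofCode 3 2 c).hreal * g.hreal := by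
  have h1 := half_mul hc hg
  have h2 : ((IntMat.ofCode 3 2 c).mul g).half ∈ allV :=
    hreal_mem_setV.mp (h1 ▸ mul_mem_setV hc hg)
  rw [mulCode, ofCode_code h2, h1]

theorem hreal_mem_matF4_of_mem_codesV : ∀ c ∈ codesV, (IntMat.ofCode 3 2 c).hreal ∈ matF4 := by
  refine mem_reach (P := fun c => (IntMat.ofCode 3 2 c).hreal ∈ matF4) ?_ _ _ _ ?_
  · intro F hF c hc
    have hcV := matF4_subset hc
    obtain ⟨g, hg, hgc⟩ := hc
    simp only [List.mem_cons, List.not_mem_nil, or_false] at hF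
    rcases hF with rfl | rfl
    · rw [mulCode_spec (hreal_intMat1 ▸ mat1_mem) hcV, hreal_intMat1]
      exact ⟨g * gen1, groupF4.mul_mem hg (Subgroup.subset_closure (by simp)), by
        rw [← hgc]; rfl⟩
    · rw [mulCode_spec (hreal_intMat2 ▸ mat2_mem) hcV, hreal_intMat2]
      exact ⟨g * gen2, groupF4.mul_mem hg (Subgroup.subset_closure (by simp)), by
        rw [← hgc]; rfl⟩
  · intro c hc
    rw [List.mem_singleton] at hc
    subst hc
    rw [ofCode_code (hreal_mem_setV.mp (IntMat.hreal_two ▸ one_mem_setV)), IntMat.hreal_two]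
    exact ⟨1, groupF4.one_mem, rfl⟩

theorem codesV_injOn : Set.InjOn (fun c => (IntMat.ofCode 3 2 c).hreal) {c | c ∈ codesV} := by
  have h := codesV_check
  simp only [Bool.and_eq_true, List.all_eq_true] at h
  intro c hc d hd hcd
  have h1 := IntMat.hreal_injective hcd
  have h2 := Nat.eq_of_beq_eq_true (h.2 c hc)
  have h3 := Nat.eq_of_beq_eq_true (h.2 d hd)
  rw [← h2, ← h3, h1]

theorem matF4_eq_and_ncard : matF4 = setV ∧ setV.ncard = 1152 := by
  have h := codesV_check
  simp only [Bool.and_eq_true] at h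
  have hnd := (nodup_of_distinctMod codesV 0 h.1.2).1
  have hlen := Nat.eq_of_beq_eq_true h.1.1
  set S := (fun c => (IntMat.ofCode 3 2 c).hreal) '' {c | c ∈ codesV} with hS
  have hcard : S.ncard = 1152 := by
    classical
    rw [hS, codesV_injOn.ncard_image]
    have : {c | c ∈ codesV} = (codesV.toFinset : Set ℕ) := by ext; simp
    rw [this, Set.ncard_coe_finset, List.toFinset_card_of_nodup hnd, hlen]
  have hSF : S ⊆ matF4 := by
    rintro _ ⟨c, hc, rfl⟩
    exact hreal_mem_matF4_of_mem_codesV c hc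
  have hSV : S = setV := Set.eq_of_subset_of_ncard_le (hSF.trans matF4_subset)
    (hcard ▸ ncard_setV_le) finite_setV
  exact ⟨Set.Subset.antisymm matF4_subset (hSV ▸ hSF), hSV ▸ hcard⟩

theorem matF4_eq : matF4 = setV := matF4_eq_and_ncard.1

theorem ncard_setV : setV.ncard = 1152 := matF4_eq_and_ncard.2

theorem convF4_eq : convF4 = convexHull ℝ setV := by
  rw [← matF4_eq]
  rfl

theorem mem_groupF4_iff {g : GL (Fin 4) ℝ} : g ∈ groupF4 ↔ (g : Mat4) ∈ setV := by
  refine ⟨coe_mem_setV, fun h => ?_⟩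
  rw [← matF4_eq] at h
  obtain ⟨g', hg', h'⟩ := h
  rwa [← Units.ext h']

/-- An element of `setV` as an invertible matrix. -/
noncomputable def unitOfMem {X : Mat4} (hX : X ∈ setV) : GL (Fin 4) ℝ :=
  ⟨X, Xᵀ, hX.1, mul_eq_one_comm.mp hX.1⟩

theorem reflMatrix_mul_transpose {v : Fin 4 → ℝ} (hv : v ⬝ᵥ v ≠ 0) :
    reflMatrix v * (reflMatrix v)ᵀ = 1 := by
  have h : (reflMatrix v)ᵀ = reflMatrix v := by
    simp [reflMatrix, Matrix.transpose_vecMulVec]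
  have h2 : Matrix.vecMulVec v v * Matrix.vecMulVec v v = (v ⬝ᵥ v) • Matrix.vecMulVec v v := by
    rw [Matrix.vecMulVec_mul_vecMulVec, Matrix.vecMulVec_smul]
  rw [h, reflMatrix, sub_mul, mul_sub, mul_sub, Matrix.smul_mul, Matrix.smul_mul, Matrix.mul_smul,
    Matrix.mul_smul, h2]
  simp only [mul_one, one_mul, smul_smul]
  have h3 : 2 / v ⬝ᵥ v * (2 / v ⬝ᵥ v * v ⬝ᵥ v) = 2 / v ⬝ᵥ v + 2 / v ⬝ᵥ v := by
    field_simp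
    ring
  rw [h3, add_smul]
  abel

/-- The reflection along an explicit vector. -/
theorem reflMatrix_vec (a b c d s : ℝ) (hs : 2 / (a * a + b * b + c * c + d * d) = s) :
    reflMatrix ![a, b, c, d] =
      !![1 - s * (a * a), -(s * (a * b)), -(s * (a * c)), -(s * (a * d));
         -(s * (b * a)), 1 - s * (b * b), -(s * (b * c)), -(s * (b * d));
         -(s * (c * a)), -(s * (c * b)), 1 - s * (c * c), -(s * (c * d));
         -(s * (d * a)), -(s * (d * b)), -(s * (d * c)), 1 - s * (d * d)] := by
  have hd : ![a, b, c, d] ⬝ᵥ ![a, b, c, d] = a * a + b * b + c * c + d * d := by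
    simp [dotProduct, Fin.sum_univ_four]
  rw [reflMatrix, hd, hs]
  ext i j
  fin_cases i <;> fin_cases j <;> simp

theorem reflMatrix_mem_setV {v : Fin 4 → ℝ} (hv : v ∈ rootsF4) : reflMatrix v ∈ setV := by
  obtain ⟨h1, h2⟩ := hv
  have hne : v ⬝ᵥ v ≠ 0 := by rcases h2 with h | h <;> rw [h] <;> norm_num
  refine mem_setV_iff.mpr ⟨reflMatrix_mul_transpose hne, fun i j => ?_⟩
  have hent : reflMatrix v i j = (1 : Mat4) i j - 2 / (v ⬝ᵥ v) * (v i * v j) := by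
    simp [reflMatrix, Matrix.vecMulVec_apply]
  have hone : ∃ k : ℤ, (1 : Mat4) i j = k := by
    rw [Matrix.one_apply]; split_ifs
    exacts [⟨1, by simp⟩, ⟨0, by simp⟩]
  obtain ⟨e, he⟩ := hone
  rw [hent, he]
  rcases h1 with h1 | h1
  · obtain ⟨k, hk⟩ := h1 i
    obtain ⟨l, hl⟩ := h1 j
    rcases h2 with h | h
    · exact ⟨2 * e - 4 * (k * l), by rw [h, hk, hl]; push_cast; ring⟩
    · exact ⟨2 * e - 2 * (k * l), by rw [h, hk, hl]; push_cast; ring⟩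
  · rcases h2 with h | h
    · obtain ⟨k, hk⟩ := h1 i
      obtain ⟨l, hl⟩ := h1 j
      exact ⟨2 * e - (2 * k + 1) * (2 * l + 1), by rw [h, hk, hl]; push_cast; ring⟩
    · exfalso
      choose k hk using h1
      have hs : (k 0 * (k 0 + 1) + k 1 * (k 1 + 1) + k 2 * (k 2 + 1) + k 3 * (k 3 + 1) : ℤ) = 1 := by
        have : ((k 0 * (k 0 + 1) + k 1 * (k 1 + 1) + k 2 * (k 2 + 1) + k 3 * (k 3 + 1) : ℤ) : ℝ) = 1 := by
          simp only [dotProduct, Fin.sum_univ_four, hk] at h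
          push_cast
          linarith
        exact_mod_cast this
      have e0 := Int.even_mul_succ_self (k 0)
      have e1 := Int.even_mul_succ_self (k 1)
      have e2 := Int.even_mul_succ_self (k 2)
      have e3 := Int.even_mul_succ_self (k 3)
      have := ((e0.add e1).add e2).add e3
      rw [hs] at this
      exact absurd this (by decide)

theorem mem_reflectionGroupF4 {g : GL (Fin 4) ℝ} {v₁ v₂ v₃ : Fin 4 → ℝ} (h1 : v₁ ∈ rootsF4)
    (h2 : v₂ ∈ rootsF4) (h3 : v₃ ∈ rootsF4)
    (hg : (g : Mat4) = reflMatrix v₁ * reflMatrix v₂ * reflMatrix v₃) :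
    g ∈ reflectionGroupF4 := by
  have h : g = unitOfMem (reflMatrix_mem_setV h1) * unitOfMem (reflMatrix_mem_setV h2) *
      unitOfMem (reflMatrix_mem_setV h3) := Units.ext hg
  rw [h]
  refine mul_mem (mul_mem ?_ ?_) ?_
  · exact Subgroup.subset_closure ⟨v₁, h1, rfl⟩
  · exact Subgroup.subset_closure ⟨v₂, h2, rfl⟩
  · exact Subgroup.subset_closure ⟨v₃, h3, rfl⟩

theorem vec_mem_rootsF4_of_int (a b c d : ℤ)
    (h : a * a + b * b + c * c + d * d = 1 ∨ a * a + b * b + c * c + d * d = 2) :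
    ![(a : ℝ), b, c, d] ∈ rootsF4 := by
  refine ⟨Or.inl fun i => ⟨![a, b, c, d] i, ?_⟩, ?_⟩
  · fin_cases i <;> rfl
  · simp only [dotProduct, Fin.sum_univ_four]
    change (a * a + b * b + c * c + d * d : ℝ) = 1 ∨ (a * a + b * b + c * c + d * d : ℝ) = 2
    rcases h with h | h
    · exact Or.inl (by exact_mod_cast h)
    · exact Or.inr (by exact_mod_cast h)

theorem vec_mem_rootsF4_of_half (a b c d : ℤ)
    (h : a * a + b * b + c * c + d * d + (a + b + c + d) = 0) :
    ![(a : ℝ) + 1 / 2, b + 1 / 2, c + 1 / 2, d + 1 / 2] ∈ rootsF4 := by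
  refine ⟨Or.inr fun i => ⟨![a, b, c, d] i, ?_⟩, Or.inl ?_⟩
  · fin_cases i <;> rfl
  · have h' : (a * a + b * b + c * c + d * d + (a + b + c + d) : ℝ) = 0 := by exact_mod_cast h
    simp [dotProduct, Fin.sum_univ_four]
    linarith

theorem groupF4_eq : groupF4 = reflectionGroupF4 := by
  apply le_antisymm
  · rw [groupF4, Subgroup.closure_le]
    rintro g (rfl | rfl)
    · refine mem_reflectionGroupF4 (vec_mem_rootsF4_of_int 0 0 1 (-1) (by decide))
        (vec_mem_rootsF4_of_int 0 1 1 0 (by decide))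
        (vec_mem_rootsF4_of_half 0 0 (-1) (-1) (by decide)) ?_
      rw [reflMatrix_vec _ _ _ _ 1 (by norm_num), reflMatrix_vec _ _ _ _ 1 (by norm_num),
        reflMatrix_vec _ _ _ _ 2 (by norm_num), Matrix.mul_fin_four, Matrix.mul_fin_four]
      simp only [gen1, mat1]
      norm_num
    · refine mem_reflectionGroupF4 (vec_mem_rootsF4_of_int 0 0 0 1 (by decide))
        (vec_mem_rootsF4_of_int 1 (-1) 0 0 (by decide))
        (vec_mem_rootsF4_of_half 0 0 0 0 (by decide)) ?_
      rw [reflMatrix_vec _ _ _ _ 2 (by norm_num), reflMatrix_vec _ _ _ _ 1 (by norm_num),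
        reflMatrix_vec _ _ _ _ 2 (by norm_num), Matrix.mul_fin_four, Matrix.mul_fin_four]
      simp only [gen2, mat2]
      norm_num
  · rw [reflectionGroupF4, Subgroup.closure_le]
    rintro g ⟨v, hv, hg⟩
    exact mem_groupF4_iff.mpr (hg ▸ reflMatrix_mem_setV hv)

/-- A quarter of the real matrix with the given integer entries. -/
noncomputable def IntMat.qreal (x : IntMat) : Mat4 := (1 / 4 : ℝ) • x.real

theorem IntMat.qreal_injective : Function.Injective IntMat.qreal := fun x y h =>
  IntMat.real_injective (smul_right_injective Mat4 (by norm_num : (1 / 4 : ℝ) ≠ 0) h)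

theorem frob_hreal_qreal (x y : IntMat) : frob x.hreal y.qreal = (x.dot y : ℝ) / 8 := by
  simp only [IntMat.hreal, IntMat.qreal, map_smul, LinearMap.smul_apply, smul_eq_mul,
    IntMat.frob_real]
  ring

theorem frob_hreal_qreal_eq_one {x y : IntMat} : frob x.hreal y.qreal = 1 ↔ x.dot y = 8 := by
  rw [frob_hreal_qreal, div_eq_one_iff_eq (by norm_num)]
  exact_mod_cast Iff.rfl

theorem frob_hreal_qreal_le_one {x y : IntMat} : frob x.hreal y.qreal ≤ 1 ↔ x.dot y ≤ 8 := by
  rw [frob_hreal_qreal, div_le_one (by norm_num)]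
  exact_mod_cast Iff.rfl

theorem nodup_allV : allV.Nodup := by
  classical
  have h1 : {x | x ∈ allV} = (allV.toFinset : Set IntMat) := by
    ext; simp
  have h := ncard_setV
  rw [setV_eq, Set.ncard_image_of_injective _ IntMat.hreal_injective, h1, Set.ncard_coe_finset,
    ← length_allV] at h
  exact Multiset.toFinset_card_eq_card_iff_nodup.mp h

theorem ncard_hreal_image {L : List IntMat} (hL : L.Nodup) :
    (IntMat.hreal '' {x | x ∈ L}).ncard = L.length := by
  classical
  have h1 : {x | x ∈ L} = (L.toFinset : Set IntMat) := by
    ext; simp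
  rw [Set.ncard_image_of_injective _ IntMat.hreal_injective, h1, Set.ncard_coe_finset,
    List.toFinset_card_of_nodup hL]

theorem tight_qreal (y : IntMat) :
    tight setV y.qreal = IntMat.hreal '' {x | x ∈ allV.filter fun x => x.dot y == 8} := by
  ext X
  simp only [tight, Set.mem_ofPred_eq, setV_eq, Set.mem_image, List.mem_filter, beq_iff_eq]
  constructor
  · rintro ⟨⟨x, hx, rfl⟩, h⟩
    exact ⟨x, ⟨hx, frob_hreal_qreal_eq_one.mp h⟩, rfl⟩
  · rintro ⟨x, ⟨hx, h⟩, rfl⟩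
    exact ⟨⟨x, hx, rfl⟩, frob_hreal_qreal_eq_one.mpr h⟩

theorem ncard_tight_qreal (y : IntMat) :
    (tight setV y.qreal).ncard = (allV.filter fun x => x.dot y == 8).length := by
  rw [tight_qreal, ncard_hreal_image (nodup_allV.filter _)]

/-- Four times the transpose of `matA1`. -/
def intN1 : IntMat := ⟨0, 0, 0, 4, 0, 0, 0, 0, 0, 0, 0, 0, 0, 0, 0, -4⟩

/-- Four times the transpose of `matA2`. -/
def intN2 : IntMat := ⟨1, 0, 0, 1, 0, 1, 1, 0, 1, 0, 0, 1, 0, -1, 1, -2⟩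

theorem qreal_intN1 : intN1.qreal = matA1ᵀ := by
  ext i j
  fin_cases i <;> fin_cases j <;> simp [IntMat.qreal, IntMat.real, intN1, matA1]

theorem qreal_intN2 : intN2.qreal = matA2ᵀ := by
  ext i j
  fin_cases i <;> fin_cases j <;> simp [IntMat.qreal, IntMat.real, intN2, matA2]

theorem dot_le_of_mem_allV : (allV.all fun x => decide (x.dot intN1 ≤ 8) && decide (x.dot intN2 ≤ 8)) = true := by
  decide +kernel

theorem ncard_tight_intN1 : (tight setV intN1.qreal).ncard = 288 := by
  rw [ncard_tight_qreal]
  decide +kernel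

theorem ncard_tight_intN2 : (tight setV intN2.qreal).ncard = 36 := by
  rw [ncard_tight_qreal]
  decide +kernel

theorem span_eq_top_of_frob {S : Set Mat4} (h : ∀ Z, (∀ x ∈ S, frob x Z = 0) → Z = 0) :
    Submodule.span ℝ S = ⊤ := by
  by_contra hne
  obtain ⟨l, hl0, hl⟩ := Submodule.exists_le_ker_of_lt_top _ (lt_top_iff_ne_top.mpr hne)
  obtain ⟨C, hC⟩ := exists_frob_eq l
  have : C = 0 := h C fun x hx => by
    rw [← hC]
    exact hl (Submodule.subset_span hx)
  apply hl0
  ext1 X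
  simp [hC, this]

/-- Elements of `F₄`, doubled, that span the space of matrices and lie on the first facet. -/
def basis1 : List IntMat :=
  [⟨-1, 1, 1, 1, 1, 1, 1, -1, -1, -1, 1, -1, -1, 1, -1, -1⟩,
   ⟨-1, 1, -1, 1, 1, 1, 1, 1, -1, 1, 1, -1, 1, 1, -1, -1⟩,
   ⟨-1, 1, -1, 1, -1, 1, 1, -1, -1, -1, -1, -1, 1, 1, -1, -1⟩,
   ⟨-1, 1, 1, 1, -1, -1, 1, -1, -1, -1, -1, 1, -1, 1, -1, -1⟩,
   ⟨-1, 1, -1, 1, 1, 1, 1, 1, -1, -1, 1, 1, -1, 1, 1, -1⟩,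
   ⟨-1, 1, -1, 1, 1, 1, -1, -1, -1, -1, -1, -1, -1, 1, 1, -1⟩,
   ⟨-1, 1, 1, 1, 1, 1, 1, -1, 1, -1, 1, 1, -1, -1, 1, -1⟩,
   ⟨1, 1, 1, 1, 1, -1, 1, -1, -1, -1, 1, 1, -1, 1, 1, -1⟩,
   ⟨0, 0, 0, 2, 0, 0, 2, 0, 0, -2, 0, 0, -2, 0, 0, 0⟩,
   ⟨-2, 0, 0, 0, 0, 2, 0, 0, 0, 0, 2, 0, 0, 0, 0, -2⟩,
   ⟨0, 0, 0, 2, 2, 0, 0, 0, 0, -2, 0, 0, 0, 0, 2, 0⟩,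
   ⟨-1, 1, -1, 1, -1, -1, -1, -1, -1, -1, 1, 1, -1, 1, 1, -1⟩,
   ⟨-1, 1, -1, 1, 1, 1, -1, -1, 1, 1, 1, 1, -1, 1, 1, -1⟩,
   ⟨-1, 1, -1, 1, -1, -1, 1, 1, -1, -1, -1, -1, -1, 1, 1, -1⟩,
   ⟨1, 1, 1, 1, 1, 1, -1, -1, 1, -1, 1, -1, -1, 1, 1, -1⟩,
   ⟨1, 1, 1, 1, -1, 1, -1, 1, -1, -1, 1, 1, -1, 1, 1, -1⟩]

/-- Elements of `F₄`, doubled, that span the space of matrices and lie on the second facet. -/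
def basis2 : List IntMat :=
  [⟨-1, -1, -1, 1, -1, 1, 1, 1, 1, -1, 1, 1, -1, -1, 1, -1⟩,
   ⟨0, 2, 0, 0, 0, 0, 2, 0, 2, 0, 0, 0, 0, 0, 0, -2⟩,
   ⟨2, 0, 0, 0, 0, 0, 2, 0, 0, 2, 0, 0, 0, 0, 0, -2⟩,
   ⟨1, 1, 1, 1, -1, -1, 1, 1, 1, -1, -1, 1, 1, -1, 1, -1⟩,
   ⟨1, -1, 1, 1, -1, 1, 1, 1, -1, -1, -1, 1, -1, -1, 1, -1⟩,
   ⟨1, -1, 1, 1, 1, 1, 1, -1, 1, 1, -1, 1, 1, -1, -1, -1⟩,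
   ⟨1, 1, 1, 1, -1, 1, 1, -1, 1, 1, -1, -1, 1, -1, 1, -1⟩,
   ⟨2, 0, 0, 0, 0, 2, 0, 0, 0, 0, 0, 2, 0, 0, 2, 0⟩,
   ⟨1, -1, -1, 1, 1, 1, 1, 1, -1, -1, 1, 1, 1, -1, 1, -1⟩,
   ⟨1, 1, 1, 1, 1, 1, -1, -1, 1, -1, -1, 1, 1, -1, 1, -1⟩,
   ⟨2, 0, 0, 0, 0, 2, 0, 0, 0, 0, -2, 0, 0, 0, 0, -2⟩,
   ⟨1, -1, 1, 1, 1, 1, 1, -1, 1, -1, -1, -1, -1, -1, 1, -1⟩,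
   ⟨1, 1, 1, 1, -1, 1, 1, -1, -1, -1, 1, 1, 1, -1, 1, -1⟩,
   ⟨2, 0, 0, 0, 0, 2, 0, 0, 0, 0, 2, 0, 0, 0, 0, -2⟩,
   ⟨2, 0, 0, 0, 0, 0, 2, 0, 0, 0, 0, 2, 0, -2, 0, 0⟩,
   ⟨1, 1, -1, 1, 1, 1, 1, -1, 1, -1, 1, 1, 1, -1, -1, -1⟩]

theorem frob_hreal_eq_zero (a b c d e f g h i j k l m n o p : ℤ) (Z : Mat4) :
    frob (IntMat.hreal ⟨a, b, c, d, e, f, g, h, i, j, k, l, m, n, o, p⟩) Z = 0 ↔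
      a * Z 0 0 + b * Z 0 1 + c * Z 0 2 + d * Z 0 3 + (e * Z 1 0 + f * Z 1 1 + g * Z 1 2 +
      h * Z 1 3) + (i * Z 2 0 + j * Z 2 1 + k * Z 2 2 + l * Z 2 3) + (m * Z 3 0 + n * Z 3 1 +
      o * Z 3 2 + p * Z 3 3) = 0 := by
  rw [IntMat.hreal, map_smul, LinearMap.smul_apply, smul_eq_mul, mul_eq_zero]
  simp [frob_apply, Fin.sum_univ_four, IntMat.real]

theorem eq_zero_of_basis1 {Z : Mat4} (h : ∀ x ∈ basis1, frob x.hreal Z = 0) : Z = 0 := by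
  simp only [basis1, List.forall_mem_cons, frob_hreal_eq_zero] at h
  obtain ⟨h1, h2, h3, h4, h5, h6, h7, h8, h9, h10, h11, h12, h13, h14, h15, h16, -⟩ := h
  norm_num at h1 h2 h3 h4 h5 h6 h7 h8 h9 h10 h11 h12 h13 h14 h15 h16
  ext i j
  fin_cases i <;> fin_cases j <;> simp only [Fin.zero_eta, Fin.mk_one, Fin.reduceFinMk, Matrix.zero_apply] <;> linarith

theorem eq_zero_of_basis2 {Z : Mat4} (h : ∀ x ∈ basis2, frob x.hreal Z = 0) : Z = 0 := by
  simp only [basis2, List.forall_mem_cons, frob_hreal_eq_zero] at h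
  obtain ⟨h1, h2, h3, h4, h5, h6, h7, h8, h9, h10, h11, h12, h13, h14, h15, h16, -⟩ := h
  norm_num at h1 h2 h3 h4 h5 h6 h7 h8 h9 h10 h11 h12 h13 h14 h15 h16
  ext i j
  fin_cases i <;> fin_cases j <;> simp only [Fin.zero_eta, Fin.mk_one, Fin.reduceFinMk, Matrix.zero_apply] <;> linarith

theorem basis1_subset : ∀ x ∈ basis1, x.hreal ∈ setV ∧ x.dot intN1 = 8 := by
  have h : (basis1.all fun x => ((x.mul x.tr).eqb ⟨4, 0, 0, 0, 0, 4, 0, 0, 0, 0, 4, 0, 0, 0, 0, 4⟩) &&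
    decide (x.dot intN1 = 8)) = true := by decide +kernel
  intro x hx
  have := List.all_eq_true.mp h x hx
  simp only [Bool.and_eq_true, decide_eq_true_eq] at this
  exact ⟨(hreal_mem_setV_iff x).mpr (IntMat.eq_of_eqb this.1), this.2⟩

theorem basis2_subset : ∀ x ∈ basis2, x.hreal ∈ setV ∧ x.dot intN2 = 8 := by
  have h : (basis2.all fun x => ((x.mul x.tr).eqb ⟨4, 0, 0, 0, 0, 4, 0, 0, 0, 0, 4, 0, 0, 0, 0, 4⟩) &&
    decide (x.dot intN2 = 8)) = true := by decide +kernel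
  intro x hx
  have := List.all_eq_true.mp h x hx
  simp only [Bool.and_eq_true, decide_eq_true_eq] at this
  exact ⟨(hreal_mem_setV_iff x).mpr (IntMat.eq_of_eqb this.1), this.2⟩

theorem isNormal_intN1 : IsNormal setV intN1.qreal := by
  constructor
  · rw [setV_eq]
    rintro _ ⟨x, hx, rfl⟩
    have := List.all_eq_true.mp dot_le_of_mem_allV x hx
    simp only [Bool.and_eq_true, decide_eq_true_eq] at this
    exact frob_hreal_qreal_le_one.mpr this.1
  · refine span_eq_top_of_frob fun Z hZ => eq_zero_of_basis1 fun x hx => ?_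
    exact hZ _ ⟨(basis1_subset x hx).1, frob_hreal_qreal_eq_one.mpr (basis1_subset x hx).2⟩

theorem isNormal_intN2 : IsNormal setV intN2.qreal := by
  constructor
  · rw [setV_eq]
    rintro _ ⟨x, hx, rfl⟩
    have := List.all_eq_true.mp dot_le_of_mem_allV x hx
    simp only [Bool.and_eq_true, decide_eq_true_eq] at this
    exact frob_hreal_qreal_le_one.mpr this.2
  · refine span_eq_top_of_frob fun Z hZ => eq_zero_of_basis2 fun x hx => ?_
    exact hZ _ ⟨(basis2_subset x hx).1, frob_hreal_qreal_eq_one.mpr (basis2_subset x hx).2⟩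

/-- Left multiplication by an element of `F₄`. -/
noncomputable def leftEquiv {g : Mat4} (hg : g ∈ setV) : Mat4 ≃ₗ[ℝ] Mat4 :=
  LinearEquiv.ofLinearMap (LinearMap.mulLeft ℝ g) (LinearMap.mulLeft ℝ gᵀ)
    (by ext1 X; simp [← Matrix.mul_assoc, hg.1])
    (by ext1 X; simp [← Matrix.mul_assoc, transpose_mul_self_of_mem hg])

/-- Right multiplication by an element of `F₄`. -/
noncomputable def rightEquiv {g : Mat4} (hg : g ∈ setV) : Mat4 ≃ₗ[ℝ] Mat4 :=
  LinearEquiv.ofLinearMap (LinearMap.mulRight ℝ g) (LinearMap.mulRight ℝ gᵀ)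
    (by ext1 X; simp [Matrix.mul_assoc, transpose_mul_self_of_mem hg])
    (by ext1 X; simp [Matrix.mul_assoc, hg.1])

/-- Transposition. -/
noncomputable def transEquiv : Mat4 ≃ₗ[ℝ] Mat4 := Matrix.transposeLinearEquiv (Fin 4) (Fin 4) ℝ ℝ

/-- A multiple of an isometry normalizing `F₄` and exchanging long and short roots. -/
def intTau : IntMat := ⟨1, 1, 0, 0, 1, -1, 0, 0, 0, 0, 1, 1, 0, 0, 1, -1⟩

theorem intTau_sq : intTau.real * intTau.real = (2 : ℝ) • 1 := by
  ext i j
  fin_cases i <;> fin_cases j <;>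
    simp [IntMat.real, intTau, Matrix.mul_apply, Fin.sum_univ_four] <;> norm_num

theorem intTau_transpose : intTau.realᵀ = intTau.real := by
  rw [← IntMat.real_tr]
  rfl

/-- Conjugation by the isometry exchanging long and short roots. -/
noncomputable def tauMap : Mat4 →ₗ[ℝ] Mat4 :=
  (1 / 2 : ℝ) • (LinearMap.mulRight ℝ intTau.real ∘ₗ LinearMap.mulLeft ℝ intTau.real)

theorem tauMap_apply (X : Mat4) : tauMap X = (1 / 2 : ℝ) • (intTau.real * X * intTau.real) := by
  simp [tauMap]

theorem tauMap_tauMap (X : Mat4) : tauMap (tauMap X) = X := by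
  rw [tauMap_apply, tauMap_apply, Matrix.mul_smul, Matrix.smul_mul, smul_smul]
  have : intTau.real * (intTau.real * X * intTau.real) * intTau.real =
      (intTau.real * intTau.real) * X * (intTau.real * intTau.real) := by
    simp only [Matrix.mul_assoc]
  rw [this, intTau_sq, Matrix.smul_mul, Matrix.mul_smul, Matrix.smul_mul, smul_smul, smul_smul]
  norm_num

/-- Conjugation by the isometry exchanging long and short roots, as an equivalence. -/
noncomputable def tauEquiv : Mat4 ≃ₗ[ℝ] Mat4 :=
  LinearEquiv.ofLinearMap tauMap tauMap (LinearMap.ext tauMap_tauMap) (LinearMap.ext tauMap_tauMap)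

/-- The action of `tauEquiv` on integer matrices. -/
def IntMat.tau (x : IntMat) : IntMat := ((intTau.mul x).mul intTau).half

theorem tau_even : (allV.all fun x =>
    ((intTau.mul x).mul intTau).all fun a => decide (a % 2 = 0)) = true := by
  decide +kernel

theorem hreal_tau {x : IntMat}
    (hx : (((intTau.mul x).mul intTau).all fun a => decide (a % 2 = 0)) = true) :
    x.tau.hreal = tauEquiv x.hreal := by
  change _ = tauMap _
  rw [IntMat.hreal, IntMat.tau, IntMat.real_half hx, tauMap_apply, IntMat.hreal, IntMat.real_mul,
    IntMat.real_mul, Matrix.mul_smul, Matrix.smul_mul]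

theorem qreal_tau {x : IntMat}
    (hx : (((intTau.mul x).mul intTau).all fun a => decide (a % 2 = 0)) = true) :
    x.tau.qreal = tauEquiv x.qreal := by
  change _ = tauMap _
  rw [IntMat.qreal, IntMat.tau, IntMat.real_half hx, tauMap_apply, IntMat.qreal, IntMat.real_mul,
    IntMat.real_mul, Matrix.mul_smul, Matrix.smul_mul, smul_comm]

theorem tauEquiv_transpose (X : Mat4) : tauEquiv Xᵀ = (tauEquiv X)ᵀ := by
  change tauMap _ = (tauMap _)ᵀ
  rw [tauMap_apply, tauMap_apply, Matrix.transpose_smul, Matrix.transpose_mul, Matrix.transpose_mul,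
    intTau_transpose, Matrix.mul_assoc]

theorem tauEquiv_mul (X Y : Mat4) : tauEquiv (X * Y) = tauEquiv X * tauEquiv Y := by
  change tauMap _ = tauMap _ * tauMap _
  rw [tauMap_apply, tauMap_apply, tauMap_apply, Matrix.smul_mul, Matrix.mul_smul, smul_smul]
  have : intTau.real * X * intTau.real * (intTau.real * Y * intTau.real) =
      intTau.real * X * (intTau.real * intTau.real) * Y * intTau.real := by
    simp only [Matrix.mul_assoc]
  rw [this, intTau_sq, Matrix.mul_smul, Matrix.smul_mul, Matrix.smul_mul, smul_smul,
    Matrix.mul_one, ← Matrix.mul_assoc]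
  norm_num

theorem tauEquiv_one : tauEquiv 1 = 1 := by
  change tauMap _ = _
  rw [tauMap_apply, Matrix.mul_one, intTau_sq, smul_smul]
  norm_num

/-- The symmetries generated by multiplications, transposition and `tauEquiv`. -/
def genSym : Subgroup (Mat4 ≃ₗ[ℝ] Mat4) :=
  Subgroup.closure ({φ | ∃ g, ∃ hg : g ∈ setV, φ = leftEquiv hg ∨ φ = rightEquiv hg} ∪
    {transEquiv, tauEquiv})

theorem leftEquiv_mem {g : Mat4} (hg : g ∈ setV) : leftEquiv hg ∈ genSym :=
  Subgroup.subset_closure (Or.inl ⟨g, hg, Or.inl rfl⟩)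

theorem rightEquiv_mem {g : Mat4} (hg : g ∈ setV) : rightEquiv hg ∈ genSym :=
  Subgroup.subset_closure (Or.inl ⟨g, hg, Or.inr rfl⟩)

theorem transEquiv_mem : transEquiv ∈ genSym := Subgroup.subset_closure (Or.inr (Or.inl rfl))

theorem tauEquiv_mem : tauEquiv ∈ genSym := Subgroup.subset_closure (Or.inr (Or.inr rfl))

theorem genSym_le : genSym ≤ symV := by
  refine (Subgroup.closure_le _).mpr ?_
  rintro φ (⟨g, hg, rfl | rfl⟩ | rfl | rfl) <;> refine mem_symV_of_mapsTo fun X hX => ?_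
  · exact mul_mem_setV hg hX
  · exact mul_mem_setV hX hg
  · exact transpose_mem_setV hX
  · refine ⟨?_, ?_⟩
    · rw [← tauEquiv_transpose, ← tauEquiv_mul, hX.1, tauEquiv_one]
    · obtain ⟨x, rfl⟩ := hX.2
      exact ⟨x.tau, hreal_tau (List.all_eq_true.mp tau_even x (hreal_mem_setV.mp hX))⟩

section Pulling

/-- A test that a face is a simplicial cone: among the supports in the list there are `d` that
meet `R` in a single ray, for different rays in `rem`. -/
noncomputable def pullLeaf (R : ℕ) (H : List ℕ) : ℕ → ℕ → Bool :=
  List.rec (motive := fun _ => ℕ → ℕ → Bool) (fun _ d => Nat.beq d 0)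
    (fun m _ ih rem d =>
      cond (Nat.beq (Nat.land (Nat.land R m) (Nat.sub (Nat.land R m) 1)) 0)
        (cond (Nat.beq (Nat.land rem m) 0) (ih rem d)
          (ih (Nat.xor rem (Nat.land R m)) (Nat.sub d 1)))
        (ih rem d)) H

/-- Remove the supports that contain a previous one within `R`, and reverse the list. The numbers
`A` and `E` hold the supports kept so far and ones, in blocks of 49 bits. -/
noncomputable def thinOut (R : ℕ) (H : List ℕ) : List ℕ → ℕ → ℕ → List ℕ :=
  List.rec (motive := fun _ => List ℕ → ℕ → ℕ → List ℕ) (fun acc _ _ => acc)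
    (fun m _ ih acc A E => cond (Nat.beq (Nat.land R m) 0) (ih acc A E)
      (cond (Nat.beq (Nat.land (Nat.add (Nat.land A (Nat.mul (Nat.xor R (Nat.land R m)) E))
          (Nat.mul 281474976710655 E)) (Nat.mul 281474976710656 E)) (Nat.mul 281474976710656 E))
        (ih (m :: acc) (Nat.add (Nat.mul A 562949953421312) m)
          (Nat.add (Nat.mul E 562949953421312) 1))
        (ih acc A E))) H

/-- The supports that are minimal within `R`. -/
noncomputable def selectMin (R : ℕ) (H : List ℕ) : List ℕ := thinOut R (thinOut R H [] 0 0) [] 0 0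

/-- The supports that contain one or two of the rays in `R`. -/
noncomputable def selectNear (R : ℕ) (H : List ℕ) : List ℕ :=
  List.rec (motive := fun _ => List ℕ) []
    (fun m _ ih => cond (Nat.beq (Nat.land R m) 0) ih
      (cond (Nat.beq (Nat.land (Nat.land (Nat.land R m) (Nat.sub (Nat.land R m) 1))
          (Nat.sub (Nat.land (Nat.land R m) (Nat.sub (Nat.land R m) 1)) 1)) 0)
        (m :: ih) ih)) H

/-- The branches of a pulling triangulation at the ray with mask `r`, one for each support that
contains it. -/
noncomputable def pullBranch (f : ℕ → List ℕ → ℕ → ℕ) (R r : ℕ) (H L : List ℕ) : ℕ → Bool → ℕ :=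
  List.rec (motive := fun _ => ℕ → Bool → ℕ) (fun c b => cond b c 0)
    (fun m _ ih c b => cond (Nat.beq (Nat.land m r) 0) (ih c b)
      (cond (Nat.beq c 0) 0 (ih (f (Nat.xor R (Nat.land R m)) H c) true))) L

/-- A pulling triangulation of a cone of dimension at most `d`, with rays in `R` and functionals
whose supports form the list `H`. The bits of `c` tell the rays to pull and how to thin out the
list. The result is zero on failure, and what is left of `c` otherwise. -/
noncomputable def pull (d : ℕ) : ℕ → List ℕ → ℕ → ℕ :=
  Nat.rec (motive := fun _ => ℕ → List ℕ → ℕ → ℕ) (fun _ _ c => c)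
    (fun d ih R H c => cond (pullLeaf R H R (Nat.succ d)) c
      (cond (Nat.beq (Nat.land R (Nat.pow 2 (Nat.land c 63))) 0) 0
        (cond (Nat.beq (Nat.land c 64) 0)
          (pullBranch ih R (Nat.pow 2 (Nat.land c 63)) (selectNear R H) (selectNear R H)
            (Nat.shiftRight c 7) false)
          (pullBranch ih R (Nat.pow 2 (Nat.land c 63)) (selectMin R H)
            (selectMin R H) (Nat.shiftRight c 7) false)))) d

/-- The test that the triangulation succeeds. -/
noncomputable def pullTest (d R : ℕ) (H : List ℕ) (c : ℕ) : Bool :=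
  cond (Nat.beq (pull d R H c) 0) false true

theorem pullTest_iff {d R : ℕ} {H : List ℕ} {c : ℕ} : pullTest d R H c = true ↔ pull d R H c ≠ 0 := by
  rw [pullTest]
  cases h : Nat.beq (pull d R H c) 0 with
  | false => simpa using Nat.ne_of_beq_eq_false h
  | true => simpa using Nat.eq_of_beq_eq_true h

theorem beq_land_two_pow (m k : ℕ) : Nat.beq (Nat.land m (Nat.pow 2 k)) 0 = !m.testBit k := by
  have h : m &&& 2 ^ k = 0 ↔ m.testBit k = false := by
    constructor
    · intro h
      have := congrArg (fun n => n.testBit k) h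
      simpa [Nat.testBit_and, Nat.testBit_two_pow_self] using this
    · intro h
      refine Nat.eq_of_testBit_eq fun i => ?_
      rw [Nat.testBit_and, Nat.testBit_two_pow, Nat.zero_testBit]
      by_cases hi : k = i
      · subst hi; simp [h]
      · simp [hi]
  cases hm : m.testBit k with
  | false => exact Nat.beq_eq ▸ h.mpr hm
  | true =>
    refine Bool.eq_false_iff.mpr fun h' => ?_
    have := h.mp (Nat.eq_of_beq_eq_true h')
    rw [hm] at this
    cases this

theorem mem_of_mem_thinOut {R m : ℕ} : ∀ {H acc : List ℕ} {A E : ℕ}, m ∈ thinOut R H acc A E →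
    m ∈ H ∨ m ∈ acc
  | [], _, _, _, h => Or.inr h
  | a :: H, acc, A, E, h => by
    change m ∈ cond _ (thinOut R H acc A E) (cond (Nat.beq (Nat.land (Nat.add _ _) _) _)
      (thinOut R H (a :: acc) _ _) (thinOut R H acc A E)) at h
    have key : ∀ {acc' A' E'}, (m ∈ acc' → m = a ∨ m ∈ acc) → m ∈ thinOut R H acc' A' E' →
        m ∈ a :: H ∨ m ∈ acc := fun hacc h => by
      rcases mem_of_mem_thinOut h with h | h
      · exact Or.inl (List.mem_cons_of_mem _ h)
      · exact (hacc h).imp (fun h => by rw [h]; exact List.mem_cons_self) id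
    revert h
    cases Nat.beq (Nat.land R a) 0
    · generalize Nat.beq _ _ = b
      cases b
      · exact key Or.inr
      · exact key fun h => List.mem_cons.mp h
    · exact key Or.inr

theorem mem_of_mem_selectMin {R m : ℕ} {H : List ℕ} (h : m ∈ selectMin R H) : m ∈ H := by
  simpa using (mem_of_mem_thinOut h).imp_left mem_of_mem_thinOut

theorem mem_of_mem_selectNear {R m : ℕ} : ∀ {H : List ℕ}, m ∈ selectNear R H → m ∈ H
  | [], h => by simp [selectNear] at h
  | a :: H, h => by
    have h' : m = a ∨ m ∈ selectNear R H := by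
      change m ∈ cond _ (selectNear R H) (cond _ (a :: selectNear R H) (selectNear R H)) at h
      revert h
      cases Nat.beq (Nat.land R a) 0
      · cases Nat.beq (Nat.land (Nat.land (Nat.land R a) (Nat.sub (Nat.land R a) 1))
          (Nat.sub (Nat.land (Nat.land R a) (Nat.sub (Nat.land R a) 1)) 1)) 0
        · exact Or.inr
        · exact List.mem_cons.mp
      · exact Or.inr
    rcases h' with rfl | h'
    · exact List.mem_cons_self
    · exact List.mem_cons_of_mem _ (mem_of_mem_selectNear h')

theorem pullBranch_cons (f : ℕ → List ℕ → ℕ → ℕ) (R k : ℕ) (H : List ℕ) (m : ℕ) (L : List ℕ)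
    (c : ℕ) (b : Bool) : pullBranch f R (Nat.pow 2 k) H (m :: L) c b =
      cond (!m.testBit k) (pullBranch f R (Nat.pow 2 k) H L c b)
        (cond (Nat.beq c 0) 0
          (pullBranch f R (Nat.pow 2 k) H L (f (Nat.xor R (Nat.land R m)) H c) true)) := by
  rw [← beq_land_two_pow]
  rfl

theorem pullBranch_zero (f : ℕ → List ℕ → ℕ → ℕ) (R k : ℕ) (H : List ℕ) :
    ∀ (L : List ℕ) (b : Bool), pullBranch f R (Nat.pow 2 k) H L 0 b = 0
  | [], b => by cases b <;> rfl
  | m :: L, b => by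
    rw [pullBranch_cons]
    cases m.testBit k
    · exact pullBranch_zero f R k H L b
    · rfl

theorem pullBranch_ne_zero {f : ℕ → List ℕ → ℕ → ℕ} {R r : ℕ} {H : List ℕ} :
    ∀ {L : List ℕ} {c : ℕ} {b : Bool}, pullBranch f R (Nat.pow 2 r) H L c b ≠ 0 →
      (∀ m ∈ L, m.testBit r = true → ∃ c', f (Nat.xor R (Nat.land R m)) H c' ≠ 0) ∧
      (b = true ∨ ∃ m ∈ L, m.testBit r = true)
  | [], c, b, h => by
    refine ⟨by simp, Or.inl ?_⟩
    cases b
    · exact absurd rfl h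
    · rfl
  | m :: L, c, b, h => by
    rw [pullBranch_cons] at h
    cases hb : m.testBit r with
    | false =>
      rw [hb] at h
      obtain ⟨h1, h2⟩ := pullBranch_ne_zero h
      refine ⟨fun m' hm' hr => ?_, h2.imp id fun ⟨m', hm', hr⟩ => ⟨m', List.mem_cons_of_mem _ hm', hr⟩⟩
      rcases List.mem_cons.mp hm' with rfl | hm'
      · rw [hb] at hr; cases hr
      · exact h1 m' hm' hr
    | true =>
      rw [hb] at h
      cases hc : Nat.beq c 0 with
      | true => rw [hc] at h; exact absurd rfl h
      | false =>
        rw [hc] at h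
        have h' : pullBranch f R (Nat.pow 2 r) H L (f (Nat.xor R (Nat.land R m)) H c) true ≠ 0 := h
        obtain ⟨h1, -⟩ := pullBranch_ne_zero h'
        refine ⟨fun m' hm' hr => ?_, Or.inr ⟨m, List.mem_cons_self, hb⟩⟩
        rcases List.mem_cons.mp hm' with rfl | hm'
        · refine ⟨c, fun h0 => h' ?_⟩
          rw [h0, pullBranch_zero]
        · exact h1 m' hm' hr

variable {E : Type*} [AddCommGroup E] [Module ℝ E]

/-- The cone generated by the rays with index in the mask `R`. -/
def maskCone (ray : ℕ → E) (R : ℕ) : Submodule ℝ≥0 E :=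
  Submodule.span ℝ≥0 (ray '' {k | R.testBit k = true})

theorem smul_ray_mem {ray : ℕ → E} {R k : ℕ} (hk : R.testBit k = true) {t : ℝ} (ht : 0 ≤ t) :
    t • ray k ∈ maskCone ray R :=
  Submodule.smul_mem (maskCone ray R) (⟨t, ht⟩ : ℝ≥0) (Submodule.subset_span ⟨k, hk, rfl⟩)

theorem maskCone_mono {ray : ℕ → E} {R R' : ℕ} (h : ∀ k, R'.testBit k = true → R.testBit k = true) :
    maskCone ray R' ≤ maskCone ray R :=
  Submodule.span_mono (Set.image_mono h)

theorem finrank_inf_ker_le [FiniteDimensional ℝ E] {W : Submodule ℝ E} {l : E →ₗ[ℝ] ℝ} {v : E}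
    (hv : v ∈ W) (hl : l v ≠ 0) {d : ℕ} (hd : Module.finrank ℝ W ≤ d + 1) :
    Module.finrank ℝ (W ⊓ LinearMap.ker l : Submodule ℝ E) ≤ d := by
  have : W ⊓ LinearMap.ker l < W := by
    refine lt_of_le_of_ne inf_le_left fun h => hl ?_
    rw [← h] at hv
    exact hv.2
  have := Submodule.finrank_lt_finrank_of_lt this
  omega

theorem testBit_xor_land (R m k : ℕ) :
    (Nat.xor R (Nat.land R m)).testBit k = (R.testBit k && !m.testBit k) := by
  change (R ^^^ (R &&& m)).testBit k = _
  rw [Nat.testBit_xor, Nat.testBit_and]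
  cases R.testBit k <;> cases m.testBit k <;> rfl

theorem pullLeaf_sound [FiniteDimensional ℝ E] {ray : ℕ → E} {sem : ℕ → E →ₗ[ℝ] ℝ} {R : ℕ} :
    ∀ (H : List ℕ) (rem d : ℕ) (W : Submodule ℝ E),
      (∀ m ∈ H, ∀ k, R.testBit k = true → 0 ≤ sem m (ray k) ∧
        (sem m (ray k) = 0 ↔ m.testBit k = false)) →
      (∀ k, rem.testBit k = true → R.testBit k = true ∧ ray k ∈ W) →
      Module.finrank ℝ W ≤ d → pullLeaf R H rem d = true → ∀ C ∈ W,
      (∀ m ∈ H, ∀ k, Nat.land R m = 2 ^ k → rem.testBit k = true → 0 ≤ sem m C) →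
      C ∈ maskCone ray R := by
  intro H
  induction H with
  | nil =>
    intro rem d W hsem hrem hd hp C hC hpos
    have hd0 : d = 0 := Nat.eq_of_beq_eq_true hp
    rw [hd0, Nat.le_zero, Submodule.finrank_eq_zero] at hd
    rw [hd, Submodule.mem_bot] at hC
    rw [hC]
    exact Submodule.zero_mem _
  | cons m H ih =>
    intro rem d W hsem hrem hd hp C hC hpos
    have hsem' : ∀ m ∈ H, ∀ k, R.testBit k = true → 0 ≤ sem m (ray k) ∧
        (sem m (ray k) = 0 ↔ m.testBit k = false) := fun m hm => hsem m (List.mem_cons_of_mem _ hm)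
    have hskip : pullLeaf R H rem d = true → C ∈ maskCone ray R := fun hp =>
      ih rem d W hsem' hrem hd hp C hC fun m hm => hpos m (List.mem_cons_of_mem _ hm)
    change cond (Nat.beq (Nat.land (Nat.land R m) (Nat.sub (Nat.land R m) 1)) 0)
      (cond (Nat.beq (Nat.land rem m) 0) (pullLeaf R H rem d)
        (pullLeaf R H (Nat.xor rem (Nat.land R m)) (Nat.sub d 1)))
      (pullLeaf R H rem d) = true at hp
    cases hc1 : Nat.beq (Nat.land (Nat.land R m) (Nat.sub (Nat.land R m) 1)) 0 with
    | false => rw [hc1] at hp; exact hskip hp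
    | true =>
      rw [hc1] at hp
      cases hc2 : Nat.beq (Nat.land rem m) 0 with
      | true => rw [hc2] at hp; exact hskip hp
      | false =>
        rw [hc2] at hp
        replace hp : pullLeaf R H (Nat.xor rem (Nat.land R m)) (d - 1) = true := hp
        have hrm : rem &&& m ≠ 0 := Nat.ne_of_beq_eq_false hc2
        obtain ⟨j, hj⟩ := Nat.exists_testBit_of_ne_zero hrm
        rw [Nat.testBit_and, Bool.and_eq_true] at hj
        have hxj : (R &&& m).testBit j = true := by
          rw [Nat.testBit_and, (hrem j hj.1).1, hj.2]; rfl
        have hx0 : R &&& m ≠ 0 := by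
          intro h
          rw [h, Nat.zero_testBit] at hxj
          cases hxj
        obtain ⟨k₀, hx1⟩ := (Nat.and_sub_one_eq_zero_iff_isPowerOfTwo hx0).mp
          (Nat.eq_of_beq_eq_true hc1)
        have hxbit : ∀ k, (R.testBit k && m.testBit k) = decide (k = k₀) := by
          intro k
          rw [← Nat.testBit_and, hx1, Nat.testBit_two_pow]
          simp [eq_comm]
        have hjk : j = k₀ := by
          have := hxbit j
          rw [(hrem j hj.1).1, hj.2] at this
          simpa using this.symm
        subst hjk
        obtain ⟨hRj, hWj⟩ := hrem j hj.1
        have hother : ∀ k, k ≠ j → R.testBit k = true → m.testBit k = false := by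
          intro k hk hR
          have h1 := hxbit k
          rw [hR] at h1
          simpa [hk] using h1
        have hsm := hsem m List.mem_cons_self
        have hs0 : sem m (ray j) ≠ 0 := fun h => by
          have := (hsm j hRj).2.mp h
          rw [hj.2] at this
          cases this
        have hs1 : 0 < sem m (ray j) := lt_of_le_of_ne (hsm j hRj).1 (Ne.symm hs0)
        have hC0 : 0 ≤ sem m C := hpos m List.mem_cons_self j hx1 hj.1
        have hd' : Module.finrank ℝ W ≤ (d - 1) + 1 := by omega
        set t := sem m C / sem m (ray j) with ht
        have ht0 : 0 ≤ t := div_nonneg hC0 hs1.le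
        have hbit : ∀ k, (Nat.xor rem (Nat.land R m)).testBit k = true →
            rem.testBit k = true ∧ k ≠ j := by
          intro k hk
          change (rem ^^^ (R &&& m)).testBit k = true at hk
          rw [Nat.testBit_xor, Nat.testBit_and, hxbit] at hk
          by_cases hkk : k = j
          · subst hkk
            rw [hj.1] at hk
            simp at hk
          · simpa [hkk] using hk
        have hC' := ih (Nat.xor rem (Nat.land R m)) (d - 1) (W ⊓ LinearMap.ker (sem m)) hsem'
          (fun k hk => by
            obtain ⟨hk1, hk2⟩ := hbit k hk
            obtain ⟨hk3, hk4⟩ := hrem k hk1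
            exact ⟨hk3, hk4, (hsm k hk3).2.mpr (hother k hk2 hk3)⟩)
          (finrank_inf_ker_le hWj hs0 hd') hp (C - t • ray j)
          ⟨W.sub_mem hC (W.smul_mem _ hWj), by
            simp only [SetLike.mem_coe, LinearMap.mem_ker, map_sub, map_smul, smul_eq_mul, ht]
            field_simp
            ring⟩
          (fun m' hm' k hk hkr => by
            obtain ⟨hk1, hk2⟩ := hbit k hkr
            have h2 := hpos m' (List.mem_cons_of_mem _ hm') k hk hk1
            have h3 : m'.testBit j = false := by
              have h4 : (R &&& m').testBit j = (2 ^ k).testBit j := congrArg (Nat.testBit · j) hk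
              rw [Nat.testBit_and, hRj, Nat.testBit_two_pow] at h4
              simpa [hk2] using h4
            rw [map_sub, map_smul, (hsem' m' hm' j hRj).2.mpr h3]
            simpa using h2)
        have := Submodule.add_mem _ hC' (smul_ray_mem (ray := ray) hRj ht0)
        simpa using this

theorem pull_sound [FiniteDimensional ℝ E] {ray : ℕ → E} {sem : ℕ → E →ₗ[ℝ] ℝ} :
    ∀ (d R : ℕ) (H : List ℕ) (c : ℕ) (W : Submodule ℝ E),
      (∀ m ∈ H, ∀ k, R.testBit k = true → 0 ≤ sem m (ray k) ∧
        (sem m (ray k) = 0 ↔ m.testBit k = false)) →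
      (∀ k, R.testBit k = true → ray k ∈ W) →
      Module.finrank ℝ W ≤ d → pullTest d R H c = true → ∀ C ∈ W,
      (∀ m ∈ H, 0 ≤ sem m C) → C ∈ maskCone ray R := by
  intro d
  induction d with
  | zero =>
    intro R H c W _ _ hd _ C hC _
    rw [Nat.le_zero, Submodule.finrank_eq_zero] at hd
    rw [hd, Submodule.mem_bot] at hC
    rw [hC]
    exact Submodule.zero_mem _
  | succ d ih =>
    intro R H c W hsem hray hd hp C hC hpos
    have hp : pull (d + 1) R H c ≠ 0 := pullTest_iff.mp hp
    change (cond (pullLeaf R H R (Nat.succ d)) c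
      (cond (Nat.beq (Nat.land R (Nat.pow 2 (Nat.land c 63))) 0) 0
        (cond (Nat.beq (Nat.land c 64) 0)
          (pullBranch (pull d) R (Nat.pow 2 (Nat.land c 63)) (selectNear R H) (selectNear R H)
            (Nat.shiftRight c 7) false)
          (pullBranch (pull d) R (Nat.pow 2 (Nat.land c 63)) (selectMin R H)
            (selectMin R H) (Nat.shiftRight c 7) false)))) ≠ 0 at hp
    rw [beq_land_two_pow] at hp
    cases hleaf : pullLeaf R H R (Nat.succ d) with
    | true =>
      exact pullLeaf_sound H R (d + 1) W hsem (fun k hk => ⟨hk, hray k hk⟩) hd hleaf C hC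
        fun m hm _ _ _ => hpos m hm
    | false =>
      rw [hleaf] at hp
      set r := Nat.land c 63
      have hstep : ∀ (H' : List ℕ) (c' : ℕ), (∀ m ∈ H', m ∈ H) → R.testBit r = true →
          pullBranch (pull d) R (Nat.pow 2 r) H' H' c' false ≠ 0 → C ∈ maskCone ray R := by
        intro H' c' hsub hr hbr
        obtain ⟨hb1, hb2⟩ := pullBranch_ne_zero hbr
        have hb2 : ∃ m ∈ H', m.testBit r = true := by simpa using hb2
        obtain ⟨m₁, hm₁, hr₁⟩ := hb2
        obtain ⟨m₀, hm₀, hmin⟩ := Finset.exists_min_image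
          (H'.toFinset.filter fun m => m.testBit r = true)
          (fun m => sem m C / sem m (ray r)) ⟨m₁, by simp [hm₁, hr₁]⟩
        simp only [Finset.mem_filter, List.mem_toFinset] at hm₀ hmin
        obtain ⟨hm₀, hr₀⟩ := hm₀
        have hs : ∀ m ∈ H', m.testBit r = true → 0 < sem m (ray r) := by
          intro m hm hmr
          refine lt_of_le_of_ne (hsem m (hsub m hm) r hr).1 fun h => ?_
          have := (hsem m (hsub m hm) r hr).2.mp h.symm
          rw [hmr] at this
          cases this
        set t := sem m₀ C / sem m₀ (ray r) with ht
        have ht0 : 0 ≤ t := div_nonneg (hpos m₀ (hsub _ hm₀)) (hs _ hm₀ hr₀).le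
        obtain ⟨c'', hc''⟩ := hb1 m₀ hm₀ hr₀
        have hbit : ∀ k, (Nat.xor R (Nat.land R m₀)).testBit k = true → R.testBit k = true ∧ m₀.testBit k = false := by
          intro k hk
          rw [testBit_xor_land, Bool.and_eq_true, Bool.not_eq_true'] at hk
          exact hk
        have hC' := ih (Nat.xor R (Nat.land R m₀)) H' c'' (W ⊓ LinearMap.ker (sem m₀))
          (fun m hm k hk => hsem m (hsub m hm) k (hbit k hk).1)
          (fun k hk => ⟨hray k (hbit k hk).1, (hsem m₀ (hsub _ hm₀) k (hbit k hk).1).2.mpr (hbit k hk).2⟩)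
          (finrank_inf_ker_le (hray r hr) (hs _ hm₀ hr₀).ne' hd) (pullTest_iff.mpr hc'') (C - t • ray r)
          ⟨W.sub_mem hC (W.smul_mem _ (hray r hr)), by
            have := (hs _ hm₀ hr₀).ne'
            simp only [SetLike.mem_coe, LinearMap.mem_ker, map_sub, map_smul, smul_eq_mul, ht]
            field_simp
            ring⟩
          (fun m hm => by
            rw [map_sub, map_smul, smul_eq_mul]
            cases hmr : m.testBit r with
            | false =>
              rw [(hsem m (hsub m hm) r hr).2.mpr hmr]
              simpa using hpos m (hsub m hm)
            | true =>
              have h1 := hmin m ⟨hm, hmr⟩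
              rw [le_div_iff₀ (hs m hm hmr)] at h1
              linarith)
        have := Submodule.add_mem _ (maskCone_mono (ray := ray) (fun k hk => (hbit k hk).1) hC')
          (smul_ray_mem (ray := ray) hr ht0)
        simpa using this
      cases hr : Nat.testBit R r with
      | false => rw [hr] at hp; exact absurd rfl hp
      | true =>
        rw [hr] at hp
        cases hc : Nat.beq (Nat.land c 64) 0 with
        | false =>
          rw [hc] at hp
          exact hstep _ _ (fun m hm => mem_of_mem_selectMin hm) hr hp
        | true =>
          rw [hc] at hp
          exact hstep _ _ (fun m hm => mem_of_mem_selectNear hm) hr hp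

end Pulling

/-- The number with the given digits in base `b`, lowest first. -/
def packDigitsBase (b : ℕ) (l : List ℕ) : ℕ := l.foldr (fun a r => Nat.add a (Nat.mul r b)) 0

theorem packDigitsBase_cons (b a : ℕ) (l : List ℕ) :
    packDigitsBase b (a :: l) = a + packDigitsBase b l * b := rfl

/-- The number with the given digits in base `2 ^ 24`, lowest first. -/
def packDigits (l : List ℕ) : ℕ := packDigitsBase 16777216 l

/-- The sum of products of two lists of numbers. -/
def dotDigits (l l' : List ℕ) : ℕ := (List.zipWith (· * ·) l l').sum

/-- The digit number `17` of a product in base `2 ^ 24`. -/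
def packedDot (n m : ℕ) : ℕ := Nat.land (Nat.shiftRight (Nat.mul n m) 408) 16777215

theorem packDigits_cons (a : ℕ) (l : List ℕ) :
    packDigits (a :: l) = a + packDigits l * 16777216 :=
  packDigitsBase_cons _ _ _

theorem packDigits_append (l : List ℕ) (b : ℕ) :
    packDigits (l ++ [b]) = packDigits l + b * 16777216 ^ l.length := by
  induction l with
  | nil => simp [packDigits, packDigitsBase]
  | cons a l ih =>
    rw [List.cons_append, packDigits_cons, ih, packDigits_cons, List.length_cons]
    ring

theorem packDigits_lt {l : List ℕ} (h : ∀ a ∈ l, a ≤ 256) : packDigits l < 16777216 ^ l.length := by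
  induction l with
  | nil => simp [packDigits, packDigitsBase]
  | cons a l ih =>
    have h1 := ih fun b hb => h b (List.mem_cons_of_mem _ hb)
    have h2 := h a List.mem_cons_self
    rw [packDigits_cons, List.length_cons, pow_succ]
    omega

theorem packDigits_append_le {l : List ℕ} (h : ∀ a ∈ l, a ≤ 256) :
    packDigits l.reverse * 16777216 ≤ 257 * 16777216 ^ l.length := by
  cases l with
  | nil => simp [packDigits, packDigitsBase]
  | cons a l =>
    have h1 : packDigits l.reverse < 16777216 ^ l.reverse.length :=
      packDigits_lt fun b hb => h b (List.mem_cons_of_mem _ (List.mem_reverse.mp hb))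
    have h2 := h a List.mem_cons_self
    rw [List.reverse_cons, packDigits_append, List.length_cons, pow_succ]
    rw [List.length_reverse] at h1 ⊢
    nlinarith

theorem packDigits_mul_reverse : ∀ {l l' : List ℕ}, l.length = l'.length → (∀ a ∈ l, a ≤ 256) →
    (∀ a ∈ l', a ≤ 256) → ∃ lo hi, packDigits l * packDigits l'.reverse * 16777216 =
      lo * 16777216 + dotDigits l l' * 16777216 ^ l.length + hi * 16777216 ^ (l.length + 1) ∧
      lo * 16777216 * 16777216 ≤ l.length * 65792 * 16777216 ^ l.length
  | [], [], _, _, _ => ⟨0, 0, by simp [packDigits, packDigitsBase, dotDigits], by simp⟩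
  | a :: l, b :: l', h, h1, h2 => by
    have hl : l.length = l'.length := by simpa using h
    obtain ⟨lo, hi, he, hlo⟩ := packDigits_mul_reverse hl
      (fun c hc => h1 c (List.mem_cons_of_mem _ hc)) (fun c hc => h2 c (List.mem_cons_of_mem _ hc))
    have hr : packDigits l'.reverse * 16777216 ≤ 257 * 16777216 ^ l.length := by
      rw [hl]
      exact packDigits_append_le fun c hc => h2 c (List.mem_cons_of_mem _ hc)
    have ha := h1 a List.mem_cons_self
    refine ⟨a * packDigits l'.reverse + lo * 16777216, hi + b * packDigits l, ?_, ?_⟩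
    · rw [packDigits_cons, List.reverse_cons, packDigits_append, List.length_reverse, ← hl,
        List.length_cons]
      have hd : dotDigits (a :: l) (b :: l') = a * b + dotDigits l l' := by simp [dotDigits]
      rw [hd]
      calc _ = (packDigits l * packDigits l'.reverse * 16777216) * 16777216 +
            (a * packDigits l'.reverse + a * b * 16777216 ^ l.length +
              b * packDigits l * 16777216 ^ (l.length + 1)) * 16777216 := by ring
        _ = _ := by rw [he]; ring
    · rw [List.length_cons, pow_succ]
      generalize 16777216 ^ l.length = p at *
      generalize packDigits l'.reverse = r at *
      have h3 : a * (r * 16777216) ≤ 256 * (257 * p) := Nat.mul_le_mul ha hr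
      nlinarith

set_option exponentiation.threshold 500 in
theorem packedDot_eq {l l' : List ℕ} (hl : l.length = 18) (hl' : l'.length = 18)
    (h : ∀ a ∈ l, a ≤ 256) (h' : ∀ a ∈ l', a ≤ 256) (hd : dotDigits l l' < 16777216) :
    packedDot (packDigits l) (packDigits l'.reverse) = dotDigits l l' := by
  obtain ⟨lo, hi, he, hlo⟩ := packDigits_mul_reverse (hl.trans hl'.symm) h h'
  rw [hl] at he hlo
  have h0 : packDigits l * packDigits l'.reverse =
      lo + dotDigits l l' * 16777216 ^ 17 + hi * 16777216 ^ 18 := by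
    have : (0 : ℕ) < 16777216 := by norm_num
    refine Nat.eq_of_mul_eq_mul_right this ?_
    rw [he]
    ring
  have h1 : lo < 16777216 ^ 17 := by
    norm_num at hlo ⊢
    omega
  have h2 : packDigits l * packDigits l'.reverse / 16777216 ^ 17 =
      dotDigits l l' + hi * 16777216 := by
    rw [h0, show lo + dotDigits l l' * 16777216 ^ 17 + hi * 16777216 ^ 18 =
      lo + 16777216 ^ 17 * (dotDigits l l' + hi * 16777216) by ring,
      Nat.add_mul_div_left _ _ (by positivity), Nat.div_eq_of_lt h1, zero_add]
  change ((packDigits l * packDigits l'.reverse) >>> 408) &&& 16777215 = _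
  rw [Nat.shiftRight_eq_div_pow, show (2 : ℕ) ^ 408 = 16777216 ^ 17 by
    rw [show (16777216 : ℕ) = 2 ^ 24 by norm_num, ← pow_mul], h2,
    show 16777215 = 2 ^ 24 - 1 by norm_num, Nat.and_two_pow_sub_one_eq_mod]
  omega

namespace IntMat

/-- The list of entries. -/
def toList : IntMat → List ℤ
  | ⟨a, b, c, d, e, f, g, h, i, j, k, l, m, n, o, p⟩ => [a, b, c, d, e, f, g, h, i, j, k, l, m, n, o, p]

/-- The entries, shifted by eight. -/
def shifted (x : IntMat) : List ℕ := x.toList.map fun a => Int.toNat (a.add 8)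

/-- A number that makes up for the shift of the entries. -/
def defect (x : IntMat) : ℕ := Int.toNat (Int.sub 128 (x.toList.foldr Int.add 0))

/-- A matrix packed into a number, as left factor for `packedDot`. -/
def packL (x : IntMat) : ℕ := packDigits (x.shifted ++ [x.defect, 8])

/-- A matrix packed into a number, as right factor for `packedDot`. -/
def packR (x : IntMat) : ℕ := packDigits (x.shifted ++ [8, x.defect]).reverse

/-- The entries have absolute value at most eight. -/
def small (x : IntMat) : Bool := x.all fun a => decide (-8 ≤ a) && decide (a ≤ 8)

theorem packedDot_packL_packR {x y : IntMat} (hx : x.small = true) (hy : y.small = true) :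
    (packedDot x.packL y.packR : ℤ) = x.dot y + 3072 := by
  have key : ∀ {x : IntMat}, x.small = true → (∀ a ∈ x.shifted, a ≤ 256) ∧ x.defect ≤ 256 ∧
      x.shifted.length = 16 := by
    intro x hx
    cases x
    simp only [small, all, Bool.and_eq_true, decide_eq_true_eq] at hx
    refine ⟨?_, ?_, rfl⟩
    · simp only [shifted, toList, List.map_cons, List.map_nil, List.mem_cons, List.not_mem_nil, or_false,
        forall_eq_or_imp, forall_eq]
      simp only [show ∀ a : ℤ, a.add 8 = a + 8 from fun _ => rfl]
      omega
    · simp only [defect, toList, List.foldr]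
      simp only [show ∀ a b : ℤ, a.add b = a + b from fun _ _ => rfl,
        show ∀ a b : ℤ, a.sub b = a - b from fun _ _ => rfl]
      omega
  obtain ⟨x1, x2, x3⟩ := key hx
  obtain ⟨y1, y2, y3⟩ := key hy
  have hdot : (dotDigits (x.shifted ++ [x.defect, 8]) (y.shifted ++ [8, y.defect]) : ℤ) =
      x.dot y + 3072 := by
    cases x with | mk a b c d e f g h i j k l m n o p => ?_
    cases y with | mk a' b' c' d' e' f' g' h' i' j' k' l' m' n' o' p' => ?_
    simp only [small, all, Bool.and_eq_true, decide_eq_true_eq] at hx hy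
    simp only [dotDigits, shifted, defect, toList, List.map_cons, List.map_nil, List.cons_append,
      List.nil_append, List.zipWith_cons_cons, List.zipWith_nil_left, List.sum_cons, List.sum_nil,
      List.foldr, dot, dot4_eq, Nat.cast_add, Nat.cast_mul, Int.ofNat_toNat]
    simp only [show ∀ a b : ℤ, a.add b = a + b from fun _ _ => rfl,
        show ∀ a b : ℤ, a.sub b = a - b from fun _ _ => rfl]
    rw [max_eq_left (by omega), max_eq_left (by omega), max_eq_left (by omega), max_eq_left (by omega),
      max_eq_left (by omega), max_eq_left (by omega), max_eq_left (by omega), max_eq_left (by omega),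
      max_eq_left (by omega), max_eq_left (by omega), max_eq_left (by omega), max_eq_left (by omega),
      max_eq_left (by omega), max_eq_left (by omega), max_eq_left (by omega), max_eq_left (by omega),
      max_eq_left (by omega), max_eq_left (by omega), max_eq_left (by omega), max_eq_left (by omega),
      max_eq_left (by omega), max_eq_left (by omega), max_eq_left (by omega), max_eq_left (by omega),
      max_eq_left (by omega), max_eq_left (by omega), max_eq_left (by omega), max_eq_left (by omega),
      max_eq_left (by omega), max_eq_left (by omega), max_eq_left (by omega), max_eq_left (by omega),
      max_eq_left (by omega), max_eq_left (by omega)]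
    ring
  have hbound : dotDigits (x.shifted ++ [x.defect, 8]) (y.shifted ++ [8, y.defect]) < 16777216 := by
    have : x.dot y ≤ 1024 := by
      have h1 := frob_self_nonneg (x.real - y.real)
      have h2 : ∀ {x : IntMat}, x.small = true → x.dot x ≤ 1024 := by
        intro x hx
        have hsq : ∀ a : ℤ, -8 ≤ a ∧ a ≤ 8 → a * a ≤ 64 := fun a ha => by nlinarith [ha.1, ha.2]
        cases x
        simp only [small, all, Bool.and_eq_true, decide_eq_true_eq] at hx
        obtain ⟨⟨⟨⟨⟨⟨⟨⟨⟨⟨⟨⟨⟨⟨⟨h1, h2⟩, h3⟩, h4⟩, h5⟩, h6⟩, h7⟩, h8⟩, h9⟩, h10⟩, h11⟩, h12⟩, h13⟩,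
          h14⟩, h15⟩, h16⟩ := hx
        simp only [dot, dot4_eq, show ∀ a b : ℤ, a.add b = a + b from fun _ _ => rfl]
        linarith [hsq _ h1, hsq _ h2, hsq _ h3, hsq _ h4, hsq _ h5, hsq _ h6, hsq _ h7, hsq _ h8,
          hsq _ h9, hsq _ h10, hsq _ h11, hsq _ h12, hsq _ h13, hsq _ h14, hsq _ h15, hsq _ h16]
      have hx2 := h2 hx
      have hy2 := h2 hy
      simp only [map_sub, LinearMap.sub_apply, frob_real, frob_comm y.real x.real] at h1
      rify at hx2 hy2 ⊢
      linarith
    omega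
  rw [packL, packR, packedDot_eq (by simp [x3]) (by simp [y3]) (by
      intro a ha
      rcases List.mem_append.mp ha with ha | ha
      · exact x1 a ha
      · simp at ha; omega)
    (by
      intro a ha
      rcases List.mem_append.mp ha with ha | ha
      · exact y1 a ha
      · simp at ha; omega) hbound, hdot]

end IntMat

/-- The images of the two representative normals under the symmetries. -/
def stdNormals : Set Mat4 := {C | ∃ φ ∈ genSym, φ intN1.qreal = C ∨ φ intN2.qreal = C}

theorem IsNormal.map_symV {φ : Mat4 ≃ₗ[ℝ] Mat4} (hφ : φ ∈ symV) {C : Mat4} (hC : IsNormal setV C) :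
    IsNormal setV (φ C) :=
  hC.map (mem_symV_iff.mp hφ) (frob_map_symV hφ)

theorem isNormal_of_mem_stdNormals {C : Mat4} (hC : C ∈ stdNormals) : IsNormal setV C := by
  obtain ⟨φ, hφ, rfl | rfl⟩ := hC
  · exact isNormal_intN1.map_symV (genSym_le hφ)
  · exact isNormal_intN2.map_symV (genSym_le hφ)

theorem map_mem_stdNormals {φ : Mat4 ≃ₗ[ℝ] Mat4} (hφ : φ ∈ genSym) {C : Mat4} (hC : C ∈ stdNormals) :
    φ C ∈ stdNormals := by
  obtain ⟨ψ, hψ, h⟩ := hC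
  exact ⟨φ * ψ, mul_mem hφ hψ, h.imp (fun h => by rw [← h]; rfl) (fun h => by rw [← h]; rfl)⟩

namespace IntMat

/-- Four times the identity. -/
def four : IntMat := ⟨4, 0, 0, 0, 0, 4, 0, 0, 0, 0, 4, 0, 0, 0, 0, 4⟩

/-- The test that twice an orthogonal matrix is given. -/
def isOrth (x : IntMat) : Bool := (x.mul x.tr).eqb four

theorem hreal_mem_of_isOrth {x : IntMat} (h : x.isOrth = true) : x.hreal ∈ setV :=
  (hreal_mem_setV_iff x).mpr (eq_of_eqb h)

theorem mem_allV_of_isOrth {x : IntMat} (h : x.isOrth = true) : x ∈ allV :=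
  hreal_mem_setV.mp (hreal_mem_of_isOrth h)

/-- Division of all entries by four. -/
def quarter (x : IntMat) : IntMat := x.map fun a => a.ediv 4

theorem real_quarter {x : IntMat} (h : x.all (fun a => decide (a % 4 = 0)) = true) :
    x.quarter.real = (1 / 4 : ℝ) • x.real := by
  refine real_map_mul x (all_mono (fun a ha => ?_) h)
  simp only [decide_eq_true_eq] at ha ⊢
  obtain ⟨b, rfl⟩ := Int.dvd_of_emod_eq_zero ha
  have : (4 * b).ediv 4 = b := Int.mul_ediv_cancel_left b (by norm_num)
  rw [this]
  push_cast
  ring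

end IntMat

/-- Four times the representative normals and their transposes. -/
def baseNormal : ℕ → IntMat
  | 0 => intN1
  | 1 => intN1.tr
  | 2 => intN2
  | _ => intN2.tr

/-- The left factor of a word. -/
def wordLeft (w : ℕ) : IntMat := IntMat.ofCode 3 2 (Nat.land (Nat.shiftRight w 2) 281474976710655)

/-- The right factor of a word. -/
def wordRight (w : ℕ) : IntMat := IntMat.ofCode 3 2 (Nat.shiftRight w 50)

/-- Sixteen times the normal given by a word. -/
def wordProd (w : ℕ) : IntMat := ((wordLeft w).mul (baseNormal (Nat.land w 3))).mul (wordRight w)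

/-- Four times the normal given by a word. -/
def wordMat (w : ℕ) : IntMat := (wordProd w).quarter

/-- The test that a word describes a normal. -/
def wordTest (w : ℕ) : Bool := (wordLeft w).isOrth && (wordRight w).isOrth &&
  ((wordProd w).all fun a => decide (a % 4 = 0)) && (wordMat w).small

theorem qreal_baseNormal_mem : ∀ b, (baseNormal b).qreal ∈ stdNormals := by
  have htr : ∀ x : IntMat, x.tr.qreal = transEquiv x.qreal := fun x => by
    change _ = x.qrealᵀ
    rw [IntMat.qreal, IntMat.real_tr, IntMat.qreal, Matrix.transpose_smul]
  have h1 : intN1.qreal ∈ stdNormals := ⟨1, one_mem _, Or.inl rfl⟩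
  have h2 : intN2.qreal ∈ stdNormals := ⟨1, one_mem _, Or.inr rfl⟩
  intro b
  match b with
  | 0 => exact h1
  | 1 => exact htr intN1 ▸ map_mem_stdNormals transEquiv_mem h1
  | 2 => exact h2
  | _ + 3 => exact htr intN2 ▸ map_mem_stdNormals transEquiv_mem h2

theorem qreal_wordMat_mem {w : ℕ} (hw : wordTest w = true) : (wordMat w).qreal ∈ stdNormals := by
  simp only [wordTest, Bool.and_eq_true] at hw
  obtain ⟨⟨⟨h1, h2⟩, h3⟩, -⟩ := hw
  have hg := IntMat.hreal_mem_of_isOrth h1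
  have hh := IntMat.hreal_mem_of_isOrth h2
  have : (wordMat w).qreal = rightEquiv hh (leftEquiv hg (baseNormal (Nat.land w 3)).qreal) := by
    change _ = ((wordLeft w).hreal * (baseNormal (Nat.land w 3)).qreal) * (wordRight w).hreal
    rw [IntMat.qreal, wordMat, IntMat.real_quarter h3, wordProd, IntMat.real_mul, IntMat.real_mul,
      IntMat.hreal, IntMat.hreal, IntMat.qreal]
    simp only [Matrix.smul_mul, Matrix.mul_smul, smul_smul]
    norm_num
  rw [this]
  exact map_mem_stdNormals (rightEquiv_mem hh) (map_mem_stdNormals (leftEquiv_mem hg)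
    (qreal_baseNormal_mem _))

theorem small_wordMat {w : ℕ} (hw : wordTest w = true) : (wordMat w).small = true := by
  simp only [wordTest, Bool.and_eq_true] at hw
  exact hw.2

theorem small_of_mem_allV {x : IntMat} (hx : x ∈ allV) : x.small = true := by
  have : (allV.all fun x => x.small) = true := by decide +kernel
  exact List.all_eq_true.mp this x hx

/-- The matrices with the same inner product with `1` and with the members of a list. -/
def tightSpace (P : List IntMat) : Submodule ℝ Mat4 where
  carrier := {X | ∀ p ∈ P, frob p.hreal X = frob 1 X}
  add_mem' hX hY p hp := by rw [map_add, map_add, hX p hp, hY p hp]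
  zero_mem' p _ := by rw [map_zero, map_zero]
  smul_mem' c X hX p hp := by rw [map_smul, map_smul, hX p hp]

/-- The bits of `m` tell which of the packed products are less than one. -/
def supportTest (n : ℕ) : List ℕ → ℕ → Bool
  | [], _ => true
  | r :: rs, m => cond (Nat.beq (Nat.land m 1) 0) (Nat.beq (packedDot n r) 3080)
      (Nat.ble (packedDot n r) 3079) && supportTest n rs (Nat.shiftRight m 1)

/-- The tests on the data of a pulling triangulation. -/
def coneTest (P : List IntMat) (words : List ℕ) (cover : List (ℕ × ℕ)) : Bool :=
  words.all wordTest &&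
  (((IntMat.two :: P).all fun p => p.isOrth && supportTest p.packL (words.map fun w => (wordMat w).packR) 0) &&
  cover.all fun c => (IntMat.ofCode 3 2 c.2).isOrth &&
    supportTest (IntMat.ofCode 3 2 c.2).packL (words.map fun w => (wordMat w).packR) c.1)

theorem supportTest_spec {x : IntMat} (hx : x.small = true) : ∀ {words : List ℕ} {m : ℕ},
    words.all wordTest = true →
    supportTest x.packL (words.map fun w => (wordMat w).packR) m = true → ∀ k < words.length,
      frob x.hreal (wordMat (words.getD k 0)).qreal ≤ 1 ∧
      (frob x.hreal (wordMat (words.getD k 0)).qreal = 1 ↔ m.testBit k = false)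
  | [], _, _, _, k, hk => by simp at hk
  | w :: words, m, hw, h, k, hk => by
    rw [List.all_cons, Bool.and_eq_true] at hw
    rw [List.map_cons, supportTest, Bool.and_eq_true] at h
    cases k with
    | zero =>
      rw [List.getD_cons_zero, frob_hreal_qreal_le_one, frob_hreal_qreal_eq_one]
      have hd := IntMat.packedDot_packL_packR hx (small_wordMat hw.1)
      have h1 := h.1
      have hb : Nat.beq (Nat.land m 1) 0 = !m.testBit 0 := beq_land_two_pow m 0
      rw [hb] at h1
      cases hm : m.testBit 0 with
      | false =>
        rw [hm, Bool.not_false, cond_true] at h1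
        have h2 := Nat.eq_of_beq_eq_true h1
        simp only [iff_true]
        omega
      | true =>
        rw [hm, Bool.not_true, cond_false] at h1
        have h2 := Nat.le_of_ble_eq_true h1
        simp only [Bool.true_eq_false, iff_false]
        omega
    | succ k =>
      have h3 := supportTest_spec hx hw.2 h.2 k (by simpa using hk)
      rw [List.getD_cons_succ]
      have h4 : (Nat.shiftRight m 1).testBit k = m.testBit (k + 1) := by
        change (m >>> 1).testBit k = _
        rw [Nat.testBit_shiftRight, add_comm]
      rwa [h4] at h3

theorem mem_stdNormals_of_mem_maskCone {C : Mat4} (hC : IsNormal setV C) (h1 : frob 1 C = 1)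
    {ray : ℕ → Mat4} {R : ℕ} (hray : ∀ k, R.testBit k = true → ray k ∈ stdNormals ∧ frob 1 (ray k) = 1)
    (h : C ∈ maskCone ray R) : C ∈ stdNormals := by
  by_contra hcon
  set T := (finite_setV.subset (fun x (hx : x ∈ tight setV C) => hx.1)).toFinset with hT
  set ψ : Mat4 →ₗ[ℝ] ℝ := ∑ x ∈ T, (frob 1 - frob x) with hψ
  have hψa : ∀ X, ψ X = ∑ x ∈ T, (frob 1 X - frob x X) := fun X => by
    simp [hψ, LinearMap.sum_apply]
  have hTmem : ∀ {x}, x ∈ T ↔ x ∈ tight setV C := by simp [hT]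
  have hpos : ∀ X ∈ maskCone ray R, 0 ≤ ψ X ∧ (ψ X = 0 → X = 0) := by
    intro X hX
    refine Submodule.span_induction (p := fun X _ => 0 ≤ ψ X ∧ (ψ X = 0 → X = 0)) ?_ ?_ ?_ ?_ hX
    · rintro _ ⟨k, hk, rfl⟩
      obtain ⟨hk1, hk2⟩ := hray k hk
      have hn := isNormal_of_mem_stdNormals hk1
      have hterm : ∀ x ∈ T, 0 ≤ frob 1 (ray k) - frob x (ray k) := fun x hx => by
        rw [hk2]
        linarith [hn.1 x (hTmem.mp hx).1]
      rw [hψa]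
      refine ⟨Finset.sum_nonneg hterm, fun h0 => ?_⟩
      rw [Finset.sum_eq_zero_iff_of_nonneg hterm] at h0
      refine absurd ?_ hcon
      rw [hC.eq_of_tight_subset (D := ray k) fun x hx => ?_]
      · exact hk1
      · have := h0 x (hTmem.mpr hx)
        rw [hk2] at this
        linarith
    · simp
    · intro X Y _ _ hX hY
      rw [map_add]
      refine ⟨add_nonneg hX.1 hY.1, fun h0 => ?_⟩
      rw [hX.2 (by linarith [hX.1, hY.1]), hY.2 (by linarith [hX.1, hY.1]), add_zero]
    · intro a X _ hX
      have ha : a • X = (a : ℝ) • X := rfl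
      rw [ha, map_smul, smul_eq_mul]
      refine ⟨mul_nonneg a.2 hX.1, fun h0 => ?_⟩
      rcases mul_eq_zero.mp h0 with h0 | h0
      · rw [h0, zero_smul]
      · rw [hX.2 h0, smul_zero]
  have h0 : ψ C = 0 := by
    rw [hψa]
    refine Finset.sum_eq_zero fun x hx => ?_
    rw [(hTmem.mp hx).2, h1, sub_self]
  have := (hpos C h).2 h0
  rw [this, map_zero] at h1
  exact zero_ne_one h1

theorem mem_stdNormals_of_pull {C : Mat4} (hC : IsNormal setV C) (h1 : frob 1 C = 1)
    {P : List IntMat} (hP : ∀ p ∈ P, frob p.hreal C = 1) {words : List ℕ} {cover : List (ℕ × ℕ)}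
    (hcone : coneTest P words cover = true) {d R c : ℕ} (hd : Module.finrank ℝ (tightSpace P) ≤ d)
    (hR : Nat.beq (Nat.shiftRight R words.length) 0 = true)
    (hpull : pullTest d R (cover.map Prod.fst) c = true) : C ∈ stdNormals := by
  simp only [coneTest, Bool.and_eq_true, List.all_eq_true (l := cover),
    List.all_eq_true (l := IntMat.two :: P)] at hcone
  obtain ⟨hw, hPt, hcov⟩ := hcone
  have hbit : ∀ k, R.testBit k = true → k < words.length := by
    intro k hk
    by_contra hlt
    have h2 : (R >>> words.length).testBit (k - words.length) = R.testBit k := by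
      rw [Nat.testBit_shiftRight]
      congr 1
      omega
    rw [show R >>> words.length = 0 from Nat.eq_of_beq_eq_true hR, Nat.zero_testBit, hk] at h2
    cases h2
  set ray : ℕ → Mat4 := fun k => (wordMat (words.getD k 0)).qreal with hrdef
  have hwk : ∀ k < words.length, wordTest (words.getD k 0) = true := by
    intro k hk
    rw [List.getD_eq_getElem _ _ hk]
    exact List.all_eq_true.mp hw _ (List.getElem_mem hk)
  have hone : ∀ p ∈ IntMat.two :: P, ∀ k < words.length, frob p.hreal (ray k) = 1 := by
    intro p hp k hk
    have := hPt p hp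
    exact (supportTest_spec (small_of_mem_allV (IntMat.mem_allV_of_isOrth this.1)) hw this.2 k hk).2.mpr
      (Nat.zero_testBit k)
  have hone' : ∀ k < words.length, frob 1 (ray k) = 1 := fun k hk => by
    have := hone _ List.mem_cons_self k hk
    rwa [IntMat.hreal_two] at this
  classical
  set sem : ℕ → Mat4 →ₗ[ℝ] ℝ := fun m =>
    if h : ∃ a, (m, a) ∈ cover then frob 1 - frob (IntMat.ofCode 3 2 h.choose).hreal else 0 with hsem
  have hsem' : ∀ m ∈ cover.map Prod.fst, ∃ a, (m, a) ∈ cover ∧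
      sem m = frob 1 - frob (IntMat.ofCode 3 2 a).hreal := by
    intro m hm
    obtain ⟨⟨m', a⟩, ha, rfl⟩ := List.mem_map.mp hm
    have hex : ∃ a, (m', a) ∈ cover := ⟨a, ha⟩
    exact ⟨hex.choose, hex.choose_spec, dif_pos hex⟩
  refine mem_stdNormals_of_mem_maskCone hC h1 (ray := ray) (R := R)
    (fun k hk => ⟨qreal_wordMat_mem (hwk k (hbit k hk)), hone' k (hbit k hk)⟩) ?_
  refine pull_sound d R (cover.map Prod.fst) c (tightSpace P) (sem := sem) ?_ ?_ hd hpull C ?_ ?_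
  · intro m hm k hk
    obtain ⟨a, ha, he⟩ := hsem' m hm
    have hca := hcov _ ha
    have := supportTest_spec (small_of_mem_allV (IntMat.mem_allV_of_isOrth hca.1)) hw hca.2 k (hbit k hk)
    rw [he, LinearMap.sub_apply, hone' k (hbit k hk), ← this.2]
    refine ⟨by linarith [this.1], ⟨fun h => by linarith, fun h => ?_⟩⟩
    rw [h, sub_self]
  · intro k hk p hp
    rw [hone p (List.mem_cons_of_mem _ hp) k (hbit k hk), hone' k (hbit k hk)]
  · intro p hp
    rw [hP p hp, h1]
  · intro m hm
    obtain ⟨a, ha, he⟩ := hsem' m hm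
    rw [he, LinearMap.sub_apply, h1]
    linarith [hC.1 _ (IntMat.hreal_mem_of_isOrth (hcov _ ha).1)]

theorem finrank_tightSpace_singleton {p : IntMat} (h : frob p.hreal 1 ≠ 4) :
    Module.finrank ℝ (tightSpace [p]) ≤ 15 := by
  have h1 : tightSpace [p] ≤ ⊤ ⊓ LinearMap.ker (frob 1 - frob p.hreal) := by
    intro X hX
    refine ⟨trivial, ?_⟩
    rw [SetLike.mem_coe, LinearMap.mem_ker, LinearMap.sub_apply, hX p List.mem_cons_self, sub_self]
  refine (Submodule.finrank_mono h1).trans (finrank_inf_ker_le (v := 1) Submodule.mem_top ?_ ?_)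
  · rw [LinearMap.sub_apply, frob_self_of_mem one_mem_setV]
    exact fun h' => h (by linarith)
  · rw [finrank_top, finrank_mat4]

theorem finrank_tightSpace_pair {p q v : IntMat} (h : frob p.hreal 1 ≠ 4)
    (hv : frob p.hreal v.hreal = frob 1 v.hreal) (hv' : frob q.hreal v.hreal ≠ frob 1 v.hreal) :
    Module.finrank ℝ (tightSpace [p, q]) ≤ 14 := by
  have h1 : tightSpace [p, q] ≤ tightSpace [p] ⊓ LinearMap.ker (frob 1 - frob q.hreal) := by
    intro X hX
    refine ⟨fun r hr => hX r ?_, ?_⟩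
    · rw [List.mem_singleton.mp hr]; exact List.mem_cons_self
    · rw [SetLike.mem_coe, LinearMap.mem_ker, LinearMap.sub_apply, hX q (by simp), sub_self]
  refine (Submodule.finrank_mono h1).trans (finrank_inf_ker_le (v := v.hreal) ?_ ?_
    (finrank_tightSpace_singleton h))
  · intro r hr
    rw [List.mem_singleton.mp hr, hv]
  · rw [LinearMap.sub_apply]
    exact fun h' => hv' (by linarith)

def eltC : IntMat := ⟨0, -2, 0, 0, -2, 0, 0, 0, 0, 0, 0, 2, 0, 0, -2, 0⟩

def eltCAux : IntMat := ⟨2, 0, 0, 0, 0, 2, 0, 0, 0, 0, 0, 2, 0, 0, -2, 0⟩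

/-- The normals of the facets that contain `1` and `eltC`. -/
def wordsC : List ℕ :=
  [0xb6496c924b2cb6c92cb25b2d, 0xb6c92cb25b2d965b24b65b6d, 0xb6496c924b2d965b24b65b6d,
   0x96596d925b65289048249240, 0x1251048249209b2cb25b64b6c, 0x92d96d925b2c925b2596592c,
   0x92d96d925b2d20a249049251, 0xb6492496d966249449289251, 0x2249449289250b6c92cb25b2d,
   0x1b2cb25b64b6d96cb6db65b2c, 0x144920824925196496db6cb64, 0xb6496c924b2d25128904a249,
   0x192c96db6cb2c92d96d925b2c, 0xb6496c924b2e249289449240, 0xb6496c924b2d289048249240,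
   0x92d92596c96492d92596c965, 0x120a249049251b2cb25b64b6c, 0x92d92596c96596496db6cb65,
   0xb6496c924b2d449208249251, 0x92d96d925b2db2cb25b64b6c, 0x196496db6cb65289048249240,
   0x96596d925b64925b2592d964, 0x925b2596592d965b24b65b6d, 0x196496db6cb64b6cb2492c964,
   0xb25b6592496596496db6cb65, 0x96c924b2cb6492d92596c965, 0x196496db6cb6492d96db2d924,
   0x925b2592d965965b25b6cb65, 0x925965b24b6492d92596c965, 0xb6cb2492c96596496db6cb65,
   0x92d96d925b2d20a249049250, 0x2249449289250b6c92cb25b2c, 0x224928944924120944a249243,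
   0x144920824925192492c96596f, 0xb65b6db25966249289449242, 0x1b2cb25b64b6c964b6db64b27,
   0x964b6db64b2524128824904b, 0x92d96d925b2d28a24924144a, 0x2249251049209449208249253,
   0x125104824920a24920924144a, 0xb2db6db2592e24928924144a, 0x96492d96cb6c965924b25b66,
   0x1251449208248925965b24b66, 0x104924024928892d92596c967, 0x128a249241449965b6c96d92e,
   0x1965b24b65b6c92db2cb6d96f, 0x224925144920920944924224b, 0x964b6db64b24925964b65b26]

/-- Elements of `F₄` that bound the cone of these normals, with their supports. -/
def coverC : List (ℕ × ℕ) :=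
  [(0xfffaac9e01b1, 0x494512092482), (0xfff925b20d99, 0x4948924a2412),
   (0xfff3ec9a0991, 0x4945124a2892), (0xffdd25330e4e, 0x8924a2490412),
   (0xff9f8167524e, 0x4124a2892494), (0xff6f124cf4b4, 0x490892412482),
   (0xff3f8244f29e, 0x490512892482), (0xfeef120df4a6, 0x4a2892412494),
   (0xfebf9045f28e, 0x4a2512892494), (0xfdfed89d8161, 0x412482092494),
   (0xfdf7dc198961, 0x412482490892), (0xfdef5a0dd461, 0x892482412494),
   (0xfbfd25720e5c, 0x8924904a2412), (0xfbbfa066525e, 0x412490892482),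
   (0xfac0243a0914, 0x65b6d9259649), (0xf8a134001480, 0x6db6c965964b),
   (0xf864181d9024, 0x6596c924964b), (0xf7fb25960799, 0x494892512482),
   (0xf7df21b7064e, 0x8924a2512494), (0xf3ff21f6065c, 0x892490512482),
   (0xf0352054921c, 0x6596c96db64b), (0xeffe8d9f01a1, 0x482512092494),
   (0xeffd2db30c89, 0x482892490412), (0xeff7cd9b0981, 0x482512490892),
   (0xeb440d3b0804, 0x6496d925965b), (0xe9258c401080, 0x2496c965964b),
   (0xe7ff2d970689, 0x482892512494), (0xdf7f5248fc94, 0x4908924a2512),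
   (0xdeff5209fc86, 0x4a2892490512), (0xddff5a09ec61, 0x892482490512),
   (0xda83100f5206, 0x65b6d96496cb), (0xd2d2209e0314, 0x65b6d92db6cb),
   (0xd0b370000640, 0x65b6496d96cb), (0xd0765819a804, 0x6596c92d96db),
   (0xcb07024e5214, 0x6496d965b6cb), (0xc9a35c0b4801, 0x64b6c96596db),
   (0xc356099f0204, 0x6496d92c96cb), (0xc137c8400240, 0x6492c96d96cb),
   (0xbfdf81636a4e, 0x4124a2490092), (0xbf7f8260f89e, 0x4905124a2092),
   (0xbeff9061f88e, 0x4a2512490092), (0xbbffa0626a5e, 0x4124904a2092),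
   (0xb8e830200460, 0x65b64925924b), (0xb07c2070a81c, 0x6596c92d9249),
   (0xa9a924624819, 0x64b6c9659249), (0xa96c88600060, 0x6492c925924b),
   (0x9aca102b6806, 0x65b6d92592db), (0x90fa30802480, 0x6db6c92d92cb),
   (0x8b4e026a6814, 0x6496d92592c9), (0x89ea188f4021, 0x64b6c92492cb),
   (0x81bb20c64219, 0x64b6c96db2cb), (0x817e88c02080, 0x2496c92d92cb),
   (0x7ffeca9c8171, 0x412494092482), (0x7ff7ce188971, 0x4124944a2892),
   (0x7fef520cd571, 0x892494412482), (0x7e8184001182, 0x25b6db65964b),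
   (0x7e44021c9134, 0x6596db25b64b), (0x76150115920e, 0x6596db6c964b),
   (0x74b164108919, 0x65b6cb6d9649), (0x6f0507001480, 0x6c96db65964b),
   (0x65354d118809, 0x6496cb6d965b), (0x5fff5208ed71, 0x8924944a2512),
   (0x5693c0000342, 0x65b2db6d96cb), (0x56564218a914, 0x6596db2d96c9),
   (0x4f83460a4911, 0x64b6db6596c9), (0x471743000640, 0x64965b6d96cb),
   (0x3ec880200162, 0x65b2db25924b), (0x3ca91005d02b, 0x65b6cb64924b),
   (0x365c0131a80e, 0x6596db2d925b), (0x34f820948139, 0x65b6cb2db24b),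
   (0x2f890523480b, 0x64b6db65925b), (0x2f4c03200460, 0x64965b25924b),
   (0x2d2d0244d039, 0x6496cb65b24b), (0x257c09958029, 0x6496cb2c924b),
   (0x16da80802182, 0x25b6db2d92cb), (0x14bb5001e80b, 0x65b6cb6d92db),
   (0xfca028e4131, 0x64b6db25b2cb), (0x79b0187420b, 0x64b6db6c92cb),
   (0x75e03802480, 0x6c96db2d92cb), (0x53f4240e819, 0x6496cb6d92c9)]

def certC : ℕ :=
  0x8c0e1e10c0e1e10c181c3870f08607be1c3878408387983038784303d6903c44488123dd264c102b60ab0208129848e08204a64c982056c156091c102b604101ac080d0031c101a00815b04040d6031c08c0206781960a3810f203870e1c3870e1c3c00f102070e1e25d051c3870e1e1020e1e644041c387841c3d1051c3c4051c3820e1c3c20e1e6c4011c3870e003870f028c40e1c3c2041c3d10e0a3c4051c3870f081070f44102040810288081028808143040a102050c102040810205003870e1e00701443870e1e00701443870f081070f440470e1c3870e1e000011c047011c14700023cc0e023870e1c3c00e028c40e1c3870e1c3870f003c4011c0470e1c3870e1c3870f003c401103808e003870f00387991004701100470e023800e1c3c00e1e6c4820a38d0206781033008790102049c0020482102009c1004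70e1c3870e1c3870f003c40e1c3c40974147040a0818e1e2008820041081004e00102049c1024108023828e04102831c3c4051c1470110008837025301102049c12e0d0810253001020409002530810240081024e09702088e4420809748de181c3c218303870e1e10c0f7c6070f08607824804c1f109120000204bb303880604000860220088101c7060400086001c70f72207011c0470e02387ad7418d00021838e1c1db0e2018d00021838e1c3808f0c04710023c1011c4008e1eddf0640000860c04101040838e1ee070e1c3870e1c387801e207081c3c4bc1c387880c25d04062008e20b80014404b0e22088037804711000470f042000002b04b600044091c141011c700a41c0070002b879b044501f100040012ec70e380520e1e2000002b870f3425692081020812b020810253081025404102048410253081024f096c25309505440812d84051ef07142a38a0e1c3870e1e8870e1c3d0b61c50a151c50a142850aa22850a152ed828e0878c1f087cb0e0a500000c1dd012850a1f0c547142850a142a88a142854b0e1c3870e1e8870e1c3c40e023870e1e5070e2a04407285001428540150c54715105442010184a210242040c1c20812102040c1c2060810306081400410204841025315101040810204854c0040810204814c544071020408102049c0e20388002000810240094c058051c54421281ca142850a8028043151c3870e1e1830f003808f1074a14285401400553151c387061c38787003808f107ca14285401400553151c147151084a0e023870e1e507141e044980a3821e347c21f30382942800a142a70ab22888a9c4454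7003c7c0943e50a8e4454421282000174004b83c544091c50a1f0c0030602e80942a38a222a70a002850a9c2ac91151c0471f2800f1f0250a8e02391151084a1e2a204000005d0970247ac1cb87a2103870f44387ae1c38ea21c74a0e1c7510e1c38e0e3a8871d2acc400022048f58502051c10f183e10f961c14abc4804c1e3c7cc0e1ed07941078a88102522410000ba0025c980c3870e1c3870e1c3879d103840e1e25e081c38789581ca1a00043060280a071c383b60c800010c0038e1ee072000043000e38c0e1c04786023808e42c008e02387ac425070710680010c18088101c72e0c680010c1c70e0ed87011e2008e1c3808f76b0a222a70a222a70a2228511153888a9a44547011c0040012b04811c8421f280009f285471c02911151084a1e2a204000005d0970247090068008002561b5e48102061010206a020204081840618f02040c30374081a80a0818606e81031c0811e06e0faa30382080a984191eb07051eb07051c3d30208202a6106470e0a381051e401051ef872608108054c9c7ba1c3828e0a3db0e041410420153260a813031c3828f42e13260815b0558104094c2470410253264c102b60ab048e0815b02080d604068018e080d0040ad820206b018e04601033c0cb051c087901c3870e1c3870e1e00788103870f12e8d02067810330147021e404081270008120840802704011c1470e1c387840838799101070e1e1070f441470f101470e083870f083879b100470e1c3800e1c3c0a3103870f081070f443828f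101470e1c3c2041c3d10408102040a202040a202050c1028408143040810204081400e1c387801c0510e1c387801c0510e1c3c2041c3d1011c3870e1c3878000047011c047051c0008f303808e1c3870f00380a3103870e1c3870e1c3c00f10047011c3870e1c3870e1c3c00f100440e023800e1c3c00e1e644011c044011c3808e003870f003879b120870e1c3870e1c387801e2070e1e204ba0a38205040c70f1004410020840802700081024e0812084011c14702081418e1e2028e0a3808800441b81c0870f043870e1c3870e1e1070f06e11021c3c10f543930510108054c982884c247ba080d0040ad820206b0124040d29940681a00638e0e1c70780003870e1c3c0af6c3950f0038e0f007070e1c7071c1e05f8370101a00815b04040d6031c8d02040102b8346d72040102b84684702300819e065828e043c80212a9205303810206607b41e40188102009c102009c10004081004e0802684011c14702061470f10702a40a38088004418a08150a02a38c0e1e78c0e30387181c3cf941c1870e1c3cf983038c0e1e7ca181c3cfb16c6071808a82a60a20a8830247ac0838a142a38a142850a154450a142a5db14285470f54607045415314323d60e1c147051ee071808a82a60a80e9430547181c147a16c3930408202a64e3dd0e0a3db0e0a387a608104054c9c72a1c147051c259051c24a0e28547141c3870e1c3d10e1c387a16c38a142a38a142850a154450a142a5db051c10f183e10f961c14a0000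183ba0250a143e18a8e0a3821e347c21f30382942800a142a70ab22888a9c44547003c7c0943e50a8e4454421282000174200b83c544091c50a142850aa22850a152c3870e1c387a21c3870f103808e1c387941c38a81101ca140050a1500543151c54415101040812104094c5442010184a210242040c1c20812102040c1c206081030608140041020408121530010204081205315101c408102040812703880e200080020409002530160147151084a072850a142a00a010c5470e1c387860c3c00e023c41d2850a1500500154c5470e1c1870e1e1c00e023c41f2850a1500500154c547051c54421283808e1c387941c507811260a143e180060c05d0128547144454e140050a1538559222a3808e3e5001e3e04a151c047222a210943c5440800000ba12e048f588422040102b64894c140e50a862a70aac2850a9a2800a142a00a862800a150c50a1538556002a3801428000b7548422040102b71c883a00815c042855d143450a9b5c102b80850aba441d0151c2041f502041e1020fa8107da08107d4083e39205301c4011cb030700003961c04a0802a828e381520e0c183ae1e687940a3829c0e387881200f074228203408420e1c102ba0408112240c71340092aa48912257c14198080d02108387040ae810204089131c4d0020a08b9224489137e691a0441d00e1c102ac04183060c0818f401ca140668d1a346caae468110740387040ab01060c18302063d007280c91424489132ad020808208090824b051c10795784840e1c3c40e1c3870e1e8870e1c3c4921c38788124020810404840814abc1020415105449808208090824c051c1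07942020a894a48410127041020204082024e8e30052a41e5040010204093ae0410104049d1c404093abc908081041012102956820a892454409082020820242052820815105441334544131c10208126048e30387841e5070e1e8840e1eb870e3a8871d286070f081021e3e60f8e1e512013078f983c387b41e50409302070f68900981e50a142850a154450a142a5870e1c3870f443870e1e207011c3870f283871502203942800a142a00a862a3828e2a210940e50a1428540140218a8e1c3870f0c187801c047882a20a88402030944204840818384102420408183840c102060c10280082040908204a62a2020810204090a9800810204090298a880e204081020409381c4071000400102048012980b03a50a142a00a002a98a8e1c3830e1c3c3801c047883e50a142a00a002a98a8e0a38a8842507011c3870f2838a0f0224c0e1c3870e1c3870e1c3ce881038789781ca1a00043060280a071c50a151c50a142850a142850a9d2c3de0710680010c18088101c70e1c7510e1c3d11c1c3d70e3a5008e0238f940078f81285471c0290a8842507011c50a15023c41c02949082024e10102041012704101270411342088e1c0470f243c00f783870f243830e1c3c30f003870f3c3830e1e007bc1c1ca061c383072640a2428552102a80a0000058156661292489040926512924890a1524408b81024c081c3da2402607940e20d000218301102038e1c1c8011c40aa0280000160559151c544130c40aa01c04714027c788380528210104081015408082040552d040410202a91c211011cb80014488096443d6bc306070e1c3c2181c3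c2181ef810e1e1070e1e107041e60c0e1e10c0f04401a006847b760912113c0001022c4c24026030200043011020301123830f640870f0408102040810300081032c3de0e0c3878206c0408102540412d840410202a91c3870e1c3870e1e1070e1e2040e1e259051c3870e1e107041e644041c387841c3d1051c3c4051c3870e1e1020e1e6c4011c3870e003870f028c40e1c3c2041c3d10e0a3c4051c3870f081070f443870e1e00701443870e1e00701443870f081070f440470e1c3870e1e000011c0470408102040a202040a202050c102840814304081020408140011c14700023cc0e023870e1c3c00e028c40e1c3870e1c3870f003c4011c0470e1c3870e1c3870f003c401103808e1c387801c007991004701100470e023870e1e0000e1e6c48210202a8102020810254096c147011c8970002880a4443d60e1c3870e1c387841c387881c3c409640472e0005122025910f580470000183010640408002438e06204001218400001830106447031008000020819004008831c3808e220008f10101a020041000400082064018e02387011c008811e2020342c072000043060208101041c7181c080010c0038e0c3d9011c3808e1e0808f42c070610000860e3970e023c30e02384011eb030800043071c38390023879010047be062010204881b0069808206701036408110069810004081030240102067010206001b2440c7bc0400001040c802004418e1c047110004788080d0113c0081002c471c029070e1e408001c000ae1e6c123100471c029070002b800e1e6d692287ca1168912244a508154044f0000285900050a140000a8f426041f1078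a8848912252845a15100000a16d8a1428000151c04498082041012102052a2840a101041012104960a3820f285449610544151024daa105448410544084810410121029414544982a2120808208090814a055c54409563820808208090824c051c107951440408104049c10404101274c0820208093a387081c3870e1c3d10e1c387881c38789549840e1e2480e1c3870f3c1cc181c6070f3e50c0454153051060a881238a142850a154450a142a58a142a387aa30115054c1501d2860a8e103870e1c387a21c3870f103870f12a82253018306000578e1c38e0f025028e1c183ae1c1cd0e38152940c1c205281ca151c6070f3c3870e1e7830f30607942850a1428551142850a961c3870e1c3d10e1c387881c0470e1c3ca0e1c540880e50a002850a802a18a8e0a38a8842503942850a1500500862a3870e1c3c3061e007011e20a882a2020810242081298a88402030944204840818384102420408183840c102060c10280082040810242a6002040810240a62a2038810204081024e07101c400100040812004a602c0e942850a802800aa62a3870e0c3870f0e007011e20f942850a802800aa62a3828e2a210941c0470e1c3ca0e283c08930902980e2071c1e0030600003af1c3ca051c702a41c183075c3cd0f28147060e1038e1e203951440408104049c104049c10447082024e0800204093825c0822385081275a00165cb0f2aa850002180071020307123830f205000002c0ab22840aa11c544102a807011c04f151e2070f3c0470f003c50e1c3d40e1c3cf0e1c387860c3c00e1c187801e2830f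28187061ea83904a185012c50815405000002c0ab21450a8b349c50810285ab289c510285050b5445c08126840e1eb85012c3ca011e0811e1c601033c08f960a38fb7542010e1c3870e1c387841c387881038789643870f12a870504108054c982a04c0c727603828f4c1470e08802a630747181c147216c147181c110054c60e8f043828f0485f0e1c102100a9938e4ec028808402a64c14426123950e0a387051c1470f222590e0894c02066070e06d5b02000ce02040800006701000670003340018e0a382070a3878238152051c40f0820259081025408102410810242041024108100848612c0409502018812184b03e3d50810204a80825b080820405523870e1c3870e1c3c20e1c3c4081c3c4b210202a8102020810254096c147225c000a2029110e023d6051c3870e1e107041e644041c387841c3d1051c3c4051c3870e1e1020e1e6c4011c3870e003870f028c40e1c3c2041c3d10e0a3c4051c3870f081070f443870e1e00701443870e1e00701443870f081070f440470e1c3870e1e000011c0470408102040a202040a202050c102840814304081020408140011c14700023cc0e023870e1c3c00e028c40e1c3870e1c3870f003c4011c0470e1c3870e1c3870f003c401103808e1c387801c007991004701100470e023870e1e0000e1e6c4821c3870e1c3870f083870f103878812c808e5c000a24404b221eb008e0000306020c80810004871c0c40800243080000306020c88e06201000004103200801106387011c440011e2020340400820008001040c8031c0470e0238011023c40406858240a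60702066010f683870f040c80e383c00e003870f003d71c1e4070e3838e0f0038e0f00707be1c407811008888123d6b2080c4040a40208120848e0620d0408081b236b8204040d903123800110041213e292980a392053008c1806a810204489031c0d20e04081031c24190165808e1404b0b2039900640450a000000a140479620408111e0859602384b61404b0e6401901142800000285011e5840810247ac287ca102a8089e000050b2000a1428500011e8088a142850b2a68e01480471d3438810204470b200172e02f0000002800b1c2d2821c482960a38996046811b2408102044898e065848204081031e40388041c4031020d1a346ca0e1c102820c18306040c703100cdae26587120a5828e0c1810324083060c181031e5848204081031ec8f881078a882a20000142db142850a000238088142850b284459a1c700a410204091c0471d340172e02f0000002800b1c2d2096eb46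

theorem coneTest_eltC : coneTest [eltC, eltCAux] wordsC coverC = true := by decide +kernel

theorem pullTest_eltC : pullTest 14 281474976710655 (coverC.map Prod.fst) certC = true := by
  decide +kernel

theorem mem_stdNormals_of_eltC {C : Mat4} (hC : IsNormal setV C) (h1 : frob 1 C = 1)
    (hg : frob eltC.hreal C = 1) : C ∈ stdNormals := by
  have ha : frob eltCAux.hreal C = 1 := by
    have h2 := hC.1 eltCAux.hreal (IntMat.hreal_mem_of_isOrth (by decide +kernel))
    have h3 := hC.1 (1 + eltC.hreal - eltCAux.hreal) (by
      have h4 := IntMat.hreal_mem_of_isOrth (x := ⟨0, -2, 0, 0, -2, 0, 0, 0, 0, 0, 2, 0, 0, 0, 0, 2⟩) (by decide +kernel)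
      convert h4 using 1
      rw [← IntMat.hreal_two]
      ext i j
      fin_cases i <;> fin_cases j <;> simp [IntMat.hreal, IntMat.real, IntMat.two, eltC, eltCAux])
    rw [map_sub, map_add, LinearMap.sub_apply, LinearMap.add_apply, h1, hg] at h3
    linarith
  refine mem_stdNormals_of_pull hC h1 (P := [eltC, eltCAux]) (by simp [hg, ha]) coneTest_eltC
    (finrank_tightSpace_pair (v := ⟨-2, 0, 0, 0, 0, 0, 2, 0, 0, 2, 0, 0, 0, 0, 0, 2⟩) ?_ ?_ ?_) (by decide +kernel) pullTest_eltC
  all_goals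
    simp only [← IntMat.hreal_two, IntMat.frob_hreal]
    norm_num [IntMat.dot, IntMat.dot4_eq, IntMat.two, eltC, eltCAux]

def eltB : IntMat := ⟨1, -1, -1, 1, 1, 1, -1, -1, -1, -1, -1, -1, 1, -1, 1, -1⟩

/-- The normals of the facets that contain `1` and `eltB`. -/
def wordsB : List ℕ :=
  [0x1251048249209449208249250, 0x96596d925b66249289449240, 0x120a24904925196cb6db65b2c,
   0x196cb6db65b2d449208249251, 0xb6c92cb25b2d965b24b65b6d, 0xb6496c924b2d965b24b65b6d,
   0x96596d925b65289048249240, 0x196cb6db65b2d965b24b65b6d, 0xb6496c924b2d448249209240,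
   0x120a24904925196cb6db65b2d, 0xb25b6592496596cb6db65b2c, 0x196cb6db65b2d20a249049250,
   0x144920824925196cb6db65b2d, 0x125104824920920a249049250, 0xb6496c924b2d25128904a249,
   0x925b2596592d25128904a249, 0xb6496c924b2e249289449240, 0xb6496c924b2d289048249240,
   0x92d92596c96492d92596c965, 0x120a249049251b2cb25b64b6c, 0x120a24904925092d96d925b2c,
   0x1251048249209449208249251, 0x196cb6db65b2d96db64b6c965, 0x144920824925092496d96592d,
   0x1b24b2db6d92c92d96d925b2c, 0x124120824904a249289449240, 0xb6c92cb25b2d449208249251,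
   0x224944925128892d92596c965, 0x224928944924092d92596c965, 0x144920824925125128904a249,
   0x196cb6db65b2d449208249250, 0x96c924b2cb65449208249250, 0x1b24b2db6d92d96cb6db65b2c,
   0x125104824920996db64b6c965, 0x1b2cb25b64b6c92d96d925b2c, 0x925b2596592d96cb6db65b2d,
   0xb64b2c96db6d25120944a24b, 0x128944a249241289048249243, 0x1b2db64b2592492c965924b26,
   0x96cb2c92592d925b64b25b2f, 0x196db64b6c96496596cb6c92e, 0x120904924224892cb25925b2e,
   0x96c924b2cb65b25b6cb2cb67, 0x192c96db6cb2c92db2d96cb6e, 0xb25b2d92492d25120904a24b,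
   0x96592596c92d965b24b65b6f, 0x125024904928920924144824a, 0x125128904a24925104928824a]

/-- Elements of `F₄` that bound the cone of these normals, with their supports. -/
def coverB : List (ℕ × ℕ) :=
  [(0xfffc9f200203, 0x2496c965964b), (0xfffc19c00d82, 0x4128924a2494),
   (0xfffc12400ea6, 0x24965925b64b), (0xfff81c2a0f04, 0x482892412494),
   (0xfff809a84583, 0x24b64925965b), (0xfff8022846a7, 0x6496d925965b),
   (0xfff4bdc20900, 0x24b64965b6cb), (0xfff4b6420a24, 0x6496d965b6cb),
   (0xfff4a3c040a3, 0x4124904a2892), (0xfff0adaa4101, 0x64b6c96596db),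
   (0xfff0a62a4225, 0x482490412892), (0xfff020ca4da4, 0x64b65925b6db),
   (0xffaae1f0ae0d, 0x494512092482), (0xff9a7286eb43, 0x64b2cb25b249),
   (0xff6ae9f19d09, 0x6db6c92d92cb), (0xff6ae2719e2d, 0x512490092482),
   (0xfeea093944b7, 0x2db6d925965b), (0xfee6bd530834, 0x2db6d965b6cb),
   (0xfeba7983e953, 0x4945124a2092), (0xfeba7203ea77, 0x2cb2d925b249),
   (0xfe787a03d973, 0x5124904a2092), (0xfdecf2411e2c, 0x2c96d92db6cb),
   (0xfde8e9a95509, 0x2cb6c92d96db), (0xfbee497d04be, 0x4a2512092494),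
   (0xfbe6ed7f003c, 0x2db2c924b6cb), (0xfbbc72438a36, 0x2492d925b2cb),
   (0xfbb869abc113, 0x24b2c92592db), (0xfb7c7a579932, 0x2d924925b2cb),
   (0xfb786a3fd133, 0x6d92c92592db), (0xf9fc3a1f7132, 0x2d92cb25b6db),
   (0xf7d902ac7783, 0x64924b25965b), (0xf7d5b6c63b00, 0x64924b65b6cb),
   (0xf779e2e19f09, 0x6c92492d92cb), (0xf5fdf2c53f08, 0x2c924b2db6cb),
   (0xf5f9e2ad7709, 0x6c92cb2d96db), (0xf3fc49fc058a, 0x412482092494),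
   (0xf3f4e67e022c, 0x6492c924b6cb), (0xefd51d8ee1da, 0x64b2cb6db25b),
   (0xefd5160ee2fe, 0x482092494412), (0xefbb01a86697, 0x24b2db25965b),
   (0xefb7b5c22a14, 0x24b2db65b6cb), (0xeef51d0bc0fe, 0x2cb2d96db25b),
   (0xedfc198c65ca, 0x24b6cb2db65b), (0xedf4b60e626c, 0x482512494892),
   (0xe8ac19010012, 0x925124a2494), (0xe8a0200b4034, 0x2cb2d925b6db),
   (0xe7f5c5e816dc, 0x482092512494), (0xe1a84028060c, 0x482512092494),
   (0xe1a4e1c00008, 0x24b2c92db6cb), (0xe19c12042202, 0x2492cb25b64b),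
   (0xe190208e6100, 0x64b2cb25b6db), (0xdfdb1284ffc3, 0x8924944a2412),
   (0xdfd3b686fb41, 0x6cb24b65b649), (0xdefa1980edc3, 0x4948924a2412),
   (0xdef2b602ea65, 0x6cb6d965b649), (0xddfbb2857f01, 0x5124944a2892),
   (0xcff795c03edc, 0x2cb25b6db64b), (0xcff385a876dd, 0x6cb2db6d965b),
   (0xccaa10002e04, 0x2cb6db25b64b), (0xcca2a1806001, 0x4945124a2892),
   (0xbfe6cd7c04ec, 0x6db6c92cb64b), (0xbfd41e1ee1ea, 0x892482494412),
   (0xbf780a3d55a3, 0x6d964925965b), (0xbf74be571920, 0x6d964965b6cb),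
   (0xbdfc1a1d75ea, 0x6d96cb2db65b), (0xbdf4be1f7168, 0x512482494892),
   (0xb7f5cdfc15c8, 0x892482512494), (0xb7f5c67c16ec, 0x6c92492cb64b),
   (0xb168483d1508, 0x512482092494), (0xb164e2551028, 0x6d92c92db6cb),
   (0x9ff596401eec, 0x6c96596db64b), (0x9ff18da855c9, 0x6cb6496d965b),
   (0x9c6818011d00, 0x5128924a2494), (0x9c60a2015021, 0x5124904a2892),
   (0x8ce49d000048, 0x2cb6c96db64b), (0x8ce0000844ec, 0x6cb6d92db65b),
   (0x85d596043248, 0x6c92cb6db64b), (0x85d1008c75c8, 0x6cb24b2db65b),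
   (0x7fd516428af6, 0x64925965b24b), (0x7fd10daac1d3, 0x64b24965925b),
   (0x7fbb41f0ae97, 0x65b2db25924b), (0x7fb3e5f2aa15, 0x494092412482),
   (0x7f7a49f08d83, 0x65b64925924b), (0x7f72e6728a25, 0x892490412482),
   (0x7ef71d5388f6, 0x2db25965b24b), (0x7ef30d3bc0f7, 0x6db2d965925b),
   (0x7bf70d7f00b6, 0x4a2092412494), (0x7a2a49318013, 0x2db2c925924b),
   (0x7a2260538834, 0x6db2d925b2cb), (0x731842208203, 0x6492c925924b),
   (0x731060c28900, 0x64b24925b2cb), (0x639501c00092, 0x4120924a2494),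
   (0x6391042a0214, 0x482092412494), (0x5ff385f03e95, 0x6db25b65964b),
   (0x4e931402aa54, 0x6cb2db65b24b), (0x4e930180e0d3, 0x4940924a2412),
   (0x3354025400a2, 0x65924925b64b), (0x33500c3e0100, 0x892482412494),
   (0x1e628d300001, 0x6db6c965964b), (0x1e6200500ca4, 0x6db65925b64b),
   (0x1e501c028940, 0x6cb64965b24b), (0x1e500200c0e3, 0x8924904a2412),
   (0x175186201201, 0x6c924965964b), (0x175100c01d80, 0x8924124a2494),
   (0x200142000, 0x6db2cb25b64b), (0x100011010, 0x5120924a2494), (0x40008048, 0x6cb2c92db24b)]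

def certB : ℕ :=
  0x11a36e05a44c6851a170e525346850a342e184344081a2045c26142db052c1022534102253468d9c346cb1a3640216085d71d1458e17602881016b820a22b85112c6c81014288ac2258896144080b5c6c8c22c28bb0142851b846939b0868d96346c81a2045c94081129a4b702040894d040894d1a36741023658e975a28b1c385d8844a4080a20405af040820a22b85112c6c81014288ac2258510202d7112c6c8c22c28bb0142851b846939b0868d96346c81a2045cc64c1149a53782a44a6930452682280ca451b3810505342851a170939a146c2c6082829a1428d0b849cd0a3614a041414d05bc682240a68d044814d1b3a505a4202880a22bca1a346e51b601120534112053468d9c089029a089029a089029a346ce8c0a708060c2d606202d70614105101445d140c583940c5830716c03060c1d710142889c20442142a105101445d060e103060c1d706141611a3640d07346c8060e68307364428a0c1c2060e2c51020443060c44e060e2881114188070a6dc1a2040d1022e0d1034408b98c6881a2045c940c081c4448c60218301032ab8122440c20c1808194183060206501c30ac0682067018c3658e960408103580d80204081035b0c2224470e976070e820858b05281050a0a501020840805280e104081610408161822c288c22c288c2346c202041020586785115c28896364080a14456112c2881016b8896364610a22b85112c6c81014288ac2258510202d7112c6c8c21428dc23644fa22c288c250081292c0c50b082850a3708d273610d0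20668d96340cd1b206881172f02a408402112c4630408402112ef13ac0e5dd0b4840510144579414288115c285101445711784050a22ec5c614948114c701030c8c1020e98d0a342e1ca3640b0a2ec05115c28896364080a202d6112c2880a22b8d90225e194144570a2258d90204050b582851022b8d9022588978718f8a04085b0142cb14280818a2a78a14040c7036050a020638a14040c71406a45b650a41033494d023408d9650a4196040cd1a365929b2050a020638a14280818e28501031c501a806901033468d960668d1b20708112c088022258b0a2308b0a230c10204081020708b0a23081033c2880a22bcb1b204080a16b0d90225850a20457112f0851a17085101445796364080a202d61b2044b0a14408ae225e11b2278b0a2308e10204089620308c238408971e1d00408102c39428b0a2308d1a2c288c30ae8f056c10a9e387420438702976c44d14287421c3a1021c3814ba40a68e1d347081c2c288c23458511846c20408161161446116144611a3614f161446116144611d0e803020710d1a3778d1b0c68db80c903ba2854d1a36c08022008897440d116144610d0c183820c188110e5c42608a4d29bc6930452693045268d1b26f891b204c8b7244881223153040ab8d13506951a2696d29341092a344d2a60810b162c5d72a56b13904c1149a4c1149a346c91220409b924409122310d1b2c68d9008989162c4dc2a2ee0b2b206cb162040bb62e409162c4dc17206cba40858bae346cb1a36402044a6821a569491048462a24ca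4b122c589b82e1151770595903658b10205db122c589b82e40b90365d2042c5d71a3658d1b20102253410d2b4a4882423102ba2660d9026409122045b1188489122045ba54c502984410210228dc1428891a60810811441020420451234a16211444491428489918899392244829a0b702265014d265014d1a364d12608a4d2608a4d1a364930452693045268d1b24982293700d135058916245dca23468dda36b0b22445e3221088490104040927102040815c162040b922c5d3164488bc64c9d12644102040ae040908152264648b042415b162415c1a36582040a68205365c984102499220408881040492204491010242040a484090a68d1a126cbae241099a081129a4b702240a682a852692084aa821b24482240a695a4086c9ba241099a241120534ad204364d108448d8040810b162c5d7160858baf7410b042c5d7a2545dc165640d962c408176c48b1626e0b902e40d9748a8bb82cac81b2c588102ed89162c4dc17205c81b2e90d965448da53250910204d10420402a244882102015123484820548689040a90d9024102a424102a54489112081529820408a40858bae3464d1b2c68c19346c8040894d0434ad2924861219204552526815292c4d416245891772891222c5e3122458bb824589177048ba126e8b840aa04900a80216085c8177410b042e402a18c6951a2696d1b2c4121188a8bb8545c81b2c5881622d8916245dc17206cb17229512a2ee1517206cb162c408b62448b17706cb17205c8a5748912246a88102045a11308e21020408b4204081168411a926b1518329121988ac82934912983268d18306c8244a6481a3064d1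b20a4d96204081168408102045a102040811688e1235048b172068c9a3658d183268d9054595177240d962c588116c6cb122458bb82e40b9148a8b2a2ee481b2c5881622d8d962448b17705c817229151a2690d97304081148408114a8881022911224489123488919820408a43058c172048b122c5c8162c5c816205d2a312f021208152da484820548689040a90d918c10898085420408148ac305561134408110810a84081029150482053454d102045212081521a24102a436409040a909040a90d1b20482054a6081022908042625e2250263233420d1b5868d1bb868d88346d708448d812246441210550841020b1712411222e8c41020452163058c172250a850c102040a267222044408444088812104b8161051014288857051304081028b042c20a140818e16102041c3c50f043c18814281031c40409440cc02108840383411191088403802490207191841024522441028e081410808141222044410464048244884038088403802048e0408802200c90812084090808803242048210242a64414195080810206487835c20205048881110411901208203081018e06101021024a0b044050a2210582061600812084090808803271111022208222044411b4888111044c1032208103ec84824440888208c8090711110222082220444104640483582111022208da4440888444088810242ac4440888444088810242222044422204440812102040a24f04226080a14442ad4428e94284081c1610a104c20408134049208993055850a0e1e2891c2478f8e1c7078b64111220a3820520108100a99327585078a3850a1d0850827802048426204090870e8838744850a28a0f1450e85145078a2040e1d207081d1c4088a1c442890408b160458bc60408b178c5c9020458bc62e1118c0a0860c040ca03243060c0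40cac01e0d7031858102040d68408582175c0810206b010204081ac2f04592240cb0344202050488811104042322081162f18203081018e06101021024a0b044050a2210582061600406102031c0c2020420494160880a202c203082c1c00610110070469c448870f582040812b0102040d6162c5e022100e022100e09644201c044201c0102471644201c02e3060d10204821020589083070c1e08190464132704102021e0c90e100e086161080a2028511084080a14442050c1089820285110ab080420153858ae8502142818f880810a140c7862a181980e0d31c040c32304083a614285060e0ce270c0c20204088c1a008803241018404147030808108125080a144420b042c1030b0560406101051c0c20204204942028511082c10b040c2c1881c10310387870420307102410a1418382062018908183060e583060c1cb062e803060c1cb062e608100c18390224c1122458b900c183072c183060e5831730183060e587862e4c2b210183881208388102420a1418382080c2020a381840408409282c1101428884160818580088038010184041470308081081250582202880b080c20b0700185183840380384038258b162c58b1780384038058b8c08082040a382020b002020a3cb04041470e100e0bd48211080706822100e00844201c012388a60620408121830612383060e2cc060ec881020443060c4470f0ec83880c1c4020c3840380884038021108070048e44201c044201c044201c0102478c04087080705ea40458bc610204da10256081209308301d3264e20492142c3060e08b16165c30e100e09a0a9021508102040addf264c9dc902c591222f188112488c22324081188102040ae08162c449174c1029220108052c408922458917204090578891162f19327449d6274418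3060ee03060c1dc062e80807441831128582a44eb4a162c58b9570183060ee0b1526103060c183b920183060ee03a42c94825245429374408102045aa6204081168443270c44c0747113264ee13942a40a860c408c44e19122448d51020408b422611c42040811684081022d0823524d62222888b20c183060ee48060c183b80e908962a192916490b902a812904489197224c51c040c32304083a6346dc0b486851a170e5264a6850a342e11b086881034408b84c1120534112053468d9c38102162eb8e8a2c5d80a20405ae08288ae1444b1b2044b1014288ac2258510202d71b2308b0a2ec050a146e11a4e6c20a16d8296346cb1a3640d1022e0d1b2c68d9128513962c593ae08402112c948292c10b160a414964a44d05221021022e02172014d9c08402112c44b11145851184585118468d8438585118446ab42c28bb0142851b846939b0868d96346c81a2045c0b7c20d1b4c2d21a14685c39494d0a14685c236102040816127342851a1708d857c102040b0939a1428d0b846c2ba105048428104081215c264c58b944c5931708102081258b1738993162e50a15385130408204961024509341520420108962ee820408161ca14585118468b0a2308d85745131a346ef1b70102110a408040824b161446116144611a3610b0a2308b0a2308b0a2308d1b0a20e1a36584040a68205365849a346cb851420484102458a20445081228811102081012288081214db04e58b164eb82100844b2520a4b042c582905259291349cb162c9d70420402964a4129052582042c5c8292e694964c1149b82382040815d0a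48292ba44882040815d233410505341050536882240a682240a68d1b388820a0a691c010104080a45c04082040522682882e4029b382510e102040974204081025d2334885881020409765910e1c8ce8b7024204448db16145d80a1428dc2349cd84088822246d820444891236ee022208891b72c387040a6dc142a10d09346cb1a1024d1b20102253420d08106c8a63614c08082040522e0204102029134144172014d9c128870810204ba102040812e919a442c40810204bb2c8870e46745b81210b0a2308b0a2308d1b0870b0a23088d56810205845851184585118468d842c288c22c288c22c288c2346c2882044410102088408204853414d10222081010242051044e081270504081610a1268409342029918288ae1444b1b204050a22b0896144080b5c44b1b230851014457963640d90202880b5844b0a14408ae225e11c2044b112c585118446abf6828d0b8428d0b868851a170912244891238489188144570a2258d9020285115844b0a20405ae2258d91842880a22bcb1b204051016b0d90225850a20457112f08b0a230889710a4d244a2049a48944905268d081268d90342041b22584081025d081020409748d2081020409748cd161270e081258bb0102040974204081025d2334885881020409765870e448ce8b7058517602851b8458b162ec0b082f08516145d8ba3424d1b2c68409346c81a1020d9132304081026b0812584b03820c173858b8812d0b0a2ec050a146e11a4e6c21a1268d96342049a364041a1020d914c6c20a1024c864c993ad2851390204051016b4a0a202880b5a18a860e5859b7c14c04083c20408157c4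2854e152089122469d3060c183bb7488d8b08183060c1dd900c183060eecc22084080544891144454b22142919008285842c28b1a362da231c4088408102057458b9444387233838a053010210228820408408a2469020f08102055c8850a464070f148820f203c58c2a30d841e4078b16e0a864e1830a16f88a20c183060eec8060c1830776607861e4591014288ac202880b5828bc02c58b171c4051016b0b0b36fc5b42258b1164591232e287904e6880b1e2c9150c403100c44bbb2418408133840834243060c2040812c030810204ae3440807222041a362049034408b8102631a20403911020d1b102481a2045c08125030810267081068486342041a1025f1a1020d0812e832246984060e204a2446512310204920c191234c2030710251223289188102421514285060e083b738408100c1d1b84e1c5063468dca3468d150c68a1a3450dc43450d1a286dc060c58b943464d1b2c1839a346cb1a36283162e50d19346cb060e68d1b2c68d84048810d7b701220435e220435e060ead80704181020f183a6240cb1f06e491e2c78b83448810d788810d78183aa4c98102040d6060c081c644591178e48b1e3c5c1264eb01030c181020678102040cfc8247c3a2040c70f2c183822c5c32744187060e783824c081ad7058b0e1e083060c1dc07041830207183960e583833c5871704183822c5c3121e413a20c383073c1c126040d6b82c3871704183060ee03820c081078c1cb07041cb9e2c38b824c183822c5c30f5c4d4032c7c1122c48bb82e08916245dc133e882a82010b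042e4630408408a20810b172010b042e402113e141022e40baa0810f1f1e08f1f248810d788810d78183aa44086bc44086bc0c1d5220435ea844086bc44086bc0c1d52644086bc1b448b80ea810208103058c08306040e3030e4010408102c60408103240810206a880e1c90725204089304081a208102058c4088404081032438790080879e08183820c183c80e0810f261081124408841834992204490c204460c20308aa18442860c1868704102860814383588810d78091021af01020c0de020c0de03a01878604092b43e183aa4e8830e0c1cf0706b93a20c383073c1c1904e8830e0c1cf07044121020908c42090824231631048412118a0930206b5c161c38b820c18307701c10604083c60e583820e5cfb82c3871704183060ee03820c081078c1cb07041cb9e040819e0e0e1841c3870f20183060e403060c1c8102044f0e0c1cf0e0c1cf060e587060e787060e7c80e0c1cf10230940204a4b17683cf061e1838250a43060e587060e788242314d070408302041e3060c081c6040cd020c181038c0c3900408103264d7074c183060c1cbae0c183072c1cd0f0c44b27364951770595903658b10205db122c589b82e40b90365d22a2ca8bb9206cb1620588b636589122c5dc17205c8a42458b902e4081022908c9063951770595903658b10205db122c589b82e40b90365d22a2ca8bb9206cb1620588b636589122c5dc17205c8a420408a42e4432a344d22a344d28254689a40408102040d2020618302041e30204181020f18302041e302070cd0650a439a4a694290e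58306346cb060e68d1b2c94d900c081078c1830207181033408306040e3030e40102040c9935c1c9060c4c80e1eb08102310310229082420908c5041831a36583073468d960e68d1b20a891b48412118a7e012081521a34482054a40910204521192389040a90d12081521b2040811484820548482054868d910c482054814d060e1031020443060c4539a0c1c91020443060c4530f0c449240c10307341cd1208152253f007060e783060c68d97084c2060e68d1b2c1cd1a36402044a6821a569491048462120c787921c3c3070418307a0183900c1d688040cd1a365841a3468ddc1068d1b0420d1a371041a1068d1b580819a346cb020458bc61268d1b2c68d920408b178c24d1a3658d1b08104060c1ee080c1838410203060c1e2080c183077058b052e1831a36183960c10b175c1dd042c582970c18d1b0c1cb060858bae0e89122040caac0e083060c1cb0704306020650196065de060c183072c1cb8a0610194040d60f048c10b548810d788810d78183aa4c98102040d6060c081c64488b178e48f1e2c5c1264eb01030c081033c08102067e4123e183a24e8830e0c1cf0704981035ae0b161c3c10704183060ee0306040e3072c1cb070678b0e2e083070458b86040c70f2c487060e08b170e413a20c383073c1c126040d61e1c1839e1c1839e0c1cb061c1839fb228b0e2e083070458b86202d92244891920408103241060c18349040af11021af11021af0307548810d788810d7a111021af02054089102065560704183060e583821830103280cb032ef1122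040caac0e083060c1cb0704306020650196065de020c0de032e85b220435e0308b01020408192040810324082bc0858b0554081020648203125c9ad44081021024aac04084092825e0f048c10b12a8b22445e3221088490104040927102040815c162040b922c5d3040a484041014b102248916245c8102415e09281830744182092c183060e587862e487060e787060e783072c383073c383073c383073c1839710187060e7e40e0c1cf0e0c1cf060e587923c58b8620483060f403ac0a4c2081248409082060c1a206098e48409243069218204850c204961024b862c582970e083060c3c3080c1e20e0c1cf061c1839f907c30704193a21c1839e0e087060e7d9064e887060e783821c1839f248c116045d60a160832744383073c1c1020c1820506993a22c38b820c102860e082962c5c3161c58b161c38b170438b0e2e0d9161c5c192080828f300c22c04081020648102040c9020af02162c155020408192080c49726b510204084092ab01021024a09783c123042c4aa0c9d10e0c1cf07040830608141a64e8dc161c38b820e083060c1dc0604083c60e583820e5cf072c08f032ee0b0e1c5c10704183060ee03820c081078c1cb072e7830e0c1cfd96628102040c90204081920415e02040819204143162c1029704141032c3878504302041a08196065c3020408192040810324082bc2c5820554081020648203125c9ac142849e3c1029706e0b0e1c5c1060c183b80e08302041e3072c1c1072e7dc161c38b820c18307701c10604083c60e583820e5cf0e0c1cf072e201020678102067c2020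40cf0408102040a7820510081033c183040a08b0e2e083040a183820a58b170c587162c5c1022c5cf161c5c19332a0f0e0c1cf0e0c1cf060e5830e0c1cfd9143430e0838784083d1081210486101550e08387841c1510e162550e0c1cf0e0c1cf060e587060e787060e787060e783072e207060e787060e782061c102860a18799502040810269091c241082c58c135620f09145871704182050c1c1052c58b86141029948b4802200889606cd1064e887060e78382489440812413261020409b498408129130810257084c20409201c81022212104846208131922510204900e40811109082423104090498ca2448c4261020409b498408129042448204ba1021224102511944891884c891aa0c1c408128840964991235418388102510812485840c183040a0d8a656984060c204a38a11122168c31022183074418522148c822442d18620443060e883060c183060c403100c183d80c1c5100ef88100ed0522148c807581cb2804094962ed0783142850a3708d27361020544891860c204860e88304448db060c183060f5830a0c1c2060c1850a0ef850a0ee83b80815122461830812183a20c111236c1cb0f181831a3658bbf0868c9a36586060e68d1b2c68c9a365861a346871a346e61a346878c3438db83438d0e36583073468d962c30b8e346d916185c71a3628d020668d963424d1b2c38d020668d963424d1b2c6811a3408d1a1c68d1ba468d823408dac3408d961c587170468db22c38b82346c9040894d0434ad29248612192045525223850e143c20b68547ac244cb162e188110c183960c48b1720483060c409060c183d00c1c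8100f103060c40807584cb162e188110c183960c48b17201da074420d08106c8a64e6c10224481030b10d934410219401040f32281020446008164471a0c68d1a361d71a361cb293419406525949a3468d86346cb902e40810204460c2044d864a68d060c6cb063468d1b0c6d828521cb1a3468d86365929b205c810204470e20454110c44d1a3430d1a346c6910c6cb292ca4d1a365929b206cb292ca4d1a365929b2218d0e3468d8e3640d11361c1a1306831a3468d875c68d872ca4d0650194965268d1a3618d1b2e40b9020408111830811361929a341831b2c18d1a346c31b60a14872c68d1a3618d964a6c81720408111c3881150443113468d0c3468d1b1a4431b2ca4b293468d964a6c81b2ca4b293468d964a6c8863438d1a3638d903444d870704c882c58b17145c1032c2850e1e0819618345822c58b822c08b8d0c0cb162c58b822c08b9f1058b170458117180cb171058b162c5c7822c58b822c08b9e1c3c982183870d040cb032e181081020482124818812183960e586862c5c30f0e083960e586862c5c30f0e0c40806204021020409062c3855290b162c5c517040cb0a1438782065860d1608b162e08b022e343032c58b162e08b022e7c4162c5c116045c6032c5c4162c58b171e08b162e08b022e7870f260860e1c341032c0cb860420408120849206204860e583961a18b170c3c3820e583961a18b170c3c38310201881008408102418b0e161a9364c21a3468d92226c90812484101040490124d4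1a366029a3468d1b0a104081210204082420522a0d1b3068d93084089324408112c40811244089220508852610810205c81124102042a10291183020c0a502b4184080d4434a9b26106101a5861154306921a6860408302a72c3060d0a68d1b1020486526929a3659496346cb90526929a3659496346cb9144a4d1a3068c904894c905268d183468d1b32b0d1a3468d9922588a2448919044411984668d1b324129a4860c252068c1a3468d997094d1a3468d983644b1144891232041123308cd22228912246411104664b22448c810448cc22228cb897a7949a4a68d965258d1b2e4149a4a68d965258d1b2e451293468c1a3241225324149a3460d1a346ccac3468d1a366489622891224641110466119a346cc904a69218309481a3068d1a3665c253468d1a3660d912c45122448c810448cc2334888a2448919044411992c89123204112330888a32e24f8d0c889a244891224649112448919b10884224465188448c4862c68d193658d1a365859a3468d0a3468d1a3468d8b765c3224658b162c58b162e4d116448cb9a4488ca32c68d193659117444d116244d1174668d19346cb1a2668d123468d1a346c91b686cb2224891124489122448912326a119a4488ca32c891224649112448919a26891232e21122328918810885a244891231488522448d22310891890c891962c58b162e28b162e891232e6859a3468d0a3468d1a3468d8b765910a448910a4489122448c523488cd1944891963464d1b2c8850b4458ba22e885a3342d1224489122462910a44891a52c64d1a3658ca2448cb88344cd1a2468d1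a3468d9236d0d962c68d19346cb1a365c3224659122328cb16168912244891231488522448d2964619122448c9222489123344d12246591232c6512246591170c6899a346891a3468d1a3648db51068d883468c9b1020d86448cd22466cb1a3468d1b3259122448cb233468d1a3660d9644891232c8cd224489123325912246611232e25e9e448cd22466cb1a3468d1b3259122448cb233468d1a3660d9644891232c8cd224489123325912246611232e24f8d0c64d1a3620d1b1068d0a3468d1a3468d8b746859a36204870a145141e28a101c3cb0e227521428742043810e053a5d21a36145041c3828e0a8881c204511d1e28810223870e227071d144088a1c40e841c408111c388a6381021c38742ad0a2cc9b1214508121040408104840a44d1a3468d840a6c21a366040812284102024809166889a3468d1b1628d1b302041a361c0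

theorem coneTest_eltB : coneTest [eltB] wordsB coverB = true := by decide +kernel

theorem pullTest_eltB : pullTest 15 281474976710655 (coverB.map Prod.fst) certB = true := by
  decide +kernel

theorem mem_stdNormals_of_eltB {C : Mat4} (hC : IsNormal setV C) (h1 : frob 1 C = 1)
    (hg : frob eltB.hreal C = 1) : C ∈ stdNormals := by
  refine mem_stdNormals_of_pull hC h1 (P := [eltB]) (by simp [hg]) coneTest_eltB
    (finrank_tightSpace_singleton ?_) (by decide +kernel) pullTest_eltB
  rw [← IntMat.hreal_two, IntMat.frob_hreal]
  norm_num [IntMat.dot, IntMat.dot4_eq, IntMat.two, eltB]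

def eltA : IntMat := ⟨1, 1, 1, -1, 1, -1, -1, -1, -1, 1, -1, -1, 1, 1, -1, 1⟩

/-- The normals of the facets that contain `1` and `eltA`. -/
def wordsA : List ℕ :=
  [0x1251048249209449209250249, 0x1251048249209449208249250, 0x196cb6db65b2cb6cb2492c964,
   0x224944928925092d96db2d924, 0xb25b6592496596496db6cb64, 0x120a24904925196cb6db65b2d,
   0xb6492496d966249449289251, 0x144920824925196cb6db65b2d, 0xb6cb2492c965449209250249,
   0x925b2596592e249449289251, 0x925b2596592e249289449240, 0x224944928925092d92596c964,
   0x224944928925092496d96592d, 0x125104824920920a249049250, 0x224944925128892d96d925b2d,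
   0xb6cb2492c964b6496c924b2c, 0x124120824904a249289449240, 0x224928944924092d92596c965,
   0x224944928925125128904a249, 0x96c924b2cb65449208249250, 0x196496db6cb6492d96db2d924,
   0xb6492496d96596496db6cb65, 0x925b2592d966249449289251, 0xb6496c924b2d96496db6cb64,
   0x1251048249208b6cb2492c965, 0x196496db6cb6492d96d925b2d, 0x224944928925092d96d925b2d,
   0xb6cb2492c965449208249250, 0xb25b65924966249289449240, 0x925b2596592d96cb6db65b2d,
   0xb6cb2492c966249449289250, 0x224944928925092d96d925b2c, 0x1b24b2c924b64925b2596592f,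
   0x124104a249208964b25b65926, 0x1b6db24b2d92d25104920824a, 0x2249209241448b25b64965927,
   0xb2db24b64925924964b2492e, 0xb6c964b25b6504925120824b, 0x1924b25b6496492d96db2d926,
   0x1b24b2d92c924925b2592d966, 0x125120a249448b6496c924b2f, 0x24904924128a24925144920a,
   0xb25b65924965965b6db2592e, 0xb6cb2492c96524120944824b, 0x2249209449240b25b65924967,
   0x1924b25b64964b65b6db25967, 0xb6496cb2c925924b25b64966, 0x125144920824892592db24b2f]

/-- Elements of `F₄` that bound the cone of these normals, with their supports. -/
def coverA : List (ℕ × ℕ) :=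
  [(0xffff808a7080, 0x65b24b6cb2db), (0xffff80523500, 0x64b2cb6db25b),
   (0xffff01a8c084, 0x892482512494), (0xffff01708504, 0x64b2492cb25b),
   (0xfffa92d230d0, 0x6cb24b65b2db), (0xfff63187a783, 0x65924925b2d9),
   (0xfff38f509502, 0x64b24965925b), (0xffee30872fb3, 0x6596db25b2d9),
   (0xffe77907a723, 0x6592d925b249), (0xffddb6c34e58, 0x2596d965b2db),
   (0xffbdb1c34e4c, 0x2592c924b2db), (0xff9fb1430e7d, 0x2492d925b2cb),
   (0xff7e32a32af6, 0x6d965b2592db), (0xff7bd2f012dc, 0x5120924a2494),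
   (0xff7721a18786, 0x6592492d925b), (0xff6f20a32fb6, 0x6596db2d925b),
   (0xfefdeea2ca58, 0x4a2892412494), (0xfedfa6e2ce18, 0x4128924a2494),
   (0xfebf21e0ce0c, 0x412482092494), (0xfddf904a34b1, 0x64b25b6db2cb),
   (0xfdbf394834b7, 0x64b25b2492cb), (0xfcff40acf089, 0x65b24b2db6cb),
   (0xfbfdceb2c950, 0x6db65964b25b), (0xfbdf86728d10, 0x64b6596db25b),
   (0xfaff4eb4c959, 0x6db65925b64b), (0xf9ff443db18b, 0x65b2592db6d9),
   (0xf85202a08090, 0x8924124a2494), (0xf7fe32f228f4, 0x6cb65b24b2db),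
   (0xf7fbd6741a5c, 0x2cb2d925b6db), (0xf7ef20722d34, 0x64b6db2cb25b),
   (0xf77f72f00afc, 0x5124a2092494), (0xeffdca927140, 0x6db2cb64b25b),
   (0xefbf29503526, 0x64b2cb24925b), (0xeeff4ab4f149, 0x6db2cb25b64b),
   (0xedff6c1d31ab, 0x65b2db2596d9), (0xec3220803082, 0x65b24b2592db),
   (0xebff4e35b14b, 0x6db2d925b659), (0xdffd918b42c4, 0x6d92c96cb2db),
   (0xdfdf914b06f5, 0x6c92d96db2cb), (0xdfbf394906f7, 0x6c92d92492cb),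
   (0xddff3d0d30b7, 0x8924a2490512), (0xdbff053d8186, 0x8924905124a2),
   (0xdb50928302d0, 0x6d925965b2db), (0xcfff2d1d31a6, 0x8925124904a2),
   (0xcf30318102c6, 0x6d92c92592db), (0xbffe118fe081, 0x892482494512),
   (0xbffb8f5cd80a, 0x64b6c96596db), (0xbff75f0dc523, 0x892490412482),
   (0xbfef590fe521, 0x892512494482), (0xbc9211408401, 0x64b24925b2cb),
   (0xb7ff057cc80c, 0x64b6c92cb6db), (0xb48e30422c31, 0x64b6db25b2cb),
   (0xb0da06748818, 0x64b65925b6db), (0xaeb00b80c000, 0x892482412494),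
   (0xa6ac20826800, 0x65b6cb24b2db), (0xa4ba00543008, 0x64b2cb25b6db),
   (0x99d2150d8083, 0x8924904a2512), (0x93d896520850, 0x6cb6d965b2db),
   (0x91ce100f20b1, 0x8924a2494512), (0x8bf00f158102, 0x8924904124a2),
   (0x87b811500044, 0x6cb2c924b2db), (0x83ec00172100, 0x8925124944a2),
   (0x7ffbce5c5a4a, 0x25b2d96596db), (0x7ff7cf08d523, 0x65b25964924b),
   (0x7fefc80a7521, 0x65b2db6cb24b), (0x7f7fc0a852cc, 0x4a2092512494),
   (0x7c1380401608, 0x4120924a2494), (0x784740208501, 0x65b2592db24b),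
   (0x77ffc47c5a4c, 0x25b2d92cb6db), (0x740f20600e3c, 0x4124a2092494),
   (0x6e31ca805248, 0x4a2092412494), (0x6c2768003523, 0x65b2db25924b),
   (0x662d60a04a4c, 0x4a2512092494), (0x5b4580030700, 0x6592d96db25b),
   (0x595384081082, 0x65b2596d92db), (0x514f002800b4, 0x8924a2512494),
   (0x4f2529010726, 0x6592d924925b), (0x4b71ce101142, 0x6db2d965925b),
   (0x436d40300144, 0x6db2d92cb25b), (0x3fffcf0cd82b, 0x65b6d96496cb),
   (0x30cf442cc809, 0x65b6d92db6cb), (0x24af480c7029, 0x65b2db24b6cb),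
   (0x13cd840a4800, 0x65b6d96cb2db), (0x7ad09084024, 0x892512482494),
   (0x50000041, 0x6db2d925b2cb), (0x24000802, 0x65b6d92592db), (0xa000030, 0x8924a2412494),
   (0x50208, 0x6592d925b6db)]

def certA : ℕ :=
  0x6b0a0d506800c1ae0d1400000861a006861a006860c183800c1c0ac50183ac3434098340060d7068a00000430d003400d0c1830700343060e0561b7c8cc181860c1972e030730303980c1cc060e000980c000060e04cac346800c1ae0a00000430d003400d0c1830700343060e0561a340060d705000002186801a006860c343060e0030702b100d50686812c8d4280c1d62c5a808060e508100ef16072a600013460c012c60307325030002b032c5818395000030002b4c2c0e5030730489902044312244c690244c6860e4039024306130e00000244c08624306130e0d91a3c006b83c006b9102000802e04001005c000280d14102431410243962858b130c50b162618b1778489081020490102400d00204082c58b17202430d00183081218307003430d0c58b8000043162e000010c204860c1c0ac3478001340411a2e081a82046b1058408aa204412c0e516035879582581ca07201830704081060e0c89858b162d346d70730203080ea84080c183072025f2b24a8398325012a54183980e0890206fc81a02608102044d1a00a0da24400d013005f22481d11802512074440c180e600010e60c913c24000102030702fd70658b03072a000060005698581ca0644951980c0819800680000068099041c10200043833c0008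20e0830206604812848000261881022488110c408112448811184898d0c1c807204860c261c00050a480d02acf1226408110c4869320349860e4039024306130e006800e4039024306130c3558824306130c3550218341030c60c862e183980e609870460c862e183980e609870640690204081124488111a081983060c8c1860c823240c183230c190c60c190c603192c306162e183980e609131a1c1180e60c183218318325c8183060c191a183982c5c6863060c860c60c960e6090c243438220408860c4088c201c88302cc4081240811002460920048081030680024048d0218409204088012304900240408183400120246810e0c7183320418306471832c840934507b20660112066090330081881020103126570e040d7ae382470e04081b21208409042410b102810a16e8c18162040906b85883268702040d909042c409042810a16e8c081208c0b10204835c65120408c70e244d78246604183060cb21024db20660112066090330081881020103126570e04081b212085881208502142dd181024118162040906b96091c3810206c84821620482140850b7460c0b102048210241ae302c4920c1ce061c3c50e1424e981c4898e1e08b12245c1031c085831c0c712262c188040cc18300c918240cc9c0c1962c0e7450810704af302849c10484130420e095c481981048988120d2b8342530638184075c2038e1024706103cc1c0e384091c60c183270c0e1c1cb09301cc191eb0d063660406101c1130c60c183220c820660c183208c023280b171208412104c103321caac0660986302049832081981208198125c108242098206643121048413065019900489122670a921e0818e0008003280010000081033a38702063cc08042048e043870206bd99828183ae0c1c4062e2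0a080e58389585c407000008810704af3020e1d16389082420983285000174500017628502142dd0a140850b742c9000000012244899d040800004081ac000431c44185a444185a500000000290000000520002d0982000410206181860618e130470e060c28587041830a161c10002081030e6841c12b89033008912040cc860c603073670c860000002061d88e1048988120858810703220c1ceb23a6870f10247091c5c40b120870f10247091c5c40b120cc1830641180465018066441830641180465003306470e1c3cb0e1e08b17360870e1e087021ec818e2c5850b040c7881c3870e1e4c1162c48982063870e1e0810e1e2818e244c583100cc183060c8230601931c0cc183060c823060193121dc80300009832180a10c1cc010c04c0000489860e641180004c190c050860e600860260000244c307320c49e1c3ef0e1c3c60e003dc0e0035c1c02e670c3e05c294c700b83a3870e1c007b81c3c40e1c3ed9e000448e000448e1e6060c183470610203060e3830618303a9385c3081a2470e123c00e1c3c09800384801c0070f02683070000000000008600000012e3d62c123870f84387aa1cb070f00b0c2b0024701582048058247080000409023cf2c5a656180c183800c003801c04fac120000902f860c489122418347001c38781307061d0035c0e12016082e2470c2e2511406f911a040009a0404c1a040cc0232a111b30081983040810228881802800980660c916068f000268082345c11e040500106c0d9e2e08001040910336a0a0c2a40686183060d004081020446801a40690204088020008a01834880183060d021ccbe1a1809020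3069022006902a00090223400c18306801a443060c1860d02600910454b162c58b9402408063c7839c28180000c18395507401c02a4d1e2ee8811a8401102258811740480238054000670e01500008204000820644d18300009a0258106040cc943c189a43c189a56848e120c4d21c0c489a42600306181830c1834a80000000024489132a18800023080002359002000001184000002300920e00380180001226043220c1860d0e0008618880860000913021830618343815009123366000200001873c4810606e89820618e06244d2030c7098238183820c1c19a2408107744c1030c0c31c0c489a4384c1060e08e060e0cd180c1cd130668d03307541d204810606e89820618e06244d2030c7098238183820c1c19a240cc1204181ba26081863818913480c31c2608e060e083070668e1306000014400c19686012336a000034680a32c08122066d4180004c190c580002e183980018381301cc1226043823468c11300009b0c40307584080700700a936e9490200881022e809004700a8000ce1c02a00010408001040c89a440cd020000186048819a380540200041030e35b1304a060d4430696043481d4800306183409d3000e1c0c1d607007000152681220668e015008001040c3183218b860e60398261c1183218b860e60398261c1900660c1832306183208c903060c8c306430c2c586860e60398244c6863060c86306039704408110c188111840391041cc1830643063064b192060c183230c862c5c6863060c860c60c960e6060c244c3073208690204081124488111a0c0b7644060d204400d20446802a00090183060d0034886203069022006902234015000480c18306801a443835c408c820444101c408b2302590002507091c048000220000025000110204913e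3870e04081b31c08188002049e0220c9f34385191c40811ac540012278a8002408982a0009020048882046c10204088a204440a14285ac20408893078a0b1040889987c80b10254102221490204081022208117064102040000206b010a04281a7204041022258193c20808102048010204094020103102488e346850a346850b584081112610901e000212064f101c4470a16205a3900088d70606b8340800372f91983030c1832e0c0d7060ca03066f181860c190065c0004001020688000040cf01306001832048034034ca83060cca300d00d32700000005118007461806601a01a64018306409c52080000004d000000082040c0000265800204000000408a20404d181a058b0004000002300221a000a818746a6466812330641220668198347088c3066918306481834646220668103000809a040c000026540c3a30c1918000b83060c81380471b3c08000040c49b2868f000268082345c11e040500106c019a0000d1a028cb02440cd8834204b02c5c40812080010408188048819b50183980c7039a0c684080c204bf3020c8e0c1cc1a126070e1c3d1181c60398101cb98323d508387471710203080e0870e1c3c30f043870f043810f140c70a161c1062c58382063c49f545c4031c1838e1c3c107040c7031c1cb820c58b07040c7882c18b160e0cf031e0000200081034400002067809820408114460f90040cc19040cc8e1c000b41c000b548587022c5da0e0458bb42ec80000400002040d58800580162c5d1000208d083628d08362c0000000001140000002280ba0620b171020482140c40a445c10200041031088b822c5c408120810200041894c78c9206388031c387dc1c387981c187920c081030c4018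e0e40302061838f7c5c3070438b022ed0702040c90e0e083070438b860c1c1be2e183821c58117683810206487070438b860c1c1060e0df170c481037c1df23303d30f38381020648b860e087022c5da0e0e083070438b860c1c1be541cc0e04081922e183821c08b1768383821c5c3060e0830706f87170ec8c08128841832903254638b173060c823608198365c1162c4898206601990c381031c38703640888f4448e922c5df2a560c9031c4018e3a3870e1c187920c081030c4018e0e40302061838f7c903a22c583070418424482510940191077e383220ef8b170c18382200c78b78191254660b162c183833c4c3000218480102090812fc3130c20f061024b8754191077e3811804601bf24181060e64706441df162e183070420810040c70310384094e888031c24002040000312648170c18408342510b242ce0e1e2048e12385882e2410e1e2048e12385882e241983060c823008ca0300cc8e1c3870e1e5c1162e6c10e1c3c10e1c0d9031c0c7161428b83103870e1e487822c58913040c70e1c3c1021c3c5031c4898b06201983060c19046011926381983060c1904601192620c183208c023280c0332243bd000008e1c3c4091c58016022008b10000891c24782000470e1e2048e2c00b011004588000448e123c1872830688102400210247000008181100870e040d7b2123810812380031038102140c70f102010b0624a8c003809532980881200b14142c414129858828255093058b2a5458b2a5650c0b1004810236081020445102220814024049000000882804808100008922a922b204081112a848022f83010e408102360806021c8aa0c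78f07385030000183072aa631f107c5140c1c51012285ac20548101040811144048a2200808204449e54a952b28408c4202081022a888a204088954240082095101204038002444060e2040810204090020408121c8a6107401c28740905458b8854ac59a12000080c184817eb84ac0c1962c0e745140c1d7060e2031710304072c1c4ac10704af0058b80000440600056080c1c4090020e095e616125a1c80644951985270b160c1c1035278c180004d012c0cc0034000003404c820e08100021c19e0c081991008001040c4081018389041810330004093e50000244c08610243060e0040002a840824204bf0c4c30818184092e1d507542122412884a00c883bf00191077e38122466cc183090103300c3000618319040c39e046011806fc9073008307323030618343800418398040c0000218c00027c702144458e2a40100000c3034e7890c184c30d548d09c102060d120010300000881c08702064400d0038700040d0814c0480220401a806300200244400400480e10253a23a900060c306813a6000a16000880c1c4081200e06441839d647058818203072e25409381830a141d388105849d00700015020b093a68b16142c10b608cb903850e812040129063848004080020224c901c3c4091c24717102c4821c3c4091c24717102c4833060c190460119400cc191c3870e1c3cb822c5cd821c387821c087b20638b0a145c1031e2070e1c3c90f0458b12260818e1c38782043878a0638913160c4033060c183208c02324c7033060c183208c02324c418306411804650180664487723070f10247091c5c40b120870f10247091c5c40b120cc1830641180465003306470e1c3870f2e08b17360870e1e0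87021ec818e2c28517040c7881c3870f243c1162c48982063870e1e0810e1e2818e244c583100cc183060c823008c931c0cc183060c823008c931060c1904601194060199121de8d0060c862e183980e609870460c862e183980e6098706401983060c8c1860c823240c183230c190c30b161a183980e609131a18c183218c06325c1073060c190c18c192c648183060c191a18b171a18c1832183183258398184890d0c1cc8220408860c4088c201c8821a408102044912204468302dd9183218b860e60398261c1183218b860e60398261c1900660c1832306183208c903060c8c306430c2c586860e60398244c6863060c863018c97041cc1830643063064b192060c1830646862c5c6863060c860c60c960e6061224343073208810221831022308072208690204081124488111a0c0b716242

theorem coneTest_eltA : coneTest [eltA] wordsA coverA = true := by decide +kernel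

theorem pullTest_eltA : pullTest 15 281474976710655 (coverA.map Prod.fst) certA = true := by
  decide +kernel

theorem mem_stdNormals_of_eltA {C : Mat4} (hC : IsNormal setV C) (h1 : frob 1 C = 1)
    (hg : frob eltA.hreal C = 1) : C ∈ stdNormals := by
  refine mem_stdNormals_of_pull hC h1 (P := [eltA]) (by simp [hg]) coneTest_eltA
    (finrank_tightSpace_singleton ?_) (by decide +kernel) pullTest_eltA
  rw [← IntMat.hreal_two, IntMat.frob_hreal]
  norm_num [IntMat.dot, IntMat.dot4_eq, IntMat.two, eltA]

/-- Normals of facets that are not images of the representatives. -/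
def IsBad (C : Mat4) : Prop := IsNormal setV C ∧ C ∉ stdNormals

/-- The facet of some bad normal contains both `1` and `X`. -/
def BadWithOne (X : Mat4) : Prop := ∃ C, IsBad C ∧ frob 1 C = 1 ∧ frob X C = 1

theorem symm_mem_genSym {φ : Mat4 ≃ₗ[ℝ] Mat4} (hφ : φ ∈ genSym) : φ.symm ∈ genSym := inv_mem hφ

theorem IsBad.map {φ : Mat4 ≃ₗ[ℝ] Mat4} (hφ : φ ∈ genSym) {C : Mat4} (hC : IsBad C) : IsBad (φ C) :=
  ⟨hC.1.map_symV (genSym_le hφ), fun h => hC.2 (by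
    have := map_mem_stdNormals (symm_mem_genSym hφ) h
    rwa [LinearEquiv.symm_apply_apply] at this)⟩

theorem BadWithOne.of_map {φ : Mat4 ≃ₗ[ℝ] Mat4} (hφ : φ ∈ genSym) (h1 : φ 1 = 1) {X : Mat4}
    (h : BadWithOne (φ X)) : BadWithOne X := by
  obtain ⟨C, hC, hC1, hCX⟩ := h
  refine ⟨φ.symm C, hC.map (symm_mem_genSym hφ), ?_, ?_⟩
  · rw [← frob_map_symV (genSym_le hφ), h1, LinearEquiv.apply_symm_apply, hC1]
  · rw [← frob_map_symV (genSym_le hφ), LinearEquiv.apply_symm_apply, hCX]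

theorem IsBad.badWithOne {C : Mat4} (hC : IsBad C) {X Y : Mat4} (hX : X ∈ setV)
    (hX1 : frob X C = 1) (hY1 : frob Y C = 1) : BadWithOne (Xᵀ * Y) := by
  have hX' := transpose_mem_setV hX
  refine ⟨leftEquiv hX' C, hC.map (leftEquiv_mem hX'), ?_, ?_⟩
  · rw [← hX1, ← frob_map_symV (genSym_le (leftEquiv_mem hX')) X C]
    change _ = frob (Xᵀ * X) _
    rw [transpose_mul_self_of_mem hX]
  · rw [← hY1, ← frob_map_symV (genSym_le (leftEquiv_mem hX')) Y C]
    rfl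

namespace IntMat

/-- The quotient `xᵀ y` of two elements of `F₄`, all doubled. -/
def quot (x y : IntMat) : IntMat := (x.tr.mul y).half

/-- The trace. -/
def trace : IntMat → ℤ
  | ⟨a, _, _, _, _, f, _, _, _, _, k, _, _, _, _, p⟩ => (a.add f).add (k.add p)

/-- The trace of the square. -/
def trace2 (x : IntMat) : ℤ := x.dot x.tr

/-- The trace of the cube. -/
def trace3 (x : IntMat) : ℤ := (x.mul x).dot x.tr

theorem hreal_quot {x y : IntMat} (hx : x ∈ allV) (hy : y ∈ allV) :
    (x.quot y).hreal = x.hrealᵀ * y.hreal := by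
  rw [← hreal_mem_setV] at hx hy
  rw [← hreal_tr]
  exact half_mul (by rw [hreal_tr]; exact transpose_mem_setV hx) hy

theorem quot_mem {x y : IntMat} (hx : x ∈ allV) (hy : y ∈ allV) : x.quot y ∈ allV := by
  rw [← hreal_mem_setV, hreal_quot hx hy]
  rw [← hreal_mem_setV] at hx hy
  exact mul_mem_setV (transpose_mem_setV hx) hy

theorem trace_eq (x : IntMat) : (x.trace : ℝ) = 2 * frob 1 x.hreal := by
  have h2 : x.trace * 2 = two.dot x := by
    cases x
    simp only [trace, dot, dot4_eq, two, show ∀ a b : ℤ, a.add b = a + b from fun _ _ => rfl]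
    ring
  rw [← hreal_two, frob_hreal, ← h2]
  push_cast
  ring

theorem frob_transpose_right (X Y : Mat4) : frob X Yᵀ = frob 1 (X * Y) := by
  rw [← trace_mul_eq_frob, ← Matrix.mul_one (X * Y), trace_mul_eq_frob, frob_comm, Matrix.transpose_one,
    Matrix.mul_one]

theorem trace2_eq (x : IntMat) : (x.trace2 : ℝ) = 4 * frob 1 (x.hreal * x.hreal) := by
  rw [← frob_transpose_right, ← hreal_tr, frob_hreal, trace2]
  ring

theorem trace3_eq (x : IntMat) : (x.trace3 : ℝ) = 8 * frob 1 (x.hreal * x.hreal * x.hreal) := by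
  rw [← frob_transpose_right, ← hreal_tr, trace3, ← frob_real, real_mul]
  simp only [hreal, Matrix.smul_mul, Matrix.mul_smul, map_smul, LinearMap.smul_apply, smul_eq_mul,
    smul_smul]
  ring

/-- The entrywise sum. -/
def add : IntMat → IntMat → IntMat
  | ⟨a, b, c, d, e, f, g, h, i, j, k, l, m, n, o, p⟩,
    ⟨a', b', c', d', e', f', g', h', i', j', k', l', m', n', o', p'⟩ =>
    ⟨a.add a', b.add b', c.add c', d.add d', e.add e', f.add f', g.add g', h.add h', i.add i',
      j.add j', k.add k', l.add l', m.add m', n.add n', o.add o', p.add p'⟩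

/-- The entrywise difference. -/
def sub (x y : IntMat) : IntMat := x.add (y.map Int.neg)

theorem hreal_add (x y : IntMat) : (x.add y).hreal = x.hreal + y.hreal := by
  cases x; cases y
  rw [hreal, hreal, hreal, ← smul_add]
  congr 1
  ext r s
  fin_cases r <;> fin_cases s <;> simp [real, add]

theorem hreal_sub (x y : IntMat) : (x.sub y).hreal = x.hreal - y.hreal := by
  rw [sub, hreal_add, sub_eq_add_neg]
  congr 1
  rw [hreal, hreal, ← smul_neg]
  congr 1
  cases y
  ext r s
  fin_cases r <;> fin_cases s <;> simp [real, map, show ∀ a : ℤ, a.neg = -a from fun _ => rfl]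

/-- Conjugation by a cyclic permutation. -/
def cycConj : IntMat → IntMat
  | ⟨a, b, c, d, e, f, g, h, i, j, k, l, m, n, o, p⟩ =>
    ⟨f, g, h, e, j, k, l, i, n, o, p, m, b, c, d, a⟩

/-- Conjugation by a transposition. -/
def swapConj : IntMat → IntMat
  | ⟨a, b, c, d, e, f, g, h, i, j, k, l, m, n, o, p⟩ =>
    ⟨f, e, g, h, b, a, c, d, j, i, k, l, n, m, o, p⟩

/-- Conjugation by a change of sign. -/
def signConj : IntMat → IntMat
  | ⟨a, b, c, d, e, f, g, h, i, j, k, l, m, n, o, p⟩ =>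
    ⟨a, b.neg, c.neg, d.neg, e.neg, f, g, h, i.neg, j, k, l, m.neg, n, o, p⟩

/-- A faster version of `tau`. -/
def tauConj : IntMat → IntMat
  | ⟨a, b, c, d, e, f, g, h, i, j, k, l, m, n, o, p⟩ =>
    half ⟨(a.add b).add (e.add f), (a.sub b).add (e.sub f), (c.add d).add (g.add h),
      (c.sub d).add (g.sub h), (a.add b).sub (e.add f), (a.sub b).sub (e.sub f),
      (c.add d).sub (g.add h), (c.sub d).sub (g.sub h),
      (i.add j).add (m.add n), (i.sub j).add (m.sub n), (k.add l).add (o.add p),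
      (k.sub l).add (o.sub p), (i.add j).sub (m.add n), (i.sub j).sub (m.sub n),
      (k.add l).sub (o.add p), (k.sub l).sub (o.sub p)⟩

theorem tauConj_eq (x : IntMat) : x.tauConj = x.tau := by
  cases x
  simp only [tauConj, tau, intTau, mul, dot4_eq, show ∀ a b : ℤ, a.add b = a + b from fun _ _ => rfl,
    show ∀ a b : ℤ, a.sub b = a - b from fun _ _ => rfl]
  congr 2 <;> ring

end IntMat

/-- The symmetries of `F₄` that respect products and traces. -/
def ConjRel (x y : IntMat) : Prop := ∃ φ ∈ genSym, φ 1 = 1 ∧ (∀ X Y, φ (X * Y) = φ X * φ Y) ∧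
  φ x.hreal = y.hreal

theorem ConjRel.refl (x : IntMat) : ConjRel x x := ⟨1, one_mem _, rfl, fun _ _ => rfl, rfl⟩

theorem ConjRel.trans {x y z : IntMat} : ConjRel x y → ConjRel y z → ConjRel x z := by
  rintro ⟨φ, h1, h2, h3, h4⟩ ⟨ψ, g1, g2, g3, g4⟩
  refine ⟨ψ * φ, mul_mem g1 h1, ?_, fun X Y => ?_, ?_⟩
  · change ψ (φ 1) = 1
    rw [h2, g2]
  · change ψ (φ (X * Y)) = ψ (φ X) * ψ (φ Y)
    rw [h3, g3]
  · change ψ (φ x.hreal) = _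
    rw [h4, g4]

theorem ConjRel.badWithOne {x y : IntMat} (h : ConjRel x y) (hy : BadWithOne y.hreal) :
    BadWithOne x.hreal := by
  obtain ⟨φ, h1, h2, -, h4⟩ := h
  exact BadWithOne.of_map h1 h2 (h4 ▸ hy)

theorem ConjRel.traces {x y : IntMat} (h : ConjRel x y) :
    x.trace = y.trace ∧ x.trace2 = y.trace2 ∧ x.trace3 = y.trace3 := by
  obtain ⟨φ, h1, h2, h3, h4⟩ := h
  have hφ : ∀ X, frob 1 (φ X) = frob 1 X := fun X => by
    rw [← frob_map_symV (genSym_le h1) 1 X, h2]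
  refine ⟨?_, ?_, ?_⟩
  · have : (x.trace : ℝ) = y.trace := by rw [x.trace_eq, y.trace_eq, ← h4, hφ]
    exact_mod_cast this
  · have : (x.trace2 : ℝ) = y.trace2 := by rw [x.trace2_eq, y.trace2_eq, ← h4, ← h3, hφ]
    exact_mod_cast this
  · have : (x.trace3 : ℝ) = y.trace3 := by rw [x.trace3_eq, y.trace3_eq, ← h4, ← h3, ← h3, hφ]
    exact_mod_cast this

theorem ConjRel.mem {x y : IntMat} (h : ConjRel x y) (hx : x ∈ allV) : y ∈ allV := by
  obtain ⟨φ, h1, -, -, h4⟩ := h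
  rw [← hreal_mem_setV] at hx ⊢
  rw [← h4]
  exact map_mem_setV (genSym_le h1) hx

theorem conjRel_of_conj {x y p : IntMat} (hp : p.isOrth = true)
    (h : p.hreal * x.hreal * p.hrealᵀ = y.hreal) : ConjRel x y := by
  have hp' := IntMat.hreal_mem_of_isOrth hp
  have hpt := transpose_mem_setV hp'
  refine ⟨rightEquiv hpt * leftEquiv hp', mul_mem (rightEquiv_mem hpt) (leftEquiv_mem hp'), ?_, ?_, h⟩
  · change p.hreal * 1 * p.hrealᵀ = 1
    rw [Matrix.mul_one, mul_transpose_self_of_mem hp']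
  · intro X Y
    change p.hreal * (X * Y) * p.hrealᵀ = p.hreal * X * p.hrealᵀ * (p.hreal * Y * p.hrealᵀ)
    calc _ = p.hreal * X * (1 : Mat4) * Y * p.hrealᵀ := by simp only [Matrix.mul_one, Matrix.mul_assoc]
      _ = _ := by rw [← transpose_mul_self_of_mem hp']; simp only [Matrix.mul_assoc]

theorem conjRel_cycConj (x : IntMat) : ConjRel x x.cycConj := by
  refine conjRel_of_conj (p := ⟨0, 2, 0, 0, 0, 0, 2, 0, 0, 0, 0, 2, 2, 0, 0, 0⟩) (by decide +kernel) ?_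
  rw [← IntMat.hreal_tr]
  cases x
  simp only [IntMat.hreal, Matrix.smul_mul, Matrix.mul_smul, ← IntMat.real_mul, smul_smul]
  ext r s
  fin_cases r <;> fin_cases s <;>
    simp [IntMat.real, IntMat.mul, IntMat.tr, IntMat.cycConj, IntMat.dot4_eq] <;> ring

theorem conjRel_swapConj (x : IntMat) : ConjRel x x.swapConj := by
  refine conjRel_of_conj (p := ⟨0, 2, 0, 0, 2, 0, 0, 0, 0, 0, 2, 0, 0, 0, 0, 2⟩) (by decide +kernel) ?_
  rw [← IntMat.hreal_tr]
  cases x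
  simp only [IntMat.hreal, Matrix.smul_mul, Matrix.mul_smul, ← IntMat.real_mul, smul_smul]
  ext r s
  fin_cases r <;> fin_cases s <;>
    simp [IntMat.real, IntMat.mul, IntMat.tr, IntMat.swapConj, IntMat.dot4_eq] <;> ring

theorem conjRel_signConj (x : IntMat) : ConjRel x x.signConj := by
  refine conjRel_of_conj (p := ⟨-2, 0, 0, 0, 0, 2, 0, 0, 0, 0, 2, 0, 0, 0, 0, 2⟩) (by decide +kernel) ?_
  rw [← IntMat.hreal_tr]
  cases x
  simp only [IntMat.hreal, Matrix.smul_mul, Matrix.mul_smul, ← IntMat.real_mul, smul_smul]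
  ext r s
  fin_cases r <;> fin_cases s <;>
    simp [IntMat.real, IntMat.mul, IntMat.tr, IntMat.signConj, IntMat.dot4_eq,
      show ∀ a : ℤ, a.neg = -a from fun _ => rfl] <;> ring

theorem conjRel_tauConj {x : IntMat} (hx : x ∈ allV) : ConjRel x x.tauConj := by
  rw [IntMat.tauConj_eq]
  exact ⟨tauEquiv, tauEquiv_mem, tauEquiv_one, tauEquiv_mul,
    (hreal_tau (List.all_eq_true.mp tau_even x hx)).symm⟩

/-- An operation on codes. -/
def onCode (F : IntMat → IntMat) (c : ℕ) : ℕ := (F (IntMat.ofCode 3 2 c)).code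

/-- The codes of the elements related to `x`. -/
def conjClass (x : IntMat) : List ℕ :=
  reach [onCode IntMat.cycConj, onCode IntMat.swapConj, onCode IntMat.signConj,
    onCode IntMat.tauConj] 26580 1000 [x.code] 0

theorem mem_conjClass {x : IntMat} (hx : x ∈ allV) :
    ∀ c ∈ conjClass x, ∃ y, ConjRel x y ∧ c = y.code := by
  have step : ∀ F : IntMat → IntMat, (∀ y ∈ allV, ConjRel y (F y)) → ∀ c,
      (∃ y, ConjRel x y ∧ c = y.code) → ∃ y, ConjRel x y ∧ onCode F c = y.code := by
    rintro F hF c ⟨y, hy, hc⟩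
    exact ⟨F y, hy.trans (hF y (hy.mem hx)), by rw [hc, onCode, ofCode_code (hy.mem hx)]⟩
  refine mem_reach (P := fun c => ∃ y, ConjRel x y ∧ c = y.code) ?_ _ _ _ ?_
  · intro F hF
    simp only [List.mem_cons, List.not_mem_nil, or_false] at hF
    rcases hF with rfl | rfl | rfl | rfl
    · exact step _ fun y _ => conjRel_cycConj y
    · exact step _ fun y _ => conjRel_swapConj y
    · exact step _ fun y _ => conjRel_signConj y
    · exact step _ fun y hy => conjRel_tauConj hy
  · intro c hc
    exact ⟨x, ConjRel.refl x, List.mem_singleton.mp hc⟩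

def eltG : IntMat := ⟨1, -1, 1, 1, -1, -1, -1, 1, 1, 1, -1, 1, 1, -1, -1, -1⟩

def eltP : IntMat := ⟨2, 0, 0, 0, 0, 0, 0, -2, 0, -2, 0, 0, 0, 0, 2, 0⟩

def eltD : IntMat := ⟨-1, 1, 1, -1, 1, 1, 1, 1, 1, 1, -1, -1, -1, 1, -1, 1⟩

def eltS : IntMat := ⟨1, -1, 1, 1, -1, 1, 1, 1, 1, 1, 1, -1, 1, 1, -1, 1⟩

def eltJ : IntMat := ⟨-1, 1, 1, -1, 1, -1, 1, -1, -1, -1, -1, -1, 1, 1, -1, -1⟩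

def eltQ : IntMat := ⟨1, -1, -1, 1, 1, 1, 1, 1, 1, -1, 1, -1, -1, -1, 1, 1⟩

def eltN : IntMat := ⟨-1, 1, -1, -1, 1, 1, -1, 1, 1, 1, 1, -1, -1, 1, 1, 1⟩

def eltE : IntMat := ⟨0, -2, 0, 0, -2, 0, 0, 0, 0, 0, 0, 2, 0, 0, 2, 0⟩

def eltK : IntMat := ⟨-1, -1, -1, 1, 1, -1, 1, 1, 1, -1, -1, -1, -1, -1, 1, -1⟩

def eltH : IntMat := ⟨-1, -1, -1, 1, 1, 1, -1, 1, -1, 1, -1, -1, 1, -1, -1, -1⟩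

def eltI : IntMat := ⟨0, 2, 0, 0, 2, 0, 0, 0, 0, 0, -2, 0, 0, 0, 0, -2⟩

def eltF : IntMat := ⟨0, 0, 0, -2, 0, 0, -2, 0, 0, 2, 0, 0, 2, 0, 0, 0⟩

def eltR : IntMat := ⟨2, 0, 0, 0, 0, 0, -2, 0, 0, 2, 0, 0, 0, 0, 0, 2⟩

def eltL : IntMat := ⟨-2, 0, 0, 0, 0, -2, 0, 0, 0, 0, -2, 0, 0, 0, 0, -2⟩

/-- Representatives of the elements of `F₄`. -/
def eltReps : List IntMat :=
  [IntMat.two, eltG, eltP, eltD, eltS, eltJ, eltQ, eltN, eltC,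
    eltB, eltE, eltA, eltK, eltH, eltI, eltF, eltR, eltL]

theorem eltReps_mem : ∀ x ∈ eltReps, x ∈ allV := by
  have : (eltReps.all IntMat.isOrth) = true := by decide +kernel
  exact fun x hx => IntMat.mem_allV_of_isOrth (List.all_eq_true.mp this x hx)

theorem conjClass_check : (Nat.beq (eltReps.flatMap conjClass).length 1152 &&
    distinctMod 26580 (eltReps.flatMap conjClass) 0) = true := by
  decide +kernel

theorem exists_conjRel {x : IntMat} (hx : x ∈ allV) : ∃ r ∈ eltReps, ConjRel r x := by
  classical
  have hcheck := conjClass_check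
  rw [Bool.and_eq_true] at hcheck
  have hlen := Nat.eq_of_beq_eq_true hcheck.1
  have hnd := (nodup_of_distinctMod _ _ hcheck.2).1
  have hmem : ∀ c ∈ eltReps.flatMap conjClass, ∃ r ∈ eltReps, ∃ y, ConjRel r y ∧ y ∈ allV ∧ c = y.code := by
    intro c hc
    obtain ⟨r, hr, hc⟩ := List.mem_flatMap.mp hc
    obtain ⟨y, hy, hyc⟩ := mem_conjClass (eltReps_mem r hr) c hc
    exact ⟨r, hr, y, hy, hy.mem (eltReps_mem r hr), hyc⟩
  have hsub : (eltReps.flatMap conjClass).toFinset ⊆ (allV.map IntMat.code).toFinset := by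
    intro c hc
    obtain ⟨r, -, y, -, hy, hyc⟩ := hmem c (List.mem_toFinset.mp hc)
    rw [hyc]
    exact List.mem_toFinset.mpr (List.mem_map_of_mem hy)
  have heq := Finset.eq_of_subset_of_card_le hsub (by
    rw [List.toFinset_card_of_nodup hnd, hlen]
    exact (List.toFinset_card_le _).trans (by rw [List.length_map, length_allV]))
  have hxc : x.code ∈ (eltReps.flatMap conjClass).toFinset := by
    rw [heq]
    exact List.mem_toFinset.mpr (List.mem_map_of_mem hx)
  obtain ⟨r, hr, y, hy, hyV, he⟩ := hmem _ (List.mem_toFinset.mp hxc)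
  refine ⟨r, hr, ?_⟩
  rwa [← ofCode_code hx, he, ofCode_code hyV]

/-- A test in terms of traces. -/
def traceTest (f : ℤ → ℤ → ℤ → Bool) (x : IntMat) : Bool := f x.trace x.trace2 x.trace3

theorem traceTest_of_badWithOne {f : ℤ → ℤ → ℤ → Bool}
    (h : ∀ r ∈ eltReps, traceTest f r = true ∨ ¬ BadWithOne r.hreal) {x : IntMat} (hx : x ∈ allV)
    (hb : BadWithOne x.hreal) : traceTest f x = true := by
  obtain ⟨r, hr, hrel⟩ := exists_conjRel hx
  obtain ⟨h1, h2, h3⟩ := hrel.traces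
  rcases h r hr with h | h
  · rwa [traceTest, h1, h2, h3] at h
  · exact absurd (hrel.badWithOne hb) h

/-- All elements with admissible quotients by the members of a list are orthogonal to `D`. -/
def spanTest (f : ℤ → ℤ → ℤ → Bool) (S : List IntMat) (D : IntMat) : Bool :=
  allV.all fun u => !(traceTest f u) || decide (D.dot u = 0) ||
    !(S.all fun s => traceTest f (s.quot u))

theorem IsBad.traceTest {f : ℤ → ℤ → ℤ → Bool}
    (hf : ∀ x ∈ allV, BadWithOne x.hreal → traceTest f x = true) {C : Mat4} (hC : IsBad C)
    {x y : IntMat} (hx : x ∈ allV) (hy : y ∈ allV) (hx1 : frob x.hreal C = 1)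
    (hy1 : frob y.hreal C = 1) : CoxeterHull.traceTest f (x.quot y) = true := by
  refine hf _ (IntMat.quot_mem hx hy) ?_
  rw [IntMat.hreal_quot hx hy]
  exact hC.badWithOne (hreal_mem_setV.mpr hx) hx1 hy1

theorem IsBad.exists_dot_ne_zero {C : Mat4} (hC : IsBad C) {D : IntMat} (hD : D.dot D ≠ 0) :
    ∃ u ∈ allV, frob u.hreal C = 1 ∧ D.dot u ≠ 0 := by
  by_contra! hcon
  have h : D.real = 0 := by
    refine eq_of_frob_eq_on_span (D := 0) hC.1.2 fun x hx => ?_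
    obtain ⟨u, rfl⟩ := hx.1.2
    have h1 := hcon u (hreal_mem_setV.mp hx.1) hx.2
    rw [map_zero, frob_comm, IntMat.hreal, map_smul, IntMat.frob_real, h1]
    simp
  apply hD
  have h2 := IntMat.frob_real D D
  rw [h, map_zero] at h2
  exact_mod_cast h2.symm

theorem not_badWithOne_of_spanTest {f : ℤ → ℤ → ℤ → Bool}
    (hf : ∀ x ∈ allV, BadWithOne x.hreal → traceTest f x = true) {g : IntMat} {S : List IntMat}
    (hS : (S.all fun s => s.isOrth &&
      ((IntMat.two.add g).sub s).isOrth) = true) {D : IntMat} (hg : g.isOrth = true)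
    (hD : decide (D.dot D = 0) = false) (h : spanTest f (g :: S) D = true) : ¬ BadWithOne g.hreal := by
  rintro ⟨C, hC, h1, hg1⟩
  have hS1 : ∀ s ∈ g :: S, s ∈ allV ∧ frob s.hreal C = 1 := by
    intro s hs
    rcases List.mem_cons.mp hs with rfl | hs
    · exact ⟨IntMat.mem_allV_of_isOrth hg, hg1⟩
    have hs' := List.all_eq_true.mp hS s hs
    rw [Bool.and_eq_true] at hs'
    refine ⟨IntMat.mem_allV_of_isOrth hs'.1, ?_⟩
    have h2 := hC.1.1 _ (IntMat.hreal_mem_of_isOrth hs'.1)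
    have h3 := hC.1.1 _ (IntMat.hreal_mem_of_isOrth hs'.2)
    rw [IntMat.hreal_sub, IntMat.hreal_add, map_sub, map_add, LinearMap.sub_apply,
      LinearMap.add_apply, IntMat.hreal_two, h1, hg1] at h3
    linarith
  obtain ⟨u, hu, hu1, hud⟩ := hC.exists_dot_ne_zero (of_decide_eq_false hD)
  have h4 := List.all_eq_true.mp h u hu
  have h5 : traceTest f u = true := by
    refine hf u hu ⟨C, hC, h1, hu1⟩
  have h6 : ((g :: S).all fun s => traceTest f (s.quot u)) = true :=
    List.all_eq_true.mpr fun s hs => hC.traceTest hf (hS1 s hs).1 hu (hS1 s hs).2 hu1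
  rw [h5, h6] at h4
  simp [hud] at h4

theorem not_badWithOne_of_add {g : IntMat} (h : (IntMat.two.add g).isOrth = true) :
    ¬ BadWithOne g.hreal := by
  rintro ⟨C, hC, h1, hg1⟩
  have h2 := hC.1.1 _ (IntMat.hreal_mem_of_isOrth h)
  rw [IntMat.hreal_add, map_add, LinearMap.add_apply, IntMat.hreal_two, h1, hg1] at h2
  norm_num at h2

theorem not_badWithOne_eltL : ¬ BadWithOne eltL.hreal := by
  rintro ⟨C, hC, h1, hg1⟩
  have h : IntMat.two.add eltL = ⟨0, 0, 0, 0, 0, 0, 0, 0, 0, 0, 0, 0, 0, 0, 0, 0⟩ :=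
    IntMat.eq_of_eqb (by decide +kernel)
  have h2 : frob (IntMat.two.add eltL).hreal C = 2 := by
    rw [IntMat.hreal_add, map_add, LinearMap.add_apply, IntMat.hreal_two, h1, hg1]
    norm_num
  have h3 : (IntMat.two.add eltL).hreal = 0 := by
    rw [h, IntMat.hreal]
    ext r s
    fin_cases r <;> fin_cases s <;> simp [IntMat.real]
  rw [h3, map_zero] at h2
  norm_num at h2

/-- The condition on traces that excludes `eltC`, `eltB`, `eltA` and `eltL`. -/
def admissible (t q _ : ℤ) : Bool :=
  !(decide (t = -8)) && !(decide (t = 0) && (decide (q = 0) || decide (q = 8)))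

theorem admissible_of_badWithOne : ∀ x ∈ allV, BadWithOne x.hreal → traceTest admissible x = true := by
  refine fun x hx => traceTest_of_badWithOne ?_ hx
  have hC : ¬ BadWithOne eltC.hreal := fun ⟨C, hC, h1, hg⟩ => hC.2 (mem_stdNormals_of_eltC hC.1 h1 hg)
  have hB : ¬ BadWithOne eltB.hreal := fun ⟨C, hC, h1, hg⟩ => hC.2 (mem_stdNormals_of_eltB hC.1 h1 hg)
  have hA : ¬ BadWithOne eltA.hreal := fun ⟨C, hC, h1, hg⟩ => hC.2 (mem_stdNormals_of_eltA hC.1 h1 hg)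
  simp only [eltReps, List.forall_mem_cons, List.not_mem_nil, false_imp_iff, implies_true, and_true]
  refine ⟨?_, ?_, ?_, ?_, ?_, ?_, ?_, ?_, Or.inr hC, Or.inr hB, ?_, Or.inr hA, ?_, ?_, ?_, ?_, ?_,
    Or.inr not_badWithOne_eltL⟩ <;> exact Or.inl (by decide +kernel)

theorem spanTest_eltD : spanTest admissible [eltD,
    ⟨0, 0, 2, 0, 0, 2, 0, 0, 2, 0, 0, 0, 0, 0, 0, 2⟩,
    ⟨1, 1, -1, -1, 1, 1, 1, 1, -1, 1, 1, -1, -1, 1, -1, 1⟩]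
    ⟨0, -1, 0, -1, 1, 0, 1, -2, 0, -1, 0, -1, 1, 2, 1, 0⟩ = true := by
  decide +kernel

theorem not_badWithOne_eltD : ¬ BadWithOne eltD.hreal :=
  not_badWithOne_of_spanTest admissible_of_badWithOne (by decide +kernel) (by decide +kernel)
    (by decide +kernel) spanTest_eltD

theorem spanTest_eltE : spanTest admissible [eltE,
    ⟨1, -1, 1, -1, -1, 1, 1, -1, 1, 1, 1, 1, -1, -1, 1, 1⟩,
    ⟨1, -1, -1, 1, -1, 1, -1, 1, 1, 1, 1, 1, -1, -1, 1, 1⟩,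
    ⟨1, -1, -1, 1, -1, 1, -1, 1, -1, -1, 1, 1, 1, 1, 1, 1⟩]
    ⟨0, 0, 1, 1, 0, 0, -1, -1, -1, 1, 0, 0, -1, 1, 0, 0⟩ = true := by
  decide +kernel

theorem not_badWithOne_eltE : ¬ BadWithOne eltE.hreal :=
  not_badWithOne_of_spanTest admissible_of_badWithOne (by decide +kernel) (by decide +kernel)
    (by decide +kernel) spanTest_eltE

theorem spanTest_eltF : spanTest admissible [eltF,
    ⟨1, -1, -1, -1, 1, 1, -1, 1, 1, 1, 1, -1, 1, -1, 1, 1⟩,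
    ⟨1, 1, 1, -1, -1, 1, -1, -1, -1, 1, 1, 1, 1, 1, -1, 1⟩,
    ⟨1, -1, 1, -1, 1, 1, -1, -1, -1, 1, 1, -1, 1, 1, 1, 1⟩,
    ⟨1, 1, -1, -1, -1, 1, -1, 1, 1, 1, 1, 1, 1, -1, -1, 1⟩]
    ⟨1, 0, 0, -1, 0, -1, 1, 0, 0, 0, 0, 0, 0, 0, 0, 0⟩ = true := by
  decide +kernel

theorem not_badWithOne_eltF : ¬ BadWithOne eltF.hreal :=
  not_badWithOne_of_spanTest admissible_of_badWithOne (by decide +kernel) (by decide +kernel)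
    (by decide +kernel) spanTest_eltF

theorem spanTest_eltH : spanTest admissible [eltH,
    ⟨0, 0, -2, 0, 0, 2, 0, 0, -2, 0, 0, 0, 0, 0, 0, 2⟩,
    ⟨1, -1, -1, -1, 1, 1, -1, 1, 1, 1, 1, -1, 1, -1, 1, 1⟩,
    ⟨-1, -1, -1, 1, 1, 1, -1, 1, -1, 1, 1, 1, 1, -1, 1, 1⟩,
    ⟨0, 0, 0, 2, 0, 2, 0, 0, -2, 0, 0, 0, 0, 0, -2, 0⟩,
    ⟨1, -1, -1, -1, 1, 1, -1, 1, -1, 1, -1, -1, -1, -1, -1, 1⟩]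
    ⟨0, 0, 0, 0, -1, 0, 0, 1, 0, 1, 0, 0, 0, 1, 0, 0⟩ = true := by
  decide +kernel

theorem not_badWithOne_eltH : ¬ BadWithOne eltH.hreal :=
  not_badWithOne_of_spanTest admissible_of_badWithOne (by decide +kernel) (by decide +kernel)
    (by decide +kernel) spanTest_eltH

theorem spanTest_eltI : spanTest admissible [eltI,
    ⟨0, 2, 0, 0, 2, 0, 0, 0, 0, 0, 2, 0, 0, 0, 0, 2⟩,
    ⟨1, 1, 1, -1, 1, 1, -1, 1, 1, -1, -1, -1, -1, 1, -1, -1⟩,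
    ⟨0, 2, 0, 0, 2, 0, 0, 0, 0, 0, -2, 0, 0, 0, 0, 2⟩]
    ⟨0, 0, 0, -1, 0, 0, 0, -1, 0, 0, 0, 0, 1, 1, 0, 0⟩ = true := by
  decide +kernel

theorem not_badWithOne_eltI : ¬ BadWithOne eltI.hreal :=
  not_badWithOne_of_spanTest admissible_of_badWithOne (by decide +kernel) (by decide +kernel)
    (by decide +kernel) spanTest_eltI

theorem spanTest_eltJ : spanTest admissible [eltJ,
    ⟨0, 2, 0, 0, 2, 0, 0, 0, 0, 0, 2, 0, 0, 0, 0, 2⟩,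
    ⟨1, -1, 1, -1, -1, 1, 1, -1, -1, -1, -1, -1, 1, 1, -1, -1⟩,
    ⟨0, 0, 0, -2, 0, 0, 2, 0, -2, 0, 0, 0, 0, 2, 0, 0⟩,
    ⟨1, 1, 1, 1, 1, 1, -1, -1, 1, -1, 1, -1, 1, -1, -1, 1⟩]
    ⟨-1, 0, -1, 0, 0, -1, 0, 1, 0, 1, 0, 1, -1, 0, 1, 0⟩ = true := by
  decide +kernel

theorem not_badWithOne_eltJ : ¬ BadWithOne eltJ.hreal :=
  not_badWithOne_of_spanTest admissible_of_badWithOne (by decide +kernel) (by decide +kernel)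
    (by decide +kernel) spanTest_eltJ

theorem not_badWithOne_eltK : ¬ BadWithOne eltK.hreal := not_badWithOne_of_add (by decide +kernel)

/-- The condition on traces that is left with `eltG`, `eltP`, `eltS`, `eltQ`, `eltN` and `eltR`. -/
def admissible1 (t _ c : ℤ) : Bool :=
  decide (2 ≤ t) || (decide (t = -2) && decide (c = 16))

theorem admissible1_of_badWithOne : ∀ x ∈ allV, BadWithOne x.hreal → traceTest admissible1 x = true := by
  refine fun x hx hb => traceTest_of_badWithOne ?_ hx hb
  have h0 : ∀ r, traceTest admissible r = false → r ∈ allV → ¬ BadWithOne r.hreal := fun r h hr hb => by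
    rw [admissible_of_badWithOne r hr hb] at h
    cases h
  simp only [eltReps, List.forall_mem_cons, List.not_mem_nil, false_imp_iff, implies_true, and_true]
  refine ⟨Or.inl ?_, Or.inl ?_, Or.inl ?_, Or.inr not_badWithOne_eltD, Or.inl ?_,
    Or.inr not_badWithOne_eltJ, Or.inl ?_, Or.inl ?_, Or.inr (h0 _ ?_ (IntMat.mem_allV_of_isOrth ?_)),
    Or.inr (h0 _ ?_ (IntMat.mem_allV_of_isOrth ?_)), Or.inr not_badWithOne_eltE,
    Or.inr (h0 _ ?_ (IntMat.mem_allV_of_isOrth ?_)), Or.inr not_badWithOne_eltK,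
    Or.inr not_badWithOne_eltH, Or.inr not_badWithOne_eltI, Or.inr not_badWithOne_eltF, Or.inl ?_,
    Or.inr not_badWithOne_eltL⟩ <;> decide +kernel

theorem spanTest_eltG : spanTest admissible1 [eltG,
    ⟨1, -1, 1, 1, -1, 1, 1, 1, 1, 1, 1, -1, 1, 1, -1, 1⟩,
    ⟨2, 0, 0, 0, 0, 0, -2, 0, 0, 0, 0, 2, 0, -2, 0, 0⟩]
    ⟨0, 2, 1, 1, 1, -1, 0, 0, 2, 0, 1, 1, -1, 1, 0, 0⟩ = true := by
  decide +kernel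

theorem not_badWithOne_eltG : ¬ BadWithOne eltG.hreal :=
  not_badWithOne_of_spanTest admissible1_of_badWithOne (by decide +kernel) (by decide +kernel)
    (by decide +kernel) spanTest_eltG

/-- The condition on traces that excludes `eltG` as well. -/
def admissible2 (t _ _ : ℤ) : Bool := decide (2 ≤ t)

theorem admissible2_of_badWithOne : ∀ x ∈ allV, BadWithOne x.hreal → traceTest admissible2 x = true := by
  refine fun x hx hb => traceTest_of_badWithOne (fun r hr => ?_) hx hb
  have h0 : ((eltReps.drop 2).all fun r => traceTest admissible2 r || !(traceTest admissible1 r)) = true := by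
    decide +kernel
  have h1 : r = IntMat.two ∨ r = eltG ∨ r ∈ eltReps.drop 2 := by
    simpa [eltReps] using hr
  rcases h1 with rfl | rfl | h1
  · exact Or.inl (by decide +kernel)
  · exact Or.inr not_badWithOne_eltG
  · have h2 := List.all_eq_true.mp h0 r h1
    rw [Bool.or_eq_true] at h2
    refine h2.imp id fun h3 hb => ?_
    rw [admissible1_of_badWithOne r (eltReps_mem r hr) hb] at h3
    cases h3

theorem exists_lowest_bit : ∀ {x : ℕ}, x ≠ 0 → ∃ j, x ^^^ (x &&& (x - 1)) = 2 ^ j := by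
  intro x
  induction x using Nat.strong_induction_on with
  | _ x ih =>
    intro hx
    rcases Nat.even_or_odd' x with ⟨y, rfl | rfl⟩
    · have hy : y ≠ 0 := by omega
      obtain ⟨j, hj⟩ := ih y (by omega) hy
      refine ⟨j + 1, ?_⟩
      have h1 : 2 * y - 1 = Nat.bit true (y - 1) := by rw [Nat.bit_val]; simp; omega
      have h2 : 2 * y = Nat.bit false y := by rw [Nat.bit_val]; simp
      rw [h1, h2, Nat.land_bit, Nat.xor_bit, hj, Nat.bit_val, pow_succ]
      simp [mul_comm]
    · refine ⟨0, ?_⟩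
      have h1 : 2 * y + 1 - 1 = Nat.bit false y := by rw [Nat.bit_val]; simp
      have h2 : 2 * y + 1 = Nat.bit true y := by rw [Nat.bit_val]; simp
      rw [h1, h2, Nat.land_bit, Nat.xor_bit, Nat.bit_val]
      simp

/-- An entry in a table of masks with `128` bits. -/
def lookup (t k : ℕ) : ℕ :=
  Nat.land (Nat.shiftRight t (Nat.mul 128 k)) 340282366920938463463374607431768211455

/-- The branches of a search, one for each bit of `x`, which is put into the clique. -/
noncomputable def searchBranch (adj : ℕ) (f : ℕ → ℕ → ℕ) (fuel : ℕ) : ℕ → ℕ → ℕ → ℕ :=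
  Nat.rec (motive := fun _ => ℕ → ℕ → ℕ → ℕ) (fun _ _ _ => 0)
    (fun _ ih cand x c => cond (Nat.beq x 0) c
      (ih (Nat.xor cand (Nat.xor x (Nat.land x (Nat.sub x 1)))) (Nat.land x (Nat.sub x 1))
        (f (Nat.land cand (lookup adj (Nat.mod (Nat.xor x (Nat.land x (Nat.sub x 1))) 131))) c))) fuel

/-- A search for cliques among the vertices in `cand` that meet each of the `K` sets of a table.
The result is nonzero if there are none; the numbers of the sets to branch on come from `c`. -/
noncomputable def search (hyp adj K : ℕ) (depth : ℕ) : ℕ → ℕ → ℕ :=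
  Nat.rec (motive := fun _ => ℕ → ℕ → ℕ) (fun _ _ => 0)
    (fun _ ih cand c => cond (Nat.ble K (Nat.land c 511)) 0
      (searchBranch adj ih 128 cand (Nat.land cand (lookup hyp (Nat.land c 511)))
        (Nat.shiftRight c 9))) depth

/-- The test that a search finds nothing. -/
noncomputable def searchTest (hyp adj K cand c : ℕ) : Bool :=
  cond (Nat.beq (search hyp adj K 128 cand c) 0) false true

theorem searchBranch_succ (adj : ℕ) (f : ℕ → ℕ → ℕ) (n cand x c : ℕ) :
    searchBranch adj f (n + 1) cand x c = cond (Nat.beq x 0) c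
      (searchBranch adj f n (Nat.xor cand (Nat.xor x (Nat.land x (Nat.sub x 1))))
        (Nat.land x (Nat.sub x 1))
        (f (Nat.land cand (lookup adj (Nat.mod (Nat.xor x (Nat.land x (Nat.sub x 1))) 131))) c)) :=
  rfl

theorem search_succ (hyp adj K n cand c : ℕ) :
    search hyp adj K (n + 1) cand c = cond (Nat.ble K (Nat.land c 511)) 0
      (searchBranch adj (search hyp adj K n) 128 cand (Nat.land cand (lookup hyp (Nat.land c 511)))
        (Nat.shiftRight c 9)) :=
  rfl

theorem searchBranch_zero (adj : ℕ) {f : ℕ → ℕ → ℕ} (hf : ∀ cand, f cand 0 = 0) :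
    ∀ n cand x, searchBranch adj f n cand x 0 = 0
  | 0, _, _ => rfl
  | n + 1, cand, x => by
    rw [searchBranch_succ]
    cases Nat.beq x 0
    · rw [cond_false, hf]
      exact searchBranch_zero adj hf n _ _
    · rfl

theorem search_zero (hyp adj K : ℕ) : ∀ n cand, search hyp adj K n cand 0 = 0
  | 0, _ => rfl
  | n + 1, cand => by
    rw [search_succ]
    cases Nat.ble K (Nat.land 0 511)
    · rw [cond_false]
      exact searchBranch_zero adj (search_zero hyp adj K n) _ _ _
    · rfl

theorem searchBranch_sound {adj : ℕ} {f : ℕ → ℕ → ℕ} (hf0 : ∀ cand, f cand 0 = 0) {t : ℕ → Prop}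
    (hadj : ∀ i j, t i → t j → (lookup adj (Nat.mod (2 ^ i) 131)).testBit j = true)
    (hf : ∀ cand c, (∀ i, t i → cand.testBit i = true) → f cand c = 0) :
    ∀ n cand x c, (∀ i, t i → cand.testBit i = true) → (∃ i, t i ∧ x.testBit i = true) →
      searchBranch adj f n cand x c = 0
  | 0, _, _, _, _, _ => rfl
  | n + 1, cand, x, c, hcand, ⟨i, hi, hxi⟩ => by
    have hx : x ≠ 0 := by
      rintro rfl
      rw [Nat.zero_testBit] at hxi
      cases hxi
    rw [searchBranch_succ]
    cases hb : Nat.beq x 0 with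
    | true => exact absurd (Nat.eq_of_beq_eq_true hb) hx
    | false =>
      rw [cond_false]
      obtain ⟨j, hj⟩ := exists_lowest_bit hx
      have hj' : Nat.xor x (Nat.land x (Nat.sub x 1)) = 2 ^ j := hj
      have hbit : ∀ k, (x &&& (x - 1)).testBit k = (x.testBit k ^^ decide (j = k)) := by
        intro k
        have h1 := congrArg (fun n => Nat.testBit n k) hj
        simp only [Nat.testBit_xor, Nat.testBit_two_pow] at h1
        rw [← h1]
        cases x.testBit k <;> simp
      rw [hj']
      by_cases htj : t j
      · rw [hf]
        · exact searchBranch_zero adj hf0 _ _ _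
        · intro k hk
          change (cand &&& _).testBit k = true
          rw [Nat.testBit_and, hcand k hk, hadj j k htj hk]
          rfl
      · refine searchBranch_sound hf0 hadj hf n _ _ _ ?_ ⟨i, hi, ?_⟩
        · intro k hk
          have hkj : j ≠ k := fun h => htj (h ▸ hk)
          change (cand ^^^ 2 ^ j).testBit k = true
          rw [Nat.testBit_xor, hcand k hk, Nat.testBit_two_pow]
          simp [hkj]
        · have hij : j ≠ i := fun h => htj (h ▸ hi)
          change (x &&& (x - 1)).testBit i = true
          rw [hbit, hxi]
          simp [hij]

theorem search_sound {hyp adj K : ℕ} {t : ℕ → Prop}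
    (hhyp : ∀ k < K, ∃ i, t i ∧ (lookup hyp k).testBit i = true)
    (hadj : ∀ i j, t i → t j → (lookup adj (Nat.mod (2 ^ i) 131)).testBit j = true) :
    ∀ n cand c, (∀ i, t i → cand.testBit i = true) → search hyp adj K n cand c = 0
  | 0, _, _, _ => rfl
  | n + 1, cand, c, hcand => by
    rw [search_succ]
    cases hk : Nat.ble K (Nat.land c 511) with
    | true => rfl
    | false =>
      rw [cond_false]
      have hk' : Nat.land c 511 < K := by
        rw [← not_le]
        intro h
        rw [Nat.ble_eq_true_of_le h] at hk
        cases hk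
      obtain ⟨i, hi, hi2⟩ := hhyp _ hk'
      refine searchBranch_sound (search_zero hyp adj K n) hadj
        (fun cand c h => search_sound hhyp hadj n cand c h) _ _ _ _ hcand ⟨i, hi, ?_⟩
      change (cand &&& _).testBit i = true
      rw [Nat.testBit_and, hcand i hi, hi2]
      rfl

/-- A condition on the members of a list at the positions of the clear bits of `m`. -/
def clearAll {α : Type*} (P : α → Bool) : List α → ℕ → Bool
  | [], _ => true
  | a :: l, m => cond (Nat.beq (Nat.land m 1) 0) (P a) true && clearAll P l (Nat.shiftRight m 1)

theorem clearAll_spec {α : Type*} {P : α → Bool} : ∀ {l : List α} {m : ℕ}, clearAll P l m = true →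
    ∀ i (hi : i < l.length), m.testBit i = false → P l[i] = true
  | [], _, _, i, hi, _ => by simp at hi
  | a :: l, m, h, i, hi, hm => by
    rw [clearAll, Bool.and_eq_true] at h
    cases i with
    | zero =>
      have hb : Nat.beq (Nat.land m 1) 0 = !m.testBit 0 := beq_land_two_pow m 0
      have h1 := h.1
      rw [hb, hm, Bool.not_false, cond_true] at h1
      exact h1
    | succ i =>
      refine clearAll_spec h.2 i (by simpa using hi) ?_
      change (m >>> 1).testBit i = _
      rw [Nat.testBit_shiftRight, add_comm]
      exact hm

/-- The test that the masks in a table contain all pairs with admissible quotients. -/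
def adjTest (f : ℤ → ℤ → ℤ → Bool) (U : List IntMat) (adj : ℕ) : List IntMat → ℕ → Bool
  | [], _ => true
  | u :: l, b => clearAll (fun v => Nat.ble (packedDot u.packL v.packR) 3075 ||
      !(traceTest f (u.quot v))) U (lookup adj (Nat.mod b 131)) && adjTest f U adj l (Nat.mul b 2)

/-- The test that the masks in a table are those of the elements off given hyperplanes. -/
def hypTest (U : List IntMat) (v : ℕ) : List IntMat → ℕ → Bool
  | [], _ => true
  | D :: l, hyp => D.small && clearAll (fun u => Nat.beq (packedDot u.packL D.packR) v) U
      (Nat.land hyp 340282366920938463463374607431768211455) && hypTest U v l (Nat.shiftRight hyp 128)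

theorem adjTest_spec {f : ℤ → ℤ → ℤ → Bool} {U : List IntMat} {adj : ℕ} :
    ∀ {l : List IntMat} {b : ℕ}, adjTest f U adj l b = true → ∀ i (hi : i < l.length) j
      (hj : j < U.length), (lookup adj (Nat.mod (b * 2 ^ i) 131)).testBit j = false →
      Nat.ble (packedDot l[i].packL U[j].packR) 3075 = true ∨ traceTest f (l[i].quot U[j]) = false
  | [], _, _, i, hi, _, _, _ => by simp at hi
  | u :: l, b, h, i, hi, j, hj, hm => by
    rw [adjTest, Bool.and_eq_true] at h
    cases i with
    | zero =>
      rw [pow_zero, mul_one] at hm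
      have h1 := clearAll_spec h.1 j hj hm
      rwa [Bool.or_eq_true, Bool.not_eq_true'] at h1
    | succ i =>
      refine adjTest_spec h.2 i (by simpa using hi) j hj ?_
      rw [← hm, pow_succ']
      congr 3
      exact mul_assoc b 2 (2 ^ i)

theorem lookup_shiftRight (t k : ℕ) : lookup (Nat.shiftRight t 128) k = lookup t (k + 1) := by
  change ((t >>> 128) >>> (128 * k)) &&& _ = (t >>> (128 * (k + 1))) &&& _
  rw [← Nat.shiftRight_add]
  congr 2
  ring

theorem hypTest_spec {U : List IntMat} {v : ℕ} :
    ∀ {l : List IntMat} {hyp : ℕ}, hypTest U v l hyp = true → ∀ k (hk : k < l.length),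
      l[k].small = true ∧ ∀ i (hi : i < U.length), (lookup hyp k).testBit i = false →
      Nat.beq (packedDot U[i].packL l[k].packR) v = true
  | [], _, _, k, hk => by simp at hk
  | D :: l, hyp, h, k, hk => by
    rw [hypTest, Bool.and_eq_true, Bool.and_eq_true] at h
    cases k with
    | zero => exact ⟨h.1.1, fun i hi hm => clearAll_spec h.1.2 i hi hm⟩
    | succ k =>
      have := hypTest_spec h.2 k (by simpa using hk)
      rwa [lookup_shiftRight] at this

/-- The test that all elements with admissible quotients by `1` and `g` are in a list. -/
def listTest (f : ℤ → ℤ → ℤ → Bool) (g : IntMat) (U : List ℕ) : Bool :=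
  allV.all fun u => !(traceTest f u) || !(traceTest f (g.quot u)) || U.any (Nat.beq u.code)

theorem trace_quot {x y : IntMat} (hx : x ∈ allV) (hy : y ∈ allV) :
    2 * (x.quot y).trace = x.dot y := by
  have h1 := (x.quot y).trace_eq
  have h2 := IntMat.frob_hreal x y
  rw [IntMat.hreal_quot hx hy, ← frob_map_symV (genSym_le (leftEquiv_mem (hreal_mem_setV.mpr hx)))] at h1
  change _ = 2 * frob (x.hreal * 1) (x.hreal * (x.hrealᵀ * y.hreal)) at h1
  rw [← Matrix.mul_assoc, mul_transpose_self_of_mem (hreal_mem_setV.mpr hx), Matrix.one_mul,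
    Matrix.mul_one, h2] at h1
  have : (2 * (x.quot y).trace : ℝ) = x.dot y := by rw [h1]; ring
  exact_mod_cast this

theorem not_badWithOne_of_search {f : ℤ → ℤ → ℤ → Bool}
    (hf : ∀ x ∈ allV, BadWithOne x.hreal → traceTest f x = true)
    (hf2 : ∀ t q c, f t q c = true → 2 ≤ t) {g : IntMat} (hg : g.isOrth = true)
    {U words lin : List ℕ} {hyp hypLin adj K cand c : ℕ} (hU : listTest f g U = true)
    (hU2 : (U.all fun c => (IntMat.ofCode 3 2 c).isOrth) = true)
    (hadj : adjTest f (U.map (IntMat.ofCode 3 2)) adj (U.map (IntMat.ofCode 3 2)) 1 = true)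
    (hw : words.all wordTest = true)
    (hhyp : hypTest (U.map (IntMat.ofCode 3 2)) 3080 (words.map wordMat) hyp = true)
    (hlin : hypTest (U.map (IntMat.ofCode 3 2)) 3072 (lin.map (IntMat.ofCode 5 8)) hypLin = true)
    (hlin0 : (lin.all fun c => !(decide ((IntMat.ofCode 5 8 c).dot (IntMat.ofCode 5 8 c) = 0))) = true)
    (hcat : Nat.beq (Nat.shiftRight hyp (Nat.mul 128 words.length)) hypLin = true)
    (hK : Nat.beq K (Nat.add words.length lin.length) = true)
    (hcand : Nat.beq (Nat.add cand 1) (Nat.pow 2 U.length) = true)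
    (hs : searchTest hyp adj K cand c = true) : ¬ BadWithOne g.hreal := by
  rintro ⟨C, hC, h1, hg1⟩
  set L := U.map (IntMat.ofCode 3 2) with hL
  have hLlen : L.length = U.length := by simp [hL]
  have hLV : ∀ u ∈ L, u ∈ allV := by
    intro u hu
    obtain ⟨c, hc, rfl⟩ := List.mem_map.mp hu
    exact IntMat.mem_allV_of_isOrth (List.all_eq_true.mp hU2 c hc)
  have hgV := IntMat.mem_allV_of_isOrth hg
  have hmem : ∀ u ∈ allV, frob u.hreal C = 1 → ∃ i, ∃ hi : i < L.length, L[i] = u := by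
    intro u hu hu1
    have h2 := List.all_eq_true.mp hU u hu
    rw [hf u hu ⟨C, hC, h1, hu1⟩, hC.traceTest hf hgV hu hg1 hu1] at h2
    have h3 : U.any (Nat.beq u.code) = true := by simpa using h2
    obtain ⟨c, hc, hcu⟩ := List.any_eq_true.mp h3
    have h4 : u ∈ L := List.mem_map.mpr ⟨c, hc, by rw [← Nat.eq_of_beq_eq_true hcu, ofCode_code hu]⟩
    exact List.mem_iff_getElem.mp h4
  set t : ℕ → Prop := fun i => ∃ hi : i < L.length, frob (L[i]).hreal C = 1 with ht
  have hK' : K = words.length + lin.length := Nat.eq_of_beq_eq_true hK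
  have hcat' : hyp >>> (128 * words.length) = hypLin := Nat.eq_of_beq_eq_true hcat
  have hzero : search hyp adj K 128 cand c = 0 := by
    refine search_sound (t := t) ?_ ?_ _ _ _ ?_
    · intro k hk
      rcases lt_or_ge k words.length with hkw | hkw
      · have hk2 : k < (words.map wordMat).length := by simpa using hkw
        obtain ⟨hsm, h2⟩ := hypTest_spec hhyp k hk2
        by_contra! hcon
        refine hC.2 ?_
        have hwk : wordTest words[k] = true := List.all_eq_true.mp hw _ (List.getElem_mem hkw)
        rw [hC.1.eq_of_tight_subset (D := (wordMat words[k]).qreal) fun x hx => ?_]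
        · exact qreal_wordMat_mem hwk
        · obtain ⟨u, rfl⟩ := hx.1.2
          have hu := hreal_mem_setV.mp hx.1
          obtain ⟨i, hi, rfl⟩ := hmem u hu hx.2
          have h3 := Nat.eq_of_beq_eq_true (h2 i hi (by simpa using hcon i ⟨hi, hx.2⟩))
          have h4 := IntMat.packedDot_packL_packR (small_of_mem_allV hu) hsm
          have h5 : (words.map wordMat)[k] = wordMat words[k] := List.getElem_map _
          rw [h5] at h3 h4
          rw [frob_hreal_qreal_eq_one]
          omega
      · have hk2 : k - words.length < (lin.map (IntMat.ofCode 5 8)).length := by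
          rw [List.length_map]
          omega
        have hk3 : k - words.length < lin.length := by simpa using hk2
        obtain ⟨hsm, h2⟩ := hypTest_spec hlin _ hk2
        have h5 := List.all_eq_true.mp hlin0 _ (List.getElem_mem hk3)
        rw [Bool.not_eq_true'] at h5
        obtain ⟨u, hu, hu1, hud⟩ := hC.exists_dot_ne_zero (of_decide_eq_false h5)
        obtain ⟨i, hi, rfl⟩ := hmem u hu hu1
        refine ⟨i, ⟨hi, hu1⟩, ?_⟩
        have hlk : lookup hypLin (k - words.length) = lookup hyp k := by
          rw [← hcat']
          change ((hyp >>> (128 * words.length)) >>> (128 * (k - words.length))) &&& _ =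
            (hyp >>> (128 * k)) &&& _
          rw [← Nat.shiftRight_add]
          congr 2
          rw [← mul_add]
          congr 1
          omega
        by_contra hbit
        have h3 := Nat.eq_of_beq_eq_true (h2 i hi (by rw [hlk]; simpa using hbit))
        have h4 := IntMat.packedDot_packL_packR (small_of_mem_allV hu) hsm
        have h9 : (lin.map (IntMat.ofCode 5 8))[k - words.length] =
            IntMat.ofCode 5 8 lin[k - words.length] := List.getElem_map _
        rw [h9] at h3 h4
        apply hud
        have h6 := IntMat.frob_hreal (IntMat.ofCode 5 8 lin[k - words.length]) L[i]
        rw [frob_comm, IntMat.frob_hreal] at h6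
        have h7 : L[i].dot (IntMat.ofCode 5 8 lin[k - words.length]) = 0 := by omega
        rw [h7] at h6
        have h8 : ((IntMat.ofCode 5 8 lin[k - words.length]).dot L[i] : ℝ) = 0 := by
          push_cast at h6
          linarith
        exact_mod_cast h8
    · rintro i j ⟨hi, hi1⟩ ⟨hj, hj1⟩
      have hVi := hLV _ (List.getElem_mem hi)
      have hVj := hLV _ (List.getElem_mem hj)
      have h2 := hC.traceTest hf hVi hVj hi1 hj1
      by_contra hbit
      rcases adjTest_spec hadj i hi j hj (by rw [one_mul]; simpa using hbit) with h3 | h3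
      · have h4 := IntMat.packedDot_packL_packR (small_of_mem_allV hVi) (small_of_mem_allV hVj)
        have h5 := trace_quot hVi hVj
        have h6 := hf2 _ _ _ h2
        have h7 := Nat.le_of_ble_eq_true h3
        omega
      · rw [h2] at h3
        cases h3
    · rintro i ⟨hi, -⟩
      have h2 : cand + 1 = 2 ^ U.length := Nat.eq_of_beq_eq_true hcand
      have h3 : cand = 2 ^ U.length - 1 := by omega
      rw [h3, Nat.testBit_two_pow_sub_one]
      exact decide_eq_true (hLlen ▸ hi)
  rw [searchTest, hzero] at hs
  cases hs

/-- The elements with admissible quotients by `1` and `eltN`. -/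
def listN : List ℕ :=
  [0x8925124a2494, 0x6d92db65b259, 0x6db6c96592d9, 0x65964b6db25b, 0x6db64b65925b, 0x6db2d96596c9,
   0x65925b6db64b, 0x6592d96db6c9, 0x6596c96db2d9, 0x2d92cb25b6db, 0x64b6db25b659, 0x6c92cb64b6db,
   0x6c96db64b2cb, 0x2cb2d96db25b, 0x6db2d92cb25b, 0x2492d965925b, 0x6db25b65964b, 0x64b2cb25b249,
   0x6c96db2d9659, 0x6592d924925b, 0x6c92cb2d9249, 0x2d96db25b2cb, 0x4a2512490092, 0x5124904a2092,
   0x6d96cb64965b, 0x6d92c9259649, 0x6cb6d965b649, 0x4908924a2412, 0x8924904124a2, 0x4900924a2512,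
   0x4124944a2092, 0x892482494412, 0x490512892482, 0x4a2512494892, 0x64925965b24b, 0x6d965b2592db,
   0x2db6cb65b24b, 0x4945128924a2, 0x6d92592db65b, 0x6cb24b65b2db, 0x65b2db6cb24b, 0x2592db6d965b,
   0x65b2db2596d9, 0x6cb2db6d92c9, 0x8924945124a2, 0x8924a2494512, 0x6492c96d9259, 0x65b6d92db259,
   0x4a2092412494, 0x6d92c96cb2db, 0x5124944a2892, 0x892494412482, 0x4940924a2412, 0x2596d965b2db,
   0x5124a2892494, 0x8924a2490412, 0x6496cb65b6d9, 0x6d96cb2db2c9, 0x482512494092, 0x4905120924a2,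
   0x6cb2db24b65b, 0x2c92db25924b, 0x8924904a2412, 0x6d96cb65b649, 0x6d925965b2db, 0x4a2512892494,
   0x65b2db6d9259, 0x8924944a2512, 0x4a2512494092, 0x6db2d925b659, 0x4900924a2412, 0x6d92db2592c9,
   0x6496d965b259, 0x2d96db65925b, 0x6d92db6cb65b, 0x5124944a2092, 0x6c92d9659249, 0x4905128924a2,
   0x8924a2412494, 0x6cb6d965b2db, 0x6c96db65964b, 0x6592d925b6db, 0x4945124a2092, 0x65b2db25924b,
   0x6596db2d925b, 0x6496cb65b24b, 0x6db2cb25b64b, 0x892512494482, 0x64b2cb6db25b, 0x8925124904a2,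
   0x6cb2db6d965b, 0x6c92d96db2cb, 0x5120924a2494, 0x6d92c92592db, 0x8924944124a2, 0x6596db25b2d9,
   0x2592db65b24b, 0x6d92c92db259, 0x6db2cb64b25b, 0x8924a2494412, 0x6cb2db65b6d9, 0x6c92cb6db2d9,
   0x6d96cb2db65b, 0x4905124a2892, 0x6c92cb6db64b, 0x6596db25b64b, 0x6c92d96db659, 0x2d92cb6db25b,
   0x6592d925b249, 0x6596db64b25b, 0x6c92d96596db, 0x6db2cb25b2d9, 0x6db2d925b2cb, 0x64b6db65925b,
   0x6c96db6592d9, 0x6db2cb2d925b, 0x8924944a2412, 0x6d92db65b6cb, 0x6db2d965925b, 0x6d96cb65b2db,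
   0x8925124a2490, 0x6592d96db25b, 0x8925124944a2, 0x4905124a2092, 0x6cb2db65b24b, 0x6d92db25965b]

/-- Normals of facets, used to branch. -/
def facetsN : List ℕ :=
  [0x1b24b2db6d92c92d96d925b2c, 0xb6cb2492c965448249209241, 0x1449208249251448249209240,
   0x144920824925092496d96592d, 0x224944925128892d96d925b2d, 0xb6cb2492c964b6496c924b2c,
   0xb6cb2492c964b6496cb2c924, 0x96c924b2cb66249449289250, 0x196cb6db65b2d96db64b6c965,
   0x196496db6cb6520a249049251, 0x1449208249250b6c92cb25b2c, 0x92d96db2d926249449289251,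
   0xb25b6592496596cb6db65b2c, 0xb6cb2492c96596496db6cb64, 0x96c924b2cb65449208249250,
   0x92d96d925b2d96db64b6c965, 0x120a24904925092d96d925b2d, 0x925965b24b6520a249049251,
   0xb6496cb2c924b6cb2492c965, 0x144920824925196cb6db65b2c, 0x224944928925092d96d925b2d,
   0x1251048249208b6cb2492c965, 0x92d96d925b2d965b25b6cb65, 0x196cb6db65b2d449208249251,
   0x196cb6db65b2d449208249250, 0x1251048249209449208249251, 0x196496db6cb6492d92596c964,
   0x120a249049250925b2596592c, 0x1289048249241449208249250, 0x224944928925092d92496596d,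
   0x196496db6cb6596db64b6c964, 0x224944928925092d96db2d924, 0x92d96d925b2e249449289250,
   0x92d96d925b2d965b24b65b6c, 0x196496db6cb64b65b24b2c925, 0x925b2596592c925b2596592c,
   0xb6492496d96596496db6cb65, 0x92d96d925b2e249449289251, 0x224944928925092d92596c964,
   0xb6496cb2c924b6c92cb25b2d, 0x925b2596592d965b24b65b6c, 0x925b2596592d924b25b64964,
   0x196cb6db65b2cb6cb2492c964, 0x925b2592d965965b25b6cb65, 0xb25b6592496596cb6db65b2d,
   0x2249449289250b6cb2492c964, 0x925b2592d96596cb6db65b2d, 0x196496db6cb64b6cb2492c964,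
   0x925b2592d96596496db6cb65, 0x92d96d925b2d924b25b64964, 0x2249251449208b6cb2492c965,
   0x1289048249240b6cb2492c964, 0x2249251449209449208249251, 0x925b2592d966249449289251,
   0xb6596496db6db6cb2c96cb66, 0xb2c92496d92d924b24965b67, 0x1449252249288b64b2db6c96f,
   0x96592596c92d964924b6496e, 0x1449208249241448249209242, 0xb6db64b25b2d25144920824b,
   0x1049251288249b6596cb6db2f, 0x96d96492592d92c924b2db27, 0x196d924965b6544920925024a,
   0x196c96492cb6c92592cb2db27, 0x192492c964b2492d92496596e, 0x124144920a249b6d96592db26,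
   0x128824904925092592cb2db27, 0x1b64b25b2cb6c96db6cb2d92e, 0xb25b2d925b6525120a24904b,
   0x1b2d96db64b6c96cb2db6d92e, 0x925b2596592d96d925b64967, 0x1b6d96496d92db2cb24b6db67,
   0x104a24920924125104920824b, 0x192db6c96d965b6d96496cb66, 0x249449209251965b6db2592e,
   0x120924144a24925128a24904b, 0x964b2492cb6db25b6cb2cb66, 0x128924104a24992c924b2db27,
   0xb2d92c92496d04920a249252, 0x104925128824892596496cb66, 0x104a24920924192d96496c927,
   0x124104920a24925120a24904a, 0x104a24920924192d96492496f, 0x2249209449240b25b64965927,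
   0x104928a249251b6596cb6db2f, 0xb2c96c924b6504920a249253, 0x128924144a24925144920824b,
   0x128824904925092db2cb6d96e, 0xb2c96c924b65925b2db6596e, 0x1240249209448b2db6db2592e,
   0x196db2d925b6525104920824b, 0x1b6cb65b24b2cb64b2c925b27, 0x249449209251b25b6d92cb2e,
   0x104928a249251b6596db2cb6f, 0xb2496492cb6d04920a249253, 0x1b64b24b6db2c24944924128b]

/-- Linear functionals, used to branch. -/
def linearN : List ℕ :=
  [0x421084a5294a4e742108, 0x4a9284a1283a8e83a0e8, 0x425284a1074a10741ce8, 0x49ce7320c849ce742108,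
   0x424e841d283a1093a109, 0x4a508420e74a508420e7, 0x4210849ce749d2942108, 0x424e84a1073a10941d28,
   0x4210849d2739d2942108, 0x4a4e739ce74210842108, 0x42108421283a10842108, 0x4a0e841d093a12842507,
   0x424e8424e841ce841ce8, 0x4252842528424e8424e8, 0x49d0839d0839d083a508, 0x51d073a0e841cc73a0e8,
   0x4a1283a0e84250742507, 0x49928398e84a1284a128, 0x42128421084250842108, 0x4a0c73a1093a0c93a109,
   0x4254951d074a1284a128, 0x4a508420e7420e739d08, 0x42129420e749d0849d08, 0x49d0839d084a5083a508,
   0x4210842508420e842108, 0x4a10741d284a107424e8, 0x49d0839d0849d084a508, 0x424e842528424e842528,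
   0x4a52749ce74210842108, 0x4a12841d09425073a0e8, 0x421294a5084a508420e7, 0x49d27418c849d2742108,
   0x42108421284250842108, 0x4a50849d083a50839d08, 0x4a4e742108320c839d29, 0x421084a4e94210849ce7,
   0x4a52949d274210842108, 0x4a529519084a52942108, 0x42129421293a5083a508, 0x4250941d074a1284a128,
   0x4212949d08421293a508, 0x4a10741ce84a10742528, 0x4a10741ce84a10741ce8, 0x4210849d293a52942108,
   0x42528424e8424e841ce8, 0x4a1074a10741ce841ce8, 0x49d0832129428e73a508, 0x52148421084a4e74a4e7,
   0x42108421094210842508, 0x49d294210849ce742108, 0x425284a9074a0c741ce8, 0x4210849d274a52942108,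
   0x4a1073a109424e8424e8, 0x42129421294a5084a508, 0x49d083a508420e7420e7, 0x4a0e84a1283a0e83a128,
   0x421293a5083a508420e7, 0x520e7418e739d0839d08, 0x4a12841cc751d073a0e8, 0x4a14741d284a907424e8,
   0x49d0849d0839d0839d08, 0x4210849d294a52742108, 0x425073a0e83a0e841d09, 0x424e84a1074a10741d28,
   0x424e8424e84a1074a107, 0x49ce749d294210842108, 0x4a10741ce841ce83a109, 0x49ce731908421083a529,
   0x52127419274a5084a508, 0x4a50842127420e73a508, 0x4212939d08421294a508, 0x424e841d284252842528,
   0x49d08420e9420e739d08, 0x4a10941d283a10942528, 0x42508421083a10842108, 0x4a12841d0741d073a0e8,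
   0x4a50849d084a50849d08, 0x4a5084a508420e7420e7, 0x4a1073a107424e841ce8, 0x4a12841d07425093a0e8,
   0x425074a0e84a0e841d09, 0x4212949d064212949d48, 0x421084a52749ce742108, 0x52129420e7520e7420e7,
   0x425284a1073a10941ce8, 0x4a128499284a9283a0e8, 0x4a10741d28424e83a109, 0x4a50839d083a5083a508,
   0x425084a1084210842108, 0x425074a128425094a0e8, 0x4a4e74210839ce742108, 0x4250741d0741d0942509,
   0x425094a128425093a0e8, 0x4a4e749d274210842108, 0x42509425093a0e83a0e8, 0x4a0e841d073a12841d07,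
   0x520e7419293a5083a508, 0x424e83a109424e83a109, 0x4a1284a0e84a0e83a0e8, 0x424e8499073a14941d28,
   0x4a0e83a0e83a0e83a128, 0x52129419294a5084a508, 0x42507425074a0e84a0e8, 0x49ce9320c849ce942108,
   0x425284a108421084a108, 0x4254951d074a1283a0e8, 0x49d08420e749d08420e7, 0x4a126398e841d0742509,
   0x42108421294250842508, 0x421284a1084210842108, 0x428c84a52739ce942108, 0x425074a0e841d094a0e8,
   0x421294a50839d08420e7, 0x4a9074a0c741ce841ce8, 0x4a1283a0e84a0e84a0e8, 0x4a1074a109424e841ce8,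
   0x49d08418e75212949d08, 0x49d0842129420e73a508, 0x4250741d074250941d09, 0x421294a1084a10842108,
   0x49d2739ce74210842108, 0x4a506420e94a4c8420e9, 0x49ce74190a421083a529, 0x4a0e6399284250942509,
   0x425094a0e63992841d07, 0x4a147499074252841ce8, 0x424e84a1074a10941ce8, 0x4a10741ce64a10731ce8,
   0x51d073a0e841cc74a128, 0x425084a10741d0842108, 0x421084a5293a4e942108, 0x49d08321293a508428e7,
   0x424e841ce84252841d28, 0x4252841ce83a1093a109, 0x4a0e8498e8399283a128, 0x42128421084a508420e8,
   0x4210849d29429483a4e7, 0x49ce739ce74190842108, 0x428e74a508320e739d08, 0x49d293a4e7520c842108,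
   0x425284a107425284a107, 0x4252851ce85252841ce8, 0x4a0e83a0e841d0742507, 0x4a50849d084a5083a508,
   0x42508425083a0e842108, 0x4a0e841d0741d094a128, 0x425074a128425073a0e8, 0x4a0e83a1283a0e83a0e8,
   0x52129418e749d083a508, 0x425284a0c741ce839909, 0x42108428c849ce749ce7, 0x4a506420e739cc842129,
   0x4a8e8498e83a1283a128, 0x425084a1284250842108, 0x4a1074a1074a1074a107, 0x424e63a109324e83a109,
   0x421293a508420e73a508, 0x4a5484a5084a4c84a508, 0x49d2939ce94210842108, 0x424e84990741d283a149,
   0x42508420e741d0842108, 0x4a1283a0e83a0e83a0e8, 0x4a508418e739d0832129, 0x425074a1083a10842108,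
   0x4250741d073a1283a0e8, 0x4250741d073a1284a128, 0x4214a421084a5274a527, 0x4a107499073a10939909,
   0x425084a1074210841d08, 0x425094a1283a12842507, 0x525073a0e83a0e8424c7, 0x524e841d28424e8324e8,
   0x421084a10841d0842108, 0x428e94a508320e939d08, 0x4a9284a1283a8e84a128, 0x421084a0e841d0841d08,
   0x4a0e83a1284250742507, 0x4a8e84a0e641d0741d07, 0x49ce7419483a52942108, 0x42108421283a50842128,
   0x42507425073a0e6398e8, 0x425094a128425073a128, 0x4250941d073a1283a128, 0x4a4e7421083a4e942108,
   0x421084a1084210841d08, 0x525074a1283a0e8424c7, 0x49ce7319083a52942108, 0x4212942929420e7428e7,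
   0x4a0e83a0e84a0e83a0e8, 0x425084a0e84210841d08, 0x52129418e749d0849d08, 0x4212942929428e7420e7,
   0x49ce73210649ce742108, 0x49d4849cc849d0849d08, 0x525073a0e8424c73a0e8, 0x49d08419293a50832129,
   0x49ce74210849ce742108, 0x4250942549424c942509, 0x4a529421084a4e742108, 0x42108421094250842108,
   0x42108421284210842508, 0x428c84210839ce939ce9, 0x4a1094a1073a1093a107, 0x4212939d0839d0842129,
   0x5190839ce9421084a527, 0x421084a52739ce942108, 0x425284a90741ce84a0c7, 0x4a10842108420e842108,
   0x5250951d074250941d07, 0x4a12841cc751d074a128, 0x42507498e83a12a41d09, 0x520c839ce939ce942108,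
   0x42927521273a50849d08, 0x4a508419274a508320e9, 0x42129421084210842108, 0x4a1093a109424e842528,
   0x49d0849d0849d0849d08, 0x42508421084250842108, 0x4a508420e7420e949d08, 0x4a1263a0e83a0e63a0e8,
   0x42508420e84210842108, 0x4212849d084212842108, 0x49ce74210839ce942108, 0x4252841d2842528424e8,
   0x49d2942108521063a4e7, 0x4a0e83a128424c932509, 0x4a0e6498e841d0941d09, 0x4a907499073a1093a109,
   0x42509499284a12a42509, 0x42507425073a0e83a0e8, 0x42129420e739d0839d08, 0x42108421084a10742108,
   0x421274a508420e749d08, 0x42509425094250742507, 0x42127420e739d0849d08, 0x421084a4e949ce742108,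
   0x4212749d484292749d08, 0x4a12841d0741d074a128, 0x525074a128424c73a0e8, 0x51d283a109424e64a107,
   0x421084290649ce749ce7, 0x4252841ce84252842528, 0x42108421084a1084a108, 0x4a508420e739d08420e7,
   0x525094a128424c93a0e8, 0x4a506420e7420e739cc8, 0x42508421074210842108, 0x4a1284a1284a0e84a0e8,
   0x4a0e841d0741d073a128, 0x42129420e742129420e7, 0x4a10741d283a10742528, 0x5250941cc74a0e83a128,
   0x4a508421273a508420e7, 0x4a12842509424c73a0e8, 0x425094a128425094a128, 0x4a1284a1284250742507,
   0x49ce742108421084a527, 0x424e8421083a1083a108, 0x49d083a4c849cc849d08, 0x4a1284a12852507424c7,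
   0x424c74a1283a0e831d09, 0x4a14941d284a909424e8, 0x4a92851d09425074a128, 0x4a1073a10741ce8424e8,
   0x5214849ce749ce742108, 0x425094a0e841d073a128, 0x4a0e841d0741d093a0e8, 0x4a10741ce83a10941ce8,
   0x4a5294a529428c842108, 0x4212949d084a548420e7, 0x5250841d06421084a107, 0x42108421293a5073a528,
   0x42128420e84a10742108, 0x7b92a598645a0e6590a4, 0x528e5495442212b4a548, 0x42128421284250742108,
   0x640e9430673282951927, 0x4a1073990741d28424e8, 0x49ce739ce94210842108, 0x4a128498e84a1283a0e8,
   0x49d0842129420e749d08]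

def hypN : ℕ :=
  0x2893aa2a7e1dcc1516aa179021ad27442490449006222c29fe0806bec88def5c005101204124827a0168d0b6e4f2686c042b78443f1676df5c09b3fe33c564e02fbebfffe6fe6ffdbf37b66eff35dfcc36c8813447f8878695c89fdc944f5ee0365b7fcfbf6feb77fa3bef7dffffc7b42b7b3fcf9fdf7afffebf6f5dfffdb77414c91e1caa82e326bc03e2750767753c382e97ade6fd1beeeb99be1fff7f48e01dcb7e1fabbefb37eca3e375d6e7f3ac2510600462066c0cfe1788105d89dbfc0c0870cd36b2155773f3f9a67bc6d2000056535a06e4a246c2680e648a52a06c300918c80eb0f7074c0c36a695c6120002ee978d6a868e40000023ff31c000d418c02db57f044843fc9f0a08f37fa73c003b58402d965a85001fb2357a0c3cb83a9d10414fbf1f58a6f5514d690fa09c2a2740886aa1375f3f42f9421b1fcfe81926a0980873db2ebdd5062e2abdf3e4252c884679c310eebed929c1944bffe40c052104dbf4ae8bb36fe96bfbae28001a2da2a33806bc86bf210fab01b771e8154d4cb5d24e2b1a2951751030e56d9011040905937000cc3691bc9c8046aba40c001459242894e0304df067665ee40000086494129a85f743be19c53dd8f60001833c0f49a032a243a1a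af04794cab82ce892a7e31b82c1682656a3f9a4cfdc30044905e3f6409b8c90357bb40e20002107f00246d56630fad0921a878e99a400664bc162c0d513c284439f10a882d40828aa2a31854c42acd861836593b2e000536603f938902d414a17405682646c0c029112eda790ecf3bef6a7cbd836003c01688d3882e6503fffff00ee00d2000303b80325d036a6c2681320d692a06c0829d592a41d2c92af44822b45fb48e0108aba6b30a95909368e11cd248a971c01d8dce0d391392bc28470eb776882fc399908015e3c8f9d24e85f940ffdb2e00004a8991bd754e003ff3fbb615ef600384049216ba6483166810d59533b3034369186fc65f5865455cf92f898071acc0287340e5a232263c118a07521c078d4300612f22d46886ccc4139e2db083200030cb239062649cd42251c64985c806c3001a2f01b15ae0b8c902a876bce20000447d24a86c332361ec0ea638163c634006dd5b62c4d24384155ba11b2ce58d4081310126d80109c2f1616a142f9545839a9109a3a18f8cd28e466dd07ffb058018300db3f0ce80743526fefd8e2d4b801d9a358462d41f7c1188fee994078fc371122ec09c1c671d5563f960f0d7e3425460fca124e14ee3c8c4d63c8656fb4042320045b2029891f446868b1ab8ce004483a08d4a64b061d5c2a3490cb3c34149047748f903e09fe26c97948bbf95c028abb6fb05a490482a6a7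94c3988ed43c0a141a271c91e03fffe0bb275824000c06054f80dc0eacf0220e4af760c800000a3f63dc2a4d00036f1c44509ee400081baa2a78254990ef8a0804bdf166580c0892b54721174cf0223db50ea0c800084dc5a4086d31762d11c5372855d834374182d8da42f821d9c62fee03877e58300286ff413d062ccfddcdee6fa6c8001e5089bd41f4621e1568b2b798f2bda401d64b5a166c38c7c2844ffd88e882fc18c1520dea9c2893ff03e9a0d3377d3c2d304ccb308aa3e2eaa1b641fceccf1c0c00288d52844e4030be3310f9a8fa00033b1aa055d118ff821852df6760b0fc04193b289582c97c1c34fa82743954581d518831db079a1e25687491fce2fdc8294d85a478eb712197114cc91c1d53902521d98b9485a7726645a201b583cf441301018c9af3f80e3568d6b6e4f279ec003d49568962c0c9c0706c18ab3210b8005959602512dd2d42251b04569c806c08481285862205462de219246963c6341d31309e2ca0d552d5527926fab2f91c000fe84252657930039cc05711a8fa00033a6598c1d9782f8184b1ff47084afc000a03b7aa8697a003bedf33cf78fe00189566745c649882fd492812bbb5f15c02d8de40aa567b59c287d01f7a2c8eb80188400076bec5d743a19fefb8d4cab8085408adc8546ab1eeb90ac5f775b27c02b95957886b4a8dc2252f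14ef9c80fc300003e489b212200c2ecfcf88361e0003358d5a93ac01df42186de798e0b0fc02d6352e1b07a25bc07070f7e57210fc036f1a0d9d8572ce82b96ab94634b2b80033e27838330389c083ac90ad040eb80442056b088c06061e333670c055d8340069a38330a5ac23c11883cb118078d4006e138106f68a4481c9982fa2c66ad42ce89032e31b92c969a474a36bdccfc836a8054f86f314269989b6dd870f7c3402d89e0caa56635bc083b07f6b440efc03646e03a31b953ec0a17702ffb402fc01846e750e60129e80a17c12a93402b802b366745c63078dc14a3f50bf0264fc3c0a144b073c15603ffff0df6106c0001629c0cf00c6a87f3f21c615e4b7f5e8028e2f22dd21c744813a5b583d3074d430050ae908c2faeb8fff3fbe0b90d6000363b9232dd4b38e827aaa31ea12bcb80305a9158124acea0207ef0d85ac8c6c0060847bc10b93acc1c9bfd0ff866ad40334f2fa063461cf41848e6fb8c84afc1948b3190ea5516e3c1c9e27887b99b4300264c731ae00774c0c09797ac612000c0330167f003cc77300176e2bb00c003ac602d7a51d0a86aa154fec4bb7b2e001e987977481ec07c1070fef948c44fc000fd49624c9a390036f03208e5ee40002d3e20fb558942dc083bf90d7840efc01e6538170c8cf97c2680fcf1a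d2a0fc081cc4844949b30c2c791581cca7b0581cb2304513ac3d52e65271a769d2fda4005987cc222d01d6c1070d648c4c446c294a097238148de6ff32947a343d5fb4110dcc85134d3910f59141915f2663a40004944d6d7b8e4003ddfcccfeaefa0002bcb2e3708aac1f422517eb98dc80fc35926057670e6c0d18178f78d70b7ee00301018c9af3f80b8168f0ffe7f2686c01ec6cf6ac62029ec1073e10fbcc44fc28c18fc56411e6497c0f228f98b5a73c108118c808887282b5ac2b36091a531c0c04801449531aa033d10cab98f61e000c084c19401ecbb773002bd5d4700c00261b804723e005fd7f3242866b7ddbd8208412a1084a88693a533e8a028a971c0304ea796210169a0168cfd23a32686c2491d950e22b4aa2fe452411bd8bcf5c110224c741284020f60d81c64e8e99a42e5422c493912ede2a07416bf9fc4fa42a2c005323131a8f3fb127ae6bfd51e80008584064365f57434ddbb6b26ee8002d546024ea566cae1a07b82afbbccbc82626c911ea82c536bf420f9b104f8fe802b68d81eca0ed1f414a0bafd8c264fc018fccd63641391503834ef984a4c6b800393f63958a48d2403d75c388fc30b801e3b87488aba38ec2683d30fd92a0fc04406248b09014515e11f18632a5d43402dd49212519d76dc0705f187fb210fc3c0168057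a06ee103fffdc10dfa828002e6092d2ec621569598676279afc8f1c30088508eabb918ccc41161decc832001616d27e4714a041ff808cec8a83bfd80361b9232d54b52ec052bb11fe821cfc036ac52c1a4e467f8052b4fe27421cfc01d734a2c1f4583bc118b0bf66c078fc01e3b97488afa526c27a9521d592bc6c1206101224078a4174474874b62c35c828c275a6380692d6bc60c176275f8b3c03068d5ada0c04cd414a0c64c8c2646c00062dc2d25840ecc09c3d5acec832002a1d8508a33c0bd1ff104ccc9c7d53d80051e35830b7842182b915a1b994b26c0826010480d48f02ac2b810bcba5ace002820157a5ff100cc23abf31ff90bcd40301df209dcc24f1824ad6d62662ac6c02ea03c007fd0004839cdf33cf68fa00161d4c190999d16e3c51770074e57dd8108067709d101252b630c89e2972a91c00641036ac701decc2557f1cffae90d435a244187586c1fd141b89fe370f6e582108184014b01f00f94c524d962663a424c145b04706ae53ff60d6182cff8f3c3aa212e1096d1766a65449de6f3fa2343c0483f4c1f10a803fffc3ec98e60800003ac580c99d3c0e8052948b47021cb80830189b6424775d2cec7dd90afba2f8042882a7630102029c6652939c3b48e00030244f1288adf7401f8fef9dcc3cb82080649414a20072ba1e0751a144b71c11081ba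49d020d20f5629d821e107da4005408adc8546abb82b93aff6754b26c01b03c0f0000377240f3c3779ff61e001209c48400ce29d177284b543872d1c8000ccc0d094dd11740d1277e5cc61200300140886a86a8500f41ef1037a8fa0001bb40003f1ec00500f3ffec70f61e00220448016305509638b8833a531c39c8006a87cc6b8d0404825564e35c6e90d402841041010b8a448255471c6dae90d4000ba2a338212b8b83223afb2d90c4000300a0980854442181d6357e060a566c2610c09c6a52282d7fc1bd6e5b8b8fd80007527a47c0203cc300def2eea0c80029400ac592921a46fcae4b69ff65a7b4005ee9621341fb4a02f410e1f55a926c1e64056b08ab99a966388963fcf27d1c0181b954802f26ae8052ac11e9021cb82207509a4e8122117b06a7648184cfc80286951ac8849e4841a645fdc23846d403040801138310c182b90ac56754b26c08119549a40f0490ece51440ed6f825804411df0250874815d8d122e12cd2e34220ba043316029a63b24436d42b4c3c80c018999c023f26bb000f6d91b50c400003b64945b3a802500ec7142e5fa22b8000476351ce8881b804d39dba3ce20000827a010127333292c9564c3295d92e000554bc12b60d0c181d62a1ad8ca566c1a2acc0d096e4e197cd2307c7073a7e8030042e079c7427b8207f0ff7f6c8c6c0180249464244025001f8eae950c3cb8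005faa0ef075413a019b303e4ac4766c030577b9861b70118125e96d473c486c0067d60186cbb39842c965227da6a2d4210e0956b044854c3923ac60c7184fa40417900624d30a3c1cc71a0ada0f4a5800327fb8dc38650240ce8a2ff80a2eb816228014497485af3fd23bf9b443afe824c006dca4321423fc0ff6d793e5673c0030189b6424775740ec4fff9afa22b8018ff00240ede3b503708d8e1b52d8b804262989d250c1429c95b21b320d56e00180184012889a8500ec4dd90afa22b8082010122420154e6c447f269a9b80e000620120088487a8423ab9313c90bcd42208840c6a4881817869a4440fda2bc80050a034d3833e5b81d635ff674a566c08422de65a0848462e8d056039fd223402e4943ac00019e8439cfcccfea8fa001922080113a48fcebeba3d974be3a7e4028802e00f7987acc1a67f12fff846d40008ba3815a5590cc09c1ea5ff083200000e4956c0c2c51b8322259ff350c4000050424ca210380a0207f0695b6c8c6c0411811080279070dca8e4278b3166581085522962cc20393512d19a35226d1c2081c5808605bc593aa0e29943bc891c0840761194b880b16e5c01e154fb30340009c580803d39dcc300fd0ddf60c800289050c9220ab8c9fe45f6d9aedb8b5c084109a90120e0616dc0e2497493ca34035143c038e3c001836f20dfbf9ee400252820df6214440ebdb61e7bf51d59e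4003840db0012280243a1966ba894cab80280840c6c70040481c9bbd093066ad4149104186ca48479fd49e9aeff25755c2100400070864057ba0189ff34488ba404184490001aa9ac1fa8192a5451ae5810820053250c0005f6120f68db82a51c041456310e68a440dc5b3834ca0778580828485240164a192f09a49438f568e0042cc846094550b91cd8a83fa00376e00410200412802c5b5c1601ef69c95858220002e00941022db80679966f2407c808440024885008aaee11383af735103400680297a202100841a66602f3f846d418c0116109a892e3fc6cc97f7d9b993c154021ac49a44626fc3eb7b68edb59b4120e48524031d516370a93c61442ddc81a15000049879add7f515ed5f4f571d8110aa22b2221c38c36625c142e70b5a400003cd476acdaa000ffc3779ffe3e0000019dc0e40b668b804d26bf7d0e20000033000049a005d243526987d862d4b81200010480f3100db428b659e71219c80354a835c0002e9a036f3fbb615ee40020811b2c813a60a2b982e4f9812c4d1c00026723b81c12574022c7f6f2f00c0000091b2c8702e5274022fb6d1df00c000420044b000881ae5c098f41fcc564e02088000006388585f9a01f949cdc411c21022723c89a5200fa234e09c6b887a4110100881a00e807b54066ef03e071a40001436ce334ba70036fe0dfbfbeec0004408030c103120addc034916fc30e34000b40db49b22dd003f3ffec70f6de000007b0023653266740d1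1be5b3c61200151ecdfe5fe5bd6cffdefff7ff97fffc303e6ffd5ff97ecebfdf7fffef7ffef80acff827fb3efbdf6ffbfffdfbfbfbfc2525d7fafec3f5e9fffffeefbfbfffe42a49dde73f5e3ef77ef7dffffbffebfc09a7f2b1eabffb9fafefffbf7fff9ffc115fb21dc7fddbbef7fdffbfdffff5fc18adcdf73de5bedbbf7f7bffeff7fbfc264e6dfe7f13f7677df7ffefbfddfffc11399fff1ded1cfef7dffff7eff77ffc16217fff1de3f573fffffbf7bfbfffe80b199febb9fe19fdefbfffdffeffe7fc28a66ff1fe33ffcbbfef7eff7ffdbffc125e6d3d5f3dff4f75fffffdfddffdfc215ecdf6775d3eeefbdfdffbffdfeffc1137d7b9ddefd9edf7fdfffffeb7bffc1269dd3f3dcedcff76fffffff6fbfbfc25199ffef7de0cfcff9ffffaffff6ffc06cbba4fe3fee737dffbf7ffdfebfffc06a66ffdcfb3e71f9feffffffd6dfffc14a9bb7ff9eeccbbbf7fbdfff7fb7ffc1a4bba0fb9fedbf77efbeffffefbf7fc099ecdf2ff35bbcdeffefefdfff7bffc05adcdf6ffc6acbf9f7ffffbf7f77ffc20edcdf67e4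3feebfbff7effbffdfbfc2a217fcbb8fb77f3ffffe75fffffffe822677699fe1bf7ef79ffffef7fedfffc291fb2cbe2ff5bfcffbdff5fffffd7fc24a7f2dde2fbe7bbbfefb7ffff6fdffc1647761dcfbff7377dfbffffddeffdfc0b47768baabff3f7effbef7ffffff5fc0749ddfe3fc6b577dff7fff7bfdfeffc289eabe7f77d2edebfffdffbebffff5c1925d7bbb8efd9f9ffffeddffeffffe40ace6de73f35bf57eff7dbfffffdfbfc071677facfb3f56ddffeffefff9ffdfc213677d9c6fb77eefbfdff7fff7f9ffc059fb27ee3fec9bddfbffdfeffff5ffc0aa9bbe7b9fe2edfaf7fffffebfbfbfc225bba4ff75e4eff7afffffefbffe7fc10e7f21df8efdbbbf7ffadffffebfffc10b66ffd5de1ff4bf7ff7bffffb7bffc18064db11d25bb403d744ab56cb6be002409b24ee2da44b03e8bb54a937e5e001406653c4fa1f5003dca79a5951efc001809992739ec18d03e1b4995e2fafa001403b21dc1eec1303d39a5b6d42afe00240666d8c613e7203de4b66a1d2cfe0014098d7e1dc48c303e56b9f284b67e001807320988bddb903ee8a91d4cfef40028099ac3b05e0af03e35865a6afee600102545381c81d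c8936ce39cd24b578e02408cdf6774224603d1756e2b31eee00280c4de23e113ec03ec65a492bfcfa0028067281e23b73c03da9460d7b7e9e000a005da3392231416d3342c5fa9aabc80486e034e322e1091d2b74acf10a9f1c08862ac18035ab12af64823b4de4b71c0a023a81813e23562d31c737686aa7c820180fca14510e60fad4925a8fb566582049d006724a50e1789b44ccb3dbca34088d8862b8148a992e66b8d868f4731c101a8935556c084c351d5fb4e013ae580506c4b0c706a12c1d34fea27406afa420204fd114432662b97506732f25aee00601364a8892c5315ee2b14e9cac75c8050196da80c68130df34a4729ea667a41021330d08e95492b6cb2917877b58e00488a96663e024129f0b51b3935a5b1c104744181c05db2174f4a8fc1ca5f434204e60046619768638cb5f29135dd834090d9022aa9c189c2e8afd0962fe51a406082d6e0f9024161ec2fb63815c79c82021d291f04a40e9393d26ce722b8ee0090455a22aa131c0ef8a4805bfde99a4014644900605b326c1f4ce331fc5a5b402180d6a1d100c4d42d6fbcce89561d81012330d41e95140f5994195df1b9c580098896671600849c31f50dcfb930b5c0149900622cc10b6c29bcd3397db41b402204db11d02244f01777fe76001abe8012445b00e81348e83ce7f23275519e400c9884630448a33c27780fa9fe1633c201e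2248c6194e8c3accbf48497d5458104b8815154c8a3634758fb244e3e63402123209c13a414d41b9f7ccf80b85d800962248c031cb09c3ecb0dcdda5155c02213209889a449f02ebbf4f606951e80121929180ce00be833daf33666307e400c660046221f303c1eb40bd9fc9993c011017ca00e11160c39cc0579f9705fc00a02bc500e12612836f03338f611bfc011e8030c71c088c039cffa8605705fc00a5c030f802c889036f3ccc70a11bfc0241540a3802d16140f3e0ccbe89e1fc024a2805071c261600f3df334149e1fc

def hypLinN : ℕ := Nat.shiftRight hypN 12288

def adjN : ℕ :=
  0x3eeb6bc53fffe617806303330169fbff3f5ebc3fc71c3ffe4090df20405fe5ff0f2157bb888235ffc322ef47260001e33dbfc3f0ffffc88d830c3c8860371fff3dfd9876f3ce88bd9f1fbcbaf2f24f370f84bce2abb6a11fcf22f023f8c0018f1798bf6e41e00570d71ad1d69f124d5b1fe9ba6fa9feafb78e23a133c0ea738f1fe7e43cffa7fb3b5562a8bc14a0fd373fe9d21fb8ced8bb767badde36eb72a73ffb7fefbfbef7774cf3f367f8c8e1cb2ca9cbf7f0422efbbb2706da23200a033b7bb20df7ff5afe70998f1c427bc4731ba47fa108a137d2a76a4b1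72f7099e30ee77a81a836e3130d63a23f78e8b38f3779d6def6ced5f5d895a462968f66a73f71b68ba8fe51f5eeb9e547fefac5e339f667d95ef9ffcaf1cc0a1d0f359c7335f7c5bcdfc7fdad955c3ca234073ea73fde621dc73dfb0e75f8dfbc5d4fb41f2fb45ff3bef337eaeb2446432f348fe33ffffffeeff6e53fdf22f5e2950e7f8f1fdaad7f5ffcad5e5512dbb4c012ed5b3516b6d8c7ffc12cdd9cb422dc0604032b963fcb80313b40eba4c25dcfb4855b2fde3acbe73f6fde6aa0d748497cc55b38a5bac1b8ffca9bae6d201b68e0120327a1bfdf80c224329b27a77387204fe33ffebfffd7fd5fecf39cdfdccf17045b32e76d1d1c01fe0330e72bfd05a1f87335fee27ce77befad998d34a8d10f1e1f3b785feb3d7b3fe5e8954245ea9fa2cb3db4bfffc0e13ffac30c00138f371fff3ef63a4dc3bbe7179debb33fd968dd5b2fe66df7ef33b7578d625223394cbb8f2fe1f6dbfadae5fb5923a64e3228cfe33f745dfa1f83b565ddd6fa67be94ede31fbccdf6ffa4bddd8f0678a1e0963b8f2979d7c232cb10e0ea9d4443bfdf02a73df6e4b0ee35fb8dafec7ca97d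f49d37387f5b813c7d5ac03cdd0a1d6affb2033fb84fff1de13c4af75e5bd7af173acb2f8cfee2e21227f03f22d64a3b7ccf033fffffe3bbbfbbdfef22ca1d6afeb38f3fffffdff65b7eeff8dd164a3b7dce732fdee4f6e71ff7ae5982de28135ccd37167b3b0d0dfc441614dbbb37c04b70cb34a4edf47fe3e40b9d4f30a3b1001a030000000000000000000000000000000027c7f41ee202f12159a3e4ec9788cd3731bccff054410ee8b35c1eda2f350e731fb63bedc9fdfb5ae7284195cd329d5b1fe55dbb3da7fddb666269c524b0f9e32bcfb807a21c3a962aa3cf3943f8c13717ceec344704a7361572dfb21540ed371a73770919abd14164f961c5fc8bb0cb257fd290e65e40ac199dbe2a724f06a73ff5fffdfcebfefbb36f2fdf27211ae31d1b933fc1ec19fcf718cd94c6120403335e7608461957e470d8df4c1f5dc4731e4b4d3f1d04bf777472cbf40480e0032fb7b2fbe2beebbd8f28b40a786e178f17a5f638c882c5b9176abdce34205de339fdd2b3fadf5afdaa8d2c0962ff12a7000000000000000000000000000000003ee5fc3ff802fffb406320cc30a9fbff32303fc91dfb444fc0dd3347e80100cb3fe745b07e03f7eb79e76eed378dbaa7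1b9eba21c13c0bdc2738df9c6872855b36f7721dfefbd7ab70e925cc1529dc733fffd7faefffb9fccf9cfc23fed605a71fdf9837bffc9bbe6630cdb044f2e537335b9d1f154c18647095cff4c693e4733ef8ade73d742e57ae7753f3e9f0eb5b3773375fcdfbd575d4d8b1469c0f74cb2fb8afeef7f32e7adb06925a8b344f5b1fb1b7ff89efd5bad70aa91786325de3157757980ce5d120d5dca8379e8734a7391c9de23ffd18ccee9c5801ead600033fdb8966775c0efe7a97dff8c3df621f2fedd8e6fa5efafb6a2344c833f8cb373f5b57ca3fffd165c090c0449e9fe5ff3b7755bb3eadfbe5e4d848053edfb0a73fb333c9c0fb47fafbada75fcf2f16cb24fe6bc46671660299cf123b9b4d1a1f347be75c57cbc4203cdd35e2950f7e031f87bd3f89a4b9103f22e9b5c4b2fd033fffff3d5deddffff4dd29b5c4b3fc7314ffc9347d64c809155f38bcf0833a1f000000000000000000000000000000000ee9ed663b82a4130e6371e3b1c87b8f377e4dfc5f5dfe6e70d45fe00515ec7318fbab4511ed8a12a67d01b3cde3321f2a7a6fc1171b264628f55763694da2cb307b431d54495eeff0dd0fdc070100731ca7633dc8a1ff9bb76a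299d05201803279ead7ec7102c0c1b86ffe8c1144d5b000000000000000000000000000000003165d4903ecfd0afc0dd2c2336c100a72ba5ddb3b80238c92b276ecd62b08be33fffebf7fbf7ef9b8f6f30bbf9e01b1f31b7b31dc0e95888b38d2d9dc7331c7336fba97f77ecee37945b11b2914b7a1f35f99bdf75ef4cfaf21d05d287334e732e4b720fe21a77f778a3c74c1348c0033af9cdf73d4fdeeb70570adc22b1ea7339ff8977fd7d9adda65c189868f7321f1bcddc2238049bf16672c8dc3ef0e1370dbd9be2a8f408988f0eb81beaf6138f26795fca3c52446158d7b24eba8d62cb32e9fa05704a46f3307b07de3369ca7328ffe240f21bca892aed34c879ed121f3a467c813f3ff3476cf1422578c8a003197fc5301f8d988c26dc7da164d730a730dea844777dca0fc0dd10b8d9c1001f3ffffc1f7f5ffff770f3cffc17c9e0372fd99deebbd63df5ce12d042bade638f2d1e47fac6113fecfb84de480f14040336f86fff5fd3667798c73363810d7acb0db6e7f0c3a3a1088f2c74a3fd061f8f0f5bb64a839e81344eb0f562dcce658f3649bc4e3fdec4375cd3b16290c860030e9a2b6fc1302f5fc322d3dcc900015b3af33b8d99ff7fd7a4790317686bb2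cb3afe6ac5f63dffd7a8e5023949edb21f0f5e5da22f3431444d92da25fadea18f0dcfc036e204bbbfc322ccb817c001371fd676bbcbb7f375cda0e025dc8eb58f3fffffffffffffffffffffffffffffff3fffffffffffffffffffffffffffffff00000000000000000000000000000000

def searchN : ℕ :=
  0x2030322e86190d0901a0b1629c0f5f7c86848f90183401768f884180b108314e0c0480c13080950c321a1608d4a160b00a90160883804230b2e4320e0f8440609063bc32a552a48320c401d6788d1084147000408c00101201c38140c00c28090280c280314a1c0a163b824281f073782c140185804851a87c0a167781c12100808406920c8182214068440c1910818061f06084242310844120a01824240c0483018094680c3e0b360241807080841603458946a19078000c030d2dc0415031141409050240414070341a16014203e1c0907c2c1a0581c2a14030582c140108c040e0582c2c2c0f88c200e164202c0e010381c02160441a230a8092802110182215018542a2601038040e088094a1903046be06010d41291528440c92088d4240a0499408c6130980802148a44403150640c2101860015f0a81abe21479d4040e020a55a0f0b0a446660f8481492058482c1f0f848461603068241605884281909024381116844ca110107198230b1484203108485c290300c3435110540606108680c290300c32356f0a43214370685219a200c5216a7864301914b003e350d0a434190b038540e0a1901c140b008481f0701c64076301c06246002c5a1cab8a848ac0fd2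0420d0502002063801804100384000144405006760402848050400810635681c2c1105078c6054c0244e251805e18269106c2a05568440a1513081a20a0280968270401152020f02810041382440180b8381827028c040031501422151000c549e44038ee2704880220e048a40409038142215620b0046301848122704a281803910240467070801cc4090240a07018700e040481c041b15838400e024704c04a70240664038700f5f378904805110580463318593805012d00a03318082212048140e030e01c0809038082a2a0888822058e06c221f0881019510202412260d82422c703814080504830120c088440a11028800a9e08a98061106060220313008122604844421106024120c0700d8e041389c120e4f2205404010141226048801c0e1502440030b0b438111204412120b00842320387008070e01c0e0416d5c481c5600de4180181c1c070e81c2a150283a5c03048991416038740e020a80c1c150707c1d640483806070705448071201d8c050a83804260a8541c023285406c6128998c09b20240eac018140a22248142a771e054400a5b80aca63500544e15150884e15328a86a29018544e260109440201325466200705c1c330f0786009010701e07078101e0e100a1462c1989c40040101c0804088091415038480e05160101c2c070801c1d028381c0403808381c16009101508808ee6e0207022040d81140290a89d18110f8244e0454bb42c04012340a07090386807100140a1d02b446a261000e68170dad0ce0913808122710038363c0f024c2171385c260e0185c1204028b01c770d84418242987c1e0e0f854231002044221f070c98a1c02008621d0e8700a09138240a0904814047001b344015038384e03170100e0417224e0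2703c4052183280c0e121386008260ecdc40567e85d1e0e10814d8610400570060f2301206460c0120403038080903014280905054101e0785412050483ad6050489246cd0503c52060081850060505410294202814950a85cc2260782066950b8786630048281c2914054a413078f0661e180cc120a0a8f0661404819401516010480400a8066301807812ec1ab4428331d8382826064bc4c0e1a8959a050b84c1e0014051083602010241c32da01e17023b0ee0f0b814001412800e60e1aa2c320f1a8a4020f260281004078043430030643e0c0d06434196287c246c148b834146b35402660d0680a7e1483014230411402290307c02450a03034190d048140c058b4ea2d06048121c3a870180906824d80a8f8b8627e0c830186018868fc3711834620b0d5900a120202c100906574380b43848141d5e024200c02a28623b0281c62300a0a40c0a0007c160436018d81e030040c04008281a060d02c328705bc80c0900034120b020217a311a0c4207c0d02c1631020000c040e019da091881c24100e8400a1402800290609090186f6f014ea125c8300e4d03109e41e030040010508c40c0a33024dc060d030240969a841616040285017028b41024930957025030941409050d010045e828140a033405008028622215128a4020a140942615569dc3201498004a2945828180012ae0301e00828d2291405c2a1e0c0545225030a5e6150287052f3068256ee20e048501141bbd4a2d42810e02d020b42a04060157025140940a28168b44a06088344c1267824d835150640ca453802d00e3e08c322c0782c581c194d8581f07092ec5607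0401c770784ca4001a85024002901832120c87c1e1a008483212000903419a706402240902c2032190a20a135201024100e01826197c80020190a08d22ca0d3c8f001118402660158bc1a1402838567d400144811a18a8567c0787c580b1602cf22b0c9f0a20b080ac4633b40b03e0d020ac540e198ac0c350a034280f0c87002241586432061997832110703c0877160b024234883856780703c3e17008cc46053b850001f0c88c0212005b0002802804240507844382c52870081c0301808a50f8341a1b020b058f40f810221c0220c501305bc86a2a0b85000284a8ac280f320511a0e0c9bc341f072e68c231084c10080983c000812a500025000004a043b81170016b83c0204000101e2a0400050245e9b0594e0e0a00017040001e25001dc020012a1438083c022781e0b84c38280383c2605128b44800120001032140c85a24068044a77008a0100107898501302870641c0202c38130781038280286802770e01450320e0705026028b00207079b04a1e0084c3e1e0781400170b83c080f020a06a15070104804650104d155c45c4807120959f5f8a8c91e05153ec020f078a0f015028982e150a0991435190c8506c008c81e250001038ac16800ee14078a0200e058413e1f4181d5af6180c052450c8b10e290d11984240e014521f041180a04370200829020d1de6c14854fc051491838461688c2a0e160380aa6300300a9d49814040e15038287d0d060c815028042a0e5b1e8341a0a8503a0211a505aef3a8701008168b4100d0201408ef0f3280815230103401798543e837780410240281cd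808180ec0c04038541c05a38185215180510e693480928190a0048a081497004051807404155480808300f05444020f00812010f8184c1906a2c321a0c818cc1a17031e6081b81838040481c0e5a1328812067681812ed06a740e650e01c681d040780830579d42806081bc581c370683a1c0d1bc346e4181c0453180a43c040a8a4101e07055a4290a8c2ca06048c0cc298c054101e218180ca976a141204011c1a41d048183a1a01039100472864320e4e9d820881a0500e223a82468240246068244e8140e340727404140a8528f47110356eb70a4ac3414030591c351a8cca41a062446a1907030001c7609038041a84aec241957c2613af86400260d8144ccaaf80019531904abe000987008110a05434104a06434190a5d8c82408328262f028501c2c028413c781984c06510a0900a0e4009028050c9bc48030884c2a000e57c261700234ad5f02800081c1784c0a170245c6a5647814082faf9dcf8261101016323900c2e03132380605091486a330714828350c0551606349a46a8b1982466170980cee13198d828050892426116e8244c050a0d6c40b11024008d9f810187c3307009103c9e4173f110cc1c721781034ec0b800e40404830de1b068cc322603514360b0185c0a26198d42e05130d67a221acf4280e199918cc61304c2ed60a0526efd0ba3c1c0501848202c04844341802a1822183c8183409384e27a0e0a06c3203048143856088bc0a0e17824f2034305034143782c201b3b0cc30154305032190a01842132a04c14630188c1410200a02625128803a34078bc1117118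c85e001588c20011a1e05e25050742622014361a95100a0042b07874c667128c8642d141f062964b06d00220d8444e3218808200b0d8600e101a09c206a3409c20310004014250ece45022110084e0f0005c30014b00608180009c3001000944400140883028911843027100d00e160504c460701845e01b038b4500f0e8784a000f0742000051a41023080d112b40f00040270093402270f5c03c1004060204d0f09420610c0002ebe0800100000b8a2a6dc0e81c00170003c0628098401f271003c02950d84040000693400340602418030602407340b89812170006c164d000344e031a0983a0d4c0249a0d003c04a27014fdc69d042bc4c1e0f3103c0a268341207058c410980006da40d9f0341602110367c0804c053a2704808901110080060d0d834220c5b80cc0c40102ccc7c10034562606858042706092ee804b834140900354046e158903a00370d03c0d86844364d0f0e83c1d1a09c361b038ac0e03088944e1e0e8002e00268789a1d0d834f80277884122f11024f821060b4480b0609018340402c483418834ce0d058286870380b418ac04008064b76858680d088080e203c05c4d120f034d411340340ec40e83456203f04448240682a24001389816e006836b40c6386d3a1b678304c1b069f41676060240840008bc2c0e160082c0e01038560f0b2542a020b2b41e270db083c1507078021d390bc401b080ac2e153e0802a2f2f85c5e2046218f2405a8401c0a0919c621c17a340217085545815080097a8a0188cc87e018b0148d4204862200a81c247b0803c1c0150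2b0301d039f9f61d7284c020e558381c03a005803270700446107801c3a1118844040700900401d1780402200d83c3a400b840d02f3b07982680d8083c801084c3611159a80634350200e340d876c60e0e0b05e13178702c2f1583c5e88440c858c209aacec34158082e13118409d40108bc200701844207d012304067019a006760f2302e10138c420020d8bd68031380874271d0080e1d1399c3c156e05c200708b70208a9e2da2c7e0d8c822100d8c410021383db801085285823084ec0e100a9e43a839d88c2c150e8b0621d081d8580e028a00c040f034380412a7000cd02048460d11c98081f0d848080d11a5c00840902ce41a000903eab35010321c0c88c24120684816060084932141289186106985e7c3219014481e0284a2e1c0c85032e2120143e014204816be058700b25179cc036c12014029c48c98601f0c870322309070201a05850000d254c4202591018aec90a05d34300d814022509034240664a100c1b0ab2592610a03436f100050855c000183c630816df60d141cc66170a00050066b9982904ae07020150e050021208048e6018bb5c50012005c29410b80456052b8cc2412158050200058103c0b0fd2cda6db80183c4d1801808040f8740ce24d00002fd069cd822800cc0209a3509400bf0a84404090880812230104430023f9e40612ac9ec5c2e010b0048a0d1f42c111209012028a0a90a030b00804244287430241588c302a0486846de018b02ccc0b031982309068228d0884418120602446184c0604e630e86a48e51108d10231006a48151508c2a2c9d8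8c2a2c6f2e572230d0150e1da28a440163e85818036f00c58186f0580a20280280a050900c060c052bc02650600c58183e8b030010b0043003118040afa178b14c20050680b453e8680223148755e010b0683416028568ade02d55bc1a0188006cc1002814035700c12153180c26f0088740a0504b500a0a0c184225f9e84c407f1787422050c124341a0288844490aa1440850a81440090d0451a110883012270ead2761a104ec44630a8884e200a8803a220d490300309004401211b5928dd4a04c402b3e814020111ddc065f1000cbe20019e4220516024587f01a29960c0e8089c2f160b068033a8e9a81801874062f098440a21010554c20090286a290b00d2829019245011048080649140442d5f530a4060a6e88006490a82688094280c0a090284d10204280d20a4058215019a703ce29405066cea80588446197c831c00c05b80421a5e86400a80d02ace237c84dd48b0786acea811858161a0c858c0239dd38581a00868268b051f416d8141c5b02a0cbf806220980c400a0f0780098508c4000349d15261e3e82d3a03138957418488a05022018646a710008c18220628442231118142217006834197888040187886a762011889e220820606a220d09de4015e888020f059804e010405802191403c30876c0881e020d3a802254b05c02931386834e50088cf2023d0828eaa170085c2000888400111ae830175585d260213805e2271388208197888016227888208181486032207927c4618058802c600c88e76203c8b0161a003dc26016582000a4058205002059286227138c80296188209e020109c02001280c46251049d2c20498ac26005202c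4600000ac1e1300aec1c031301c061c478c442036902c16030700d121901838160313a3c041c0fa08542a01a784e0c01864f40c0b2203e1901ba05682010b81c190606417480103016c00603180a1058582c0b1087c56190d885c0190d886909249064160b1106c16270c86044200ca616e207006c4c0b0c01c1c070b3801c19058381618039b808194903c4e0b6008808086902c380f160103e0b3d00032265081154000600008b23c8d4176205cfc42c40c858d41602248080b05b00160b6028418190e064380c160858e0c1108690924906416020794eca0e13008110d03c8836040390dce040409cc20407424080f1123c3004070b81c1913a086817038104c0e0c089c0190c4884c1813b80401b4609c40260589c360b0c08816180382c0f600702c1c0b0c01cdc020583c16049fb9c6026138101173138106000218c4160b18011160207010107013a3c042f060085803bb2c1880e1a0080ec4620301c024e8d00408b088804480d81c0821038851e026953c2c2601858434f8822cb4e7138084c021a83c1d4f0723c04047401c086b028a04c02130142a610c0982a050488892140985026090c008b41856adcba14010040210ae05050061301944760a00806180828d6e0d1408828011331672181142c0a010a0544c092d06010150300a70180c0a02a7674950500a088142826ae0982b1c0c0140a283b0400a281120008030c0604c69022dd7008128000c001e8882206142815a02110384c28128552109485701001ae0380aae032f02a030a898062503062ae0e022b406b809818071d580101269011d8148d08a5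45005018512a0262a5406286280cb4026280eaec6970982a840927c0e0f07818050a7181c0e0f7329c260502070000f031a414120780416058c8144204002380c09022941602098d81e8e030841603023840c215e8040e055c86806078f808025002ae434030927c06076600c24a707804c800059f0040607a310c21731b034810200424000d0de3e070d04816212b0b11603022941602161f0586f10870221006dd8215f068b0201003008165610b000804164654e2105b014e2102070260510810060d0882c26c02b0840e052b01408136d0b0421a0480a140d08b442803719f0c81407b64c804718840e07020441a114c22404da072343e0a59028280390044220a83b5410040289002690f87c0c140faa03e0a08d0c06065287d64020887daa191d81446023001832030b01c1c605c85a2b23060500e233019822030602801760880c18000c8182c070b05804c00634c2c0433180460a3f00c280a5a28d6e1636814021f0008c465108d0c1c23b3a960e7711865280202ae42c03060e0220d0b020187e061bc19678a89048cc061d40a241182278056608c0a020602048160681c200d0687c32070601c1a14018200b300200964037c1980c020601c2c239e058180a024801c1601810fc0702014c006330291860471980805043d4327e060440a1608bbd3c0301d656009370403c240993c2601120b0200d0e264181c0d000b62d09834641c3b128380109870261052004461c0688c1a0016070380c6a9f868081180434190e07032080d0b4d81c0e030f81708264001316892ce19b3891a6083706418230988c392e5ca9cf83217840011d04090541a1908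d1a2c0d534320b2c0881a117f0083ac1110741a020783d882f0f9204402460090c1b9602c900f1c8c872320db06c2630d888d02f0e9e836110392ec22203808041b6e0740e0f06b8c1a26718d45002039201e6707880ed52038bc640f014b4360f6c89c50b18b01c3a0f068883ada0e8441a89139c1c602620881a1106a8c44020d83464270d88808440c0400ea60186cd4180d840060a0522868121d06006b4018e9461d8a02aa0100ad405225018441425088943011052b837452a0a0640a128443a3a0881c9cd40c04406030ec48361105040740a3c0284e7696844682d0500c3a6a8f828402575bf0221b0384414100c01c0e310900d14100380c3003689d836183e86c20180801c0e2bb6880061d081d85a200e8600a2359844222a118a856140839442b3598c8421919084321b118644226030403211168a4282d120404c1508000323f1f884320b169440019bb0a4421416acd6605a00145ab30888420261206d94b308acc0aeb1586c42002886c5400bb050005108944000d002cc421b02045ca26002cc42110808c32113006502041189000690889047321207db0060a0504a000008532001486452290c82c0c0b05819fc1f140341a0b1283400240a03428290a0d40b490a0ac1a06728444c25128191a150d8400c0b108a84804108c84200120c8482a10b1842c8108119e190a00042210c800f8051085028000881502210c8ad22743a0b42c1a1685816054b0683a1a05a642c0d0acac0e0b3a01c0e2e0588c0896170c41a064c0581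a260a835862d128046435030ca0a0b6187c381c171d00e74022c4621d0b0045c69008b83898008dc022e031d02c0503a602a01009d02c07068687c3e0b0c86a063a8586474068682a010b0047c073a1d008b10e83408323a01c2c0d0a870161a03a64346d0282c38013481c380b7f87024ba0a0180c28008042c1a3782c521a1a8d42c140a05016a60909446061281802280a8a0286e130502a050e850472b0b0c46407022c0240703870080714850209f030b838050b0b42c010e0b4382e0b4602d1e02a0c34060085802d23f0102c06030040e04368682c3143bcc481e090a00a35141d0263d1205c2e05130d42235140f564d2098a022be0d8446a28590bd7e1b0686824a40304c220d1e9c80d6504b340c260e1d04813068d5ae01141d83cfd1401a3406930a002137e8146a26519fcda117b01546897b28ce8a30086d63760a84c0ad2008783813150042a1304d980c1219018082d2307c4a04148956608208703c1e02054522520a7e2208128405210148953e345f8740e41329f44a14328501c15560500e143a8643e0808091661c040401130020a42b2a1285222144209400290e040001e0409430750e9d674081700030080a0604a0e040104cb80005c100c000902a14080b40e055a838560a0b0802f070705432300508c14030b854caaf100596a0e578585208070580230148544601100a4502a00aac2caf0419c2c010b004100e060202c81180c03c2a142bcca205583c26af50005be150aa295601009a0565c00970607d07038040e182d42a0e00a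70021e010541c985a8396a0e838382adf102d42a0c0180c461e050a40326040043c01338a850150a8045220320808a02100601016078c0400301008328414d78ae2007270400f6b0a014131e0804e170500c460a1002814035a83806200985402751680c62750584c420a1a09c180b5d8681a2f06278060b01891aa243a845c02108b58342b0980d6a0c0184c160a018441a09052784e2118284142b1382468801a0bcec035a82d3a220d081261a018c468275d836788006844143a1380c56205a834400176030120a050803416660682c0c330c0340c0483018099f00e000d05834120c16875aa0306c013a0b5aaf4150000836000d098441a0c658e86803118680c1b150383233073943e2b0707c1c2c1587c0c190706c58970f818561b03010662b030b00c0d3ca693433160c028011608c2a1400abc0c230c8b00c1d070c068300f88ddeaf16250021a1808d5e0d020d0580d0e85534040a81060230a839340e160183a1f2e07c8e1f158ac560d0756056140351c1a1d070182a0e4d0102a0e030ac0c1516268580e0303402060e86c0c011186402600ca04282411839ca0181038460e07004320e11838020e8107c21750bb884610008401a1c17b0c02341a08c34100c86420791225c34170a0781a010e05002140d08c206f0e01002150f868f2100e01858150f4602a1d0f87c801d02038361b158bc2e730f8512b410f8502e1c0a0400a0e150c01c048805c1c14a303556060d80066040c8c000190002cfa0baf824120906010340b06000e60c0a05c5e1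903200280d0da84241403048621a18030189809509148a061cc1831049ec60310607428050c8154414082613a33178cc096a4c8cc2405398983a31189c80010080006209a48c40006001cc18040d800127306024280baf9c8188b000646672080145e0c0806d421400030e60b2c82c1226398144c05199cc120c0a06c24140e86c296a02da828000586800bd0d1b40c1c058253000a1024161a04818160900026841206a4c200d120d0166f0d0bc16bd068301a0d05a743831090640c1703000360600018320d059bc48050002c2412091343605048743a311a078249a03136e01e1883436300303408051a0405e1208018202e080700a0d03260121b0b85c1a7d0e80036191303436040a034320c9f0c8042bbb08c1016078bc58180808c46cb3a81c048910058041c49072ec070c81c04070c058622c0c2ec06104d88c301001aec30021a00c4020071d8f218010ac40bb080bc1e070b8404079070cc1e2b1008d12200b0c410b60126c2e0204080102016008460f0101c5e03083416c100383d78200108c42db160405e3113a6c2018003081c0f0789c042b0da48054da7064c833118581c160b03956211786d4e02119d8041013809c420118b0562f3c8641c10a30bc461c080ac200e17aadb69b0826c20db0808c4e0e0185c460f1580020cb6d84010345d81c58cb17841ee03240bc1c2c17840040b190444a231c83c100808894140a08a068a210780174030008400ea1688c5a25108c822aa088b4220c0ca58d4001680810020d8b41f0477cbc102504000041b11889220c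0ccf04a13820b44411060b42219000d0f42d5506c18eb003bc421b168304421753a83002078b41e210d888041b04009541b751ac22391403c1e000c0444ae43004400aa060002c11010440011459a44e22043e0681b010005225710204a290500010000c0020816088282232010d022080d8fc561b018887e00150a8446b0006c441b758b4301101c9acc1916830442d5a88856031a04d6a03110e0180a169f068000b00046231586c000335809f011078acd61312bac5a11050b44a11743a046030b3a05a003c0c4129b110844e031989d3609130982eb8448944e094e09c1489128681427172704a08160867c0f0482810c90b84c98200f05ce44c2609c4017079a0422110808d0316209e520f0409804261382406260ba6c120c05808622201024102e133342e09860bc2e22099c84e33108083413018d4cc27050cc4e350d00806bb978781227102884e021102d3e260182536fe39098421305899cc0b04af4cc09138cc4e27108cc6621061accc099f0005a07140605a080581c100f058601e0705058e20700b6004010b004e232058c850161681d7c071681c581a4b2f802320184c061d19029e2226b074262800d7c260b140740618438b0341a680a010f1190600e2c100c80e1a00858020a018c8640a0e804e22c5f0c85816009c42c1605060e21d19058a8180b1c43a710c00c3a0a0c00d621d38b7c26034801e3825050280222038a1c8bd038057d491081c06070081d28fb1404c1e0f143c4026910060271b098bc3a030e8f86218010607c01170b8309000874301d588c8274901874062200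8880e024200c401a0982c10131780c5a13098840607190b058200782c0e18179f83008190605e0b01809769b015790807050c52008142c46407078c8500752084040b1902d36020099c180c1a0280e8d0605c003006208143b1284818000f820766d0e03076a061028183b0410c181c1482060310628062cf0e01cd40e040284017039ec245e0607c1e1609028760a060ec141f1d80c18970702861130007d040a4106c4a03ba0a44a0a039b8426a07032460e10b28240c018300603050300e6cb7830195f09028142901838380801d680e08ad05810920c81c2e0063058140c0ca2c140c0180c421b060309817018284020180cc4e4c13a6ee60cb9820012341028246c0520825230700c320e0506c2e170784a267d090d02c8b0e0c0241f91a483e920e065240c020b114280b004662c3f83c6c280f87c0212078d8f224160da18ec078b06c13940902609198b0570c15a0c48111b590147b04884342c1b024240909b0426090789cf61e0883c674100848fe0f0f874507f014941e11108081e2b089de422c143bc3e7c0b3045809878242cf30f0b0042c160f03c020789c4e33180816a2c9a84d2add1000442801220298160080a941a078281e3501024420f1606928020b0802c0f100083a300787d2e3305048f630090ac3e16050481e9c403943e01079fd5e7b0f878141da607c1230015301f0f1208506cc16384421a198843e1f160c0621f468b03416840cc581a160ac3e12028181e06020380cdf030083c0800bd1102a4881000040307811110c800115b0086408020001860061805002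f50680904220105c1019040002e061301808060200410140c864102213098290418002041e181d41a025d0512e170c850262a2b83c2e06098081a141504e2813008a8042200050d200030a8320203008000606801f0140cba0042256abc0401160c01202070886022180781002043a828012983ca61f0d008040143020442604004cc023bb5429200a240040c150b054570c95c0006008a82e000c804ee2a0d018320f6111de81f03010261f720881a13470c0602201034ec137403e1826078882e040f8081a1f4bbd01809ad81218020983c600202011195b7a889d0020f56c1a9704d6c0912001952e040b8380c8c0205c60300b8000801033380c01181981c06330191c68040122530008787a970b819669732878021f0003c0c0f67068320f000183200184501e1a008101e19030b032067a07c0c040783c54040101010085781104220f81018022b87c8ee50f852b01a068188e1f120641a1e068340c9a0f37c1c06160a9be04238183e0d06810480e020643c0e150102e0e068043402260081e17260081e097589804021305c008b13239701e0b8983cad0eb45a2170c4203d11128ba102788894529f0e88052250f07ab8ca100a44cad13860c6800b8bc3aa21144836340f0a04a1e0bd703628ae2fc36170c08840250f06d321e138cc3b251989850260f05c3a1b0b860301b0e8745c26731a0401719b982e181385c441e0bdb03017110782f6c0c2ecc62691098370930888301b139ae0e20102003c270f4243d5c5fa39006b30a4900ee4730d5cc0571d43a8e602b8401d6006c4e1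b6d4443627ae2b6ba275b3683a1e0b89c50200ec95b8f612b60641d140884c310ec6c50280e9a43a221909dea257a899ec228498c5a280e888371f0f0944022129945420a808aa0221507aa06157330c2cc30a48ea28ae2184c25110883adc1508aa0221008208174989460275b098c6280e86e24341286d461e7a86c56180e9ad1c1b8089860180b8a8441b470804a1b13a585a221106df0220d8a850eb8fc7c44341689436187307866250f1acc227131c85e2f131a04e20110cc4e201709c4c17588745c254b078641d1446e86208f878442f190a03b430c05420030e81416130d042d60116861660100040200148801f87000ab44a01008415a1800841222e002cd66010004000670182c0201000605a0100014340b00042b00c568b4e2d4028044877098b4062d09cba222416a1c2801a28294c0c0c01c122e438241810048042807170240ad4048145c010d0280e700182c5c2e0c00406100a00dc2070c510021a170788818221c014051703028181702820186a060076e0f094201020800124a05814021e1683402080d0b4342d1204c02670507894011287426710e81c0a130281cec018f004440104466320b171b816240680c26ea0d0500260302854c1a06300280112828e0097e09414a11680412147e034062d0080d4c600602c5a1a01850191e0d4e0151e01d3c0000a8c0c140830000182d06014200805015a81016800111e09b54c0009904c4ac8028920610479c190240280c202505029a8180500c2018018b5a818050740a240982c1b2709ba8280109804441a098003c180853c200a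b70782000050285c00009104a414f8940eaa0e8300e10208944c180a09028070a0416624b88b85a08080942814000785d72128008200080205c000a09810000c03010240282c160a9387406011c030160a1c030700300d252c0d0106c082304064641106d60440100088040d000c8e80006835ae0d00001702806801ae743a000020d009e058e10307000011188c08000c870d808010c8111d192e2c20494020011a0e0c92206001e8227a16088220e152441c2c068380006088a81d030701054000cd86ae325f0080202078c94c870e0640ce10021ec29fb0a613e100c51038a6438228801320405832070c80c06708002028008081e02008c80144079c464180c80050020004000010e0000c325684c1a325f00458321904c1acc5382002ff4203530015c01038233300a8802089b8040d1508c000d001d8040d5001804111153c0019150381a2a070181a221400844c40083508286b8a82e0d00960082a5508ac258078880495079d8641307cb99e0e118445411748003223152041e3940a045039079e8ec5b098c8213209870641c15300ec00044741e18079e9d423b30c8220423af8580d42af9581c020a0040f0683ec21b078081a22010ca060f0d8102e22068041e2206b5c2e0d0083c1e2a0080002080455c02710c8a0021800160503d590a022280d86c0c0d0e0181a3d140544415031d038c8098342e2a640047a0d140180c011404c2a1c098a80366030103600278001e2c278001e8811d34002c118087a06008f40c0150089f0e40680980000c8a92c100b8b8120a6b04814050600c3c1a050280000670681400671c4e2000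08280266748480a0a000b83c00008782e0a00dd96e0004855b4760c04020050f025b42e39c18062e0c04000e10c0b8e413003b012870a848120e199c81c15050380013048cc1d330700c66000b8500a01831c05c050a05c271a174a43000040500a01170680205003059c7b674a41c2c588780b29338202a2e1704c2e130704e340092852a61a0285400e10c0680a00040b9280a030b90e010a8b85c0605028210a00c6d62010836806180f1e00b2504851b2330f00014006cca426056e02424fd0005cd8065a026522e04198340c06020d82e0f0cc200e5105028090b879b2170f0242e0017021cc0621018302e0c0cda26c00041b41406051d8730f000382e0480c2633070280a12018f00a120541828125c04ad60567068145205360026458828fe874486006010a0481419090299c19050042833008000210081d02e1ca99c00200588501414830300a0a050480a14174cc280c018140a000f078295320814001520800821e0a852d68706068a50c0d0250e0c0602414180982414520d0b024130c8cc340129028341309804e206030cd9c01030cc02131601802120a8183003a105db8c36c848666d0884824251785c5e22308955d2f5723837391a898121e1205c5225148784e610b824153a574e95c7597ab91c179c8d037240f028c612318282e0a110c4e4251231c1812054e8362109824d20c128841524123a4d40c088a04e30128a0d61315ce4c6630b848e42135825550e0931c422409cdc133748098d425108244a300533c4c09180c4420c0b84c626a460944461358467827358441427340884a21110984e2113094182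f108882e0a1789c4c2f0b8842e0c049ae5a118606e1822358242e6113824366106029e621098a82e2a1f8304a131084e7222051b0126b0b84c2e0c0d8a418259e0fc4417060985013b49e0d2171386cd00a430b84e1e3486c36175f890141e128c0122909090d41e08890502512044562612878220914828480a0886d7e12098482e32090445e113c090241e0b84812121205c3c091705c3c1209826a212178441226388305c2a0884419780489c561318824421106024151c04060581512860621730856bd093198c2a070c0c8500f100583a17100a84a610ed79dc63318741e16180782e1e140743a1c0e83a541d0b9a01e2804060d01d0e83c502a0e85c300f150b80e0e0a99da0255f8803c0f0e8398235160741e1f0b0705cd816079061d54c2450c1aa0a02a16aa07c580e548781c1f043042a1f0bafcc228431842ca00c0a02c1530a410c160401d7e1e040782e1c0e28038bf071a02f01348783e0e188944a081a0782e173403c501e9d820d21e0b8581031158380e550f0ccaa1e0e8550c0733a3068250c2d0501d0a8801cb7150783a174aad02a650b2401c2b0f0d0d018040782c080c03c541e04060540e040382c2c0f0544a0e168200e3e0c076ac1e0c0205c0833858402c0e8801e205f0601e350e880400707b4040310403c30070385850171a01c660f072f04a1e0e058181c82c15510537870240c050283e16120a1060a3087814160f83048256a87c182412b559e0a0f83c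58080e4383812123e43812124160aa8829bc381f0503014240f07c3c160f8901817678583e160509414179c8225a0809d78241e0b20c26610f0282c1287084388d10c3938170e0851acf0987838080b03c1e0a09b3c1e1312870101c3088426080983c1e13090959e0a0e550581253872a82c1404858a741830421215831381715848422409830142e120305c0a090b0ee2a0e0a8585e09084541c1607c1e16042f45c1f12030d8081887c62160e39048340b0d0481e09078621e0b0286a12140a026d23c0702612538a06a1312355aa081487c4a1c5f894520836070f62f2a84838121783d1a770785e3862

theorem listTest_eltN : listTest admissible2 eltN listN = true := by decide +kernel

theorem adjTest_eltN : adjTest admissible2 (listN.map (IntMat.ofCode 3 2)) adjN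
    (listN.map (IntMat.ofCode 3 2)) 1 = true := by
  decide +kernel

theorem wordTest_eltN : facetsN.all wordTest = true := by decide +kernel

theorem hypTest_facetsN : hypTest (listN.map (IntMat.ofCode 3 2)) 3080 (facetsN.map wordMat)
    hypN = true := by
  decide +kernel

theorem hypTest_linearN : hypTest (listN.map (IntMat.ofCode 3 2)) 3072
    (linearN.map (IntMat.ofCode 5 8)) hypLinN = true := by
  decide +kernel

theorem searchTest_eltN : searchTest hypN adjN 377 0x3fffffffffffffffffffffffffffffff searchN = true := by
  decide +kernel

theorem not_badWithOne_eltN : ¬ BadWithOne eltN.hreal :=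
  not_badWithOne_of_search admissible2_of_badWithOne (by simp [admissible2]) (by decide +kernel)
    listTest_eltN (by decide +kernel) adjTest_eltN wordTest_eltN hypTest_facetsN hypTest_linearN
    (by decide +kernel) (by decide +kernel) (by decide +kernel) (by decide +kernel) searchTest_eltN

/-- The condition on traces that excludes `eltN` as well. -/
def admissible3 (t _ c : ℤ) : Bool := decide (4 ≤ t) || (decide (t = 2) && decide (c = 32))

theorem two_le_of_admissible3 (t q c : ℤ) (h : admissible3 t q c = true) : 2 ≤ t := by
  simp only [admissible3, Bool.or_eq_true, Bool.and_eq_true, decide_eq_true_eq] at h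
  omega

/-- Strengthening a condition on traces. -/
theorem traceTest_strengthen {f f' : ℤ → ℤ → ℤ → Bool}
    (hf : ∀ x ∈ allV, BadWithOne x.hreal → traceTest f x = true) {r : IntMat}
    (h0 : ((eltReps).all fun x => x.eqb r || traceTest f' x || !(traceTest f x)) = true)
    (hr : ¬ BadWithOne r.hreal) : ∀ x ∈ allV, BadWithOne x.hreal → traceTest f' x = true := by
  refine fun x hx hb => traceTest_of_badWithOne (fun s hs => ?_) hx hb
  have h2 := List.all_eq_true.mp h0 s hs
  rw [Bool.or_eq_true, Bool.or_eq_true] at h2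
  rcases h2 with (h2 | h2) | h2
  · rw [IntMat.eq_of_eqb h2]
    exact Or.inr hr
  · exact Or.inl h2
  · refine Or.inr fun hb => ?_
    rw [hf s (eltReps_mem s hs) hb] at h2
    cases h2

theorem admissible3_of_badWithOne : ∀ x ∈ allV, BadWithOne x.hreal → traceTest admissible3 x = true :=
  traceTest_strengthen admissible2_of_badWithOne (by decide +kernel) not_badWithOne_eltN

/-- The elements with admissible quotients by `1` and `eltP`. -/
def listP : List ℕ :=
  [0x8925124a2494, 0x512482092494, 0x482892412494, 0x5128924a2494, 0x892482412494, 0x482512092494,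
   0x494512092482, 0x4a2092412494, 0x5124944a2892, 0x482092512494, 0x892482490512, 0x4a2892512494,
   0x5124904a2092, 0x892482494412, 0x4905120924a2, 0x6c92cb6db64b, 0x6cb2c96d92db, 0x6596c92d96db,
   0x2db2c925924b, 0x6db6c92cb64b, 0x2d92cb25b6db, 0x6d92db25965b, 0x65b6cb2db24b, 0x6db2d925b2cb,
   0x6cb24b2db65b, 0x6c92492d92cb, 0x6d96cb2c92db, 0x6db2cb25b64b, 0x6db6c92d92cb, 0x6cb2c92db24b,
   0x4a2512092494, 0x5120924a2494, 0x6d92c92592db, 0x6d96cb2db65b, 0x6c92cb2d96db, 0x892482512494,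
   0x6d92c92db6cb, 0x6db2cb2d925b]

/-- Normals of facets, used to branch. -/
def facetsP : List ℕ :=
  []

/-- Linear functionals, used to branch. -/
def linearP : List ℕ :=
  [0x4a50842129420e93a508, 0x4a10941d283a10942528, 0x42507425094a0e83a0e8]

def hypP : ℕ :=
  0x50280000000000000000000000000000184800000000000000000000000000004860000

def hypLinP : ℕ := Nat.shiftRight hypP 0

def adjP : ℕ :=
  0x31c8b4009300000000000000000000000000000000000000000000000000000000000000000000000000000000000000368930810b00000000000000000000003ffbb5938b0000000000000000000000000000000000000000000000000000000000000000000000000000000000000000000000000000000000000000000000000000000000000000000000000000003ca30182230000000000000000000000000000000000000000000000000000003ffeb7549300000000000000000000000000000000000000000000000000000000000000000000000000000000000000000000000000000000000000000000000000000000000000000000000000000000000000000000000000000000000000000000000000000000000000000000000000000000000000000000000000000000000000000000000000000000000000000000000000000000000000000000003d1603041300000000000000000000003ff9fca1d300000000000000000000000000000000000000000000000000000037cdb6c18300000000000000000000003ffd7ae90b0000000000000000000000000000000000000000000000000000000000000000000000000000000000000000000000000000000000000000000000000000000000000000000000000000000000000000000000000000000000000000000000000000000000000000000000000000000000000000000000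000000000000000000000000000000000000000000000000000000000000000000000000000000000000000000000000000000003db7879603000000000000000000000000000000000000000000000000000000000000000000000000000000000000000000000000000000000000000000000000000000000000000000000000000000000000000000000000000000000000000000000000000000000000000000000000000000000000000000000000000000000000000000000000000000000000003a544a080b0000000000000000000000000000000000000000000000000000003ffecf1c4b00000000000000000000000000000000000000000000000000000000000000000000000000000000000000000000000000000000000000000000003a7dcea84300000000000000000000003fffffffc300000000000000000000003fff33c723000000000000000000000000000000000000000000000000000000000000000000000000000000000000003f567b4c030000000000000000000000000000000000000000000000000000003a2948a013000000000000000000000000000000000000000000000000000000000000000000000000000000000000000000000000000000000000000000000000000000000000000000000000000000000000000000000000000000000000003078cc00630000000000000000000000000000000000000000000000000000003ffcfe48e3000000000000000000000000000000000000000000000000000000000000000000000000000000000000000000000000000000000000000000000000000000000000000000000000000000000000000000000000000000000000000000000000000000000000000000000000000000000000000000000000000000000000000000000000000000000000003f567b4c03000000000000000000000037cdb6c183000000000000000000000000000000000000000000000000000000000000000000000000000000000000000000000000000000000000000000000000000000000000000000000000000000000000000000000000000000000000003eab79a3030000000000000000000000000000000000000000000000000000000000000000000000000000000000000000000000000000000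000000000000000000000000000000000000000000000000000000000000000000000000000000000000000000000000000000000000000000000000000000000000000000000003fffffffc30000000000000000000000000000000000000000000000000000003db7879603000000000000000000000031b285100b00000000000000000000000000000000000000000000000000000000000000000000000000000000000000046000427f00000000000000000000003ffbcdb2630000000000000000000000000000000000000000000000000000000000000000000000000000000000000000000000000000000000000000000000000000000000000000000000000000003a7dcea8430000000000000000000000000000000000000000000000000000000000000000000000000000000000000031fafd10c300000000000000000000000000000000000000000000000000000000000000000000000000000000000000000000000000000000000000000000003fff4bae1300000000000000000000003eab79a30300000000000000000000000000000000000000000000000000000009080024bf0000000000000000000000000000000000000000000000000000000000000000000000000000000000000031fafd10c3000000000000000000000000000000000000000000000000000000000000000000000000000000000000000000000000000000000000000000000037443240230000000000000000000000029000193f0000000000000000000000000000000000000000000000000000000000000000000000000000000000000000000000000000000000000000000000000000003f0000000000000000000000000000000000000000000000000000003fffffffff00000000000000000000003fffffffff00000000000000000000000000000000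

def searchP : ℕ :=
  0x201010080200

theorem listTest_eltP : listTest admissible3 eltP listP = true := by decide +kernel

theorem adjTest_eltP : adjTest admissible3 (listP.map (IntMat.ofCode 3 2)) adjP
    (listP.map (IntMat.ofCode 3 2)) 1 = true := by
  decide +kernel

theorem wordTest_eltP : facetsP.all wordTest = true := by decide +kernel

theorem hypTest_facetsP : hypTest (listP.map (IntMat.ofCode 3 2)) 3080 (facetsP.map wordMat)
    hypP = true := by
  decide +kernel

theorem hypTest_linearP : hypTest (listP.map (IntMat.ofCode 3 2)) 3072
    (linearP.map (IntMat.ofCode 5 8)) hypLinP = true := by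
  decide +kernel

theorem searchTest_eltP : searchTest hypP adjP 3 0x3fffffffff searchP = true := by
  decide +kernel

theorem not_badWithOne_eltP : ¬ BadWithOne eltP.hreal :=
  not_badWithOne_of_search admissible3_of_badWithOne two_le_of_admissible3 (by decide +kernel)
    listTest_eltP (by decide +kernel) adjTest_eltP wordTest_eltP hypTest_facetsP hypTest_linearP
    (by decide +kernel) (by decide +kernel) (by decide +kernel) (by decide +kernel) searchTest_eltP

/-- The condition on traces that excludes `eltP` as well. -/
def admissible4 (t _ _ : ℤ) : Bool := decide (4 ≤ t)

theorem admissible4_of_badWithOne : ∀ x ∈ allV, BadWithOne x.hreal → traceTest admissible4 x = true :=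
  traceTest_strengthen admissible3_of_badWithOne (by decide +kernel) not_badWithOne_eltP

theorem not_badWithOne_eltR : ¬ BadWithOne eltR.hreal :=
  not_badWithOne_of_spanTest admissible4_of_badWithOne (S := [])
    (D := ⟨0, 0, 0, 1, 0, 0, 0, 0, 0, 0, 0, 0, 1, 0, 0, 0⟩) (by decide +kernel) (by decide +kernel)
    (by decide +kernel) (by decide +kernel)

theorem not_badWithOne_eltQ : ¬ BadWithOne eltQ.hreal :=
  not_badWithOne_of_spanTest admissible4_of_badWithOne (S := [])
    (D := ⟨0, 0, -1, -1, -1, -1, 0, 0, 0, 0, 1, -1, -1, 1, 0, 0⟩) (by decide +kernel) (by decide +kernel)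
    (by decide +kernel) (by decide +kernel)

theorem not_badWithOne_eltS : ¬ BadWithOne eltS.hreal :=
  not_badWithOne_of_spanTest admissible4_of_badWithOne (S := [])
    (D := ⟨-1, -1, -1, -1, 1, 1, 1, 1, 0, 0, 0, 0, 0, 0, 0, 0⟩) (by decide +kernel) (by decide +kernel)
    (by decide +kernel) (by decide +kernel)

/-- The condition on traces of the identity. -/
def admissible5 (t _ _ : ℤ) : Bool := decide (t = 8)

theorem admissible5_of_badWithOne : ∀ x ∈ allV, BadWithOne x.hreal → traceTest admissible5 x = true := by
  refine fun x hx hb => traceTest_of_badWithOne (fun s hs => ?_) hx hb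
  have h0 : (eltReps.all fun x => x.eqb eltR || x.eqb eltQ || x.eqb eltS || traceTest admissible5 x ||
      !(traceTest admissible4 x)) = true := by decide +kernel
  have h2 := List.all_eq_true.mp h0 s hs
  simp only [Bool.or_eq_true] at h2
  rcases h2 with (((h2 | h2) | h2) | h2) | h2
  · rw [IntMat.eq_of_eqb h2]
    exact Or.inr not_badWithOne_eltR
  · rw [IntMat.eq_of_eqb h2]
    exact Or.inr not_badWithOne_eltQ
  · rw [IntMat.eq_of_eqb h2]
    exact Or.inr not_badWithOne_eltS
  · exact Or.inl h2
  · refine Or.inr fun hb => ?_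
    rw [admissible4_of_badWithOne s (eltReps_mem s hs) hb] at h2
    cases h2

theorem not_badWithOne_two : ¬ BadWithOne IntMat.two.hreal :=
  not_badWithOne_of_spanTest admissible5_of_badWithOne (S := [])
    (D := ⟨0, 1, 0, 0, 0, 0, 0, 0, 0, 0, 0, 0, 0, 0, 0, 0⟩) (by decide +kernel) (by decide +kernel)
    (by decide +kernel) (by decide +kernel)

/-- Each facet is an image of one of the two representatives. -/
theorem mem_stdNormals_of_isNormal {C : Mat4} (hC : IsNormal setV C) : C ∈ stdNormals := by
  by_contra hcon
  have hbad : IsBad C := ⟨hC, hcon⟩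
  obtain ⟨u, hu, hu1, -⟩ := hbad.exists_dot_ne_zero (D := IntMat.two) (by decide +kernel)
  have huV := hreal_mem_setV.mpr hu
  have h := hbad.badWithOne huV hu1 hu1
  rw [transpose_mul_self_of_mem huV, ← IntMat.hreal_two] at h
  exact not_badWithOne_two h

namespace IntMat

/-- Transposition followed by `tau`, or nothing. -/
def twist (b : Bool) (x : IntMat) : IntMat := bif b then x.tr.tauConj else x

/-- A symmetry, acting on the doubles of elements of `F₄`. -/
def symOp (w : Bool × IntMat × IntMat) (x : IntMat) : IntMat :=
  (w.2.1.mul ((x.twist w.1).mul w.2.2).half).half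

/-- The test that a symmetry fixes a matrix. -/
def fixTest (n : IntMat) (w : Bool × IntMat × IntMat) : Bool := w.2.1.isOrth && w.2.2.isOrth &&
  (((intTau.mul n.tr).mul intTau).all fun a => decide (a % 2 = 0)) &&
  ((w.2.1.mul (n.twist w.1)).mul w.2.2).eqb (four.mul n)

theorem real_four : four.real = (4 : ℝ) • 1 := by
  ext i j
  fin_cases i <;> fin_cases j <;> simp [real, four]

theorem real_eq (x : IntMat) : x.real = (2 : ℝ) • x.hreal := by
  rw [hreal, smul_smul]
  norm_num

end IntMat

theorem hreal_mul_qreal_mul_hreal {g m k n : IntMat} (h : ((g.mul m).mul k).eqb (IntMat.four.mul n) = true) :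
    g.hreal * m.qreal * k.hreal = n.qreal := by
  have h4 := congrArg IntMat.real (IntMat.eq_of_eqb h)
  simp only [IntMat.real_mul, IntMat.real_four, Matrix.smul_mul, Matrix.one_mul] at h4
  rw [IntMat.hreal, IntMat.hreal, IntMat.qreal, IntMat.qreal]
  simp only [Matrix.smul_mul, Matrix.mul_smul, h4, smul_smul]
  norm_num

theorem exists_symOp {n : IntMat} {w : Bool × IntMat × IntMat} (h : n.fixTest w = true) :
    ∃ φ ∈ genSym, φ n.qreal = n.qreal ∧
      ∀ x ∈ allV, x.symOp w ∈ allV ∧ φ x.hreal = (x.symOp w).hreal := by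
  obtain ⟨b, g, k⟩ := w
  simp only [IntMat.fixTest, Bool.and_eq_true] at h
  obtain ⟨⟨⟨hg, hk⟩, hpar⟩, heq⟩ := h
  replace hg := IntMat.hreal_mem_of_isOrth hg
  replace hk := IntMat.hreal_mem_of_isOrth hk
  obtain ⟨ψ, hψ, hψn, hψV⟩ : ∃ ψ ∈ genSym, ψ n.qreal = (n.twist b).qreal ∧
      ∀ x ∈ allV, x.twist b ∈ allV ∧ ψ x.hreal = (x.twist b).hreal := by
    cases b with
    | false => exact ⟨1, one_mem _, rfl, fun x hx => ⟨hx, rfl⟩⟩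
    | true =>
      refine ⟨tauEquiv * transEquiv, mul_mem tauEquiv_mem transEquiv_mem, ?_, fun x hx => ?_⟩
      · change tauEquiv (n.qreal)ᵀ = (n.tr.tauConj).qreal
        rw [IntMat.tauConj_eq, qreal_tau hpar, IntMat.qreal, IntMat.qreal, IntMat.real_tr,
          Matrix.transpose_smul]
      · have hx' : x.tr ∈ allV := by
          rw [← hreal_mem_setV, IntMat.hreal_tr]
          exact transpose_mem_setV (hreal_mem_setV.mpr hx)
        have hτ := hreal_tau (List.all_eq_true.mp tau_even _ hx')
        change x.tr.tauConj ∈ allV ∧ tauEquiv (x.hreal)ᵀ = (x.tr.tauConj).hreal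
        rw [IntMat.tauConj_eq, ← hreal_mem_setV, hτ, IntMat.hreal_tr]
        exact ⟨map_mem_setV (genSym_le tauEquiv_mem)
          (transpose_mem_setV (hreal_mem_setV.mpr hx)), rfl⟩
  refine ⟨leftEquiv hg * (rightEquiv hk * ψ),
    mul_mem (leftEquiv_mem hg) (mul_mem (rightEquiv_mem hk) hψ), ?_, fun x hx => ?_⟩
  · change g.hreal * (ψ n.qreal * k.hreal) = _
    rw [hψn, ← Matrix.mul_assoc, hreal_mul_qreal_mul_hreal heq]
  · obtain ⟨h1, h2⟩ := hψV x hx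
    have h1' := hreal_mem_setV.mpr h1
    have h3 := half_mul h1' hk
    have h3' := h3 ▸ mul_mem_setV h1' hk
    have h5 := half_mul hg h3'
    refine ⟨hreal_mem_setV.mp (h5 ▸ mul_mem_setV hg h3'), ?_⟩
    change g.hreal * (ψ x.hreal * k.hreal) = _
    rw [h2, ← h3]
    exact h5.symm

theorem finite_orbit {K : Subgroup (Mat4 ≃ₗ[ℝ] Mat4)} (hK : K ≤ symV) {X : Mat4} (hX : X ∈ setV) :
    (MulAction.orbit K X).Finite :=
  finite_setV.subset fun _ ⟨φ, hφ⟩ => hφ ▸ map_mem_setV (hK φ.2) hX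

/-- The codes of the images of `z` under the group generated by some symmetries. -/
def orbitCodes (ws : List (Bool × IntMat × IntMat)) (p n : ℕ) (z : IntMat) : List ℕ :=
  reach (ws.map fun w => onCode (IntMat.symOp w)) p n [z.code] 0

theorem length_orbitCodes_le {K : Subgroup (Mat4 ≃ₗ[ℝ] Mat4)} (hK : K ≤ symV)
    {ws : List (Bool × IntMat × IntMat)}
    (hws : ∀ w ∈ ws, ∃ φ ∈ K, ∀ x ∈ allV, x.symOp w ∈ allV ∧ φ x.hreal = (x.symOp w).hreal)
    {z : IntMat} (hz : z ∈ allV) {p n : ℕ} (h : distinctMod p (orbitCodes ws p n z) 0 = true) :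
    (orbitCodes ws p n z).length ≤ (MulAction.orbit K z.hreal).ncard := by
  classical
  have key : ∀ c ∈ orbitCodes ws p n z, ∃ φ ∈ K, ∃ y ∈ allV, c = y.code ∧ φ z.hreal = y.hreal := by
    refine mem_reach (P := fun c => ∃ φ ∈ K, ∃ y ∈ allV, c = y.code ∧ φ z.hreal = y.hreal) ?_ _ _ _ ?_
    · intro F hF c
      obtain ⟨w, hw, rfl⟩ := List.mem_map.mp hF
      rintro ⟨φ, hφ, y, hy, hc, hφy⟩
      obtain ⟨ψ, hψ, hψV⟩ := hws w hw
      refine ⟨ψ * φ, mul_mem hψ hφ, y.symOp w, (hψV y hy).1, ?_, ?_⟩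
      · rw [hc, onCode, ofCode_code hy]
      · rw [← (hψV y hy).2, ← hφy]
        rfl
    · intro c hc
      exact ⟨1, one_mem _, z, hz, List.mem_singleton.mp hc, rfl⟩
  have hinj : Set.InjOn (fun c => (IntMat.ofCode 3 2 c).hreal) {c | c ∈ orbitCodes ws p n z} := by
    intro c hc d hd hcd
    obtain ⟨-, -, y, hy, hc, -⟩ := key c hc
    obtain ⟨-, -, y', hy', hd, -⟩ := key d hd
    have := IntMat.hreal_injective hcd
    rw [hc, hd, ofCode_code hy, ofCode_code hy'] at this
    rw [hc, hd, this]
  have h1 : {c | c ∈ orbitCodes ws p n z} = ((orbitCodes ws p n z).toFinset : Set ℕ) := by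
    ext; simp
  rw [← List.toFinset_card_of_nodup (nodup_of_distinctMod _ _ h).1, ← Set.ncard_coe_finset, ← h1,
    ← Set.InjOn.ncard_image hinj]
  refine Set.ncard_le_ncard ?_ (finite_orbit hK (hreal_mem_setV.mpr hz))
  rintro _ ⟨c, hc, rfl⟩
  obtain ⟨φ, hφ, y, hy, hcy, hφy⟩ := key c hc
  exact ⟨⟨φ, hφ⟩, hφy.trans (by simp only [hcy, ofCode_code hy])⟩

theorem card_eq_ncard_orbit_mul {G α : Type*} [Group G] [MulAction G α] (K : Subgroup G) (x : α) :
    Nat.card K = (MulAction.orbit K x).ncard * Nat.card ↥(K ⊓ MulAction.stabilizer G x) := by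
  rw [← MulAction.index_stabilizer, mul_comm, ← (MulAction.stabilizer K x).card_mul_index]
  congr 1
  have h : MulAction.stabilizer K x = (K ⊓ MulAction.stabilizer G x).subgroupOf K := by
    ext g
    simp [Subgroup.mem_subgroupOf, Subgroup.smul_def]
  rw [h]
  exact Nat.card_congr (Subgroup.subgroupOfEquivOfLe inf_le_left).toEquiv

theorem ncard_orbit_le_card {G α : Type*} [Group G] [MulAction G α] [Finite G] (x : α) :
    (MulAction.orbit G x).ncard ≤ Nat.card G :=
  Finite.card_range_le fun g : G => g • x

/-- The members of `L` that have the same products with the members of `F` as `b`. -/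
def sameDots (L F : List IntMat) (b : IntMat) : List IntMat :=
  L.filter fun y => F.all fun f => decide (y.dot f = b.dot f)

/-- The lists of members of `L` that have the same products, with each other and with the members
of `F`, as those of a given list. -/
def gramTuples (L F : List IntMat) : List IntMat → List (List IntMat)
  | [] => [[]]
  | b :: bs => (sameDots L F b).flatMap fun y => ((gramTuples L F bs).filter fun ys =>
      (List.zipWith (fun b' y' => decide (y.dot y' = b.dot b')) bs ys).all id).map (y :: ·)

/-- The test that each member of a list is determined by its products with those before it. -/
def rigidTest (L : List IntMat) : List IntMat → List IntMat → Bool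
  | _, [] => true
  | F, b :: r => ((sameDots L F b).all fun y => y.eqb b) && rigidTest L (b :: F) r

theorem dot_eq_of_map {φ : Mat4 ≃ₗ[ℝ] Mat4} (hφ : φ ∈ symV) {x y x' y' : IntMat}
    (hx : φ x.real = x'.real) (hy : φ y.real = y'.real) : x'.dot y' = x.dot y := by
  have := frob_map_symV hφ x.real y.real
  rw [hx, hy, IntMat.frob_real, IntMat.frob_real] at this
  exact_mod_cast this

/-- A group of symmetries that permutes the members of a list. -/
structure ActsOn (K : Subgroup (Mat4 ≃ₗ[ℝ] Mat4)) (L : List IntMat) : Prop where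
  le : K ≤ symV
  nodup : L.Nodup
  maps : ∀ φ ∈ K, ∀ y ∈ L, ∃ z ∈ L, φ y.real = z.real

variable {K : Subgroup (Mat4 ≃ₗ[ℝ] Mat4)} {L F : List IntMat} {φ : Mat4 ≃ₗ[ℝ] Mat4}

theorem ActsOn.exists_mem_sameDots (h : ActsOn K L) (hφ : φ ∈ K) (hF : ∀ f ∈ F, φ f.real = f.real)
    (b : IntMat) :
    ∀ y ∈ sameDots L F b, ∃ z ∈ sameDots L F b, φ y.real = z.real := by
  intro y hy
  simp only [sameDots, List.mem_filter, List.all_eq_true, decide_eq_true_eq] at hy ⊢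
  obtain ⟨z, hz, hyz⟩ := h.maps φ hφ y hy.1
  exact ⟨z, ⟨hz, fun f hf => (dot_eq_of_map (h.le hφ) hyz (hF f hf)).trans (hy.2 f hf)⟩, hyz⟩

theorem real_foldr_add (l : List IntMat) :
    (l.foldr IntMat.add (IntMat.two.sub IntMat.two)).real = (l.map IntMat.real).sum := by
  have hadd : ∀ x y : IntMat, (x.add y).real = x.real + y.real := fun x y => by
    rw [IntMat.real_eq, IntMat.hreal_add, smul_add, ← IntMat.real_eq, ← IntMat.real_eq]
  induction l with
  | nil =>
    rw [List.foldr_nil, IntMat.real_eq, IntMat.hreal_sub, sub_self, smul_zero]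
    rfl
  | cons x l ih => rw [List.foldr_cons, hadd, ih, List.map_cons, List.sum_cons]

theorem ActsOn.map_sum_sameDots (h : ActsOn K L) (hφ : φ ∈ K) (hF : ∀ f ∈ F, φ f.real = f.real)
    (b : IntMat) :
    φ ((sameDots L F b).foldr IntMat.add (IntMat.two.sub IntMat.two)).real =
      ((sameDots L F b).foldr IntMat.add (IntMat.two.sub IntMat.two)).real := by
  have hM := h.exists_mem_sameDots hφ hF b
  have hnd : (sameDots L F b).Nodup := h.nodup.filter _
  generalize sameDots L F b = M at hM hnd
  choose! π hπ hπr using hM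
  have hperm : (M.map π).Perm M := by
    have hnd' : (M.map π).Nodup := hnd.map_on fun x hx y hy hxy => by
      apply IntMat.real_injective
      apply φ.injective
      rw [hπr x hx, hπr y hy, hxy]
    refine (List.subperm_of_subset hnd' fun z hz => ?_).perm_of_length_le (List.length_map _).ge
    obtain ⟨y, hy, rfl⟩ := List.mem_map.mp hz
    exact hπ y hy
  rw [real_foldr_add, map_list_sum, ← (hperm.map IntMat.real).sum_eq, List.map_map, List.map_map]
  exact congrArg List.sum (List.map_congr_left hπr)

theorem ActsOn.exists_gramTuple (h : ActsOn K L) (hφ : φ ∈ K) (hF : ∀ f ∈ F, φ f.real = f.real) :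
    ∀ bs : List IntMat, (∀ b ∈ bs, b ∈ L) →
      ∃ ys ∈ gramTuples L F bs, List.Forall₂ (fun b y : IntMat => φ b.real = y.real) bs ys
  | [], _ => ⟨[], List.mem_singleton.mpr rfl, List.Forall₂.nil⟩
  | b :: bs, hbs => by
    obtain ⟨ys, hys, hall⟩ := h.exists_gramTuple hφ hF bs fun b hb => hbs b (List.mem_cons_of_mem _ hb)
    obtain ⟨y, hy, hby⟩ := h.exists_mem_sameDots hφ hF b b (by
      simp [sameDots, hbs b List.mem_cons_self])
    refine ⟨y :: ys, ?_, List.Forall₂.cons hby hall⟩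
    simp only [gramTuples, List.mem_flatMap, List.mem_map, List.mem_filter]
    refine ⟨y, hy, ys, ⟨hys, ?_⟩, rfl⟩
    clear hys hbs
    induction hall with
    | nil => rfl
    | cons h1 _ ih =>
      simp only [List.zipWith_cons_cons, List.all_cons, id, Bool.and_eq_true, decide_eq_true_eq]
      exact ⟨dot_eq_of_map (h.le hφ) hby h1, ih⟩

theorem ActsOn.fixed_of_rigidTest (h : ActsOn K L) (hφ : φ ∈ K) :
    ∀ (r F : List IntMat), (∀ f ∈ F, φ f.real = f.real) → (∀ b ∈ r, b ∈ L) →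
      rigidTest L F r = true → ∀ b ∈ r, φ b.real = b.real
  | [], _, _, _, _ => by simp
  | b :: r, F, hF, hr, ht => by
    simp only [rigidTest, Bool.and_eq_true, List.all_eq_true] at ht
    obtain ⟨y, hy, hby⟩ := h.exists_mem_sameDots hφ hF b b (by
      simp [sameDots, hr b List.mem_cons_self])
    rw [IntMat.eq_of_eqb (ht.1 y hy)] at hby
    intro c hc
    rcases List.mem_cons.mp hc with rfl | hc
    · exact hby
    · refine h.fixed_of_rigidTest hφ r (b :: F) (fun f hf => ?_)
        (fun c hc => hr c (List.mem_cons_of_mem _ hc)) ht.2 c hc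
      rcases List.mem_cons.mp hf with rfl | hf
      · exact hby
      · exact hF f hf

theorem ActsOn.card_le (h : ActsOn K L) (hF : ∀ φ ∈ K, ∀ f ∈ F, φ f.real = f.real)
    {bs r : List IntMat} (hbs : ∀ b ∈ bs, b ∈ L) (hr : ∀ b ∈ r, b ∈ L)
    (ht : rigidTest L (bs ++ F) r = true)
    (hspan : Submodule.span ℝ (IntMat.real '' {x | x ∈ bs ++ r}) = ⊤) :
    Finite K ∧ Nat.card K ≤ (gramTuples L F bs).length := by
  classical
  choose f hf hfr using fun φ : K => h.exists_gramTuple φ.2 (hF φ φ.2) bs hbs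
  have hinj : Function.Injective fun φ : K =>
      (⟨f φ, List.mem_toFinset.mpr (hf φ)⟩ : (gramTuples L F bs).toFinset) := by
    intro φ ψ hφψ
    have h1 : f φ = f ψ := congrArg Subtype.val hφψ
    have h2 : ∀ b ∈ bs, ((ψ : Mat4 ≃ₗ[ℝ] Mat4)⁻¹ * φ) b.real = b.real := by
      intro b hb
      have h3 := hfr φ
      have h4 := hfr ψ
      rw [← h1] at h4
      have h5 : (φ : Mat4 ≃ₗ[ℝ] Mat4) b.real = (ψ : Mat4 ≃ₗ[ℝ] Mat4) b.real := by
        clear h1 hφψ hbs ht hspan hf hfr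
        generalize f φ = ys at h3 h4
        induction h3 with
        | nil => simp at hb
        | cons h6 _ ih =>
          obtain ⟨h7, h8⟩ := List.forall₂_cons.mp h4
          rcases List.mem_cons.mp hb with rfl | hb
          · rw [h6, h7]
          · exact ih hb h8
      change (ψ : Mat4 ≃ₗ[ℝ] Mat4).symm ((φ : Mat4 ≃ₗ[ℝ] Mat4) b.real) = _
      rw [h5, LinearEquiv.symm_apply_apply]
    have hθ : ((ψ⁻¹ * φ : K) : Mat4 ≃ₗ[ℝ] Mat4) ∈ K := (ψ⁻¹ * φ).2
    have h6 := h.fixed_of_rigidTest hθ r (bs ++ F) (fun x hx => by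
      rcases List.mem_append.mp hx with hx | hx
      · exact h2 x hx
      · exact hF _ hθ x hx) hr ht
    have h7 : (((ψ⁻¹ * φ : K) : Mat4 ≃ₗ[ℝ] Mat4) : Mat4 →ₗ[ℝ] Mat4) = LinearMap.id := by
      refine LinearMap.ext_on hspan ?_
      rintro _ ⟨x, hx, rfl⟩
      rcases List.mem_append.mp hx with hx | hx
      · exact h2 x hx
      · exact h6 x hx
    have h8 : ψ⁻¹ * φ = 1 := Subtype.ext (LinearEquiv.toLinearMap_injective h7)
    exact (inv_mul_eq_one.mp h8).symm
  refine ⟨Finite.of_injective _ hinj, (Nat.card_le_card_of_injective _ hinj).trans ?_⟩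
  rw [Nat.card_eq_fintype_card, Fintype.card_coe]
  exact List.toFinset_card_le _

theorem actsOn_tight {K : Subgroup (Mat4 ≃ₗ[ℝ] Mat4)} (hK : K ≤ symV) {n : IntMat}
    (hn : ∀ φ ∈ K, φ n.qreal = n.qreal) : ActsOn K (allV.filter fun x => decide (x.dot n = 8)) := by
  refine ⟨hK, nodup_allV.filter _, fun φ hφ y hy => ?_⟩
  obtain ⟨hy, hyn⟩ := List.mem_filter.mp hy
  have hV := map_mem_setV (hK hφ) (hreal_mem_setV.mpr hy)
  obtain ⟨z, hz⟩ := hV.2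
  rw [← hz, hreal_mem_setV] at hV
  refine ⟨z, List.mem_filter.mpr ⟨hV, ?_⟩, ?_⟩
  · rw [decide_eq_true_eq] at hyn ⊢
    rw [← frob_hreal_qreal_eq_one] at hyn ⊢
    rw [hz, ← hn φ hφ, frob_map_symV (hK hφ), hyn]
  · rw [IntMat.real_eq, IntMat.real_eq, map_smul, hz]

/-- The test that a group fixing the members of `F` and permuting those of `L` has at most `N`
members. -/
def countTest (L F bs r : List IntMat) (N : ℕ) : Bool :=
  ((bs ++ r).all fun b => L.any fun y => y.eqb b) && rigidTest L (bs ++ F) r &&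
    Nat.beq (gramTuples L F bs).length N

theorem ActsOn.card_le_of_countTest (h : ActsOn K L) (hF : ∀ φ ∈ K, ∀ f ∈ F, φ f.real = f.real)
    {bs r : List IntMat} {N : ℕ} (ht : countTest L F bs r N = true)
    (hspan : ∀ Z, (∀ x ∈ bs ++ r, frob x.hreal Z = 0) → Z = 0) : Finite K ∧ Nat.card K ≤ N := by
  simp only [countTest, Bool.and_eq_true, List.all_eq_true] at ht
  obtain ⟨⟨h1, h2⟩, h3⟩ := ht
  have hmem : ∀ b ∈ bs ++ r, b ∈ L := fun b hb => by
    obtain ⟨y, hy, hyb⟩ := List.any_eq_true.mp (h1 b hb)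
    exact IntMat.eq_of_eqb hyb ▸ hy
  rw [← Nat.eq_of_beq_eq_true h3]
  refine h.card_le hF (fun b hb => hmem b (List.mem_append_left _ hb))
    (fun b hb => hmem b (List.mem_append_right _ hb)) h2 (span_eq_top_of_frob fun Z hZ => ?_)
  refine hspan Z fun x hx => ?_
  rw [IntMat.hreal, map_smul, LinearMap.smul_apply, hZ _ ⟨x, hx, rfl⟩, smul_zero]

/-- The test that an orbit has at least `N` elements. -/
def orbitTest (n : IntMat) (zs : List IntMat) (ws : List (Bool × IntMat × IntMat)) (p m : ℕ)
    (z : IntMat) (N : ℕ) : Bool :=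
  (ws.all fun w => n.fixTest w && zs.all fun x => (x.symOp w).eqb x) && z.isOrth &&
    zs.all IntMat.isOrth && Nat.beq (orbitCodes ws p m z).length N &&
    distinctMod p (orbitCodes ws p m z) 0

theorem le_ncard_orbit_of_orbitTest (hK : K ≤ symV) {n : IntMat} {zs : List IntMat}
    {ws : List (Bool × IntMat × IntMat)} {p m : ℕ} {z : IntMat} {N : ℕ}
    (hmem : ∀ φ ∈ symV, φ n.qreal = n.qreal → (∀ x ∈ zs, φ x.hreal = x.hreal) → φ ∈ K)
    (ht : orbitTest n zs ws p m z N = true) : N ≤ (MulAction.orbit K z.hreal).ncard := by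
  simp only [orbitTest, Bool.and_eq_true, List.all_eq_true] at ht
  obtain ⟨⟨⟨⟨h1, h2⟩, h3⟩, h4⟩, h5⟩ := ht
  rw [← Nat.eq_of_beq_eq_true h4]
  refine length_orbitCodes_le hK (fun w hw => ?_) (IntMat.mem_allV_of_isOrth h2) h5
  obtain ⟨φ, hφ, hφn, hφV⟩ := exists_symOp (h1 w hw).1
  refine ⟨φ, hmem φ (genSym_le hφ) hφn fun x hx => ?_, hφV⟩
  rw [(hφV x (IntMat.mem_allV_of_isOrth (h3 x hx))).2, IntMat.eq_of_eqb ((h1 w hw).2 x hx)]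

/-- The members of `F₄` on the first facet. -/
def tight1 : List IntMat := allV.filter fun x => decide (x.dot intN1 = 8)

/-- The members of `F₄` on the second facet. -/
def tight2 : List IntMat := allV.filter fun x => decide (x.dot intN2 = 8)

/-- The sum of the members of `F₄` on the second facet. -/
def sum2 : IntMat := (sameDots tight2 [] IntMat.two).foldr IntMat.add (IntMat.two.sub IntMat.two)

/-- The sum of the members of `F₄` on the first facet that are at distance two from `intMat1`. -/
def sum1 : IntMat :=
  (sameDots tight1 [intMat1] ⟨0, 0, 0, 0, 0, 0, 0, 0, 0, 0, 0, 0, 2, -2, -2, -2⟩).foldr IntMat.add (IntMat.two.sub IntMat.two)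

/-- Generators of a group of symmetries that fix the second normal. -/
def gens2 : List (Bool × IntMat × IntMat) :=
  [(false, ⟨0, 0, -2, 0, 0, 2, 0, 0, -2, 0, 0, 0, 0, 0, 0, -2⟩,
     ⟨-1, 1, -1, -1, 1, 1, 1, -1, -1, 1, 1, 1, -1, -1, 1, -1⟩),
   (true, ⟨-1, -1, 1, -1, 1, -1, 1, 1, 1, -1, -1, -1, -1, -1, -1, 1⟩,
     ⟨0, 2, 0, 0, 0, 0, -2, 0, -2, 0, 0, 0, 0, 0, 0, 2⟩),
   (true, ⟨1, 1, -1, -1, -1, -1, -1, -1, -1, 1, 1, -1, -1, 1, -1, 1⟩,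
     ⟨0, 0, -2, 0, 2, 0, 0, 0, 0, -2, 0, 0, 0, 0, 0, 2⟩)]

/-- Generators of a group of symmetries that fix the first normal. -/
def gens1 : List (Bool × IntMat × IntMat) :=
  [(true, ⟨-1, -1, -1, 1, 1, -1, -1, -1, 1, -1, 1, 1, -1, -1, 1, -1⟩,
     ⟨-1, -1, 1, -1, -1, 1, -1, -1, -1, 1, 1, 1, 1, 1, 1, -1⟩),
   (false, ⟨-1, -1, -1, 1, 1, 1, -1, 1, -1, 1, -1, -1, 1, -1, -1, -1⟩,
     ⟨0, 0, -2, 0, 0, -2, 0, 0, -2, 0, 0, 0, 0, 0, 0, -2⟩)]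

/-- Generators of a group of symmetries that fix the first normal and `intMat1`. -/
def gens1' : List (Bool × IntMat × IntMat) :=
  [(true, ⟨-1, 1, -1, 1, 1, 1, -1, -1, -1, -1, -1, -1, -1, 1, 1, -1⟩,
     ⟨1, -1, -1, -1, -1, -1, 1, -1, -1, -1, -1, 1, -1, 1, -1, -1⟩),
   (false, ⟨1, -1, 1, -1, -1, 1, 1, -1, 1, 1, 1, 1, -1, -1, 1, 1⟩,
     ⟨2, 0, 0, 0, 0, -2, 0, 0, 0, 0, 2, 0, 0, 0, 0, 2⟩)]

/-- The symmetries fixing the second normal. -/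
noncomputable def stab2 : Subgroup (Mat4 ≃ₗ[ℝ] Mat4) := symV ⊓ MulAction.stabilizer _ intN2.qreal

/-- The symmetries fixing the first normal. -/
noncomputable def stab1 : Subgroup (Mat4 ≃ₗ[ℝ] Mat4) := symV ⊓ MulAction.stabilizer _ intN1.qreal

/-- The symmetries fixing the first normal and `intMat1`. -/
noncomputable def stab1' : Subgroup (Mat4 ≃ₗ[ℝ] Mat4) := stab1 ⊓ MulAction.stabilizer _ intMat1.hreal

theorem countTest2 : countTest tight2 [sum2] (basis2.take 2) (basis2.drop 2) 48 = true := by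
  decide +kernel

theorem orbitTest2 : orbitTest intN2 [] gens2 4093 1000 intMat1 48 = true := by
  decide +kernel

theorem countTest1 : countTest tight1 [sum1, intMat1] (basis1.take 4) (basis1.drop 4) 16 = true := by
  decide +kernel

theorem orbitTest1 : orbitTest intN1 [] gens1 26580 2000 intMat1 288 = true := by
  decide +kernel

theorem orbitTest1' : orbitTest intN1 [intMat1] gens1' 26580 1000 IntMat.two 16 = true := by
  decide +kernel

theorem card_stab2 : Nat.card stab2 = 48 := by
  have hact : ActsOn stab2 tight2 := actsOn_tight inf_le_left fun φ hφ => hφ.2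
  obtain ⟨hfin, hle⟩ := hact.card_le_of_countTest (fun φ hφ f hf => by
    rw [List.mem_singleton.mp hf]
    exact hact.map_sum_sameDots hφ (by simp) _) countTest2 fun Z => by
      rw [List.take_append_drop]
      exact eq_zero_of_basis2
  refine le_antisymm hle ?_
  exact (le_ncard_orbit_of_orbitTest (K := stab2) inf_le_left (fun φ h1 h2 _ => ⟨h1, h2⟩)
    orbitTest2).trans (ncard_orbit_le_card _)

theorem real_of_hreal {φ : Mat4 ≃ₗ[ℝ] Mat4} {x : IntMat} (h : φ x.hreal = x.hreal) :
    φ x.real = x.real := by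
  rw [IntMat.real_eq, map_smul, h]

theorem card_stab1' : Nat.card stab1' = 16 := by
  have hact : ActsOn stab1' tight1 :=
    actsOn_tight (inf_le_left.trans inf_le_left) fun φ hφ => hφ.1.2
  have hx : ∀ φ ∈ stab1', ∀ f ∈ [intMat1], φ f.real = f.real := fun φ hφ f hf => by
    rw [List.mem_singleton.mp hf]
    exact real_of_hreal hφ.2
  obtain ⟨hfin, hle⟩ := hact.card_le_of_countTest (fun φ hφ f hf => by
    rcases List.mem_cons.mp hf with rfl | hf
    · exact hact.map_sum_sameDots hφ (hx φ hφ) _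
    · exact hx φ hφ f hf) countTest1 fun Z => by
      rw [List.take_append_drop]
      exact eq_zero_of_basis1
  refine le_antisymm hle ?_
  exact (le_ncard_orbit_of_orbitTest (K := stab1') (inf_le_left.trans inf_le_left)
    (fun φ h1 h2 h3 => ⟨⟨h1, h2⟩, h3 _ (List.mem_singleton.mpr rfl)⟩)
    orbitTest1').trans (ncard_orbit_le_card _)

theorem card_stab1 : Nat.card stab1 = 4608 := by
  have h1 : (MulAction.orbit stab1 intMat1.hreal).ncard = 288 := by
    refine le_antisymm ?_ (le_ncard_orbit_of_orbitTest (K := stab1) inf_le_left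
      (fun φ h1 h2 _ => ⟨h1, h2⟩) orbitTest1)
    rw [← ncard_tight_intN1]
    refine Set.ncard_le_ncard ?_ (finite_setV.subset fun _ h => h.1)
    have hmem : mat1 ∈ tight setV intN1.qreal := by
      refine ⟨mat1_mem, ?_⟩
      rw [← hreal_intMat1, frob_hreal_qreal_eq_one]
      decide
    rintro _ ⟨⟨φ, hφ, hφn⟩, rfl⟩
    rw [hreal_intMat1]
    refine ⟨map_mem_setV hφ hmem.1, ?_⟩
    have := frob_map_symV hφ mat1 intN1.qreal
    rw [hmem.2] at this
    rw [← this]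
    exact congrArg (frob _) hφn.symm
  rw [card_eq_ncard_orbit_mul stab1 intMat1.hreal, h1]
  change 288 * Nat.card stab1' = _
  rw [card_stab1']

/-- The products of a long and a short root, or a short and a long one, scaled. -/
def tensors : Set Mat4 :=
  {C | ∃ x ∈ setV, ∃ y ∈ setV, C = x * intN1.qreal * y ∨ C = x * intN1.qrealᵀ * y}

theorem qreal_tr (x : IntMat) : x.tr.qreal = x.qrealᵀ := by
  rw [IntMat.qreal, IntMat.real_tr, IntMat.qreal, Matrix.transpose_smul]

theorem tauEquiv_intN1 : ∃ x ∈ setV, ∃ y ∈ setV, tauEquiv intN1.qreal = x * intN1.qrealᵀ * y := by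
  refine ⟨IntMat.hreal ⟨1, -1, 1, 1, -1, 1, 1, 1, 1, 1, 1, -1, 1, 1, -1, 1⟩,
    IntMat.hreal_mem_of_isOrth (by decide +kernel),
    IntMat.hreal ⟨0, 0, 2, 0, -2, 0, 0, 0, 0, 2, 0, 0, 0, 0, 0, 2⟩,
    IntMat.hreal_mem_of_isOrth (by decide +kernel), ?_⟩
  rw [← qreal_tau (by decide +kernel), ← qreal_tr]
  exact (hreal_mul_qreal_mul_hreal (by decide +kernel)).symm

theorem map_mem_tensors {φ : Mat4 ≃ₗ[ℝ] Mat4} (hφ : φ ∈ genSym) : ∀ C, φ C ∈ tensors ↔ C ∈ tensors := by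
  have htr : ∀ C ∈ tensors, Cᵀ ∈ tensors := by
    rintro _ ⟨x, hx, y, hy, rfl | rfl⟩
    · exact ⟨_, transpose_mem_setV hy, _, transpose_mem_setV hx, Or.inr (by
        simp [Matrix.transpose_mul, Matrix.mul_assoc])⟩
    · exact ⟨_, transpose_mem_setV hy, _, transpose_mem_setV hx, Or.inl (by
        simp [Matrix.transpose_mul, Matrix.mul_assoc])⟩
  have hl : ∀ g ∈ setV, ∀ C ∈ tensors, g * C ∈ tensors := by
    rintro g hg _ ⟨x, hx, y, hy, h⟩
    exact ⟨_, mul_mem_setV hg hx, y, hy, h.imp (by rintro rfl; simp only [Matrix.mul_assoc])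
      (by rintro rfl; simp only [Matrix.mul_assoc])⟩
  have hr : ∀ g ∈ setV, ∀ C ∈ tensors, C * g ∈ tensors := by
    intro g hg C hC
    simpa using htr _ (hl _ (transpose_mem_setV hg) _ (htr C hC))
  have hτ : ∀ C ∈ tensors, tauEquiv C ∈ tensors := by
    obtain ⟨a, ha, b, hb, hab⟩ := tauEquiv_intN1
    rintro _ ⟨x, hx, y, hy, rfl | rfl⟩
    · rw [tauEquiv_mul, tauEquiv_mul, hab]
      exact hr _ (map_mem_setV (genSym_le tauEquiv_mem) hy) _
        (hl _ (map_mem_setV (genSym_le tauEquiv_mem) hx) _ ⟨a, ha, b, hb, Or.inr rfl⟩)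
    · rw [tauEquiv_mul, tauEquiv_mul, tauEquiv_transpose, hab]
      exact hr _ (map_mem_setV (genSym_le tauEquiv_mem) hy) _
        (hl _ (map_mem_setV (genSym_le tauEquiv_mem) hx) _ (htr _ ⟨a, ha, b, hb, Or.inr rfl⟩))
  refine Subgroup.closure_induction (p := fun φ _ => ∀ C, φ C ∈ tensors ↔ C ∈ tensors) ?_
    (fun _ => Iff.rfl) (fun φ ψ _ _ h1 h2 C => (h1 (ψ C)).trans (h2 C)) (fun φ _ h C => ?_) hφ
  · rintro φ (⟨g, hg, rfl | rfl⟩ | rfl | rfl) C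
    · refine ⟨fun h => ?_, hl g hg C⟩
      have := hl _ (transpose_mem_setV hg) _ h
      change gᵀ * (g * C) ∈ _ at this
      rwa [← Matrix.mul_assoc, transpose_mul_self_of_mem hg, Matrix.one_mul] at this
    · refine ⟨fun h => ?_, hr g hg C⟩
      have := hr _ (transpose_mem_setV hg) _ h
      change C * g * gᵀ ∈ _ at this
      rwa [Matrix.mul_assoc, hg.1, Matrix.mul_one] at this
    · exact ⟨fun h => htr _ h, htr C⟩
    · exact ⟨fun h => tauMap_tauMap C ▸ hτ _ h, hτ C⟩
  · rw [← h (φ⁻¹ C)]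
    change φ (φ.symm C) ∈ _ ↔ _
    rw [LinearEquiv.apply_symm_apply]

theorem ncard_tight_map {φ : Mat4 ≃ₗ[ℝ] Mat4} (hφ : φ ∈ symV) (C : Mat4) :
    (tight setV (φ C)).ncard = (tight setV C).ncard := by
  rw [tight_map (mem_symV_iff.mp hφ) (frob_map_symV hφ), Set.ncard_image_of_injective _ φ.injective]

/-- The orbit of a normal under the symmetries. -/
abbrev normalOrbit (C : Mat4) : Set Mat4 := MulAction.orbit symV C

theorem isNormal_iff {C : Mat4} :
    IsNormal setV C ↔ C ∈ normalOrbit intN1.qreal ∨ C ∈ normalOrbit intN2.qreal := by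
  constructor
  · intro h
    obtain ⟨φ, hφ, h | h⟩ := mem_stdNormals_of_isNormal h
    · exact Or.inl ⟨⟨φ, genSym_le hφ⟩, h⟩
    · exact Or.inr ⟨⟨φ, genSym_le hφ⟩, h⟩
  · rintro (⟨φ, rfl⟩ | ⟨φ, rfl⟩)
    · exact isNormal_intN1.map_symV φ.2
    · exact isNormal_intN2.map_symV φ.2

theorem ncard_tight_of_mem_orbit {C D : Mat4} (h : C ∈ normalOrbit D) :
    (tight setV C).ncard = (tight setV D).ncard := by
  obtain ⟨φ, rfl⟩ := h
  exact ncard_tight_map φ.2 D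

theorem normalOrbit_intN1 : normalOrbit intN1.qreal = tensors := by
  have h1 : intN1.qreal ∈ tensors :=
    ⟨1, one_mem_setV, 1, one_mem_setV, Or.inl (by rw [Matrix.one_mul, Matrix.mul_one])⟩
  ext C
  constructor
  · intro hC
    obtain ⟨φ, hφ, h | h⟩ := mem_stdNormals_of_isNormal (isNormal_iff.mpr (Or.inl hC))
    · exact h ▸ (map_mem_tensors hφ _).mpr h1
    · have h2 := ncard_tight_of_mem_orbit hC
      rw [← h, ncard_tight_map (genSym_le hφ), ncard_tight_intN1, ncard_tight_intN2] at h2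
      omega
  · rintro ⟨x, hx, y, hy, rfl | rfl⟩
    · exact ⟨⟨_, genSym_le (mul_mem (rightEquiv_mem hy) (leftEquiv_mem hx))⟩, rfl⟩
    · exact ⟨⟨_, genSym_le (mul_mem (rightEquiv_mem hy) (mul_mem (leftEquiv_mem hx) transEquiv_mem))⟩, rfl⟩

/-- Twice the difference of the outer columns. -/
def IntMat.colDiff : IntMat → ℤ × ℤ × ℤ × ℤ
  | ⟨a, _, _, d, e, _, _, h, i, _, _, l, m, _, _, p⟩ => (a.sub d, e.sub h, i.sub l, m.sub p)

/-- The last row. -/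
def IntMat.lastRow : IntMat → ℤ × ℤ × ℤ × ℤ
  | ⟨_, _, _, _, _, _, _, _, _, _, _, _, m, n, o, p⟩ => (m, n, o, p)

/-- The product of a column and a row. -/
def IntMat.outer : ℤ × ℤ × ℤ × ℤ → ℤ × ℤ × ℤ × ℤ → IntMat
  | (a, b, c, d), (e, f, g, h) => ⟨a.mul e, a.mul f, a.mul g, a.mul h, b.mul e, b.mul f, b.mul g,
      b.mul h, c.mul e, c.mul f, c.mul g, c.mul h, d.mul e, d.mul f, d.mul g, d.mul h⟩

theorem hreal_mul_intN1_mul (x y : IntMat) :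
    x.hreal * intN1.qreal * y.hreal = (IntMat.outer x.colDiff y.lastRow).qreal := by
  cases x; cases y
  simp only [IntMat.hreal, IntMat.qreal, Matrix.smul_mul, Matrix.mul_smul, smul_smul,
    ← IntMat.real_mul]
  ext i j
  fin_cases i <;> fin_cases j <;> simp [IntMat.real, IntMat.mul, IntMat.outer, IntMat.colDiff,
    IntMat.lastRow, intN1, IntMat.dot4_eq, show ∀ a b : ℤ, a.sub b = a - b from fun _ _ => rfl] <;> ring

/-- The test that the first nonzero entry is positive. -/
def isPos : ℤ × ℤ × ℤ × ℤ → Bool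
  | (a, b, c, d) => decide (0 < ((a * 8 + b) * 8 + c) * 8 + d)

/-- The opposite. -/
def negVec : ℤ × ℤ × ℤ × ℤ → ℤ × ℤ × ℤ × ℤ
  | (a, b, c, d) => (-a, -b, -c, -d)

/-- Twice the long roots. -/
def longRoots : List (ℤ × ℤ × ℤ × ℤ) := (allV.map IntMat.colDiff).dedup

/-- Twice the short roots. -/
def shortRoots : List (ℤ × ℤ × ℤ × ℤ) := (allV.map IntMat.lastRow).dedup

/-- Four times the first half of `tensors`. -/
def tensorList : List IntMat :=
  (longRoots.filter isPos).flatMap fun u => shortRoots.map fun v => IntMat.outer u v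

theorem tensorTest : (Nat.beq (tensorList ++ tensorList.map IntMat.tr).length 576 &&
    distinctMod 30116 ((tensorList ++ tensorList.map IntMat.tr).map IntMat.packL) 0 &&
    longRoots.all fun u => isPos u || isPos (negVec u)) = true := by
  decide +kernel

theorem colDiff_neg (x : IntMat) : (x.map Int.neg).colDiff = negVec x.colDiff := by
  cases x
  simp only [IntMat.map, IntMat.colDiff, negVec, show ∀ a b : ℤ, a.sub b = a - b from fun _ _ => rfl,
    show ∀ a : ℤ, a.neg = -a from fun _ => rfl, neg_sub, neg_sub_neg]

theorem outer_negVec (u v : ℤ × ℤ × ℤ × ℤ) :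
    IntMat.outer (negVec u) (negVec v) = IntMat.outer u v := by
  simp [IntMat.outer, negVec]

theorem neg_mem_allV {x : IntMat} (hx : x ∈ allV) : x.map Int.neg ∈ allV := by
  have h : (x.map Int.neg).hreal = -x.hreal := by
    rw [IntMat.hreal, IntMat.hreal, ← smul_neg]
    congr 1
    cases x
    ext r s
    fin_cases r <;> fin_cases s <;> simp [IntMat.real, IntMat.map, show ∀ a : ℤ, a.neg = -a from fun _ => rfl]
  rw [← hreal_mem_setV, h]
  exact neg_mem_setV (hreal_mem_setV.mpr hx)

theorem mem_tensorList {c : IntMat} :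
    c ∈ tensorList ↔ ∃ x ∈ allV, ∃ y ∈ allV, IntMat.outer x.colDiff y.lastRow = c := by
  simp only [tensorList, longRoots, shortRoots, List.mem_flatMap, List.mem_map, List.mem_filter,
    List.mem_dedup]
  constructor
  · rintro ⟨_, ⟨⟨x, hx, rfl⟩, -⟩, _, ⟨y, hy, rfl⟩, rfl⟩
    exact ⟨x, hx, y, hy, rfl⟩
  · rintro ⟨x, hx, y, hy, rfl⟩
    have h := tensorTest
    simp only [Bool.and_eq_true, List.all_eq_true] at h
    have hx' := h.2 x.colDiff (List.mem_dedup.mpr (List.mem_map_of_mem hx))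
    rcases Bool.or_eq_true _ _ ▸ hx' with h1 | h1
    · exact ⟨_, ⟨⟨x, hx, rfl⟩, h1⟩, _, ⟨y, hy, rfl⟩, rfl⟩
    · refine ⟨_, ⟨⟨x.map Int.neg, neg_mem_allV hx, colDiff_neg x⟩, h1⟩, _,
        ⟨y.map Int.neg, neg_mem_allV hy, ?_⟩, outer_negVec x.colDiff y.lastRow⟩
      cases y
      rfl

theorem tensors_eq : tensors = IntMat.qreal '' {c | c ∈ tensorList ++ tensorList.map IntMat.tr} := by
  have hset : ∀ X : Mat4, X ∈ setV ↔ ∃ x ∈ allV, x.hreal = X := fun X => by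
    rw [setV_eq]
    rfl
  ext C
  simp only [tensors, hset, Set.mem_ofPred_eq, Set.mem_image, List.mem_append, List.mem_map,
    mem_tensorList]
  constructor
  · rintro ⟨_, ⟨x, hx, rfl⟩, _, ⟨y, hy, rfl⟩, rfl | rfl⟩
    · exact ⟨_, Or.inl ⟨x, hx, y, hy, rfl⟩, (hreal_mul_intN1_mul x y).symm⟩
    · have htr : ∀ z ∈ allV, z.tr ∈ allV := fun z hz => by
        rw [← hreal_mem_setV, IntMat.hreal_tr]
        exact transpose_mem_setV (hreal_mem_setV.mpr hz)
      refine ⟨_, Or.inr ⟨_, ⟨y.tr, htr y hy, x.tr, htr x hx, rfl⟩, rfl⟩, ?_⟩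
      rw [qreal_tr, ← hreal_mul_intN1_mul, IntMat.hreal_tr, IntMat.hreal_tr]
      simp only [Matrix.transpose_mul, Matrix.transpose_transpose, Matrix.mul_assoc]
  · rintro ⟨_, ⟨x, hx, y, hy, rfl⟩ | ⟨_, ⟨x, hx, y, hy, rfl⟩, rfl⟩, rfl⟩
    · exact ⟨_, ⟨x, hx, rfl⟩, _, ⟨y, hy, rfl⟩, Or.inl (hreal_mul_intN1_mul x y).symm⟩
    · have hset' := fun (z : IntMat) (hz : z ∈ allV) =>
        (hset _).mp (transpose_mem_setV (hreal_mem_setV.mpr hz))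
      refine ⟨_, hset' y hy, _, hset' x hx, Or.inr ?_⟩
      rw [qreal_tr, ← hreal_mul_intN1_mul]
      simp only [Matrix.transpose_mul, Matrix.mul_assoc]

theorem ncard_tensors : tensors.ncard = 576 := by
  classical
  have h := tensorTest
  simp only [Bool.and_eq_true] at h
  have hnd := (nodup_of_distinctMod _ _ h.1.2).1.of_map
  have h1 : ∀ l : List IntMat, {x | x ∈ l} = (l.toFinset : Set IntMat) := fun l => by
    ext; simp
  rw [tensors_eq, Set.ncard_image_of_injective _ IntMat.qreal_injective, h1, Set.ncard_coe_finset,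
    List.toFinset_card_of_nodup hnd, Nat.eq_of_beq_eq_true h.1.1]

theorem ncard_normalOrbit_intN1 : (normalOrbit intN1.qreal).ncard = 576 := by
  rw [normalOrbit_intN1, ncard_tensors]

theorem card_symV : Nat.card symV = 2654208 := by
  rw [card_eq_ncard_orbit_mul symV intN1.qreal, ncard_normalOrbit_intN1]
  change 576 * Nat.card stab1 = _
  rw [card_stab1]

theorem ncard_normalOrbit_intN2 : (normalOrbit intN2.qreal).ncard = 55296 := by
  have h := card_eq_ncard_orbit_mul symV intN2.qreal
  change _ = _ * Nat.card stab2 at h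
  rw [card_symV, card_stab2] at h
  exact Nat.eq_of_mul_eq_mul_right (by norm_num : 0 < 48) h.symm

theorem traceFace_eq (A : Mat4) : traceFace convF4 A = face setV Aᵀ := by
  rw [convF4_eq]
  ext X
  simp only [traceFace, face, trace_mul_eq_frob]

theorem facets_eq : facets convF4 = face setV '' {C | IsNormal setV C} := by
  rw [convF4_eq]
  ext G
  constructor
  · intro h
    obtain ⟨C, hC, h⟩ := exists_normal_of_isFacet zero_mem_convexHull (fun _ => neg_mem_setV) span_setV h
    exact ⟨C, hC, h.symm⟩
  · rintro ⟨C, hC, rfl⟩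
    exact isFacet_face zero_mem_convexHull span_setV hC

theorem symOrbit_face (C : Mat4) : symOrbit convF4 (face setV C) = face setV '' normalOrbit C := by
  rw [convF4_eq]
  have h : ∀ φ : symV, φ • face setV C = face setV (φ • C) := fun φ =>
    (face_map (mem_symV_iff.mp φ.2) (frob_map_symV φ.2) C).symm
  ext G
  constructor
  · rintro ⟨φ, rfl⟩
    exact ⟨φ • C, ⟨φ, rfl⟩, (h φ).symm⟩
  · rintro ⟨_, ⟨φ, rfl⟩, rfl⟩
    exact ⟨φ, h φ⟩

theorem incidence_face (C : Mat4) : incidence convF4 (face setV C) = (tight setV C).ncard := by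
  rw [incidence, convF4_eq, extremePoints_convexHull_eq fun _ => frob_self_of_mem, inter_face]

theorem isNormal_of_mem_normalOrbit {C D : Mat4} (hD : IsNormal setV D) (h : C ∈ normalOrbit D) :
    IsNormal setV C := by
  obtain ⟨φ, rfl⟩ := h
  exact hD.map_symV φ.2

theorem ncard_face_image {S : Set Mat4} (hS : ∀ C ∈ S, IsNormal setV C) :
    (face setV '' S).ncard = S.ncard :=
  Set.InjOn.ncard_image ((face_injOn setV).mono hS)

theorem stabOrder_of_mem_symOrbit {D : Mat4} (hD : IsNormal setV D) {G : Set Mat4}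
    (hG : G ∈ symOrbit convF4 (face setV D)) :
    (normalOrbit D).ncard * stabOrder convF4 G = 2654208 := by
  have h1 : symOrbit convF4 G = symOrbit convF4 (face setV D) := MulAction.orbit_eq_iff.mpr hG
  rw [symOrbit_face] at h1
  rw [← ncard_face_image fun C => isNormal_of_mem_normalOrbit hD, ← h1, ← card_symV, symOrbit,
    ← MulAction.index_stabilizer, stabOrder, mul_comm, Subgroup.card_mul_index, convF4_eq]

theorem disjoint_normalOrbits : Disjoint (normalOrbit intN1.qreal) (normalOrbit intN2.qreal) := by
  refine Set.disjoint_left.mpr fun C h1 h2 => ?_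
  have h := (ncard_tight_of_mem_orbit h1).symm.trans (ncard_tight_of_mem_orbit h2)
  rw [ncard_tight_intN1, ncard_tight_intN2] at h
  omega

theorem ncard_facets : (facets convF4).ncard = 55872 := by
  have h : {C | IsNormal setV C} = normalOrbit intN1.qreal ∪ normalOrbit intN2.qreal :=
    Set.ext fun C => isNormal_iff
  rw [facets_eq, ncard_face_image (S := {C | IsNormal setV C}) fun _ h => h, h, Set.ncard_union_eq disjoint_normalOrbits
    (Set.finite_of_ncard_ne_zero (by rw [ncard_normalOrbit_intN1]; norm_num))
    (Set.finite_of_ncard_ne_zero (by rw [ncard_normalOrbit_intN2]; norm_num)),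
    ncard_normalOrbit_intN1, ncard_normalOrbit_intN2]

/-- The simple roots of a simple system of `F₄`. -/
noncomputable def simpleRoot : Fin 4 → Fin 4 → ℝ :=
  ![![1, -1, 0, 0], ![0, 1, -1, 0], ![0, 0, 1, 0], ![-1 / 2, -1 / 2, -1 / 2, -1 / 2]]

/-- Multiples of the fundamental weights. -/
noncomputable def weight : Fin 4 → Fin 4 → ℝ :=
  ![![1, 0, 0, -1], ![1, 1, 0, -2], ![1, 1, 1, -3], ![0, 0, 0, -1]]

/-- The products of the simple roots with the weights. -/
noncomputable def weightScale : Fin 4 → ℝ := ![1, 1, 1, 1 / 2]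

theorem weightScale_pos (k : Fin 4) : 0 < weightScale k := by
  fin_cases k <;> simp [weightScale]

theorem simpleRoot_dot_weight (k l : Fin 4) :
    simpleRoot k ⬝ᵥ weight l = if k = l then weightScale l else 0 := by
  fin_cases k <;> fin_cases l <;>
    simp [simpleRoot, weight, weightScale, dotProduct, Fin.sum_univ_four] <;> norm_num

theorem sum_simpleRoot (v : Fin 4 → ℝ) :
    ∑ k, (v ⬝ᵥ weight k / weightScale k) • simpleRoot k = v := by
  ext i
  fin_cases i <;>
    simp [simpleRoot, weight, weightScale, dotProduct, Fin.sum_univ_four] <;> ring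

theorem simpleRoot_mem_rootsF4 (k : Fin 4) : simpleRoot k ∈ rootsF4 := by
  fin_cases k
  · simpa [simpleRoot] using vec_mem_rootsF4_of_int 1 (-1) 0 0 (by norm_num)
  · simpa [simpleRoot] using vec_mem_rootsF4_of_int 0 1 (-1) 0 (by norm_num)
  · simpa [simpleRoot] using vec_mem_rootsF4_of_int 0 0 1 0 (by norm_num)
  · have := vec_mem_rootsF4_of_half (-1) (-1) (-1) (-1) (by norm_num)
    convert this using 1
    simp [simpleRoot]
    norm_num

/-- The test that the products of a vector with the weights have the same sign. -/
def signTest (a b c d : ℤ) : Bool :=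
  (decide (0 ≤ a - d) && decide (0 ≤ a + b - 2 * d) && decide (0 ≤ a + b + c - 3 * d) &&
    decide (0 ≤ -d)) ||
  (decide (a - d ≤ 0) && decide (a + b - 2 * d ≤ 0) && decide (a + b + c - 3 * d ≤ 0) &&
    decide (-d ≤ 0))

/-- The test that the rows of `2 - x` pass `signTest`. -/
def rowTest : IntMat → Bool
  | ⟨a, b, c, d, e, f, g, h, i, j, k, l, m, n, o, p⟩ => signTest (2 - a) (-b) (-c) (-d) &&
    signTest (-e) (2 - f) (-g) (-h) && signTest (-i) (-j) (2 - k) (-l) &&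
    signTest (-m) (-n) (-o) (2 - p)

theorem rowTest_of_symm : (allV.all fun x =>
    !(x.eqb x.tr && decide (x.trace = 4)) || rowTest x) = true := by
  decide +kernel

theorem signs_of_signTest {a b c d : ℤ} (h : signTest a b c d = true) {v : Fin 4 → ℝ}
    (hv : v = ![(a : ℝ), b, c, d]) : (∀ k, 0 ≤ v ⬝ᵥ weight k) ∨ ∀ k, v ⬝ᵥ weight k ≤ 0 := by
  subst hv
  simp only [signTest, Bool.or_eq_true, Bool.and_eq_true, decide_eq_true_eq] at h
  refine h.imp ?_ ?_ <;> rintro ⟨⟨⟨h1, h2⟩, h3⟩, h4⟩ k <;>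
    fin_cases k <;> simp [weight, dotProduct, Fin.sum_univ_four] <;>
    first | omega | (rify at h1 h2 h3 h4; linarith)

theorem signs_of_rowTest {x : IntMat} (h : rowTest x = true) (i : Fin 4) :
    (∀ k, 0 ≤ (((2 : ℝ) • (1 : Mat4) - x.real) i) ⬝ᵥ weight k) ∨
      ∀ k, (((2 : ℝ) • (1 : Mat4) - x.real) i) ⬝ᵥ weight k ≤ 0 := by
  cases x
  simp only [rowTest, Bool.and_eq_true] at h
  fin_cases i
  · refine signs_of_signTest h.1.1.1 ?_
    ext j; fin_cases j <;> simp [IntMat.real]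
  · refine signs_of_signTest h.1.1.2 ?_
    ext j; fin_cases j <;> simp [IntMat.real]
  · refine signs_of_signTest h.1.2 ?_
    ext j; fin_cases j <;> simp [IntMat.real]
  · refine signs_of_signTest h.2 ?_
    ext j; fin_cases j <;> simp [IntMat.real]

theorem IsRootVector.reflMatrix_mem {v : Fin 4 → ℝ} (h : IsRootVector groupF4 v) :
    reflMatrix v ∈ setV := by
  obtain ⟨-, g, hg, hgv⟩ := h
  exact hgv ▸ coe_mem_setV hg

theorem isRootVector_of_reflMatrix_mem {v : Fin 4 → ℝ} (h0 : v ≠ 0) (h : reflMatrix v ∈ setV) :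
    IsRootVector groupF4 v :=
  ⟨h0, unitOfMem h, mem_groupF4_iff.mpr h, rfl⟩

theorem IsRootVector.signs {v : Fin 4 → ℝ} (h : IsRootVector groupF4 v) :
    (∀ k, 0 ≤ v ⬝ᵥ weight k) ∨ ∀ k, v ⬝ᵥ weight k ≤ 0 := by
  have hmem := h.reflMatrix_mem
  obtain ⟨x, hx⟩ := hmem.2
  have hpos : 0 < v ⬝ᵥ v := by
    refine lt_of_le_of_ne (Finset.sum_nonneg fun i _ => mul_self_nonneg (v i)) fun h0 => h.1 ?_
    exact dotProduct_self_eq_zero.mp h0.symm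
  have hreal : x.real = (2 : ℝ) • (1 : Mat4) - (4 / (v ⬝ᵥ v)) • Matrix.vecMulVec v v := by
    rw [IntMat.real_eq, hx, reflMatrix, smul_sub, smul_smul]
    congr 2
    ring
  have htr : x.tr = x := by
    apply IntMat.real_injective
    rw [IntMat.real_tr, hreal]
    simp [Matrix.transpose_vecMulVec]
  have htrace : x.trace = 4 := by
    have : (x.trace : ℝ) = 4 := by
      have h1 : (x.trace : ℝ) = x.real.trace := by
        rw [x.trace_eq, ← smul_eq_mul, ← map_smul, ← IntMat.real_eq, frob_comm, frob_eq_trace,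
          Matrix.transpose_one, Matrix.mul_one]
      rw [h1, hreal, Matrix.trace_sub, Matrix.trace_smul, Matrix.trace_smul, Matrix.trace_one,
        Matrix.trace_vecMulVec]
      simp
      field_simp
      norm_num
    exact_mod_cast this
  have ht := List.all_eq_true.mp rowTest_of_symm x (hreal_mem_setV.mp (hx ▸ hmem))
  obtain ⟨i, hi⟩ : ∃ i, v i ≠ 0 := Function.ne_iff.mp h.1
  have hrow : (((2 : ℝ) • (1 : Mat4) - x.real) i) = (4 / (v ⬝ᵥ v) * v i) • v := by
    rw [hreal, sub_sub_cancel]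
    ext j
    simp [Matrix.vecMulVec_apply, mul_assoc]
  have hself : x.eqb x = true := by cases x; simp [IntMat.eqb]
  simp only [htr, hself, htrace, decide_true, Bool.and_self, Bool.not_true, Bool.false_or] at ht
  have hs := signs_of_rowTest ht i
  simp only [hrow, smul_dotProduct, smul_eq_mul] at hs
  have h4 : 0 < 4 / (v ⬝ᵥ v) := by positivity
  rcases lt_or_gt_of_ne hi with hi | hi
  · have hneg : 4 / (v ⬝ᵥ v) * v i < 0 := mul_neg_of_pos_of_neg h4 hi
    exact hs.symm.imp (fun hs k => nonneg_of_mul_nonpos_right (hs k) hneg)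
      fun hs k => nonpos_of_mul_nonneg_right (hs k) hneg
  · have hp : 0 < 4 / (v ⬝ᵥ v) * v i := mul_pos h4 hi
    exact hs.imp (fun hs k => nonneg_of_mul_nonneg_right (hs k) hp)
      fun hs k => nonpos_of_mul_nonpos_right (hs k) hp

theorem mulVec_dot {g : Mat4} (u v : Fin 4 → ℝ) : (g *ᵥ u) ⬝ᵥ v = u ⬝ᵥ (gᵀ *ᵥ v) := by
  rw [Matrix.mulVec_transpose, dotProduct_comm, Matrix.dotProduct_mulVec, dotProduct_comm]

theorem mulVec_dot_mulVec {g : Mat4} (hg : g ∈ setV) (u v : Fin 4 → ℝ) :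
    (g *ᵥ u) ⬝ᵥ (g *ᵥ v) = u ⬝ᵥ v := by
  rw [mulVec_dot, Matrix.mulVec_mulVec, transpose_mul_self_of_mem hg, Matrix.one_mulVec]

theorem IsRootVector.mulVec {v : Fin 4 → ℝ} (h : IsRootVector groupF4 v) {g : Mat4} (hg : g ∈ setV) :
    IsRootVector groupF4 (g *ᵥ v) := by
  refine isRootVector_of_reflMatrix_mem (fun h0 => h.1 ?_) ?_
  · rw [← Matrix.one_mulVec v, ← transpose_mul_self_of_mem hg, ← Matrix.mulVec_mulVec, h0,
      Matrix.mulVec_zero]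
  · have : reflMatrix (g *ᵥ v) = g * reflMatrix v * gᵀ := by
      rw [reflMatrix, reflMatrix, mulVec_dot_mulVec hg, Matrix.mul_sub, Matrix.sub_mul, Matrix.mul_one,
        hg.1, Matrix.mul_smul, Matrix.smul_mul, Matrix.mul_vecMulVec, Matrix.vecMulVec_mul,
        Matrix.vecMul_transpose]
    rw [this]
    exact mul_mem_setV (mul_mem_setV hg h.reflMatrix_mem) (transpose_mem_setV hg)

theorem isRootVector_simpleRoot (k : Fin 4) : IsRootVector groupF4 (simpleRoot k) := by
  refine isRootVector_of_reflMatrix_mem (fun h => ?_) (reflMatrix_mem_setV (simpleRoot_mem_rootsF4 k))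
  have := simpleRoot_dot_weight k k
  rw [h, zero_dotProduct, if_pos rfl] at this
  exact (weightScale_pos k).ne this

theorem exists_dot_eq (L : (Fin 4 → ℝ) →ₗ[ℝ] ℝ) : ∃ ρ : Fin 4 → ℝ, ∀ v, ρ ⬝ᵥ v = L v :=
  ⟨fun j => L fun l => if j = l then 1 else 0, fun v => by
    rw [LinearMap.pi_apply_eq_sum_univ L v, dotProduct]
    exact Finset.sum_congr rfl fun i _ => by rw [smul_eq_mul, mul_comm]⟩

/-- The orbit of each vector meets the closed fundamental chamber. -/
theorem exists_dominant (ρ : Fin 4 → ℝ) : ∃ g ∈ setV, ∀ k, 0 ≤ (g *ᵥ ρ) ⬝ᵥ simpleRoot k := by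
  obtain ⟨g, hg, hmax⟩ := Set.exists_max_image setV (fun g : Mat4 => (g *ᵥ ρ) ⬝ᵥ ∑ k, weight k)
    finite_setV ⟨1, one_mem_setV⟩
  refine ⟨g, hg, fun k => ?_⟩
  have hr := reflMatrix_mem_setV (simpleRoot_mem_rootsF4 k)
  have h := hmax _ (mul_mem_setV hr hg)
  have hw : simpleRoot k ⬝ᵥ ∑ l, weight l = weightScale k := by
    simp [dotProduct_sum, simpleRoot_dot_weight]
  have hpos : 0 < simpleRoot k ⬝ᵥ simpleRoot k := by
    rcases (simpleRoot_mem_rootsF4 k).2 with h | h <;> rw [h] <;> norm_num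
  rw [← Matrix.mulVec_mulVec, reflMatrix, Matrix.sub_mulVec, Matrix.one_mulVec, Matrix.smul_mulVec,
    Matrix.vecMulVec_mulVec, sub_dotProduct, smul_dotProduct, op_smul_eq_smul, smul_dotProduct, hw,
    smul_eq_mul, smul_eq_mul, dotProduct_comm (simpleRoot k) (g *ᵥ ρ)] at h
  by_contra hneg
  have h1 := mul_pos (div_pos two_pos hpos) (mul_pos_of_neg_of_neg (not_le.mp hneg)
    (neg_neg_of_pos (weightScale_pos k)))
  linarith

/-- Each simple system of `F₄` is an image of the standard one, up to scaling. -/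
theorem IsSimpleSystem.exists_smul {α : Module.Basis (Fin 4) ℝ (Fin 4 → ℝ)}
    (hα : IsSimpleSystem groupF4 α) : ∃ g ∈ setV, ∃ σ : Fin 4 → Fin 4, Function.Injective σ ∧
      ∃ c : Fin 4 → ℝ, ∀ i, 0 < c i ∧ g *ᵥ α i = c i • simpleRoot (σ i) := by
  obtain ⟨ρ, hρ⟩ := exists_dot_eq (∑ i, α.coord i)
  obtain ⟨g, hg, hdom⟩ := exists_dominant ρ
  have hgt := transpose_mem_setV hg
  have hgg : ∀ v : Fin 4 → ℝ, gᵀ *ᵥ (g *ᵥ v) = v := fun v => by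
    rw [Matrix.mulVec_mulVec, transpose_mul_self_of_mem hg, Matrix.one_mulVec]
  have hgg' : ∀ v : Fin 4 → ℝ, g *ᵥ (gᵀ *ᵥ v) = v := fun v => by
    rw [Matrix.mulVec_mulVec, hg.1, Matrix.one_mulVec]
  have hb : ∀ k, (g *ᵥ ρ) ⬝ᵥ simpleRoot k = ∑ i, α.repr (gᵀ *ᵥ simpleRoot k) i := fun k => by
    rw [mulVec_dot, hρ]
    simp
  have hm0 : ∀ k, α.repr (gᵀ *ᵥ simpleRoot k) ≠ 0 := fun k h => by
    have h1 := (isRootVector_simpleRoot k).mulVec hgt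
    exact h1.1 (α.repr.map_eq_zero_iff.mp h)
  have hm : ∀ k i, 0 ≤ α.repr (gᵀ *ᵥ simpleRoot k) i := by
    intro k
    rcases hα.2 _ ((isRootVector_simpleRoot k).mulVec hgt) with h | h
    · exact h
    · intro i
      have h1 := hb k ▸ hdom k
      exact ((Finset.sum_eq_zero_iff_of_nonpos fun i _ => h i).mp
        (le_antisymm (Finset.sum_nonpos fun i _ => h i) h1) i (Finset.mem_univ i)).ge
  have hn : ∀ i k, 0 ≤ (g *ᵥ α i) ⬝ᵥ weight k := by
    intro i
    rcases ((hα.1 i).mulVec hg).signs with h | h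
    · exact h
    · exfalso
      have h1 : (g *ᵥ ρ) ⬝ᵥ (g *ᵥ α i) = 1 := by
        rw [mulVec_dot_mulVec hg, hρ]
        simp [Finsupp.single_apply]
      rw [← sum_simpleRoot (g *ᵥ α i), dotProduct_sum] at h1
      have h2 : ∑ k, (g *ᵥ ρ) ⬝ᵥ (((g *ᵥ α i) ⬝ᵥ weight k / weightScale k) • simpleRoot k) ≤ 0 := by
        refine Finset.sum_nonpos fun k _ => ?_
        rw [dotProduct_smul, smul_eq_mul]
        exact mul_nonpos_of_nonpos_of_nonneg
          (div_nonpos_of_nonpos_of_nonneg (h k) (weightScale_pos k).le) (hdom k)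
      linarith
  have key : ∀ i, ∃ k, ∃ c : ℝ, 0 < c ∧ g *ᵥ α i = c • simpleRoot k := by
    intro i
    have hcoord : ∀ j, ∑ k, ((g *ᵥ α i) ⬝ᵥ weight k / weightScale k) *
        α.repr (gᵀ *ᵥ simpleRoot k) j = α.repr (α i) j := fun j => by
      have h1 := congrArg (fun v => α.repr (gᵀ *ᵥ v) j) (sum_simpleRoot (g *ᵥ α i))
      simp only [hgg, Matrix.mulVec_sum, Matrix.mulVec_smul, map_sum, map_smul] at h1
      simpa using h1
    obtain ⟨k, hk⟩ : ∃ k, (g *ᵥ α i) ⬝ᵥ weight k ≠ 0 := by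
      by_contra! hcon
      have := hcoord i
      simp [hcon] at this
    have hz : ∀ j, j ≠ i → α.repr (gᵀ *ᵥ simpleRoot k) j = 0 := fun j hj => by
      have h1 := hcoord j
      rw [α.repr_self, Finsupp.single_eq_of_ne hj] at h1
      have h2 := (Finset.sum_eq_zero_iff_of_nonneg fun l _ =>
        mul_nonneg (div_nonneg (hn i l) (weightScale_pos l).le) (hm l j)).mp h1 k (Finset.mem_univ k)
      exact (mul_eq_zero.mp h2).resolve_left (div_ne_zero hk (weightScale_pos k).ne')
    have hsing : gᵀ *ᵥ simpleRoot k = α.repr (gᵀ *ᵥ simpleRoot k) i • α i := by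
      conv_lhs => rw [← α.sum_repr (gᵀ *ᵥ simpleRoot k)]
      exact Finset.sum_eq_single i (fun j _ hj => by rw [hz j hj, zero_smul]) (by simp)
    have hne : α.repr (gᵀ *ᵥ simpleRoot k) i ≠ 0 := fun h => hm0 k (by
      rw [h, zero_smul] at hsing
      rw [hsing, map_zero])
    refine ⟨k, (α.repr (gᵀ *ᵥ simpleRoot k) i)⁻¹,
      inv_pos.mpr (lt_of_le_of_ne (hm k i) hne.symm), ?_⟩
    rw [eq_inv_smul_iff₀ hne, ← Matrix.mulVec_smul, ← hsing, hgg']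
  choose σ c hc hσ using key
  refine ⟨g, hg, σ, fun i j hij => ?_, c, fun i => ⟨hc i, hσ i⟩⟩
  by_contra hne
  have h1 : c j • α i = c i • α j := by
    rw [← hgg (α i), ← hgg (α j), hσ i, hσ j, hij, Matrix.mulVec_smul, Matrix.mulVec_smul,
      smul_comm]
  have h2 := congrArg (fun v => α.repr v i) h1
  simp only [map_smul, Module.Basis.repr_self, Finsupp.smul_apply, Finsupp.single_eq_same,
    Finsupp.single_eq_of_ne hne, smul_eq_mul, mul_one, mul_zero] at h2
  exact (hc j).ne' h2

theorem simpleRoot_dot_simpleRoot_ne_zero : simpleRoot 0 ⬝ᵥ simpleRoot 1 ≠ 0 ∧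
    simpleRoot 1 ⬝ᵥ simpleRoot 2 ≠ 0 ∧ simpleRoot 2 ⬝ᵥ simpleRoot 3 ≠ 0 := by
  simp [simpleRoot, dotProduct, Fin.sum_univ_four]

theorem simpleRoot_dot_simpleRoot_eq_zero : simpleRoot 0 ⬝ᵥ simpleRoot 2 = 0 ∧
    simpleRoot 0 ⬝ᵥ simpleRoot 3 = 0 ∧ simpleRoot 1 ⬝ᵥ simpleRoot 3 = 0 := by
  simp [simpleRoot, dotProduct, Fin.sum_univ_four]

section Image

variable {α : Module.Basis (Fin 4) ℝ (Fin 4 → ℝ)} {g : Mat4} {σ : Fin 4 → Fin 4} {c : Fin 4 → ℝ}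

theorem IsEndVertex.eq_or_eq (hg : g ∈ setV) (hσ : Function.Injective σ)
    (h : ∀ i, 0 < c i ∧ g *ᵥ α i = c i • simpleRoot (σ i)) {i : Fin 4} (hi : IsEndVertex α i) :
    σ i = 0 ∨ σ i = 3 := by
  have hadj : ∀ a, simpleRoot (σ i) ⬝ᵥ simpleRoot (σ a) ≠ 0 → α i ⬝ᵥ α a ≠ 0 := fun a ha => by
    rw [← mulVec_dot_mulVec hg, (h i).2, (h a).2, smul_dotProduct, dotProduct_smul]
    exact smul_ne_zero (h i).1.ne' (smul_ne_zero (h a).1.ne' ha)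
  have hadj' : ∀ {k}, simpleRoot (σ i) ⬝ᵥ simpleRoot k ≠ 0 → k ≠ σ i →
      ∃ a, σ a = k ∧ a ≠ i ∧ α i ⬝ᵥ α a ≠ 0 := fun {k} hk hki => by
    obtain ⟨a, rfl⟩ := (Finite.injective_iff_surjective.mp hσ) k
    exact ⟨a, rfl, fun h => hki (h ▸ rfl), hadj a hk⟩
  have huniq : ∀ {k l}, simpleRoot (σ i) ⬝ᵥ simpleRoot k ≠ 0 → k ≠ σ i →
      simpleRoot (σ i) ⬝ᵥ simpleRoot l ≠ 0 → l ≠ σ i → k = l := by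
    intro k l hk hki hl hli
    obtain ⟨a, rfl, ha⟩ := hadj' hk hki
    obtain ⟨b, rfl, hb⟩ := hadj' hl hli
    rw [hi.unique ha hb]
  obtain ⟨h01, h12, h23⟩ := simpleRoot_dot_simpleRoot_ne_zero
  have hcases : ∀ k : Fin 4, k = 0 ∨ k = 1 ∨ k = 2 ∨ k = 3 := by decide
  rcases hcases (σ i) with hk | hk | hk | hk
  · exact Or.inl hk
  · rw [hk] at huniq
    exact absurd (huniq (k := 0) (l := 2) (by rwa [dotProduct_comm]) (by decide) h12 (by decide))
      (by decide)
  · rw [hk] at huniq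
    exact absurd (huniq (k := 1) (l := 3) (by rwa [dotProduct_comm]) (by decide) h23 (by decide))
      (by decide)
  · exact Or.inr hk

theorem IsWeight.exists_smul (hg : g ∈ setV) (hσ : Function.Injective σ)
    (h : ∀ i, 0 < c i ∧ g *ᵥ α i = c i • simpleRoot (σ i)) {i : Fin 4} {u : Fin 4 → ℝ}
    (hu : IsWeight α i u) : ∃ t : ℝ, 0 < t ∧ u = gᵀ *ᵥ (t • weight (σ i)) := by
  have hdot : ∀ j, u ⬝ᵥ α j = c j * ((g *ᵥ u) ⬝ᵥ simpleRoot (σ j)) := fun j => by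
    rw [← mulVec_dot_mulVec hg, (h j).2, dotProduct_smul, smul_eq_mul]
  set t := (g *ᵥ u) ⬝ᵥ simpleRoot (σ i) / weightScale (σ i) with ht
  have hz : ∀ j, (g *ᵥ u - t • weight (σ i)) ⬝ᵥ simpleRoot (σ j) = 0 := by
    intro j
    rw [sub_dotProduct, smul_dotProduct, dotProduct_comm (weight _), simpleRoot_dot_weight]
    by_cases hj : j = i
    · rw [hj, if_pos rfl, smul_eq_mul, ht, div_mul_cancel₀ _ (weightScale_pos _).ne', sub_self]
    · rw [if_neg fun he => hj (hσ he), smul_zero, sub_zero]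
      exact (mul_eq_zero.mp ((hdot j).symm.trans (hu.2 j hj))).resolve_left (h j).1.ne'
  have h0 : g *ᵥ u - t • weight (σ i) = 0 := by
    refine dotProduct_self_eq_zero.mp ?_
    conv_lhs => rw [← sum_simpleRoot (g *ᵥ u - t • weight (σ i)), dotProduct_sum]
    refine Finset.sum_eq_zero fun k _ => ?_
    obtain ⟨j, rfl⟩ := (Finite.injective_iff_surjective.mp hσ) k
    rw [dotProduct_smul, sum_simpleRoot, hz, smul_zero]
  refine ⟨t, div_pos ?_ (weightScale_pos _), ?_⟩
  · exact pos_of_mul_pos_right (hdot i ▸ hu.1) (h i).1.le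
  · rw [← sub_eq_zero.mp h0, Matrix.mulVec_mulVec, transpose_mul_self_of_mem hg, Matrix.one_mulVec]

end Image

theorem vecMulVec_weight : Matrix.vecMulVec (weight 0) (weight 3) = -intN1.qreal := by
  rw [qreal_intN1]
  ext i j
  fin_cases i <;> fin_cases j <;> simp [Matrix.vecMulVec_apply, weight, matA1]

theorem vecMulVec_weight' : Matrix.vecMulVec (weight 3) (weight 0) = -intN1.qrealᵀ := by
  rw [← Matrix.transpose_neg, ← vecMulVec_weight, Matrix.transpose_vecMulVec]

theorem isNormal_of_mem_tensors {C : Mat4} (h : C ∈ tensors) : IsNormal setV C :=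
  isNormal_of_mem_normalOrbit isNormal_intN1 (normalOrbit_intN1 ▸ h)

theorem isGreatest_trace_of_mem_tensors {C : Mat4} (h : C ∈ tensors) {κ : ℝ} (hκ : 0 ≤ κ) :
    IsGreatest {t : ℝ | ∃ X ∈ groupF4, t = ((X : Mat4) * (κ • C)ᵀ).trace} κ := by
  have hn := isNormal_of_mem_tensors h
  constructor
  · have hne : (tight setV C).Nonempty := by
      refine Set.nonempty_of_ncard_ne_zero ?_
      rw [ncard_tight_of_mem_orbit (normalOrbit_intN1 ▸ h), ncard_tight_intN1]
      norm_num
    obtain ⟨X, hX, hXC⟩ := hne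
    exact ⟨unitOfMem hX, mem_groupF4_iff.mpr hX, by
      change κ = (X * _).trace
      rw [trace_mul_eq_frob, Matrix.transpose_transpose, map_smul, hXC, smul_eq_mul, mul_one]⟩
  · rintro _ ⟨X, hX, rfl⟩
    rw [trace_mul_eq_frob, Matrix.transpose_transpose, map_smul, smul_eq_mul]
    exact mul_le_of_le_one_right hκ (hn.1 _ (coe_mem_setV hX))

theorem IsBirkhoffTensor.transpose_mem {A : Mat4} (hA : IsBirkhoffTensor groupF4 A) :
    Aᵀ ∈ tensors := by
  obtain ⟨⟨α, hα, i, j, hij, hi, hj, u, w, hu, hw, x, hx, y, hy, rfl⟩, hmax⟩ := hA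
  obtain ⟨g, hg, σ, hσ, c, h⟩ := hα.exists_smul
  obtain ⟨s, hs, rfl⟩ := hu.exists_smul hg hσ h
  obtain ⟨t, ht, rfl⟩ := hw.exists_smul hg hσ h
  have hx' := transpose_mem_setV (mul_mem_setV (coe_mem_setV hx) (transpose_mem_setV hg))
  have hy' := neg_mem_setV (mul_mem_setV (coe_mem_setV hy) (transpose_mem_setV hg))
  have hne : σ i ≠ σ j := fun he => hij (hσ he)
  have hkey : ∃ C ∈ tensors, (Matrix.vecMulVec ((x : Mat4) *ᵥ gᵀ *ᵥ s • weight (σ i))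
      ((y : Mat4) *ᵥ gᵀ *ᵥ t • weight (σ j)))ᵀ = (s * t) • C := by
    refine ⟨-((y : Mat4) * gᵀ) * -Matrix.vecMulVec (weight (σ j)) (weight (σ i)) *
      ((x : Mat4) * gᵀ)ᵀ, ?_, ?_⟩
    · rcases hi.eq_or_eq hg hσ h with hi | hi <;> rcases hj.eq_or_eq hg hσ h with hj | hj
      · exact absurd (hi.trans hj.symm) hne
      · exact ⟨_, hy', _, hx', Or.inr (by rw [hi, hj, vecMulVec_weight', neg_neg])⟩
      · exact ⟨_, hy', _, hx', Or.inl (by rw [hi, hj, vecMulVec_weight, neg_neg])⟩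
      · exact absurd (hi.trans hj.symm) hne
    · rw [Matrix.transpose_vecMulVec, neg_mul_neg, Matrix.mul_vecMulVec, Matrix.vecMulVec_mul,
        Matrix.vecMul_transpose]
      simp only [Matrix.mulVec_mulVec, Matrix.mulVec_smul, Matrix.smul_vecMulVec,
        Matrix.vecMulVec_smul, smul_smul]
  obtain ⟨C, hC, hAC⟩ := hkey
  have h1 := isGreatest_trace_of_mem_tensors hC (mul_pos hs ht).le
  rw [← hAC, Matrix.transpose_transpose] at h1
  rw [hAC, h1.unique hmax, one_smul]
  exact hC

/-- The basis of simple roots. -/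
theorem exists_basis_simpleRoot : ∃ α : Module.Basis (Fin 4) ℝ (Fin 4 → ℝ),
    (∀ i, α i = simpleRoot i) ∧ ∀ v i, α.repr v i = v ⬝ᵥ weight i / weightScale i := by
  have hdot : ∀ (f : Fin 4 → ℝ) (k : Fin 4),
      (∑ l, f l • simpleRoot l) ⬝ᵥ weight k / weightScale k = f k := fun f k => by
    have := (weightScale_pos k).ne'
    rw [sum_dotProduct]
    simp [simpleRoot_dot_weight, this]
  have hli : LinearIndependent ℝ simpleRoot := by
    refine Fintype.linearIndependent_iff.mpr fun f hf k => ?_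
    rw [← hdot f k, hf, zero_dotProduct, zero_div]
  have hsp : ⊤ ≤ Submodule.span ℝ (Set.range simpleRoot) := fun v _ => by
    rw [← sum_simpleRoot v]
    exact Submodule.sum_mem _ fun k _ => Submodule.smul_mem _ _ (Submodule.subset_span ⟨k, rfl⟩)
  refine ⟨Module.Basis.mk hli hsp, fun i => Module.Basis.mk_apply hli hsp i, fun v i => ?_⟩
  have h := (Module.Basis.mk hli hsp).sum_repr v
  simp only [Module.Basis.mk_apply] at h
  conv_rhs => rw [← h, hdot]

theorem isBirkhoffTensor_of_mem_tensors {C : Mat4} (hC : C ∈ tensors) :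
    IsBirkhoffTensor groupF4 Cᵀ := by
  refine ⟨?_, by simpa using isGreatest_trace_of_mem_tensors hC zero_le_one⟩
  obtain ⟨α, hα, hrepr⟩ := exists_basis_simpleRoot
  obtain ⟨h01, -, h23⟩ := simpleRoot_dot_simpleRoot_ne_zero
  obtain ⟨h02, h03, h13⟩ := simpleRoot_dot_simpleRoot_eq_zero
  have hsimple : IsSimpleSystem groupF4 α := by
    refine ⟨fun i => hα i ▸ isRootVector_simpleRoot i, fun v hv => ?_⟩
    simp only [hrepr]
    exact hv.signs.imp (fun h i => div_nonneg (h i) (weightScale_pos i).le)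
      fun h i => div_nonpos_of_nonpos_of_nonneg (h i) (weightScale_pos i).le
  have hw : ∀ i, IsWeight α i (weight i) := fun i => by
    refine ⟨?_, fun j hj => ?_⟩ <;> rw [hα, dotProduct_comm, simpleRoot_dot_weight]
    · simpa using weightScale_pos i
    · rw [if_neg hj]
  have h0 : IsEndVertex α 0 := by
    refine ⟨1, ⟨by decide, by rwa [hα, hα]⟩, fun j hj => ?_⟩
    rw [hα, hα] at hj
    fin_cases j <;> simp_all
  have h3 : IsEndVertex α 3 := by
    refine ⟨2, ⟨by decide, by rwa [hα, hα, dotProduct_comm]⟩, fun j hj => ?_⟩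
    rw [hα, hα, dotProduct_comm] at hj
    fin_cases j <;> simp_all
  refine ⟨α, hsimple, ?_⟩
  obtain ⟨x, hx, y, hy, rfl | rfl⟩ := hC
  · refine ⟨3, 0, by decide, h3, h0, _, _, hw 3, hw 0, unitOfMem (transpose_mem_setV hy),
      mem_groupF4_iff.mpr (transpose_mem_setV hy), unitOfMem (neg_mem_setV hx),
      mem_groupF4_iff.mpr (neg_mem_setV hx), ?_⟩
    change _ = Matrix.vecMulVec (yᵀ *ᵥ weight 3) (-x *ᵥ weight 0)
    rw [← Matrix.transpose_vecMulVec, ← Matrix.vecMul_transpose yᵀ, Matrix.transpose_transpose,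
      ← Matrix.vecMulVec_mul, ← Matrix.mul_vecMulVec, vecMulVec_weight, neg_mul_neg]
  · refine ⟨0, 3, by decide, h0, h3, _, _, hw 0, hw 3, unitOfMem (transpose_mem_setV hy),
      mem_groupF4_iff.mpr (transpose_mem_setV hy), unitOfMem (neg_mem_setV hx),
      mem_groupF4_iff.mpr (neg_mem_setV hx), ?_⟩
    change _ = Matrix.vecMulVec (yᵀ *ᵥ weight 0) (-x *ᵥ weight 3)
    rw [← Matrix.transpose_vecMulVec, ← Matrix.vecMul_transpose yᵀ, Matrix.transpose_transpose,
      ← Matrix.vecMulVec_mul, ← Matrix.mul_vecMulVec, vecMulVec_weight', neg_mul_neg]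

theorem birkhoffFaces_eq : birkhoffFaces groupF4 = face setV '' tensors := by
  ext F
  constructor
  · rintro ⟨A, hA, rfl⟩
    exact ⟨_, hA.transpose_mem, (traceFace_eq A).symm⟩
  · rintro ⟨C, hC, rfl⟩
    exact ⟨_, isBirkhoffTensor_of_mem_tensors hC, (traceFace_eq Cᵀ).symm⟩

end CoxeterHull

open CoxeterHull

theorem mainTheorem2 :
    -- the two generators realize the reflection group of type `F₄`
    CoxeterHull.groupF4 = CoxeterHull.reflectionGroupF4 ∧
    -- both inequalities are valid and define facets
    (∀ X ∈ CoxeterHull.convF4, (X * CoxeterHull.matA1).trace ≤ 1) ∧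
    (∀ X ∈ CoxeterHull.convF4, (X * CoxeterHull.matA2).trace ≤ 1) ∧
    CoxeterHull.traceFace CoxeterHull.convF4 CoxeterHull.matA1
      ∈ CoxeterHull.facets CoxeterHull.convF4 ∧
    CoxeterHull.traceFace CoxeterHull.convF4 CoxeterHull.matA2
      ∈ CoxeterHull.facets CoxeterHull.convF4 ∧
    -- there are exactly two orbits of facets, represented by these two
    CoxeterHull.symOrbit CoxeterHull.convF4 '' CoxeterHull.facets CoxeterHull.convF4 =
      {CoxeterHull.symOrbit CoxeterHull.convF4
          (CoxeterHull.traceFace CoxeterHull.convF4 CoxeterHull.matA1),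
        CoxeterHull.symOrbit CoxeterHull.convF4
          (CoxeterHull.traceFace CoxeterHull.convF4 CoxeterHull.matA2)} ∧
    CoxeterHull.symOrbit CoxeterHull.convF4
        (CoxeterHull.traceFace CoxeterHull.convF4 CoxeterHull.matA1) ≠
      CoxeterHull.symOrbit CoxeterHull.convF4
        (CoxeterHull.traceFace CoxeterHull.convF4 CoxeterHull.matA2) ∧
    -- total number of facets
    (CoxeterHull.facets CoxeterHull.convF4).ncard = 55872 ∧
    -- the first orbit: incidence, stabilizer, and it consists exactly of the Birkhoff tensors
    (∀ F ∈ CoxeterHull.symOrbit CoxeterHull.convF4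
        (CoxeterHull.traceFace CoxeterHull.convF4 CoxeterHull.matA1),
      CoxeterHull.incidence CoxeterHull.convF4 F = 288 ∧
      CoxeterHull.stabOrder CoxeterHull.convF4 F = 4608) ∧
    CoxeterHull.birkhoffFaces CoxeterHull.groupF4 =
      CoxeterHull.symOrbit CoxeterHull.convF4
        (CoxeterHull.traceFace CoxeterHull.convF4 CoxeterHull.matA1) ∧
    -- the second orbit: incidence, stabilizer, and it contains no Birkhoff tensor
    (∀ F ∈ CoxeterHull.symOrbit CoxeterHull.convF4
        (CoxeterHull.traceFace CoxeterHull.convF4 CoxeterHull.matA2),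
      CoxeterHull.incidence CoxeterHull.convF4 F = 36 ∧
      CoxeterHull.stabOrder CoxeterHull.convF4 F = 48 ∧
      F ∉ CoxeterHull.birkhoffFaces CoxeterHull.groupF4) ∧
    -- hence not every facet is given by a Birkhoff tensor
    ¬ (CoxeterHull.facets CoxeterHull.convF4 ⊆
      CoxeterHull.birkhoffFaces CoxeterHull.groupF4) := by
  have e1 : traceFace convF4 matA1 = face setV intN1.qreal := by rw [traceFace_eq, qreal_intN1]
  have e2 : traceFace convF4 matA2 = face setV intN2.qreal := by rw [traceFace_eq, qreal_intN2]
  have hb : birkhoffFaces groupF4 = symOrbit convF4 (face setV intN1.qreal) := by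
    rw [birkhoffFaces_eq, symOrbit_face, normalOrbit_intN1]
  have hle : ∀ {A : Mat4}, IsNormal setV Aᵀ → ∀ X ∈ convF4, (X * A).trace ≤ 1 := fun h X hX => by
    rw [trace_mul_eq_frob]
    exact frob_le_of_mem_convexHull h.1 X (convF4_eq ▸ hX)
  have hf1 : face setV intN1.qreal ∈ facets convF4 := facets_eq ▸ ⟨_, isNormal_intN1, rfl⟩
  have hf2 : face setV intN2.qreal ∈ facets convF4 := facets_eq ▸ ⟨_, isNormal_intN2, rfl⟩
  have horb : ∀ {C D : Mat4}, C ∈ normalOrbit D →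
      symOrbit convF4 (face setV C) = symOrbit convF4 (face setV D) := fun {C D} h => by
    rw [symOrbit_face, symOrbit_face]
    exact congrArg _ (MulAction.orbit_eq_iff.mpr h)
  have hdisj : ∀ F ∈ symOrbit convF4 (face setV intN2.qreal),
      F ∉ symOrbit convF4 (face setV intN1.qreal) := by
    intro F h2 h1
    rw [symOrbit_face] at h1 h2
    obtain ⟨C, hC, rfl⟩ := h1
    obtain ⟨D, hD, h⟩ := h2
    rw [face_injOn setV (isNormal_of_mem_normalOrbit isNormal_intN2 hD)
      (isNormal_of_mem_normalOrbit isNormal_intN1 hC) h] at hD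
    exact Set.disjoint_left.mp disjoint_normalOrbits hC hD
  have hself : face setV intN2.qreal ∈ symOrbit convF4 (face setV intN2.qreal) :=
    MulAction.mem_orbit_self _
  have hinc : ∀ {D F}, F ∈ symOrbit convF4 (face setV D) →
      incidence convF4 F = (tight setV D).ncard := fun {D F} h => by
    rw [symOrbit_face] at h
    obtain ⟨C, hC, rfl⟩ := h
    rw [incidence_face, ncard_tight_of_mem_orbit hC]
  rw [e1, e2, hb]
  refine ⟨groupF4_eq, hle (qreal_intN1 ▸ isNormal_intN1), hle (qreal_intN2 ▸ isNormal_intN2),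
    hf1, hf2, ?_, fun h => hdisj _ hself (h ▸ hself), ncard_facets, fun F hF => ⟨?_, ?_⟩, rfl,
    fun F hF => ⟨?_, ?_, hdisj F hF⟩, fun h => hdisj _ hself (h hf2)⟩
  · rw [facets_eq, Set.image_image]
    ext S
    constructor
    · rintro ⟨C, hC, rfl⟩
      exact (isNormal_iff.mp hC).imp horb horb
    · rintro (rfl | rfl)
      · exact ⟨_, isNormal_intN1, rfl⟩
      · exact ⟨_, isNormal_intN2, rfl⟩
  · rw [hinc hF, ncard_tight_intN1]
  · have h := stabOrder_of_mem_symOrbit isNormal_intN1 hF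
    rw [ncard_normalOrbit_intN1] at h
    omega
  · rw [hinc hF, ncard_tight_intN2]
  · have h := stabOrder_of_mem_symOrbit isNormal_intN2 hF
    rw [ncard_normalOrbit_intN2] at h
    omega
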